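/- Let $S=\{F=0\}\subset\mathbb P^3_{\mathbb C}$ be a surface with ordinary singularities: at each singular point $S$ is, in formal coordinates, $xy=0$ (double curve), $xyz=0$ (triple point) or $x^2y-z^2=0$ (pinch point). Let $Z$ be its singular locus, let $p\notin S$, and let $\pi$ be the projection from $p$ to $\mathbb P^2$. The contour is the set $F=\partial_pF=0$; the proper contour $R$ is the closure of the set of smooth points of $S$ whose tangent plane contains $p$; $W=\pi(Z)$ is the singular image and $B=\pi(R)$ the proper silhouette (reduced curves). The projection is called good if: (1) $\pi$ is injective on the contour up to finitely many points; (2) $R$ is smooth and $B$ has at most nodes and ordinary cusps; (3) at each point of $R$ that is smooth on $S$ and does not map to a cusp of $B$, and at all but finitely many points of $Z$, the line through $p$ meets $S$ with multiplicity exactly $2$; (4) $W$ has only nodes and ordinary triple points, the latter being images of triple points of $S$; (5) $B$ and $W$ meet only at points that are smooth on both, either transversally, or, at images of points of $R\cap Z$, tangentially with intersection multiplicity $2$; pinch points map to transversal intersections. The fat contour $Y$ is the scheme $F=\partial_pF=0$, the fat silhouette $C\subset\mathbb P^2$ is the scheme defined by the discriminant of $F$ in the direction of projection. For $c\in C$ let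 $E=\hat{\mathcal O}_{C,c}=\mathbb C[[x,y]]/(D)$, where $D$ is a local equation of $C$ in affine coordinates centred at $c$. The conductor ideal at $c$ is the image of $\mathrm{Hom}_E\big((\pi_*\mathcal O_Y)_c\otimes E,\,E\big)\to E$, $\varphi\mapsto\varphi(1)$. The special points are: nodes and cusps of $B$; nodes and triple points of $W$; transversal intersections of $B$ and $W$ having two distinct preimages, one in $R$ and one in $Z$; transversal intersections coming from pinch points; tangential intersections of $B$ and $W$. **Lemma.** (a) Let $c$ be a special point of a good projection. Up to a unit $D$ has the following form, and the preimage $I\subset\mathbb C[[x,y]]$ of the conductor ideal at $c$ is the following ideal. Here $h_i,h,g$ are power series of order one. - Node of $B$: $D=h_1h_2$ with independent linear parts; $I$ is the maximal ideal. - Cusp of $B$: $D=h_1^3-h_2^2$ with independent linear parts; $I$ is the maximal ideal. - Node of $W$: $D=h_1^2h_2^2$ with independent linear parts; $I=(h_1)^2+(h_2)^2$. - Triple point of $W$: $D=(h_1h_2h_3)^2$ with pairwise independent linear parts and $h_1+h_2+h_3=0$; $I$ is generated by the sums $a_1^2+a_2^2+a_3^2$ with $a_i\in(h_i)$ and $a_1+a_2+a_3=0$.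 - Transversal intersection, two distinct preimages: $D=hg^2$ with independent linear parts; $I=(h)+(g)^2$. - Transversal intersection, pinch point: $D=hg^2$ with independent linear parts; $I=(1)$. - Tangential intersection: $D=hg^2$ with $\dim_{\mathbb C}\mathbb C[[x,y]]/(h,g)=2$. Write $P$ for the origin, $B=\{h=0\}$, $W=\{g=0\}$. Blow up $P$, with exceptional curve $E_1$; let $Q\in E_1$ be the common point of the strict transforms $B',W'$; blow up $Q$, with exceptional curve $E_2$. Let $R_0\in E_2$ be the point with coordinate $-1/3$ for the coordinate on $E_2\cong\mathbb P^1$ that is $\infty,0,1$ on the strict transforms of $E_1$, $B'$, $W'$ respectively. Then $I$ is the set of all $a$ with $a(P)=0$, whose controlled transform (pull-back divided once by the equation of $E_1$) vanishes at $Q$, and whose second controlled transform (pull-back of the former divided once by the equation of $E_2$) vanishes at $R_0$. (b) For each of the seven types, the ideal $I$ that is described in (a) depends only on the ideal $(D)$ and not on the choice of the $h_i,h,g$, and its description is invariant under all automorphisms of the $\mathbb C$-algebra $\mathbb C[[x,y]]$. (c) The conductor ideals at the special points depend only on the fat silhouette (and, at transversal intersections, on whether they come from a pinch point), not on the fat contour: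 let $c,c'$ be special points of two good projections, either both or none of the type "transversal intersection coming from a pinch point", with local equations $D,D'$ of the fat silhouettes. If an automorphism $\sigma$ of the $\mathbb C$-algebra $\mathbb C[[x,y]]$ satisfies $(\sigma(D))=(D')$, then it maps the preimage of the conductor ideal at $c$ onto the preimage of the conductor ideal at $c'$. -/

import Mathlib

noncomputable section

open MvPolynomial

/-! ### Formal power series -/

/-- The linear part of a power series, as the vector of its coefficients of degree one. -/
def linPart {n : ℕ} (h : MvPowerSeries (Fin n) ℂ) : Fin n → ℂ :=
  fun i => MvPowerSeries.coeff (Finsupp.single i 1) h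

/-- The linear part of a power series, evaluated at a vector. -/
def linEval {n : ℕ} (h : MvPowerSeries (Fin n) ℂ) (u : Fin n → ℂ) : ℂ :=
  ∑ i, linPart h i * u i

/-- The `h i` vanish at the origin and have linearly independent linear parts there: they are
part of a system of formal coordinates. For `k = 1` this says that `h 0` has order one. -/
def IsPartOfCoords {n k : ℕ} (h : Fin k → MvPowerSeries (Fin n) ℂ) : Prop :=
  (∀ i, MvPowerSeries.constantCoeff (h i) = 0) ∧ LinearIndependent ℂ (fun i => linPart (h i))

/-- `ℂ⟦x, y⟧`, the completed local ring of the projective plane at a point. -/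
abbrev PlaneSeries : Type := MvPowerSeries (Fin 2) ℂ

/-! ### Surfaces in projective three-space

A surface is given by a form `F` in four variables, and the centre of projection by a vector `p`.
Subsets of projective three-space are handled as cones in `ℂ⁴`. The target plane of the projection
is `ℙ(ℂ⁴ / p)`. A basis `b` of `ℂ⁴` with `b 3 = p` gives the point `c = [b 0]` of the
target plane, the affine chart `(x, y) ↦ [b 0 + x b 1 + y b 2]` centred at `c`, and the affine
coordinate `z` on the lines through the centre: the line over `(x, y)` consists of the points
`b 0 + x b 1 + y b 2 + z p` and of the centre. -/

/-- Bases of `ℂ⁴`. -/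
abbrev Frame : Type := Module.Basis (Fin 4) ℂ (Fin 4 → ℂ)

/-- The directional derivative of `F` at `q` in the direction `p`. -/
def dirDeriv (F : MvPolynomial (Fin 4) ℂ) (p q : Fin 4 → ℂ) : ℂ :=
  ∑ j, p j * eval q (pderiv j F)

/-- The gradient. -/
def grad (F : MvPolynomial (Fin 4) ℂ) (q : Fin 4 → ℂ) : Fin 4 → ℂ :=
  fun j => eval q (pderiv j F)

/-- The contour (as a set). -/
def contour (F : MvPolynomial (Fin 4) ℂ) (p : Fin 4 → ℂ) : Set (Fin 4 → ℂ) :=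
  {q | eval q F = 0 ∧ dirDeriv F p q = 0}

/-- The singular locus `Z` of the surface. -/
def singularLocus (F : MvPolynomial (Fin 4) ℂ) : Set (Fin 4 → ℂ) :=
  {q | eval q F = 0 ∧ grad F q = 0}

/-- The proper contour `R`: the closed curve of the smooth points of the surface whose tangent
plane passes through the centre of projection. -/
def properContour (F : MvPolynomial (Fin 4) ℂ) (p : Fin 4 → ℂ) : Set (Fin 4 → ℂ) :=
  zeroLocus ℂ (vanishingIdeal ℂ {q | q ∈ contour F p ∧ grad F q ≠ 0})

/-- The equation of the surface in the affine chart centred at `[b 0]` that is given by `b`,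
as a power series in the affine coordinates. -/
def spaceGerm (F : MvPolynomial (Fin 4) ℂ) (b : Frame) : MvPowerSeries (Fin 3) ℂ :=
  MvPolynomial.toMvPowerSeries
    (aeval (fun j => C (b 0 j) + ∑ i : Fin 3, C (b i.succ j) * X i) F :
      MvPolynomial (Fin 3) ℂ)

/-- Point of a double curve: two smooth sheets meeting transversally. -/
def IsDoublePoint (F : MvPolynomial (Fin 4) ℂ) (q : Fin 4 → ℂ) : Prop :=
  q ≠ 0 ∧ ∀ b : Frame, b 0 = q → ∃ h : Fin 2 → MvPowerSeries (Fin 3) ℂ,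
    IsPartOfCoords h ∧ Associated (spaceGerm F b) (h 0 * h 1)

/-- Triple point: three smooth sheets with independent tangent planes. -/
def IsTriplePoint (F : MvPolynomial (Fin 4) ℂ) (q : Fin 4 → ℂ) : Prop :=
  q ≠ 0 ∧ ∀ b : Frame, b 0 = q → ∃ h : Fin 3 → MvPowerSeries (Fin 3) ℂ,
    IsPartOfCoords h ∧ Associated (spaceGerm F b) (h 0 * h 1 * h 2)

/-- Pinch point (Whitney umbrella). -/
def IsPinchPoint (F : MvPolynomial (Fin 4) ℂ) (q : Fin 4 → ℂ) : Prop :=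
  q ≠ 0 ∧ ∀ b : Frame, b 0 = q → ∃ h : Fin 3 → MvPowerSeries (Fin 3) ℂ,
    IsPartOfCoords h ∧ Associated (spaceGerm F b) (h 0 ^ 2 * h 1 - h 2 ^ 2)

/-- The only singularities are double curves, triple points and pinch points. -/
def HasOrdinarySingularities (F : MvPolynomial (Fin 4) ℂ) : Prop :=
  ∀ q ∈ singularLocus F, q ≠ 0 → IsDoublePoint F q ∨ IsTriplePoint F q ∨ IsPinchPoint F q

/-- The multiplicity at `q` of the intersection of the surface with the line through `q` and the
centre `p`. -/
def lineMultiplicity (F : MvPolynomial (Fin 4) ℂ) (p q : Fin 4 → ℂ) : ℕ :=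
  (aeval (fun j => Polynomial.C (q j) + Polynomial.C (p j) * Polynomial.X) F :
    Polynomial ℂ).rootMultiplicity 0

/-! ### Curves in the target plane -/

/-- Some point of `A` lies over the point `[b 0]` of the target plane. -/
def HasPointOver (A : Set (Fin 4 → ℂ)) (b : Frame) : Prop :=
  ∃ z : ℂ, b 0 + z • b 3 ∈ A

/-- The projection of `A`, in the affine chart of the target plane given by `b`. -/
def planeImage (A : Set (Fin 4 → ℂ)) (b : Frame) : Set (Fin 2 → ℂ) :=
  {t | ∃ z : ℂ, b 0 + t 0 • b 1 + t 1 • b 2 + z • b 3 ∈ A}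

/-- The ideal in `ℂ⟦x, y⟧` of the (reduced) projection of `A` at the point `[b 0]`. -/
def localIdeal (A : Set (Fin 4 → ℂ)) (b : Frame) : Ideal PlaneSeries :=
  (vanishingIdeal ℂ (planeImage A b)).map MvPolynomial.coeToMvPowerSeries.ringHom

/-- The plane curve germ with ideal `I` is smooth. -/
def IsSmoothGerm (I : Ideal PlaneSeries) : Prop :=
  ∃ h : PlaneSeries, IsPartOfCoords ![h] ∧ I = Ideal.span {h}

/-- The plane curve germ with ideal `I` is a node. -/
def IsNodeGerm (I : Ideal PlaneSeries) : Prop :=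
  ∃ h₁ h₂ : PlaneSeries, IsPartOfCoords ![h₁, h₂] ∧ I = Ideal.span {h₁ * h₂}

/-- The plane curve germ with ideal `I` is an ordinary cusp. -/
def IsCuspGerm (I : Ideal PlaneSeries) : Prop :=
  ∃ h₁ h₂ : PlaneSeries, IsPartOfCoords ![h₁, h₂] ∧ I = Ideal.span {h₁ ^ 3 - h₂ ^ 2}

/-- The plane curve germ with ideal `I` is an ordinary triple point: three smooth branches with
pairwise different tangents. -/
def IsTripleGerm (I : Ideal PlaneSeries) : Prop :=
  ∃ h₁ h₂ h₃ : PlaneSeries, IsPartOfCoords ![h₁, h₂] ∧ IsPartOfCoords ![h₁, h₃] ∧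
    IsPartOfCoords ![h₂, h₃] ∧ I = Ideal.span {h₁ * h₂ * h₃}

/-- Two smooth plane curve germs meet transversally. -/
def MeetTransversally (I J : Ideal PlaneSeries) : Prop :=
  ∃ h g : PlaneSeries, IsPartOfCoords ![h, g] ∧ I = Ideal.span {h} ∧ J = Ideal.span {g}

/-- `h` and `g` are equations of two smooth plane curve germs that are tangent of order two, that
is, with intersection multiplicity two. -/
def AreSimplyTangent (h g : PlaneSeries) : Prop :=
  IsPartOfCoords ![h] ∧ IsPartOfCoords ![g] ∧
    Module.finrank ℂ (PlaneSeries ⧸ (Ideal.span {h, g} : Ideal PlaneSeries)) = 2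

/-- Two smooth plane curve germs meet tangentially, with order two. -/
def MeetSimplyTangentially (I J : Ideal PlaneSeries) : Prop :=
  ∃ h g : PlaneSeries, AreSimplyTangent h g ∧ I = Ideal.span {h} ∧ J = Ideal.span {g}

/-- The local ideal of the proper silhouette `B`. -/
def properIdeal (F : MvPolynomial (Fin 4) ℂ) (b : Frame) : Ideal PlaneSeries :=
  localIdeal (properContour F (b 3)) b

/-- The local ideal of the singular image `W`. -/
def singularIdeal (F : MvPolynomial (Fin 4) ℂ) (b : Frame) : Ideal PlaneSeries :=
  localIdeal (singularLocus F) b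

/-! ### Good projections -/

/-- The projection with centre `p` of the surface `F = 0` is good. -/
structure IsGoodProjection (F : MvPolynomial (Fin 4) ℂ) (p : Fin 4 → ℂ) : Prop where
  /-- The centre is not on the surface. -/
  center : eval p F ≠ 0
  ordinary : HasOrdinarySingularities F
  /-- The projection is injective on the contour, up to finitely many points. -/
  injective : ∃ T : Set (Projectivization ℂ (Fin 4 → ℂ)), T.Finite ∧ ∀ q ∉ T, ∀ q' ∉ T,
    q.rep ∈ contour F p → q'.rep ∈ contour F p →
    q'.rep ∈ Submodule.span ℂ {q.rep, p} → q = q'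
  /-- The proper contour is smooth (Jacobian criterion). -/
  smooth : ∀ q ∈ properContour F p, q ≠ 0 →
    ∃ g₁ ∈ vanishingIdeal ℂ (properContour F p), ∃ g₂ ∈ vanishingIdeal ℂ (properContour F p),
      LinearIndependent ℂ ![grad g₁ q, grad g₂ q]
  /-- The proper silhouette has at most nodes and ordinary cusps. -/
  proper : ∀ b : Frame, b 3 = p → HasPointOver (properContour F p) b →
    IsSmoothGerm (properIdeal F b) ∨ IsNodeGerm (properIdeal F b) ∨ IsCuspGerm (properIdeal F b)
  /-- A line through the centre meets the surface with multiplicity two at a point of the proper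
  contour, unless the point is singular on the surface or maps to a cusp. -/
  multiplicity : ∀ b : Frame, b 3 = p → b 0 ∈ properContour F p → grad F (b 0) ≠ 0 →
    ¬ IsCuspGerm (properIdeal F b) → lineMultiplicity F p (b 0) = 2
  /-- A line through the centre and a general point of the singular locus meets the surface with
  multiplicity two at that point. -/
  singularMultiplicity : ∃ T : Set (Projectivization ℂ (Fin 4 → ℂ)), T.Finite ∧
    ∀ q ∉ T, q.rep ∈ singularLocus F → lineMultiplicity F p q.rep = 2
  /-- The singular image has only nodes and ordinary triple points. -/
  singular : ∀ b : Frame, b 3 = p → HasPointOver (singularLocus F) b →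
    IsSmoothGerm (singularIdeal F b) ∨ IsNodeGerm (singularIdeal F b) ∨
      IsTripleGerm (singularIdeal F b)
  /-- The triple points of the singular image are images of triple points of the surface. -/
  triple : ∀ b : Frame, b 3 = p → IsTripleGerm (singularIdeal F b) →
    HasPointOver {q | IsTriplePoint F q} b
  /-- The proper silhouette and the singular image meet at smooth points of both, either
  transversally, or, at images of common points of the proper contour and the singular locus,
  tangentially with order two. -/
  intersection : ∀ b : Frame, b 3 = p → HasPointOver (properContour F p) b →
    HasPointOver (singularLocus F) b →
    MeetTransversally (properIdeal F b) (singularIdeal F b) ∨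
      (MeetSimplyTangentially (properIdeal F b) (singularIdeal F b) ∧
        HasPointOver (properContour F p ∩ singularLocus F) b)
  /-- Pinch points are mapped to transversal intersections. -/
  pinch : ∀ b : Frame, b 3 = p → HasPointOver {q | IsPinchPoint F q} b →
    MeetTransversally (properIdeal F b) (singularIdeal F b)

/-! ### Special points -/

/-- The seven types of special points. -/
inductive SpecialType where
  | properNode
  | properCusp
  | singularNode
  | singularTriple
  | transversalDistinct
  | transversalPinch
  | tangential

/-- The point `[b 0]` of the target plane of the projection with centre `b 3` is a special point
of the given type. -/
def IsSpecialPoint (F : MvPolynomial (Fin 4) ℂ) (b : Frame) : SpecialType → Prop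
  | .properNode => IsNodeGerm (properIdeal F b)
  | .properCusp => IsCuspGerm (properIdeal F b)
  | .singularNode => IsNodeGerm (singularIdeal F b)
  | .singularTriple => IsTripleGerm (singularIdeal F b)
  | .transversalDistinct => MeetTransversally (properIdeal F b) (singularIdeal F b) ∧
      ∃ z z' : ℂ, z ≠ z' ∧ b 0 + z • b 3 ∈ properContour F (b 3) ∧
        b 0 + z' • b 3 ∈ singularLocus F
  | .transversalPinch => MeetTransversally (properIdeal F b) (singularIdeal F b) ∧
      HasPointOver {q | IsPinchPoint F q} b
  | .tangential => MeetSimplyTangentially (properIdeal F b) (singularIdeal F b)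

/-! ### Fat contour, fat silhouette and conductor ideal -/

/-- The equation `f(x, y, z) = F(b 0 + x b 1 + y b 2 + z b 3)` of the surface, as a
polynomial in `z` over `ℂ[x, y]`. -/
def fibrePoly (F : MvPolynomial (Fin 4) ℂ) (b : Frame) : Polynomial (MvPolynomial (Fin 2) ℂ) :=
  aeval (fun j => Polynomial.C (C (b 0 j) + C (b 1 j) * X 0 + C (b 2 j) * X 1) +
    Polynomial.C (C (b 3 j)) * Polynomial.X) F

/-- The local equation at `[b 0]` of the fat silhouette: the discriminant. -/
def silhouetteEq (F : MvPolynomial (Fin 4) ℂ) (b : Frame) : PlaneSeries :=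
  MvPolynomial.toMvPowerSeries (fibrePoly F b).discr

/-- The completed local ring `E` of the fat silhouette `C` at `c = [b 0]`. -/
abbrev SilhouetteRing (F : MvPolynomial (Fin 4) ℂ) (b : Frame) : Type :=
  PlaneSeries ⧸ (Ideal.span {silhouetteEq F b} : Ideal PlaneSeries)

/-- The quotient map from `ℂ⟦x, y⟧` to the completed local ring of the fat silhouette. -/
abbrev toSilhouetteRing (F : MvPolynomial (Fin 4) ℂ) (b : Frame) :
    PlaneSeries →+* SilhouetteRing F b :=
  Ideal.Quotient.mk _

/-- The equation of the surface as a polynomial in `z` over `E`. -/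
def fibrePolyE (F : MvPolynomial (Fin 4) ℂ) (b : Frame) : Polynomial (SilhouetteRing F b) :=
  (fibrePoly F b).map ((toSilhouetteRing F b).comp MvPolynomial.coeToMvPowerSeries.ringHom)

/-- The stalk at `c` of the direct image `π_* 𝒪_Y` of the structure sheaf of the fat contour
`Y = {f = ∂f/∂z = 0}`, tensored with `E`. It is a finite `E`-algebra, the product of the completed
local rings of `Y` at the points over `c`. -/
abbrev ContourAlgebra (F : MvPolynomial (Fin 4) ℂ) (b : Frame) : Type :=
  Polynomial (SilhouetteRing F b) ⧸
    (Ideal.span {fibrePolyE F b, Polynomial.derivative (fibrePolyE F b)} :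
      Ideal (Polynomial (SilhouetteRing F b)))

/-- The conductor ideal at `c`: the image of `Hom_E(π_* 𝒪_Y, E) → E`, `φ ↦ φ 1`. -/
def conductorIdeal (F : MvPolynomial (Fin 4) ℂ) (b : Frame) : Ideal (SilhouetteRing F b) :=
  LinearMap.range (LinearMap.applyₗ (R := SilhouetteRing F b) (M := ContourAlgebra F b)
    (M₂ := SilhouetteRing F b) 1)

/-- The conductor ideal as an ideal of `ℂ⟦x, y⟧` that contains the equation of the fat
silhouette. -/
def conductorPreimage (F : MvPolynomial (Fin 4) ℂ) (b : Frame) : Ideal PlaneSeries :=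
  (conductorIdeal F b).comap (toSilhouetteRing F b)

/-! ### Blow-ups and infinitely near points -/

/-- Two vectors of `ℂ²` form a basis. -/
def IsPair (r s : Fin 2 → ℂ) : Prop := r 0 * s 1 - r 1 * s 0 ≠ 0

/-- Pull-back of functions from the plane to the completed blow-up of the origin at the point `[r]`
of the exceptional line: the local coordinates `(u, v)` of the blow-up are such that the
blow-up map is `(u, v) ↦ u (r + v s)`, and the exceptional line is `u = 0`. -/
def blowup (r s : Fin 2 → ℂ) (a : PlaneSeries) : PlaneSeries :=
  MvPowerSeries.subst (fun i => MvPowerSeries.X 0 *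
    (MvPowerSeries.C (r i) + MvPowerSeries.C (s i) * MvPowerSeries.X 1) : Fin 2 → PlaneSeries) a

/-- `a'` is the controlled transform of `a` (the pull-back divided by the equation of the
exceptional line) at the point `[r]`, and it vanishes at that point. For a series of order one this
says that the strict transform passes through the point `[r]`. -/
def IsVanishingTransform (r s : Fin 2 → ℂ) (a a' : PlaneSeries) : Prop :=
  blowup r s a = MvPowerSeries.X 0 * a' ∧ MvPowerSeries.constantCoeff a' = 0

/-- Let `h`, `g` be equations of simply tangent germs `B`, `W`. The point `Q = [r]` of the first
exceptional line `E₁` lies on the strict transforms `B'`, `W'`, and the point `R = [ρ]` of the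
second exceptional line `E₂` is the one whose coordinate is `-1/3` if one takes on `E₂` the
coordinate with value `∞` on `E₁'`, `0` on `B''` and `1` on `W''`. (Here `[w]` is the
point of `W''` on `E₂`, and up to a constant factor the coordinate of `[u]` is
`linEval h' u / u 0`, since `E₁` has the equation `u 0 = 0` at `Q`.) -/
def IsTangentialCluster (h g : PlaneSeries) (r s ρ τ : Fin 2 → ℂ) : Prop :=
  IsPair r s ∧ IsPair ρ τ ∧ ∃ h' g' : PlaneSeries,
    IsVanishingTransform r s h h' ∧ IsVanishingTransform r s g g' ∧
    ∃ w : Fin 2 → ℂ, w ≠ 0 ∧ linEval g' w = 0 ∧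
      3 * (linEval h' ρ * w 0) + linEval h' w * ρ 0 = 0

/-- `a` vanishes at the origin `P`, its controlled transform vanishes at the point `Q = [r]` of the
first blow-up, and its second controlled transform vanishes at the point `R = [ρ]` of the second
blow-up. -/
def VanishesOnCluster (r s ρ τ : Fin 2 → ℂ) (a : PlaneSeries) : Prop :=
  MvPowerSeries.constantCoeff a = 0 ∧ ∃ a' a'' : PlaneSeries,
    IsVanishingTransform r s a a' ∧ IsVanishingTransform ρ τ a' a''

/-! ### Descriptions of the conductor ideals in terms of the fat silhouette -/

/-- The ideal generated by the `a₁² + a₂² + a₃²` with `aᵢ ∈ (hᵢ)` and `a₁ + a₂ + a₃ = 0`. -/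
def sumOfSquaresIdeal (h₁ h₂ h₃ : PlaneSeries) : Ideal PlaneSeries :=
  Ideal.span {s | ∃ a₁ a₂ a₃ : PlaneSeries, a₁ ∈ Ideal.span {h₁} ∧ a₂ ∈ Ideal.span {h₂} ∧
    a₃ ∈ Ideal.span {h₃} ∧ a₁ + a₂ + a₃ = 0 ∧ s = a₁ ^ 2 + a₂ ^ 2 + a₃ ^ 2}

/-- `D` has the shape of an equation of a fat silhouette at a special point of the given type, and
`I` is the ideal that is attached to it. -/
def IsSilhouetteIdeal (D : PlaneSeries) (I : Ideal PlaneSeries) : SpecialType → Prop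
  | .properNode => ∃ h₁ h₂ : PlaneSeries, IsPartOfCoords ![h₁, h₂] ∧
      Associated D (h₁ * h₂) ∧ I = IsLocalRing.maximalIdeal PlaneSeries
  | .properCusp => ∃ h₁ h₂ : PlaneSeries, IsPartOfCoords ![h₁, h₂] ∧
      Associated D (h₁ ^ 3 - h₂ ^ 2) ∧ I = IsLocalRing.maximalIdeal PlaneSeries
  | .singularNode => ∃ h₁ h₂ : PlaneSeries, IsPartOfCoords ![h₁, h₂] ∧
      Associated D (h₁ ^ 2 * h₂ ^ 2) ∧ I = Ideal.span {h₁} ^ 2 ⊔ Ideal.span {h₂} ^ 2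
  | .singularTriple => ∃ h₁ h₂ h₃ : PlaneSeries, IsPartOfCoords ![h₁, h₂] ∧
      IsPartOfCoords ![h₁, h₃] ∧ IsPartOfCoords ![h₂, h₃] ∧ h₁ + h₂ + h₃ = 0 ∧
      Associated D ((h₁ * h₂ * h₃) ^ 2) ∧ I = sumOfSquaresIdeal h₁ h₂ h₃
  | .transversalDistinct => ∃ h g : PlaneSeries, IsPartOfCoords ![h, g] ∧
      Associated D (h * g ^ 2) ∧ I = Ideal.span {h} ⊔ Ideal.span {g} ^ 2
  | .transversalPinch => ∃ h g : PlaneSeries, IsPartOfCoords ![h, g] ∧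
      Associated D (h * g ^ 2) ∧ I = ⊤
  | .tangential => ∃ h g : PlaneSeries, AreSimplyTangent h g ∧ Associated D (h * g ^ 2) ∧
      ∃ r s ρ τ : Fin 2 → ℂ, IsTangentialCluster h g r s ρ τ ∧
        ∀ a, a ∈ I ↔ VanishesOnCluster r s ρ τ a

end

noncomputable section

namespace FatSilhouette

open MvPowerSeries

/-! ### Linear parts and orders of formal power series. -/

section LinearPart

variable {n : ℕ}

/-! Let `O = ℂ⟦x, y⟧`. Over the formal neighbourhood of `c` the surface is a monic polynomial `f`
over `O` in the fibre coordinate `z` (`sheet`). Up to a unit, `D` is the discriminant of `f`, and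
the points of the contour over `c` are the multiple roots of `f` over the origin. Weierstrass
preparation attaches to each such root a factor `W` of `f` that is coprime to the complementary
factor (`exists_isLocalFactor`). For coprime factors the discriminant is multiplicative up to a unit
and `(f, f')` is the intersection of two comaximal ideals (`jacIdeal_mul`), so the conductor ideal
is the sum of the contributions of the local factors (`condIdeal_inf`).

Only two kinds of contributions occur. A factor of degree two can be brought to the form `z² - δ`;
if `D = δ e`, it contributes the quotient ideal `(D) : δ = (e)`. A factor of degree three that
carries the whole discriminant can be brought to the form `z³ + 3pz + 2q`; then `D = p³ + q²` up to
a unit, and two linear relations between the values of a functional at `1` and `z` show that it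
contributes `(p, q)` (`condIdeal_cubic`).

It remains to determine the local factors at each special point. Globally, `D = G H²` where `G` and
`H` are equations of `B` and `W` (`exists_factorization`): at general points of `B` and of `W` the
discriminant has order one and two, by the multiplicity and injectivity hypotheses. Hence the order
of `D` at a special point is known. On the other hand `disc W` has order at least `deg W - 1`, at
least `deg W` if the point is singular on the surface, at least three at a pinch point with `deg W =
2`, and at least six at a triple point. Comparison of these orders fixes the number of contour
points and their degrees, up to a few cases that need geometry: two transversal sheets over a node
of `W` (`not_unique_of_node`), a pinch point of degree three (`not_cubic_of_coords`), and points of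
`R ∩ Z`, where degree two is excluded (`IsLocalFactor.notMem_properContour`). The last argument and
`IsLocalFactor.properIdeal_le` compare the Zariski closure that defines `R` with formal local
equations, by the Nullstellensatz and Krull's intersection theorem.

For the remaining two claims, smooth germs are prime elements of `O`, so the equation `D` determines
its factors up to units and order. The blow-up description in the tangential case is first replaced
by explicit generators (`tangIdeal`) which depend on the germs only through their ideals and the
ratio of their linear parts. The order of `D`, together with the distinction of pinch points and of
tangential from transversal intersections, separates the types, except for nodes and cusps of `B`,
which have the same ideal. Together with compatibility with automorphisms this gives both invariance
claims. -/

theorem linPart_eq_pderiv (h : MvPowerSeries (Fin n) ℂ) (i : Fin n) :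
    linPart h i = constantCoeff (pderiv ℂ i h) := by
  rw [← coeff_zero_eq_constantCoeff_apply, coeff_pderiv]
  simp [linPart]

@[simp] theorem linPart_add (a b : MvPowerSeries (Fin n) ℂ) :
    linPart (a + b) = linPart a + linPart b := by
  ext i; simp [linPart]

@[simp] theorem linPart_sub (a b : MvPowerSeries (Fin n) ℂ) :
    linPart (a - b) = linPart a - linPart b := by
  ext i; simp [linPart]

@[simp] theorem linPart_neg (a : MvPowerSeries (Fin n) ℂ) : linPart (-a) = -linPart a := by
  ext i; simp [linPart]

@[simp] theorem linPart_zero : linPart (0 : MvPowerSeries (Fin n) ℂ) = 0 := by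
  ext i; simp [linPart]

theorem linPart_mul (a b : MvPowerSeries (Fin n) ℂ) :
    linPart (a * b) = constantCoeff a • linPart b + constantCoeff b • linPart a := by
  ext i
  simp [linPart_eq_pderiv, Derivation.leibniz]

@[simp] theorem linPart_C (c : ℂ) : linPart (C c : MvPowerSeries (Fin n) ℂ) = 0 := by
  ext i
  simp [linPart_eq_pderiv]

@[simp] theorem linPart_C_mul (c : ℂ) (a : MvPowerSeries (Fin n) ℂ) :
    linPart (C c * a) = c • linPart a := by
  simp [linPart_mul]

theorem linPart_X (i j : Fin n) :
    linPart (X i : MvPowerSeries (Fin n) ℂ) j = if j = i then 1 else 0 := by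
  rw [linPart_eq_pderiv, pderiv_X]
  rcases eq_or_ne j i with rfl | h
  · simp
  · simp [h]

theorem linEval_eq (h : MvPowerSeries (Fin n) ℂ) (u : Fin n → ℂ) :
    linEval h u = linPart h ⬝ᵥ u := rfl

@[simp] theorem linEval_add (a b : MvPowerSeries (Fin n) ℂ) (u : Fin n → ℂ) :
    linEval (a + b) u = linEval a u + linEval b u := by
  simp [linEval_eq, add_dotProduct]

@[simp] theorem linEval_sub (a b : MvPowerSeries (Fin n) ℂ) (u : Fin n → ℂ) :
    linEval (a - b) u = linEval a u - linEval b u := by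
  simp [linEval_eq, sub_dotProduct]

@[simp] theorem linEval_C_mul (c : ℂ) (a : MvPowerSeries (Fin n) ℂ) (u : Fin n → ℂ) :
    linEval (C c * a) u = c * linEval a u := by
  simp [linEval_eq]

theorem linEval_mul (a b : MvPowerSeries (Fin n) ℂ) (u : Fin n → ℂ) :
    linEval (a * b) u = constantCoeff a * linEval b u + constantCoeff b * linEval a u := by
  simp [linEval_eq, linPart_mul, add_dotProduct]

theorem one_le_order {a : MvPowerSeries (Fin n) ℂ} :
    1 ≤ a.order ↔ constantCoeff a = 0 :=
  one_le_order_iff_constCoeff_eq_zero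

theorem two_le_order {a : MvPowerSeries (Fin n) ℂ} :
    2 ≤ a.order ↔ constantCoeff a = 0 ∧ linPart a = 0 := by
  constructor
  · intro h
    refine ⟨one_le_order.1 (le_trans (by norm_num) h), ?_⟩
    ext i
    refine coeff_of_lt_order (lt_of_lt_of_le ?_ h)
    rw [Finsupp.degree_single]
    norm_num
  · rintro ⟨h0, h1⟩
    refine nat_le_order (n := 2) fun d hd => ?_
    have : d.degree = 0 ∨ d.degree = 1 := by omega
    rcases this with h | h
    · rw [Finsupp.degree_eq_zero_iff] at h
      rw [h]; exact h0
    · obtain ⟨i, rfl⟩ := (Finsupp.sum_eq_one_iff d).1 (by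
        rwa [Finsupp.sum_fintype _ _ (fun _ => rfl), ← Finsupp.degree_eq_sum])
      exact congrFun h1 i

theorem isUnit_iff {a : MvPowerSeries (Fin n) ℂ} : IsUnit a ↔ constantCoeff a ≠ 0 := by
  rw [MvPowerSeries.isUnit_iff_constantCoeff, isUnit_iff_ne_zero]

theorem mem_maximalIdeal {a : MvPowerSeries (Fin n) ℂ} :
    a ∈ IsLocalRing.maximalIdeal (MvPowerSeries (Fin n) ℂ) ↔ constantCoeff a = 0 := by
  rw [IsLocalRing.mem_maximalIdeal, mem_nonunits_iff, isUnit_iff, not_not]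

theorem order_eq_zero {a : MvPowerSeries (Fin n) ℂ} : a.order = 0 ↔ constantCoeff a ≠ 0 := by
  rw [← Order.lt_one_iff, ← not_le, one_le_order]

theorem order_eq_one {a : MvPowerSeries (Fin n) ℂ} (h0 : constantCoeff a = 0)
    (h1 : linPart a ≠ 0) : a.order = 1 := by
  refine le_antisymm ?_ (one_le_order.2 h0)
  by_contra h
  have : (2 : ℕ∞) ≤ a.order := by
    rw [← one_add_one_eq_two]
    exact Order.add_one_le_of_lt (not_le.1 h)
  exact h1 (two_le_order.1 this).2

theorem order_of_associated {a b : MvPowerSeries (Fin n) ℂ} (h : Associated a b) :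
    a.order = b.order := by
  obtain ⟨u, rfl⟩ := h
  rw [order_mul, order_eq_zero.2 (isUnit_iff.1 u.isUnit), add_zero]

/-- A power series of order one. -/
def IsSmooth (h : MvPowerSeries (Fin n) ℂ) : Prop := constantCoeff h = 0 ∧ linPart h ≠ 0

theorem IsSmooth.order_eq {h : MvPowerSeries (Fin n) ℂ} (hh : IsSmooth h) : h.order = 1 :=
  order_eq_one hh.1 hh.2

theorem isSmooth_of_order {h : MvPowerSeries (Fin n) ℂ} (hh : h.order = 1) : IsSmooth h := by
  refine ⟨one_le_order.1 hh.ge, fun h1 => ?_⟩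
  have := two_le_order.2 ⟨one_le_order.1 hh.ge, h1⟩
  rw [hh] at this
  exact absurd this (by norm_num)

theorem IsSmooth.ne_zero {h : MvPowerSeries (Fin n) ℂ} (hh : IsSmooth h) : h ≠ 0 := by
  rintro rfl; exact hh.2 (by simp)

theorem isPartOfCoords_one {h : MvPowerSeries (Fin n) ℂ} :
    IsPartOfCoords ![h] ↔ IsSmooth h := by
  rw [IsPartOfCoords, IsSmooth, linearIndependent_unique_iff]
  simp

theorem isPartOfCoords_two {h k : MvPowerSeries (Fin n) ℂ} :
    IsPartOfCoords ![h, k] ↔ constantCoeff h = 0 ∧ constantCoeff k = 0 ∧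
      LinearIndependent ℂ ![linPart h, linPart k] := by
  rw [IsPartOfCoords]
  have : (fun i => linPart (![h, k] i)) = ![linPart h, linPart k] := by
    ext i; fin_cases i <;> rfl
  rw [this]
  simp [Fin.forall_fin_two, and_assoc]

theorem _root_.IsPartOfCoords.left {h k : MvPowerSeries (Fin n) ℂ} (H : IsPartOfCoords ![h, k]) :
    IsSmooth h :=
  ⟨H.1 0, H.2.ne_zero 0⟩

theorem _root_.IsPartOfCoords.right {h k : MvPowerSeries (Fin n) ℂ} (H : IsPartOfCoords ![h, k]) :
    IsSmooth k :=
  ⟨H.1 1, H.2.ne_zero 1⟩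

theorem _root_.IsPartOfCoords.swap {h k : MvPowerSeries (Fin n) ℂ} (H : IsPartOfCoords ![h, k]) :
    IsPartOfCoords ![k, h] := by
  rw [isPartOfCoords_two] at *
  exact ⟨H.2.1, H.1, LinearIndependent.pair_symm_iff.1 H.2.2⟩

end LinearPart

/-! ### Formal coordinates of the plane and the maximal ideal. -/

section Plane

variable {h k : PlaneSeries}

instance {n : ℕ} : IsDomain (MvPowerSeries (Fin n) ℂ) := NoZeroDivisors.to_isDomain _

/-- The determinant of the linear parts. -/
def jac (h k : PlaneSeries) : ℂ := linPart h 0 * linPart k 1 - linPart h 1 * linPart k 0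

theorem linearIndependent_pair_iff (v w : Fin 2 → ℂ) :
    LinearIndependent ℂ ![v, w] ↔ v 0 * w 1 - v 1 * w 0 ≠ 0 := by
  have := (Matrix.linearIndependent_rows_iff_isUnit (K := ℂ) (A := Matrix.of ![v, w]))
  rw [Matrix.isUnit_iff_isUnit_det, isUnit_iff_ne_zero, Matrix.det_fin_two] at this
  exact this

theorem isPartOfCoords_iff_jac :
    IsPartOfCoords ![h, k] ↔ constantCoeff h = 0 ∧ constantCoeff k = 0 ∧ jac h k ≠ 0 := by
  rw [isPartOfCoords_two, linearIndependent_pair_iff]; rfl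

theorem exists_eq_X_mul_add {a : PlaneSeries} (ha : constantCoeff a = 0) :
    ∃ a₀ a₁ : PlaneSeries, a = X 0 * a₀ + X 1 * a₁ := by
  -- The monomials of `a` that are free of `X 0`; as `a` has no constant term, they are divisible by
  -- `X 1`.
  let b : PlaneSeries := fun m => if m 0 = 0 then coeff m a else 0
  have h1 : (X 0 : PlaneSeries) ∣ a - b := by
    rw [X_dvd_iff]
    intro m hm
    have : coeff m b = coeff m a := if_pos hm
    simp [this]
  have h2 : (X 1 : PlaneSeries) ∣ b := by
    rw [X_dvd_iff]
    intro m hm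
    by_cases h0 : m 0 = 0
    · have hm0 : m = 0 := by ext i; fin_cases i <;> simp [h0, hm]
      have hb : coeff m b = coeff m a := if_pos h0
      rw [hb, hm0, coeff_zero_eq_constantCoeff_apply, ha]
    · exact if_neg h0
  obtain ⟨a₀, h1⟩ := h1
  obtain ⟨a₁, h2⟩ := h2
  exact ⟨a₀, a₁, by rw [← h1, ← h2]; ring⟩

theorem maximalIdeal_eq_span_X :
    IsLocalRing.maximalIdeal PlaneSeries = Ideal.span {X 0, X 1} := by
  apply le_antisymm
  · intro a ha
    obtain ⟨a₀, a₁, rfl⟩ := exists_eq_X_mul_add (mem_maximalIdeal.1 ha)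
    exact Ideal.mem_span_pair.2 ⟨a₀, a₁, by ring⟩
  · rw [Ideal.span_le]
    rintro _ (rfl | rfl) <;> exact mem_maximalIdeal.2 (by simp)

/-- Completeness is what Weierstrass preparation and division over `ℂ⟦x, y⟧` need. -/
instance : IsAdicComplete (IsLocalRing.maximalIdeal PlaneSeries) PlaneSeries := by
  have : IsLocalRing.maximalIdeal PlaneSeries = Ideal.span (Set.range X) := by
    rw [maximalIdeal_eq_span_X]
    congr 1
    ext a
    simp [Fin.exists_fin_two, eq_comm]
  rw [this]
  infer_instance

/-- Two power series with independent linear parts generate the maximal ideal. -/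
theorem span_pair_eq_maximalIdeal (H : IsPartOfCoords ![h, k]) :
    Ideal.span {h, k} = IsLocalRing.maximalIdeal PlaneSeries := by
  rw [isPartOfCoords_iff_jac] at H
  obtain ⟨hh, hk, hj⟩ := H
  apply le_antisymm
  · rw [Ideal.span_le]
    rintro _ (rfl | rfl) <;> exact mem_maximalIdeal.2 (by assumption)
  obtain ⟨h₀, h₁, rfl⟩ := exists_eq_X_mul_add hh
  obtain ⟨k₀, k₁, rfl⟩ := exists_eq_X_mul_add hk
  -- The value of this determinant at the origin is the Jacobian; Cramer's rule then expresses `X 0`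
  -- and `X 1` by `h` and `k`.
  have hu : IsUnit (h₀ * k₁ - h₁ * k₀) := by
    rw [isUnit_iff]
    simpa [jac, linPart_mul, linPart_X] using hj
  obtain ⟨u, hu⟩ := hu
  have hu' : (h₀ * k₁ - h₁ * k₀) * (↑u⁻¹ : PlaneSeries) = 1 := by rw [← hu]; simp
  rw [maximalIdeal_eq_span_X, Ideal.span_le]
  rintro _ (rfl | rfl)
  · refine Ideal.mem_span_pair.2 ⟨k₁ * ↑u⁻¹, -h₁ * ↑u⁻¹, ?_⟩
    linear_combination (X 0 : PlaneSeries) * hu'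
  · refine Ideal.mem_span_pair.2 ⟨-k₀ * ↑u⁻¹, h₀ * ↑u⁻¹, ?_⟩
    linear_combination (X 1 : PlaneSeries) * hu'

theorem exists_eq_mul_add (H : IsPartOfCoords ![h, k]) {a : PlaneSeries}
    (ha : constantCoeff a = 0) : ∃ a₀ a₁ : PlaneSeries, a = h * a₀ + k * a₁ := by
  have := mem_maximalIdeal.2 ha
  rw [← span_pair_eq_maximalIdeal H, Ideal.mem_span_pair] at this
  obtain ⟨x, y, rfl⟩ := this
  exact ⟨x, y, by ring⟩

/-- Two series are part of coordinates if they generate the maximal ideal. -/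
theorem isPartOfCoords_of_span_eq
    (H : Ideal.span {h, k} = IsLocalRing.maximalIdeal PlaneSeries) :
    IsPartOfCoords ![h, k] := by
  have hh : constantCoeff h = 0 := mem_maximalIdeal.1 (H ▸ Ideal.subset_span (by simp))
  have hk : constantCoeff k = 0 := mem_maximalIdeal.1 (H ▸ Ideal.subset_span (by simp))
  have hX : ∀ i, ∃ a b : PlaneSeries, a * h + b * k = X i := fun i =>
    Ideal.mem_span_pair.1 (by rw [H]; exact mem_maximalIdeal.2 (by simp))
  obtain ⟨a, b, h0⟩ := hX 0
  obtain ⟨c, d, h1⟩ := hX 1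
  rw [isPartOfCoords_iff_jac]
  refine ⟨hh, hk, fun hj => ?_⟩
  have e0 := fun i => congrFun (congrArg linPart h0) i
  have e1 := fun i => congrFun (congrArg linPart h1) i
  simp only [linPart_add, linPart_mul, hh, hk, zero_smul, add_zero, Pi.add_apply, Pi.smul_apply,
    smul_eq_mul, linPart_X] at e0 e1
  have e00 := e0 0
  have e01 := e0 1
  have e10 := e1 0
  have e11 := e1 1
  simp at e00 e01 e10 e11
  rw [jac] at hj
  -- The determinant of the linear parts of `X 0`, `X 1` is one, but it is also a multiple of the
  -- Jacobian of `h`, `k`.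
  have : (constantCoeff a * linPart h 0 + constantCoeff b * linPart k 0) *
    (constantCoeff c * linPart h 1 + constantCoeff d * linPart k 1) -
    (constantCoeff a * linPart h 1 + constantCoeff b * linPart k 1) *
    (constantCoeff c * linPart h 0 + constantCoeff d * linPart k 0) = 0 := by
    linear_combination (constantCoeff a * constantCoeff d - constantCoeff b * constantCoeff c) * hj
  rw [e00, e01, e10, e11] at this
  norm_num at this

/-- A smooth series can be completed to a coordinate system. -/
theorem IsSmooth.exists_coords (hh : IsSmooth h) : ∃ i, IsPartOfCoords ![h, X i] := by
  by_contra H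
  push Not at H
  apply hh.2
  have h0 := H 0
  have h1 := H 1
  rw [isPartOfCoords_iff_jac] at h0 h1
  simp [hh.1, jac, linPart_X] at h0 h1
  ext i; fin_cases i <;> simp [h0, h1]

theorem IsSmooth.of_associated {n : ℕ} {h k : MvPowerSeries (Fin n) ℂ} (hh : IsSmooth h)
    (a : Associated h k) : IsSmooth k :=
  isSmooth_of_order (by rw [← order_of_associated a, hh.order_eq])

theorem _root_.IsPartOfCoords.of_associated {h' k' : PlaneSeries} (H : IsPartOfCoords ![h, k])
    (ah : Associated h h') (ak : Associated k k') : IsPartOfCoords ![h', k'] := by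
  apply isPartOfCoords_of_span_eq
  rw [← span_pair_eq_maximalIdeal H, Ideal.span_insert, Ideal.span_insert,
    Ideal.span_singleton_eq_span_singleton.2 ah, Ideal.span_singleton_eq_span_singleton.2 ak]

end Plane

end FatSilhouette
end

noncomputable section

namespace FatSilhouette

open MvPowerSeries

/-! ### Parametrizations of smooth plane branches. -/

section Arcs

/-- The value at the origin is preserved by every arc. -/
theorem constantCoeff_arc (ρ : PlaneSeries →ₐ[ℂ] PowerSeries ℂ) (a : PlaneSeries) :
    PowerSeries.constantCoeff (ρ a) = constantCoeff a := by
  by_contra H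
  -- If the values differed, this difference would be a unit with a non-unit as image.
  have hu : IsUnit (a - algebraMap ℂ PlaneSeries (PowerSeries.constantCoeff (ρ a))) := by
    rw [isUnit_iff]
    simpa [MvPowerSeries.algebraMap_apply, sub_eq_zero] using fun h => H h.symm
  have := hu.map ρ
  rw [map_sub, AlgHom.commutes, PowerSeries.isUnit_iff_constantCoeff] at this
  simp at this

/-- The tangent direction of an arc. -/
def arcDir (ρ : PlaneSeries →ₐ[ℂ] PowerSeries ℂ) : Fin 2 → ℂ := fun i => PowerSeries.coeff 1 (ρ (X i))

theorem coeff_one_mul (a b : PowerSeries ℂ) : PowerSeries.coeff 1 (a * b) =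
    PowerSeries.constantCoeff a * PowerSeries.coeff 1 b +
      PowerSeries.coeff 1 a * PowerSeries.constantCoeff b := by
  rw [PowerSeries.coeff_mul, Finset.Nat.antidiagonal_succ]
  simp

theorem coeff_one_arc (ρ : PlaneSeries →ₐ[ℂ] PowerSeries ℂ) (a : PlaneSeries) :
    PowerSeries.coeff 1 (ρ a) = linEval a (arcDir ρ) := by
  have h : constantCoeff (a - C (constantCoeff a)) = 0 := by simp
  obtain ⟨a₀, a₁, h⟩ := exists_eq_X_mul_add h
  have hC : ρ (C (constantCoeff a)) = PowerSeries.C (constantCoeff a) :=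
    ρ.commutes (constantCoeff a)
  have ha : a = C (constantCoeff a) + (X 0 * a₀ + X 1 * a₁) := by
    rw [← h]; simp
  generalize constantCoeff a = c at hC ha
  subst ha
  rw [map_add, hC]
  simp [coeff_one_mul, constantCoeff_arc, linEval, linPart_mul, linPart_X,
    arcDir]
  ring

/-- Restriction to the line in the direction `u`. -/
def lineArc (u : Fin 2 → ℂ) : PlaneSeries →ₐ[ℂ] PowerSeries ℂ :=
  substAlgHom (a := fun i => (MvPowerSeries.C (u i) * MvPowerSeries.X () : PowerSeries ℂ))
    (hasSubst_of_constantCoeff_zero fun i => by simp)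

theorem arcDir_lineArc (u : Fin 2 → ℂ) : arcDir (lineArc u) = u := by
  ext i
  rw [arcDir, lineArc, substAlgHom_X]
  exact (PowerSeries.coeff_C_mul 1 PowerSeries.X (u i)).trans (by simp)

theorem coeff_add_X_mul {n : ℕ} (m : Fin n →₀ ℕ) (i : Fin n) (b : MvPowerSeries (Fin n) ℂ) :
    coeff (m + Finsupp.single i 1) (X i * b) = coeff m b := by
  rw [X, add_comm, coeff_add_monomial_mul, one_mul]

instance : IsAdicComplete (IsLocalRing.maximalIdeal (MvPowerSeries (Fin 1) ℂ))
    (MvPowerSeries (Fin 1) ℂ) := by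
  have : IsLocalRing.maximalIdeal (MvPowerSeries (Fin 1) ℂ) = Ideal.span (Set.range X) := by
    apply le_antisymm
    · intro a ha
      rw [mem_maximalIdeal] at ha
      have : (X 0 : MvPowerSeries (Fin 1) ℂ) ∣ a := by
        rw [X_dvd_iff]
        intro m hm
        have : m = 0 := by ext; simpa using hm
        rw [this]; exact ha
      obtain ⟨b, rfl⟩ := this
      exact Ideal.mul_mem_right _ _ (Ideal.subset_span ⟨0, rfl⟩)
    · rw [Ideal.span_le]
      rintro _ ⟨i, rfl⟩
      exact mem_maximalIdeal.2 (by simp)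
  rw [this]
  infer_instance

/-- The quotient of a power series ring over a complete local ring by a series whose reduction has
order one. -/
theorem exists_section_of_order_one {A : Type*} [CommRing A] [IsLocalRing A]
    [IsAdicComplete (IsLocalRing.maximalIdeal A) A] {g : PowerSeries A}
    (h0 : PowerSeries.coeff 0 g ∈ IsLocalRing.maximalIdeal A)
    (h1 : IsUnit (PowerSeries.coeff 1 g)) :
    ∃ ρ : PowerSeries A →ₐ[A] A, RingHom.ker ρ = Ideal.span {g} := by
  have horder : (g.map (IsLocalRing.residue A)).order = 1 := by
    have := PowerSeries.order_eq_nat (φ := g.map (IsLocalRing.residue A)) (n := 1)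
    rw [Nat.cast_one] at this
    rw [this]
    refine ⟨?_, fun i hi => ?_⟩
    · rw [PowerSeries.coeff_map]
      exact (h1.map (IsLocalRing.residue A)).ne_zero
    · obtain rfl : i = 0 := by omega
      rw [PowerSeries.coeff_map, IsLocalRing.residue_eq_zero_iff]
      exact h0
  have hne : g.map (IsLocalRing.residue A) ≠ 0 := by
    intro h
    rw [h, PowerSeries.order_zero] at horder
    exact absurd horder (by simp)
  -- Up to a unit `g` is a monic linear polynomial `X - c`, so the quotient by `g` is `A[X]/(X - c)
  -- = A`.
  obtain ⟨W, u, H⟩ := PowerSeries.exists_isWeierstrassFactorization hne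
  have hdeg : W.natDegree = 1 := by
    rw [H.natDegree_eq_toNat_order_map, horder]; rfl
  have hW : W = Polynomial.X - Polynomial.C (-W.coeff 0) := by
    rw [map_neg, sub_neg_eq_add]
    conv_lhs => rw [Polynomial.eq_X_add_C_of_natDegree_le_one hdeg.le]
    have : W.coeff 1 = 1 := by
      have := H.isDistinguishedAt.monic.coeff_natDegree
      rwa [hdeg] at this
    rw [this]; simp
  have hspan : Ideal.span {(W : PowerSeries A)} = Ideal.span {g} := by
    rw [H.eq_mul, Ideal.span_singleton_mul_right_unit H.isUnit]
  let e := H.isDistinguishedAt.algEquivQuotient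
  let e' : (Polynomial A ⧸ Ideal.span {W}) ≃ₐ[A] A :=
    (Ideal.quotientEquivAlgOfEq A (by rw [← hW])).trans
      (Polynomial.quotientSpanXSubCAlgEquiv (-W.coeff 0))
  refine ⟨((e.symm.trans e').toAlgHom).comp (Ideal.Quotient.mkₐ A _), ?_⟩
  ext a
  rw [RingHom.mem_ker, ← hspan]
  change (e.symm.trans e') (Ideal.Quotient.mk _ a) = 0 ↔ _
  rw [EmbeddingLike.map_eq_zero_iff, Ideal.Quotient.eq_zero_iff_mem]

/-- As a series in the first variable over the series in the second one, `h` has order one modulo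
the maximal ideal; so the first variable can be eliminated. -/
theorem exists_arc_aux {h : PlaneSeries} (h0 : constantCoeff h = 0) (h1 : linPart h 0 ≠ 0) :
    ∃ ρ : PlaneSeries →ₐ[ℂ] PowerSeries ℂ, Function.Surjective ρ ∧
      RingHom.ker ρ = Ideal.span {h} := by
  let e := finSuccEquiv ℂ 1
  have c0 : PowerSeries.coeff 0 (e h) ∈ IsLocalRing.maximalIdeal (MvPowerSeries (Fin 1) ℂ) := by
    rw [mem_maximalIdeal, ← coeff_zero_eq_constantCoeff_apply, coeff_coeff_finSuccEquiv,
      Finsupp.cons_zero_zero]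
    exact h0
  have c1 : IsUnit (PowerSeries.coeff 1 (e h)) := by
    rw [isUnit_iff, ← coeff_zero_eq_constantCoeff_apply, coeff_coeff_finSuccEquiv]
    convert h1 using 1
    rw [linPart]
    congr 2
    ext i; fin_cases i <;> simp [Finsupp.cons]
  obtain ⟨σ, hσ⟩ := exists_section_of_order_one c0 c1
  let e₁ : MvPowerSeries (Fin 1) ℂ ≃ₐ[ℂ] PowerSeries ℂ :=
    renameEquiv ℂ (Equiv.ofUnique (Fin 1) Unit)
  let ρ : PlaneSeries →+* PowerSeries ℂ :=
    (e₁ : MvPowerSeries (Fin 1) ℂ →+* PowerSeries ℂ).comp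
      ((σ : _ →+* MvPowerSeries (Fin 1) ℂ).comp (e.toRingEquiv.toRingHom))
  refine ⟨⟨ρ, fun c => ?_⟩, ?_, ?_⟩
  · change e₁ (σ (e (C c))) = _
    rw [show e (C c) = PowerSeries.C (C c) from finSuccEquiv_C c]
    have : σ (PowerSeries.C (C c)) = C c := σ.commutes (C c)
    rw [this]
    exact e₁.commutes c
  · intro y
    refine ⟨e.symm (PowerSeries.C (e₁.symm y)), ?_⟩
    change e₁ (σ (e (e.symm _))) = y
    rw [AlgEquiv.apply_symm_apply]
    have : σ (PowerSeries.C (e₁.symm y)) = e₁.symm y := σ.commutes _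
    rw [this, AlgEquiv.apply_symm_apply]
  · ext a
    change e₁ (σ (e a)) = 0 ↔ _
    rw [EmbeddingLike.map_eq_zero_iff, ← RingHom.mem_ker (f := σ), hσ,
      Ideal.mem_span_singleton, Ideal.mem_span_singleton]
    exact map_dvd_iff e

/-- A smooth curve germ has a parametrization. -/
theorem IsSmooth.exists_arc {h : PlaneSeries} (hh : IsSmooth h) :
    ∃ ρ : PlaneSeries →ₐ[ℂ] PowerSeries ℂ, Function.Surjective ρ ∧
      RingHom.ker ρ = Ideal.span {h} := by
  by_cases h1 : linPart h 0 = 0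
  · let s : PlaneSeries ≃ₐ[ℂ] PlaneSeries := renameEquiv ℂ (Equiv.swap 0 1)
    have hs : linPart (s h) 0 = linPart h 1 := by
      have := coeff_embDomain_rename (Equiv.swap (0 : Fin 2) 1).toEmbedding h (Finsupp.single 1 1)
      rw [Finsupp.embDomain_single] at this
      exact this
    have h0 : constantCoeff (s h) = 0 := by
      have := constantCoeff_rename (f := Equiv.swap (0 : Fin 2) 1) h
      exact this.trans hh.1
    obtain ⟨ρ, h2, h3⟩ := exists_arc_aux h0 (by
      rw [hs]; intro h2; apply hh.2; ext i; fin_cases i <;> simpa)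
    refine ⟨ρ.comp s.toAlgHom, h2.comp s.surjective, ?_⟩
    ext a
    rw [RingHom.mem_ker]
    change ρ (s a) = 0 ↔ _
    rw [← RingHom.mem_ker, h3, Ideal.mem_span_singleton, Ideal.mem_span_singleton]
    exact map_dvd_iff s
  · exact exists_arc_aux hh.1 h1

/-- The uniformizer is in the image, and first-order coefficients along the arc only see the tangent
direction. -/
theorem arcDir_ne_zero {ρ : PlaneSeries →ₐ[ℂ] PowerSeries ℂ} (hρ : Function.Surjective ρ) :
    arcDir ρ ≠ 0 := by
  intro h
  obtain ⟨a, ha⟩ := hρ PowerSeries.X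
  have := coeff_one_arc ρ a
  rw [ha, h] at this
  simp [linEval_eq] at this

/-- The ideal `(h)` is the kernel of a parametrization, a map to a domain. -/
theorem IsSmooth.prime {h : PlaneSeries} (hh : IsSmooth h) : Prime h := by
  obtain ⟨ρ, -, h1⟩ := hh.exists_arc
  rw [← Ideal.span_singleton_prime hh.ne_zero, ← h1]
  exact RingHom.ker_isPrime _

theorem isSmooth_X (i : Fin 2) : IsSmooth (X i : PlaneSeries) := by
  refine ⟨by simp, fun h => ?_⟩
  have := congrFun h i
  simp [linPart_X] at this

end Arcs

end FatSilhouette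
end

noncomputable section

namespace FatSilhouette

open MvPowerSeries

/-! ### Automorphisms preserve the maximal ideal, its powers and coordinate systems. -/

section SquareOfMaximalIdeal

theorem mem_maximalIdeal_sq {a : PlaneSeries} :
    a ∈ IsLocalRing.maximalIdeal PlaneSeries ^ 2 ↔ constantCoeff a = 0 ∧ linPart a = 0 := by
  constructor
  · intro ha
    rw [pow_two] at ha
    refine Submodule.mul_induction_on ha (fun x hx y hy => ?_) fun x y hx hy => ?_
    · rw [mem_maximalIdeal] at hx hy
      simp [linPart_mul, hx, hy]
    · simp [hx.1, hx.2, hy.1, hy.2]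
  · rintro ⟨h0, h1⟩
    obtain ⟨a₀, a₁, rfl⟩ := exists_eq_X_mul_add h0
    have e0 := congrFun h1 0
    have e1 := congrFun h1 1
    simp [linPart_mul, linPart_X] at e0 e1
    rw [pow_two]
    exact add_mem (Ideal.mul_mem_mul (mem_maximalIdeal.2 (by simp)) (mem_maximalIdeal.2 e0))
      (Ideal.mul_mem_mul (mem_maximalIdeal.2 (by simp)) (mem_maximalIdeal.2 e1))

theorem map_maximalIdeal (σ : PlaneSeries ≃ₐ[ℂ] PlaneSeries) :
    (IsLocalRing.maximalIdeal PlaneSeries).map σ = IsLocalRing.maximalIdeal PlaneSeries := by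
  refine IsLocalRing.eq_maximalIdeal ?_
  have := Ideal.map_isMaximal_of_equiv (p := IsLocalRing.maximalIdeal PlaneSeries) σ.toRingEquiv
  exact this

/-- Coordinates are characterized as pairs of generators of the maximal ideal, which every
automorphism preserves. -/
theorem _root_.IsPartOfCoords.map {h k : PlaneSeries} (H : IsPartOfCoords ![h, k])
    (σ : PlaneSeries ≃ₐ[ℂ] PlaneSeries) : IsPartOfCoords ![σ h, σ k] := by
  apply isPartOfCoords_of_span_eq
  rw [← map_maximalIdeal σ, ← span_pair_eq_maximalIdeal H, Ideal.map_span, Set.image_pair]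

theorem IsSmooth.map {h : PlaneSeries} (hh : IsSmooth h) (σ : PlaneSeries ≃ₐ[ℂ] PlaneSeries) :
    IsSmooth (σ h) := by
  obtain ⟨i, hi⟩ := hh.exists_coords
  exact (hi.map σ).left

theorem not_associated_of_coords {h k : PlaneSeries} (H : IsPartOfCoords ![h, k]) :
    ¬ Associated h k := by
  rintro ⟨u, rfl⟩
  rw [isPartOfCoords_iff_jac] at H
  apply H.2.2
  simp [jac, linPart_mul, H.1]
  ring

end SquareOfMaximalIdeal

/-! ### Simply tangent germs and the ideal attached to them. -/

section Tangency

/-- The map of an ideal quotient to `ℂ³` given by the coefficients of order at most two along an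
arc. -/
theorem finrank_ne_two {ρ : PlaneSeries →ₐ[ℂ] PowerSeries ℂ} (hρ : Function.Surjective ρ)
    {I : Ideal PlaneSeries} (hI : ∀ a ∈ I, PowerSeries.X ^ 3 ∣ ρ a) :
    Module.finrank ℂ (PlaneSeries ⧸ I) ≠ 2 := by
  intro H
  let L : PlaneSeries →ₗ[ℂ] (Fin 3 → ℂ) :=
    LinearMap.pi fun i => (PowerSeries.coeff (i : ℕ)).comp ρ.toLinearMap
  have hL : Function.Surjective L := by
    intro v
    obtain ⟨a, ha⟩ := hρ (PowerSeries.mk fun i => if h : i < 3 then v ⟨i, h⟩ else 0)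
    refine ⟨a, ?_⟩
    ext i
    change PowerSeries.coeff (i : ℕ) (ρ a) = v i
    rw [ha, PowerSeries.coeff_mk]
    simp
  have hker : I.restrictScalars ℂ ≤ LinearMap.ker L := by
    intro a ha
    rw [LinearMap.mem_ker]
    ext i
    exact PowerSeries.X_pow_dvd_iff.1 (hI a ha) i i.2
  have h2 := Submodule.Quotient.restrictScalarsEquiv ℂ I
  rw [← h2.finrank_eq] at H
  -- The value two of `finrank` rules out the default value zero of infinite dimension; then the
  -- surjection to a space of dimension three is a contradiction.
  have : Module.Finite ℂ (PlaneSeries ⧸ I.restrictScalars ℂ) :=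
    Module.finite_of_finrank_pos (by omega)
  have h3 := LinearMap.finrank_le_finrank_of_surjective
    (f := (I.restrictScalars ℂ).liftQ L hker) (by
      intro v
      obtain ⟨a, ha⟩ := hL v
      exact ⟨Submodule.Quotient.mk a, ha⟩)
  rw [H, Module.finrank_fin_fun] at h3
  omega

theorem _root_.AreSimplyTangent.left {h g : PlaneSeries} (H : AreSimplyTangent h g) : IsSmooth h :=
  isPartOfCoords_one.1 H.1

theorem _root_.AreSimplyTangent.right {h g : PlaneSeries} (H : AreSimplyTangent h g) : IsSmooth g :=
  isPartOfCoords_one.1 H.2.1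

/-- Otherwise `h` and `g` generate the maximal ideal and the intersection multiplicity is one. -/
theorem _root_.AreSimplyTangent.jac_eq {h g : PlaneSeries} (H : AreSimplyTangent h g) : jac h g = 0 := by
  by_contra hj
  have hc : IsPartOfCoords ![h, g] := isPartOfCoords_iff_jac.2 ⟨H.left.1, H.right.1, hj⟩
  have h2 := H.2.2
  rw [span_pair_eq_maximalIdeal hc] at h2
  have := finrank_eq_one (R := ℂ)
    (1 : PlaneSeries ⧸ IsLocalRing.maximalIdeal PlaneSeries) one_ne_zero (fun w => by
      obtain ⟨a, rfl⟩ := Ideal.Quotient.mk_surjective w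
      refine ⟨constantCoeff a, ?_⟩
      rw [← map_one (Ideal.Quotient.mk _)]
      change Ideal.Quotient.mk _ (constantCoeff a • (1 : PlaneSeries)) = _
      rw [Ideal.Quotient.eq, mem_maximalIdeal]
      simp [MvPowerSeries.smul_eq_C_mul])
  omega

/-- Otherwise the ideal of the intersection is `(h)`, which vanishes to every order along the branch
`h = 0`. -/
theorem _root_.AreSimplyTangent.not_associated {h g : PlaneSeries} (H : AreSimplyTangent h g) :
    ¬ Associated h g := by
  intro ha
  obtain ⟨ρ, h1, h2⟩ := H.left.exists_arc
  refine finrank_ne_two h1 (I := Ideal.span {h, g}) (fun a ha' => ?_) H.2.2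
  have : a ∈ Ideal.span {h} := by
    refine (Ideal.span_le.2 ?_ : Ideal.span {h, g} ≤ Ideal.span {h}) ha'
    rintro _ (rfl | rfl)
    · exact Ideal.mem_span_singleton_self _
    · exact Ideal.mem_span_singleton.2 ha.dvd
  rw [← h2, RingHom.mem_ker] at this
  rw [this]
  exact dvd_zero _

/-- If `δ` and `a² - δ` are simply tangent then `a` and `δ` are coordinates. -/
theorem _root_.AreSimplyTangent.coords {δ a : PlaneSeries} (H : AreSimplyTangent δ (a ^ 2 - δ))
    (ha : constantCoeff a = 0) : IsPartOfCoords ![a, δ] := by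
  rw [isPartOfCoords_iff_jac]
  refine ⟨ha, H.left.1, fun hj => ?_⟩
  obtain ⟨ρ, h1, h2⟩ := H.left.exists_arc
  have hδ : ρ δ = 0 := by
    rw [← RingHom.mem_ker, h2]; exact Ideal.mem_span_singleton_self _
  -- If the linear parts are dependent, `a` vanishes to order two along the branch `δ = 0`. Then `a²
  -- - δ` vanishes to order four there, which exceeds the intersection multiplicity two.
  have hla : linEval a (arcDir ρ) = 0 := by
    have e := coeff_one_arc ρ δ
    rw [hδ, map_zero] at e
    simp only [linEval, Fin.sum_univ_two, jac] at e hj ⊢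
    by_contra hne
    apply H.left.2
    ext i
    fin_cases i
    · simp only [Fin.zero_eta, Pi.zero_apply]
      have : linPart δ 0 * (linPart a 0 * arcDir ρ 0 + linPart a 1 * arcDir ρ 1) = 0 := by
        linear_combination (-linPart a 0) * e - arcDir ρ 1 * hj
      simpa [hne] using this
    · simp only [Fin.mk_one, Pi.zero_apply]
      have : linPart δ 1 * (linPart a 0 * arcDir ρ 0 + linPart a 1 * arcDir ρ 1) = 0 := by
        linear_combination (-linPart a 1) * e + arcDir ρ 0 * hj
      simpa [hne] using this
  have hX : PowerSeries.X ^ 2 ∣ ρ a := by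
    rw [PowerSeries.X_pow_dvd_iff]
    intro m hm
    have : m = 0 ∨ m = 1 := by omega
    rcases this with rfl | rfl
    · rw [PowerSeries.coeff_zero_eq_constantCoeff_apply, constantCoeff_arc, ha]
    · rw [coeff_one_arc, hla]
  refine finrank_ne_two h1 (I := Ideal.span {δ, a ^ 2 - δ}) (fun b hb => ?_) H.2.2
  obtain ⟨x, y, rfl⟩ := Ideal.mem_span_pair.1 hb
  simp only [map_add, map_mul, map_sub, map_pow, hδ, mul_zero, zero_add, sub_zero]
  refine Dvd.dvd.mul_left (dvd_trans ?_ (pow_dvd_pow_of_dvd hX 2)) _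
  rw [← pow_mul]
  exact pow_dvd_pow _ (by norm_num)

theorem _root_.AreSimplyTangent.map {h g : PlaneSeries} (H : AreSimplyTangent h g)
    (σ : PlaneSeries ≃ₐ[ℂ] PlaneSeries) : AreSimplyTangent (σ h) (σ g) := by
  refine ⟨isPartOfCoords_one.2 (H.left.map σ), isPartOfCoords_one.2 (H.right.map σ), ?_⟩
  refine Eq.trans ?_ H.2.2
  refine (LinearEquiv.finrank_eq (Ideal.quotientEquivAlg (Ideal.span {h, g})
    (Ideal.span {σ h, σ g}) σ ?_).toLinearEquiv).symm
  rw [Ideal.map_span]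
  exact congrArg Ideal.span (Set.image_pair _ _ _).symm

theorem _root_.AreSimplyTangent.of_associated {h g h' g' : PlaneSeries} (H : AreSimplyTangent h g)
    (ah : Associated h h') (ag : Associated g g') : AreSimplyTangent h' g' := by
  refine ⟨isPartOfCoords_one.2 (H.left.of_associated ah),
    isPartOfCoords_one.2 (H.right.of_associated ag), ?_⟩
  refine Eq.trans ?_ H.2.2
  rw [Ideal.span_insert h, Ideal.span_insert h',
    Ideal.span_singleton_eq_span_singleton.2 ah, Ideal.span_singleton_eq_span_singleton.2 ag]

/-- The ratio of the linear parts of tangent germs. -/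
theorem exists_slope {h g : PlaneSeries} (hh : IsSmooth h) (hg : IsSmooth g) (hj : jac h g = 0) :
    ∃ c : ℂ, c ≠ 0 ∧ linPart g = c • linPart h := by
  rw [jac] at hj
  by_cases h0 : linPart h 0 = 0
  · have h1 : linPart h 1 ≠ 0 := fun h1 => hh.2 (by ext i; fin_cases i <;> simpa)
    have g0 : linPart g 0 = 0 := by simpa [h0, h1] using hj
    have g1 : linPart g 1 ≠ 0 := fun h1 => hg.2 (by ext i; fin_cases i <;> simpa)
    refine ⟨linPart g 1 / linPart h 1, div_ne_zero g1 h1, ?_⟩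
    ext i; fin_cases i
    · simp [g0, h0]
    · simp [h1]
  · refine ⟨linPart g 0 / linPart h 0, fun hc => hg.2 ?_, ?_⟩
    · have g0 : linPart g 0 = 0 := by simpa [h0] using hc
      have g1 : linPart g 1 = 0 := by simpa [h0, g0] using hj
      ext i; fin_cases i <;> simpa
    · ext i; fin_cases i
      · simp [h0]
      · simp only [Fin.mk_one, Pi.smul_apply, smul_eq_mul]
        field_simp
        linear_combination hj

/-- The ideal attached to tangent germs `h`, `g` the linear parts of which have the ratio `c`. -/
def tangIdeal (h g : PlaneSeries) (c : ℂ) : Ideal PlaneSeries :=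
  Ideal.span {g - C (4 * c) * h} ⊔
    (IsLocalRing.maximalIdeal PlaneSeries * Ideal.span {h} ⊔
      IsLocalRing.maximalIdeal PlaneSeries ^ 3)

theorem tangIdeal_map (h g : PlaneSeries) (c : ℂ) (σ : PlaneSeries ≃ₐ[ℂ] PlaneSeries) :
    (tangIdeal h g c).map σ = tangIdeal (σ h) (σ g) c := by
  have hC : ∀ z : ℂ, σ (C z) = C z := fun z => σ.commutes z
  rw [tangIdeal, tangIdeal, Ideal.map_sup, Ideal.map_sup, Ideal.map_mul, Ideal.map_pow,
    map_maximalIdeal, Ideal.map_span, Ideal.map_span, Set.image_singleton, Set.image_singleton,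
    map_sub, map_mul, hC]

/-- The ideal contains `𝔪 h`, so only the constant terms of the units matter, and the ratio of the
linear parts is rescaled in such a way that these constants cancel. -/
theorem tangIdeal_le_of_associated {h g : PlaneSeries} (c : ℂ) (u v : PlaneSeriesˣ) :
    tangIdeal (h * (u : PlaneSeries)) (g * (v : PlaneSeries))
      (c * constantCoeff (v : PlaneSeries) / constantCoeff (u : PlaneSeries)) ≤
        tangIdeal h g c := by
  have hu : constantCoeff (u : PlaneSeries) ≠ 0 := isUnit_iff.1 u.isUnit
  have hgen : g - C (4 * c) * h ∈ tangIdeal h g c :=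
    Ideal.mem_sup_left (Ideal.mem_span_singleton_self _)
  have hm : ∀ m : PlaneSeries, constantCoeff m = 0 → m * h ∈ tangIdeal h g c := fun m hm =>
    Ideal.mem_sup_right (Ideal.mem_sup_left (Ideal.mul_mem_mul (mem_maximalIdeal.2 hm)
      (Ideal.mem_span_singleton_self _)))
  refine sup_le ?_ (sup_le ?_ ?_)
  · rw [Ideal.span_singleton_le_iff_mem]
    set v₀ := constantCoeff (v : PlaneSeries)
    set u₀ := constantCoeff (u : PlaneSeries)
    have e : g * (v : PlaneSeries) - C (4 * (c * v₀ / u₀)) * (h * (u : PlaneSeries)) =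
        (v : PlaneSeries) * (g - C (4 * c) * h) + (C (4 * c) * ((v : PlaneSeries) - C v₀) -
          C (4 * c * v₀ / u₀) * ((u : PlaneSeries) - C u₀)) * h := by
      have e1 : (C (4 * c) * C v₀ : PlaneSeries) = C (4 * c * v₀ / u₀) * C u₀ := by
        rw [← map_mul, ← map_mul]; congr 1; field_simp
      have e2 : (C (4 * (c * v₀ / u₀)) : PlaneSeries) = C (4 * c * v₀ / u₀) := by
        congr 1; ring
      rw [e2]
      linear_combination h * e1
    rw [e]
    refine add_mem (Ideal.mul_mem_left _ _ hgen) (hm _ ?_)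
    simp [v₀, u₀]
  · rw [Ideal.span_singleton_mul_right_unit u.isUnit]
    exact le_sup_of_le_right le_sup_left
  · exact le_sup_of_le_right le_sup_right

theorem slope_of_units {h g : PlaneSeries} {c : ℂ} (hh : constantCoeff h = 0)
    (hg : constantCoeff g = 0) (H : linPart g = c • linPart h) (u v : PlaneSeriesˣ) :
    linPart (g * (v : PlaneSeries)) = (c * constantCoeff (v : PlaneSeries) / constantCoeff (u : PlaneSeries)) •
      linPart (h * (u : PlaneSeries)) := by
  have hu : constantCoeff (u : PlaneSeries) ≠ 0 := isUnit_iff.1 u.isUnit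
  rw [linPart_mul, linPart_mul, H, hh, hg]
  ext i
  simp
  field_simp

theorem slope_unique {h g : PlaneSeries} (hh : IsSmooth h) {c c' : ℂ}
    (H : linPart g = c • linPart h) (H' : linPart g = c' • linPart h) : c = c' :=
  smul_left_injective ℂ hh.2 (H.symm.trans H')

theorem tangIdeal_eq_of_associated {h g h' g' : PlaneSeries} (hh : IsSmooth h) (hg : IsSmooth g)
    {c c' : ℂ} (H : linPart g = c • linPart h) (H' : linPart g' = c' • linPart h')
    (ah : Associated h h') (ag : Associated g g') : tangIdeal h g c = tangIdeal h' g' c' := by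
  have key : ∀ {h g h' g' : PlaneSeries}, IsSmooth h → IsSmooth g → ∀ {c c' : ℂ},
      linPart g = c • linPart h → linPart g' = c' • linPart h' →
      Associated h h' → Associated g g' → tangIdeal h' g' c' ≤ tangIdeal h g c := by
    rintro h g _ _ hh hg c c' H H' ⟨u, rfl⟩ ⟨v, rfl⟩
    rw [slope_unique (hh.of_associated ⟨u, rfl⟩) H' (slope_of_units hh.1 hg.1 H u v)]
    exact tangIdeal_le_of_associated c u v
  exact le_antisymm (key (hh.of_associated ah) (hg.of_associated ag) H' H ah.symm ag.symm)
    (key hh hg H H' ah ag)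

end Tangency

/-! ### Infinitely near points: the cluster ideal has explicit generators. -/

section Cluster

/-- The quadratic part of a power series, evaluated at a vector. -/
def quadEval (a : PlaneSeries) (u : Fin 2 → ℂ) : ℂ := PowerSeries.coeff 2 (lineArc u a)

theorem lineArc_X (u : Fin 2 → ℂ) (i : Fin 2) :
    lineArc u (X i) = PowerSeries.C (u i) * PowerSeries.X := by
  rw [lineArc, substAlgHom_X]; rfl

theorem coeff_two_mul (a b : PowerSeries ℂ) : PowerSeries.coeff 2 (a * b) =
    PowerSeries.constantCoeff a * PowerSeries.coeff 2 b +
      PowerSeries.coeff 1 a * PowerSeries.coeff 1 b +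
      PowerSeries.coeff 2 a * PowerSeries.constantCoeff b := by
  rw [PowerSeries.coeff_mul, Finset.Nat.antidiagonal_succ]
  simp [Finset.Nat.antidiagonal_succ]
  ring

theorem quadEval_mul (a b : PlaneSeries) (u : Fin 2 → ℂ) : quadEval (a * b) u =
    constantCoeff a * quadEval b u + linEval a u * linEval b u +
      quadEval a u * constantCoeff b := by
  rw [quadEval, map_mul, coeff_two_mul, coeff_one_arc, coeff_one_arc, constantCoeff_arc,
    constantCoeff_arc, arcDir_lineArc]
  rfl

@[simp] theorem quadEval_add (a b : PlaneSeries) (u : Fin 2 → ℂ) :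
    quadEval (a + b) u = quadEval a u + quadEval b u := by simp [quadEval]

@[simp] theorem quadEval_sub (a b : PlaneSeries) (u : Fin 2 → ℂ) :
    quadEval (a - b) u = quadEval a u - quadEval b u := by simp [quadEval]

@[simp] theorem quadEval_C (c : ℂ) (u : Fin 2 → ℂ) : quadEval (C c) u = 0 := by
  have : lineArc u (C c) = PowerSeries.C c := (lineArc u).commutes c
  rw [quadEval, this, PowerSeries.coeff_C]
  simp

theorem quadEval_X (i : Fin 2) (u : Fin 2 → ℂ) : quadEval (X i) u = 0 := by
  rw [quadEval, lineArc_X, PowerSeries.coeff_C_mul, PowerSeries.coeff_X]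
  simp

theorem quadEval_C_mul (c : ℂ) (a : PlaneSeries) (u : Fin 2 → ℂ) :
    quadEval (C c * a) u = c * quadEval a u := by
  rw [quadEval_mul, quadEval_C, linEval_eq (C c), linPart_C, zero_dotProduct]
  simp

theorem linEval_X (i : Fin 2) (u : Fin 2 → ℂ) : linEval (X i : PlaneSeries) u = u i := by
  simp [linEval, linPart_X]

theorem blowup_hasSubst (r s : Fin 2 → ℂ) : HasSubst (fun i => MvPowerSeries.X 0 *
    (MvPowerSeries.C (r i) + MvPowerSeries.C (s i) * MvPowerSeries.X 1) : Fin 2 → PlaneSeries) :=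
  hasSubst_of_constantCoeff_zero fun i => by simp

theorem blowup_eq (r s : Fin 2 → ℂ) (a : PlaneSeries) :
    blowup r s a = substAlgHom (blowup_hasSubst r s) a := by
  rw [substAlgHom_apply]; rfl

theorem blowup_add (r s : Fin 2 → ℂ) (a b : PlaneSeries) :
    blowup r s (a + b) = blowup r s a + blowup r s b := by
  rw [blowup_eq, blowup_eq, blowup_eq, map_add]

theorem blowup_mul (r s : Fin 2 → ℂ) (a b : PlaneSeries) :
    blowup r s (a * b) = blowup r s a * blowup r s b := by
  rw [blowup_eq, blowup_eq, blowup_eq, map_mul]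

theorem blowup_C (r s : Fin 2 → ℂ) (c : ℂ) : blowup r s (C c) = C c := by
  rw [blowup_eq]; exact (substAlgHom (blowup_hasSubst r s)).commutes c

theorem blowup_X (r s : Fin 2 → ℂ) (i : Fin 2) :
    blowup r s (X i) = X 0 * (C (r i) + C (s i) * X 1) := by
  rw [blowup_eq, substAlgHom_X]

theorem exists_transform (r s : Fin 2 → ℂ) {a : PlaneSeries} (ha : constantCoeff a = 0) :
    ∃ a', blowup r s a = X 0 * a' := by
  obtain ⟨a₀, a₁, rfl⟩ := exists_eq_X_mul_add ha
  refine ⟨(C (r 0) + C (s 0) * X 1) * blowup r s a₀ + (C (r 1) + C (s 1) * X 1) * blowup r s a₁, ?_⟩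
  rw [blowup_add, blowup_mul, blowup_mul, blowup_X, blowup_X]
  ring

theorem constantCoeff_blowup (r s : Fin 2 → ℂ) (a : PlaneSeries) :
    constantCoeff (blowup r s a) = constantCoeff a := by
  have h : constantCoeff (a - C (constantCoeff a)) = 0 := by simp
  obtain ⟨a', h'⟩ := exists_transform r s h
  have : a = C (constantCoeff a) + (a - C (constantCoeff a)) := by ring
  rw [this, blowup_add, blowup_C, h']
  simp

theorem linPart_blowup (r s : Fin 2 → ℂ) (a : PlaneSeries) (i : Fin 2) :
    linPart (blowup r s a) i = if i = 0 then linEval a r else 0 := by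
  have h : constantCoeff (a - C (constantCoeff a)) = 0 := by simp
  obtain ⟨a₀, a₁, h'⟩ := exists_eq_X_mul_add h
  have : a = C (constantCoeff a) + (X 0 * a₀ + X 1 * a₁) := by rw [← h']; ring
  generalize constantCoeff a = c at this
  rw [this, blowup_add, blowup_C, blowup_add, blowup_mul, blowup_mul, blowup_X, blowup_X]
  fin_cases i <;>
  simp [linPart_mul, linEval_mul, linPart_X, linEval_X, constantCoeff_blowup, linEval_eq (C c)]

/-- The first coefficients of the controlled transform. -/
theorem transform_coeffs {r s : Fin 2 → ℂ} {a a' : PlaneSeries} (H : blowup r s a = X 0 * a') :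
    constantCoeff a = 0 ∧ constantCoeff a' = linEval a r ∧
      linPart a' 0 = quadEval a r ∧ linPart a' 1 = linEval a s := by
  have h0 : constantCoeff a = 0 := by
    rw [← constantCoeff_blowup r s, H]; simp
  refine ⟨h0, ?_⟩
  obtain ⟨a₀, a₁, rfl⟩ := exists_eq_X_mul_add h0
  have : a' = (C (r 0) + C (s 0) * X 1) * blowup r s a₀ +
      (C (r 1) + C (s 1) * X 1) * blowup r s a₁ := by
    apply mul_left_cancel₀ (isSmooth_X 0).ne_zero
    rw [← H, blowup_add, blowup_mul, blowup_mul, blowup_X, blowup_X]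
    ring
  subst this
  refine ⟨?_, ?_, ?_⟩
  · simp [linEval_mul, linEval_X, constantCoeff_blowup]; ring
  · simp only [linPart_add, linPart_mul, linPart_C, Pi.add_apply, Pi.smul_apply, Pi.zero_apply,
      linPart_blowup, linPart_X, quadEval_add, quadEval_mul, quadEval_X, linEval_X]
    simp
  · simp only [linPart_add, linPart_mul, linPart_C, Pi.add_apply, Pi.smul_apply, Pi.zero_apply,
      linPart_blowup, linPart_X, constantCoeff_blowup, linEval_add, linEval_mul, linEval_X]
    simp

/-- The three vanishing conditions become conditions on the terms of order at most two. In
particular they do not involve `τ`. -/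
theorem vanishesOnCluster_iff {r s ρ τ : Fin 2 → ℂ} {a : PlaneSeries} :
    VanishesOnCluster r s ρ τ a ↔ constantCoeff a = 0 ∧ linEval a r = 0 ∧
      quadEval a r * ρ 0 + linEval a s * ρ 1 = 0 := by
  constructor
  · rintro ⟨h0, a', a'', ⟨h1, h2⟩, h3, h4⟩
    obtain ⟨-, e1, e2, e3⟩ := transform_coeffs h1
    obtain ⟨-, e4, -⟩ := transform_coeffs h3
    refine ⟨h0, e1 ▸ h2, ?_⟩
    rw [e4, linEval, Fin.sum_univ_two, e2, e3] at h4
    exact h4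
  · rintro ⟨h0, h1, h2⟩
    obtain ⟨a', ha'⟩ := exists_transform r s h0
    obtain ⟨-, e1, e2, e3⟩ := transform_coeffs ha'
    rw [h1] at e1
    obtain ⟨a'', ha''⟩ := exists_transform ρ τ e1
    obtain ⟨-, e4, -⟩ := transform_coeffs ha''
    refine ⟨h0, a', a'', ⟨ha', e1⟩, ha'', ?_⟩
    rw [e4, linEval, Fin.sum_univ_two, e2, e3]
    exact h2

/-- The ideal of the series that vanish on a cluster of three infinitely near points. -/
def clusterIdeal (r s ρ : Fin 2 → ℂ) : Ideal PlaneSeries where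
  carrier := {a | constantCoeff a = 0 ∧ linEval a r = 0 ∧
    quadEval a r * ρ 0 + linEval a s * ρ 1 = 0}
  add_mem' := by
    rintro a b ⟨h0, h1, h2⟩ ⟨h3, h4, h5⟩
    refine ⟨by simp [h0, h3], by simp [h1, h4], ?_⟩
    simp only [quadEval_add, linEval_add]
    linear_combination h2 + h5
  zero_mem' := by simp [linEval_eq, quadEval]
  smul_mem' := by
    rintro b a ⟨h0, h1, h2⟩
    refine ⟨by simp [h0], by simp [linEval_mul, h0, h1], ?_⟩
    simp only [smul_eq_mul, quadEval_mul, linEval_mul, h0, h1]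
    linear_combination constantCoeff b * h2

theorem linEval_smul_of {g h : PlaneSeries} {c : ℂ} (H : linPart g = c • linPart h)
    (u : Fin 2 → ℂ) : linEval g u = c * linEval h u := by
  simp [linEval_eq, H]

theorem isPair_linEval_ne_zero {r s : Fin 2 → ℂ} (hrs : IsPair r s) {h : PlaneSeries}
    (hh : IsSmooth h) (hr : linEval h r = 0) : linEval h s ≠ 0 := by
  intro hs
  simp only [linEval, Fin.sum_univ_two] at hr hs
  rw [IsPair] at hrs
  apply hh.2
  ext i; fin_cases i
  · have : linPart h 0 * (r 0 * s 1 - r 1 * s 0) = 0 := by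
      linear_combination s 1 * hr - r 1 * hs
    simpa [hrs] using this
  · have : linPart h 1 * (r 0 * s 1 - r 1 * s 0) = 0 := by
      linear_combination r 0 * hs - s 0 * hr
    simpa [hrs] using this

/-- Let `t` be the coordinate on the second exceptional line that is `0` on `B''` and `1` on `W''`.
The restrictions of the linear parts of `g'` and `c h'` have the ratio `(t - 1) / t`, which equals
`4` for `t = -1/3`. Thus `g - 4c h` is the member of the pencil that passes through the third point,
as `key` says; it generates the ideal together with `𝔪 h + 𝔪³`. -/
theorem clusterIdeal_eq {h g : PlaneSeries} {c : ℂ} (hh : IsSmooth h) (hg : IsSmooth g)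
    (hc : c ≠ 0) (hs : linPart g = c • linPart h) {r s ρ : Fin 2 → ℂ} (hrs : IsPair r s)
    (hρ : ρ 0 ≠ 0) (hr : linEval h r = 0)
    (key : 3 * c * linEval h s * ρ 1 = (quadEval g r - 4 * c * quadEval h r) * ρ 0) :
    clusterIdeal r s ρ = tangIdeal h g c := by
  have hl := isPair_linEval_ne_zero hrs hh hr
  have hgen : g - C (4 * c) * h ∈ clusterIdeal r s ρ := by
    refine ⟨by simp [hh.1, hg.1], ?_, ?_⟩
    · rw [linEval_sub, linEval_C_mul, linEval_smul_of hs, hr]; ring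
    · rw [linEval_sub, linEval_C_mul, quadEval_sub, quadEval_C_mul, linEval_smul_of hs]
      linear_combination -key
  apply le_antisymm
  · intro a ha
    obtain ⟨k, hk⟩ : ∃ k, IsPartOfCoords ![h, k] := by
      obtain ⟨i, hi⟩ := hh.exists_coords; exact ⟨_, hi⟩
    have hkr : linEval k r ≠ 0 := by
      intro hkr
      have := isPartOfCoords_iff_jac.1 hk
      simp only [linEval, Fin.sum_univ_two] at hr hkr
      apply hrs
      have h0 : r 0 = 0 := by
        have : jac h k * r 0 = 0 := by rw [jac]; linear_combination linPart k 1 * hr - linPart h 1 * hkr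
        simpa [‹_ ∧ _ ∧ jac h k ≠ 0›.2.2] using this
      have h1 : r 1 = 0 := by
        have : jac h k * r 1 = 0 := by rw [jac]; linear_combination linPart h 0 * hkr - linPart k 0 * hr
        simpa [‹_ ∧ _ ∧ jac h k ≠ 0›.2.2] using this
      rw [h0, h1]; ring
    obtain ⟨a₀, a₁, rfl⟩ := exists_eq_mul_add hk ha.1
    have ha1 : constantCoeff a₁ = 0 := by
      have := ha.2.1
      rw [linEval_add, linEval_mul, linEval_mul, hh.1, hk.right.1, hr] at this
      simpa [hkr] using this
    set κ := constantCoeff a₀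
    -- The linear part of `g - 4c h` is `-3c` times that of `h`; so this multiple removes the linear
    -- part of `a`, which is `κ` times that of `h`.
    set b := h * a₀ + k * a₁ + C (κ / (3 * c)) * (g - C (4 * c) * h) with hb
    have hbmem : b ∈ clusterIdeal r s ρ := add_mem ha (Ideal.mul_mem_left _ _ hgen)
    have hblin : linPart b = 0 := by
      rw [hb]
      simp only [linPart_add, linPart_mul, linPart_sub, hs, hh.1,
        hk.right.1, ha1]
      ext i
      simp [κ]
      field_simp
      ring
    obtain ⟨b₀, b₁, hb'⟩ := exists_eq_mul_add hk hbmem.1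
    have hjac := isPartOfCoords_iff_jac.1 hk
    have e0 := congrFun hblin 0
    have e1 := congrFun hblin 1
    rw [hb'] at e0 e1
    simp [linPart_mul, hh.1, hk.right.1] at e0 e1
    have hb0 : constantCoeff b₀ = 0 := by
      have : jac h k * constantCoeff b₀ = 0 := by
        rw [jac]; linear_combination linPart k 1 * e0 - linPart k 0 * e1
      simpa [hjac.2.2] using this
    have hb1 : constantCoeff b₁ = 0 := by
      have : jac h k * constantCoeff b₁ = 0 := by
        rw [jac]; linear_combination linPart h 0 * e1 - linPart h 1 * e0
      simpa [hjac.2.2] using this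
    obtain ⟨c₀, c₁, rfl⟩ := exists_eq_mul_add hk hb1
    -- For an element of order at least two the third condition says that the coefficient of `k²`
    -- vanishes, because `h` but not `k` vanishes in the direction `r`.
    have hc1 : constantCoeff c₁ = 0 := by
      have := hbmem.2.2
      rw [linEval_eq b, hblin, zero_dotProduct, zero_mul, add_zero, hb'] at this
      simp [quadEval_mul, linEval_mul, hh.1, hk.right.1, hr, hb0, hkr, hρ] at this
      exact this
    have : h * a₀ + k * a₁ = b - C (κ / (3 * c)) * (g - C (4 * c) * h) := by rw [hb]; ring
    rw [this, hb']
    refine sub_mem ?_ (Ideal.mul_mem_left _ _ (Ideal.mem_sup_left (Ideal.mem_span_singleton_self _)))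
    apply Ideal.mem_sup_right
    have e : h * b₀ + k * (h * c₀ + k * c₁) = (b₀ + k * c₀) * h + k * k * c₁ := by ring
    rw [e]
    refine add_mem (Ideal.mem_sup_left (Ideal.mul_mem_mul (mem_maximalIdeal.2 ?_)
      (Ideal.mem_span_singleton_self _))) (Ideal.mem_sup_right ?_)
    · simp [hb0, hk.right.1]
    · rw [pow_succ, pow_two]
      have := mem_maximalIdeal.2 hk.right.1
      exact Ideal.mul_mem_mul (Ideal.mul_mem_mul this this) (mem_maximalIdeal.2 hc1)
  · refine sup_le ?_ (sup_le ?_ ?_)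
    · rwa [Ideal.span_singleton_le_iff_mem]
    · rw [Ideal.mul_le]
      intro m hm y hy
      obtain ⟨x, rfl⟩ := Ideal.mem_span_singleton.1 hy
      rw [mem_maximalIdeal] at hm
      rw [show m * (h * x) = x * (m * h) by ring]
      refine Ideal.mul_mem_left _ _ ⟨by simp [hm], ?_, ?_⟩ <;>
        simp [linEval_mul, quadEval_mul, hm, hh.1, hr]
    · rw [pow_succ, pow_two, Ideal.mul_le]
      intro x hx y hy
      rw [mem_maximalIdeal] at hy
      have hx : constantCoeff x = 0 ∧ linPart x = 0 := by
        rw [← pow_two] at hx; exact mem_maximalIdeal_sq.1 hx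
      refine ⟨by simp [hy], ?_, ?_⟩ <;>
        simp [linEval_mul, quadEval_mul, hy, hx.1, linEval_eq x, hx.2]

/-- The cluster of a pair of simply tangent germs determines the ideal. -/
theorem clusterIdeal_of_isTangentialCluster {h g : PlaneSeries} {c : ℂ} (hh : IsSmooth h)
    (hg : IsSmooth g) (hc : c ≠ 0) (hs : linPart g = c • linPart h) {r s ρ τ : Fin 2 → ℂ}
    (H : IsTangentialCluster h g r s ρ τ) (a : PlaneSeries) :
    VanishesOnCluster r s ρ τ a ↔ a ∈ tangIdeal h g c := by
  obtain ⟨hrs, hρτ, h', g', ⟨h1, h2⟩, ⟨h3, h4⟩, w, hw, h5, h6⟩ := H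
  obtain ⟨-, e1, e2, e3⟩ := transform_coeffs h1
  obtain ⟨-, f1, f2, f3⟩ := transform_coeffs h3
  have hr : linEval h r = 0 := e1 ▸ h2
  have hl := isPair_linEval_ne_zero hrs hh hr
  rw [linEval, Fin.sum_univ_two, f2, f3] at h5
  rw [linEval, linEval, Fin.sum_univ_two, Fin.sum_univ_two, e2, e3] at h6
  rw [linEval_smul_of hs] at h5
  -- The strict transform of `W` does not meet that of the first exceptional line on the second one.
  have hw0 : w 0 ≠ 0 := by
    intro hw0
    apply hw
    rw [hw0] at h5
    have : w 1 = 0 := by simpa [hc, hl] using h5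
    ext i; fin_cases i <;> simpa
  -- Elimination of `w` from the equation of `W''` and the condition that the coordinate of `ρ` is
  -- `-1/3`.
  have key : 3 * c * linEval h s * ρ 1 = (quadEval g r - 4 * c * quadEval h r) * ρ 0 := by
    apply mul_left_cancel₀ hw0
    linear_combination c * h6 - ρ 0 * h5
  have hρ0 : ρ 0 ≠ 0 := by
    intro hρ0
    rw [hρ0] at key
    have : ρ 1 = 0 := by simpa [hc, hl] using key
    apply hρτ
    rw [hρ0, this]; ring
  rw [← clusterIdeal_eq hh hg hc hs hrs hρ0 hr key, vanishesOnCluster_iff]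
  rfl

theorem exists_isTangentialCluster {h g : PlaneSeries} {c : ℂ} (hh : IsSmooth h)
    (hg : IsSmooth g) (hc : c ≠ 0) (hs : linPart g = c • linPart h) :
    ∃ r s ρ τ : Fin 2 → ℂ, IsTangentialCluster h g r s ρ τ := by
  obtain ⟨r, s, hrs, hr⟩ : ∃ r s : Fin 2 → ℂ, IsPair r s ∧ linEval h r = 0 := by
    by_cases h0 : linPart h 0 = 0
    · exact ⟨![1, 0], ![0, 1], by simp [IsPair], by simp [linEval, h0]⟩
    · exact ⟨![-linPart h 1, linPart h 0], ![1, 0], by simp [IsPair, h0], by simp [linEval]; ring⟩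
  have hl := isPair_linEval_ne_zero hrs hh hr
  obtain ⟨h', h1⟩ := exists_transform r s hh.1
  obtain ⟨g', h3⟩ := exists_transform r s hg.1
  obtain ⟨-, e1, e2, e3⟩ := transform_coeffs h1
  obtain ⟨-, f1, f2, f3⟩ := transform_coeffs h3
  -- The vector `ρ` solves the linear equation for the third point, and the vector `w` below spans
  -- the kernel of the linear part of `g'`.
  refine ⟨r, s, ![3 * c * linEval h s, quadEval g r - 4 * c * quadEval h r], ![0, 1], hrs, ?_,
    h', g', ⟨h1, e1.trans hr⟩, ⟨h3, f1.trans (by rw [linEval_smul_of hs, hr, mul_zero])⟩,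
    ![c * linEval h s, -quadEval g r], ?_, ?_, ?_⟩
  · simp [IsPair, hc, hl]
  · intro h0
    have := congrFun h0 0
    simp [hc, hl] at this
  · rw [linEval, Fin.sum_univ_two, f2, f3, linEval_smul_of hs]
    simp
    ring
  · have h6 : ∀ u : Fin 2 → ℂ, linEval h' u = quadEval h r * u 0 + linEval h s * u 1 := fun u => by
      rw [linEval, Fin.sum_univ_two, e2, e3]
    rw [h6, h6]
    simp
    ring

end Cluster

end FatSilhouette
end

noncomputable section

namespace FatSilhouette

open MvPowerSeries

/-! ### Dependence on the equation of the fat silhouette only. -/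

section Associates

variable {R : Type*} [CommRing R] [IsDomain R]

/-- Unique factorization with multiplicities. If `h` were associated to `g'`, cancellation would
leave `g²` and `h' g'`; then `g` is associated to `g'` in either case, hence to `h`. -/
theorem associated_of_mul_sq {h g h' g' : R} (hh : Prime h) (hg : Prime g) (hh' : Prime h')
    (hg' : Prime g') (hn : ¬ Associated h g) (H : Associated (h * g ^ 2) (h' * g' ^ 2)) :
    Associated h h' ∧ Associated g g' := by
  have h1 : h ∣ h' * g' ^ 2 := (dvd_mul_right _ _).trans H.dvd
  have h2 : Associated h h' → Associated g g' := fun ha => by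
    have := Associated.of_mul_left H ha hh.ne_zero
    exact (hg.dvd_prime_iff_associated hg').1
      (hg.dvd_of_dvd_pow ((dvd_pow_self g two_ne_zero).trans this.dvd))
  rcases hh.dvd_or_dvd h1 with h1 | h1
  · have := (hh.dvd_prime_iff_associated hh').1 h1
    exact ⟨this, h2 this⟩
  · exfalso
    have ha := (hh.dvd_prime_iff_associated hg').1 (hh.dvd_of_dvd_pow h1)
    have H' : Associated (h * g ^ 2) (g' * (h' * g')) := by
      rwa [show g' * (h' * g') = h' * g' ^ 2 by ring]
    have H2 := Associated.of_mul_left H' ha hh.ne_zero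
    have hd : g ∣ h' * g' := (dvd_pow_self g two_ne_zero).trans H2.dvd
    rcases hg.dvd_or_dvd hd with hd | hd
    · have hc := (hg.dvd_prime_iff_associated hh').1 hd
      have H3 := Associated.of_mul_left (a := g) (by rwa [← pow_two]) hc hg.ne_zero
      exact hn (ha.trans H3.symm)
    · exact hn (ha.trans ((hg.dvd_prime_iff_associated hg').1 hd).symm)

theorem exists_associated_of_dvd_prod_sq {ι : Type*} [Fintype ι] {p : R} (hp : Prime p) {h : ι → R}
    (hh : ∀ i, Prime (h i)) (H : p ∣ (∏ i, h i) ^ 2) : ∃ i, Associated p (h i) := by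
  obtain ⟨i, -, hi⟩ := hp.exists_mem_finset_dvd (hp.dvd_of_dvd_pow H)
  exact ⟨i, (hp.dvd_prime_iff_associated (hh i)).1 hi⟩

end Associates

/-- The indexed form makes the invariance under permutations a change of summation index. -/
theorem sumOfSquaresIdeal_eq (h : Fin 3 → PlaneSeries) : sumOfSquaresIdeal (h 0) (h 1) (h 2) =
    Ideal.span {s | ∃ a : Fin 3 → PlaneSeries, (∀ i, a i ∈ Ideal.span {h i}) ∧ ∑ i, a i = 0 ∧
      s = ∑ i, a i ^ 2} := by
  rw [sumOfSquaresIdeal]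
  congr 1
  ext s
  constructor
  · rintro ⟨a₁, a₂, a₃, h1, h2, h3, h0, rfl⟩
    refine ⟨![a₁, a₂, a₃], fun i => ?_, ?_, ?_⟩
    · fin_cases i <;> assumption
    · simpa [Fin.sum_univ_three] using h0
    · simp [Fin.sum_univ_three]
  · rintro ⟨a, h1, h0, rfl⟩
    rw [Fin.sum_univ_three] at h0
    exact ⟨a 0, a 1, a 2, h1 0, h1 1, h1 2, h0, by rw [Fin.sum_univ_three]⟩

theorem sumOfSquaresIdeal_congr {h h' : Fin 3 → PlaneSeries} (e : Fin 3 ≃ Fin 3)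
    (H : ∀ i, Associated (h i) (h' (e i))) :
    sumOfSquaresIdeal (h 0) (h 1) (h 2) = sumOfSquaresIdeal (h' 0) (h' 1) (h' 2) := by
  rw [sumOfSquaresIdeal_eq, sumOfSquaresIdeal_eq]
  congr 1
  ext s
  constructor
  · rintro ⟨a, h1, h0, rfl⟩
    refine ⟨a ∘ e.symm, fun i => ?_, ?_, ?_⟩
    · have := h1 (e.symm i)
      rwa [Ideal.span_singleton_eq_span_singleton.2 (H (e.symm i)), e.apply_symm_apply] at this
    · rw [← h0]; exact Equiv.sum_comp e.symm a
    · exact (Equiv.sum_comp e.symm fun i => a i ^ 2).symm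
  · rintro ⟨a, h1, h0, rfl⟩
    refine ⟨a ∘ e, fun i => ?_, ?_, ?_⟩
    · have := h1 (e i)
      rwa [← Ideal.span_singleton_eq_span_singleton.2 (H i)] at this
    · rw [← h0]; exact Equiv.sum_comp e a
    · exact (Equiv.sum_comp e fun i => a i ^ 2).symm

theorem sumOfSquaresIdeal_map_le (h₁ h₂ h₃ : PlaneSeries) (σ : PlaneSeries ≃ₐ[ℂ] PlaneSeries) :
    (sumOfSquaresIdeal h₁ h₂ h₃).map σ ≤ sumOfSquaresIdeal (σ h₁) (σ h₂) (σ h₃) := by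
  rw [sumOfSquaresIdeal, Ideal.map_span, Ideal.span_le]
  rintro _ ⟨_, ⟨a₁, a₂, a₃, h1, h2, h3, h0, rfl⟩, rfl⟩
  apply Ideal.subset_span
  rw [Ideal.mem_span_singleton] at h1 h2 h3
  refine ⟨σ a₁, σ a₂, σ a₃, ?_, ?_, ?_, ?_, by simp⟩
  · exact Ideal.mem_span_singleton.2 (map_dvd σ h1)
  · exact Ideal.mem_span_singleton.2 (map_dvd σ h2)
  · exact Ideal.mem_span_singleton.2 (map_dvd σ h3)
  · rw [← map_add, ← map_add, h0, map_zero]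

theorem sumOfSquaresIdeal_map (h₁ h₂ h₃ : PlaneSeries) (σ : PlaneSeries ≃ₐ[ℂ] PlaneSeries) :
    (sumOfSquaresIdeal h₁ h₂ h₃).map σ = sumOfSquaresIdeal (σ h₁) (σ h₂) (σ h₃) := by
  refine le_antisymm (sumOfSquaresIdeal_map_le h₁ h₂ h₃ σ) ?_
  have := sumOfSquaresIdeal_map_le (σ h₁) (σ h₂) (σ h₃) σ.symm
  simp only [AlgEquiv.symm_apply_apply] at this
  intro a ha
  rw [← σ.apply_symm_apply a]
  exact Ideal.mem_map_of_mem σ (this (Ideal.mem_map_of_mem σ.symm ha))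

/-- The ratio of linear parts is intrinsic: it means that `g - c h` lies in `𝔪²`, which
automorphisms preserve. -/
theorem linPart_map_smul {h g : PlaneSeries} {c : ℂ} (hh : constantCoeff h = 0)
    (hg : constantCoeff g = 0) (H : linPart g = c • linPart h)
    (σ : PlaneSeries ≃ₐ[ℂ] PlaneSeries) : linPart (σ g) = c • linPart (σ h) := by
  have : g - C c * h ∈ IsLocalRing.maximalIdeal PlaneSeries ^ 2 := by
    rw [mem_maximalIdeal_sq]; simp [hh, hg, H]
  have := Ideal.mem_map_of_mem σ this
  rw [Ideal.map_pow, map_maximalIdeal, mem_maximalIdeal_sq, map_sub, map_mul] at this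
  have hC : σ (C c) = C c := σ.commutes c
  rw [hC] at this
  have h2 := this.2
  rw [linPart_sub, linPart_C_mul, sub_eq_zero] at h2
  exact h2

/-- This removes the frames `r, s, ρ, τ` of the blow-ups, so that independence of choices and
invariance can be checked on generators. -/
theorem isSilhouetteIdeal_tangential_iff {D : PlaneSeries} {I : Ideal PlaneSeries} :
    IsSilhouetteIdeal D I .tangential ↔ ∃ (h g : PlaneSeries) (c : ℂ), AreSimplyTangent h g ∧
      Associated D (h * g ^ 2) ∧ c ≠ 0 ∧ linPart g = c • linPart h ∧ I = tangIdeal h g c := by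
  constructor
  · rintro ⟨h, g, H, hD, r, s, ρ, τ, hcl, hI⟩
    obtain ⟨c, hc, hs⟩ := exists_slope H.left H.right H.jac_eq
    refine ⟨h, g, c, H, hD, hc, hs, ?_⟩
    ext a
    rw [hI, clusterIdeal_of_isTangentialCluster H.left H.right hc hs hcl]
  · rintro ⟨h, g, c, H, hD, hc, hs, rfl⟩
    obtain ⟨r, s, ρ, τ, hcl⟩ := exists_isTangentialCluster H.left H.right hc hs
    exact ⟨h, g, H, hD, r, s, ρ, τ, hcl, fun a =>
      (clusterIdeal_of_isTangentialCluster H.left H.right hc hs hcl a).symm⟩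

theorem map_span_singleton (σ : PlaneSeries ≃ₐ[ℂ] PlaneSeries) (h : PlaneSeries) :
    (Ideal.span {h}).map σ = Ideal.span {σ h} := by
  rw [Ideal.map_span, Set.image_singleton]

/-- All the data of the description (coordinate systems, intersection multiplicities, the ratio of
linear parts and the generators) are transported by `σ`. -/
theorem _root_.IsSilhouetteIdeal.map {D D' : PlaneSeries} {I : Ideal PlaneSeries}
    {t : SpecialType} (H : IsSilhouetteIdeal D I t) (σ : PlaneSeries ≃ₐ[ℂ] PlaneSeries)
    (hD : Associated (σ D) D') : IsSilhouetteIdeal D' (I.map σ) t := by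
  have key : ∀ {x}, Associated D x → Associated D' (σ x) := fun hx => hD.symm.trans (hx.map σ)
  cases t with
  | properNode =>
    obtain ⟨h₁, h₂, H, hD, rfl⟩ := H
    exact ⟨σ h₁, σ h₂, H.map σ, by simpa using key hD, map_maximalIdeal σ⟩
  | properCusp =>
    obtain ⟨h₁, h₂, H, hD, rfl⟩ := H
    exact ⟨σ h₁, σ h₂, H.map σ, by simpa using key hD, map_maximalIdeal σ⟩
  | singularNode =>
    obtain ⟨h₁, h₂, H, hD, rfl⟩ := H
    refine ⟨σ h₁, σ h₂, H.map σ, by simpa using key hD, ?_⟩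
    rw [Ideal.map_sup, Ideal.map_pow, Ideal.map_pow, map_span_singleton, map_span_singleton]
  | singularTriple =>
    obtain ⟨h₁, h₂, h₃, H1, H2, H3, h0, hD, rfl⟩ := H
    exact ⟨σ h₁, σ h₂, σ h₃, H1.map σ, H2.map σ, H3.map σ,
      by rw [← map_add, ← map_add, h0, map_zero], by simpa using key hD,
      sumOfSquaresIdeal_map h₁ h₂ h₃ σ⟩
  | transversalDistinct =>
    obtain ⟨h, g, H, hD, rfl⟩ := H
    refine ⟨σ h, σ g, H.map σ, by simpa using key hD, ?_⟩
    rw [Ideal.map_sup, Ideal.map_pow, map_span_singleton, map_span_singleton]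
  | transversalPinch =>
    obtain ⟨h, g, H, hD, rfl⟩ := H
    exact ⟨σ h, σ g, H.map σ, by simpa using key hD, Ideal.map_top _⟩
  | tangential =>
    obtain ⟨h, g, c, hT, hD, hc, hs, rfl⟩ := isSilhouetteIdeal_tangential_iff.1 H
    exact isSilhouetteIdeal_tangential_iff.2 ⟨σ h, σ g, c, hT.map σ, by simpa using key hD, hc,
      linPart_map_smul hT.left.1 hT.right.1 hs σ, tangIdeal_map h g c σ⟩

/-- The order of an equation of the fat silhouette. -/
def typeOrder : SpecialType → ℕ∞
  | .properNode => 2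
  | .properCusp => 2
  | .singularNode => 4
  | .singularTriple => 6
  | .transversalDistinct => 3
  | .transversalPinch => 3
  | .tangential => 3

theorem order_cusp {n : ℕ} {h k : MvPowerSeries (Fin n) ℂ} (hh : IsSmooth h) (hk : IsSmooth k) :
    (h ^ 3 - k ^ 2).order = 2 := by
  have e1 : (h ^ 3).order = 3 := by rw [pow_succ, pow_two, order_mul, order_mul, hh.order_eq]; rfl
  have e2 : (-k ^ 2).order = 2 := by rw [order_neg, pow_two, order_mul, hk.order_eq]; rfl
  rw [sub_eq_add_neg, order_add_of_order_ne (by rw [e1, e2]; decide), e1, e2]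
  decide

theorem _root_.IsSilhouetteIdeal.order_eq {D : PlaneSeries} {I : Ideal PlaneSeries}
    {t : SpecialType} (H : IsSilhouetteIdeal D I t) : D.order = typeOrder t := by
  cases t with
  | properNode =>
    obtain ⟨h₁, h₂, H, hD, -⟩ := H
    rw [order_of_associated hD, order_mul, H.left.order_eq, H.right.order_eq]; rfl
  | properCusp =>
    obtain ⟨h₁, h₂, H, hD, -⟩ := H
    rw [order_of_associated hD, order_cusp H.left H.right]; rfl
  | singularNode =>
    obtain ⟨h₁, h₂, H, hD, -⟩ := H
    rw [order_of_associated hD, pow_two, pow_two]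
    simp only [order_mul, H.left.order_eq, H.right.order_eq]; rfl
  | singularTriple =>
    obtain ⟨h₁, h₂, h₃, H1, H2, H3, h0, hD, -⟩ := H
    rw [order_of_associated hD, pow_two]
    simp only [order_mul, H1.left.order_eq, H1.right.order_eq, H2.right.order_eq]; rfl
  | transversalDistinct =>
    obtain ⟨h, g, H, hD, -⟩ := H
    rw [order_of_associated hD, pow_two]
    simp only [order_mul, H.left.order_eq, H.right.order_eq]; rfl
  | transversalPinch =>
    obtain ⟨h, g, H, hD, -⟩ := H
    rw [order_of_associated hD, pow_two]
    simp only [order_mul, H.left.order_eq, H.right.order_eq]; rfl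
  | tangential =>
    obtain ⟨h, g, H, hD, -⟩ := H
    rw [order_of_associated hD, pow_two]
    simp only [order_mul, H.left.order_eq, H.right.order_eq]; rfl

theorem not_coords_of_tangent {h g h' g' : PlaneSeries} (H : IsPartOfCoords ![h, g])
    (H' : AreSimplyTangent h' g') (e : Associated (h * g ^ 2) (h' * g' ^ 2)) : False := by
  obtain ⟨e1, e2⟩ := associated_of_mul_sq H.left.prime H.right.prime H'.left.prime H'.right.prime
    (not_associated_of_coords H) e
  exact (isPartOfCoords_iff_jac.1 (H.of_associated e1 e2)).2.2 H'.jac_eq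

/-- The ideal that is attached to a special point depends only on the equation of the fat
silhouette, and on whether the point comes from a pinch point. -/
theorem _root_.IsSilhouetteIdeal.unique {D : PlaneSeries} {I I' : Ideal PlaneSeries}
    {t t' : SpecialType} (H : IsSilhouetteIdeal D I t) (H' : IsSilhouetteIdeal D I' t')
    (ht : t = .transversalPinch ↔ t' = .transversalPinch) : I = I' := by
  -- Equal orders leave few pairs of different types. A node and a cusp both have the maximal ideal;
  -- pinch points are separated by `ht`; tangential and transversal intersections are separated by
  -- the Jacobian of the two factors of `D`.
  have ho : typeOrder t = typeOrder t' := H.order_eq.symm.trans H'.order_eq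
  cases t <;> cases t' <;> (try simp at ht) <;>
    (try (exfalso; revert ho; simp only [typeOrder]; decide))
  · obtain ⟨_, _, _, _, rfl⟩ := H; obtain ⟨_, _, _, _, rfl⟩ := H'; rfl
  · obtain ⟨_, _, _, _, rfl⟩ := H; obtain ⟨_, _, _, _, rfl⟩ := H'; rfl
  · obtain ⟨_, _, _, _, rfl⟩ := H; obtain ⟨_, _, _, _, rfl⟩ := H'; rfl
  · obtain ⟨_, _, _, _, rfl⟩ := H; obtain ⟨_, _, _, _, rfl⟩ := H'; rfl
  · obtain ⟨h₁, h₂, H, hD, rfl⟩ := H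
    obtain ⟨k₁, k₂, H', hD', rfl⟩ := H'
    have e := hD.symm.trans hD'
    have key : ∀ {p : PlaneSeries}, Prime p → p ∣ k₁ ^ 2 * k₂ ^ 2 →
        Associated p k₁ ∨ Associated p k₂ := fun hp hd =>
      (hp.dvd_or_dvd hd).imp
        (fun h => (hp.dvd_prime_iff_associated H'.left.prime).1 (hp.dvd_of_dvd_pow h))
        (fun h => (hp.dvd_prime_iff_associated H'.right.prime).1 (hp.dvd_of_dvd_pow h))
    have hn := not_associated_of_coords H
    rcases key H.left.prime ((Dvd.intro _ (by ring : h₁ * (h₁ * h₂ ^ 2) = _)).trans e.dvd)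
      with a | a <;>
    rcases key H.right.prime ((Dvd.intro _ (by ring : h₂ * (h₂ * h₁ ^ 2) = _)).trans e.dvd)
      with b | b
    · exact (hn (a.trans b.symm)).elim
    · rw [Ideal.span_singleton_eq_span_singleton.2 a, Ideal.span_singleton_eq_span_singleton.2 b]
    · rw [Ideal.span_singleton_eq_span_singleton.2 a, Ideal.span_singleton_eq_span_singleton.2 b,
        sup_comm]
    · exact (hn (a.trans b.symm)).elim
  · obtain ⟨h₁, h₂, h₃, H1, H2, H3, -, hD, rfl⟩ := H
    obtain ⟨k₁, k₂, k₃, K1, K2, K3, -, hD', rfl⟩ := H'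
    have e := hD.symm.trans hD'
    have hk : ∀ i, Prime (![k₁, k₂, k₃] i) := by
      intro i; fin_cases i
      exacts [K1.left.prime, K1.right.prime, K2.right.prime]
    have hh : ∀ i, Prime (![h₁, h₂, h₃] i) := by
      intro i; fin_cases i
      exacts [H1.left.prime, H1.right.prime, H2.right.prime]
    have hn : ∀ i j, i ≠ j → ¬ Associated (![h₁, h₂, h₃] i) (![h₁, h₂, h₃] j) := by
      have n1 := not_associated_of_coords H1
      have n2 := not_associated_of_coords H2
      have n3 := not_associated_of_coords H3
      intro i j hij a
      fin_cases i <;> fin_cases j <;> first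
        | exact hij rfl | exact n1 a | exact n2 a | exact n3 a | exact n1 a.symm
        | exact n2 a.symm | exact n3 a.symm
    have hex : ∀ i, ∃ j, Associated (![h₁, h₂, h₃] i) (![k₁, k₂, k₃] j) := by
      intro i
      apply exists_associated_of_dvd_prod_sq (hh i) hk
      have : (∏ j, ![k₁, k₂, k₃] j) = k₁ * k₂ * k₃ := by simp [Fin.prod_univ_three]
      rw [this]
      refine dvd_trans ?_ e.dvd
      apply dvd_pow _ two_ne_zero
      fin_cases i
      · exact Dvd.intro (h₂ * h₃) (by simp; ring)
      · exact Dvd.intro (h₁ * h₃) (by simp; ring)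
      · exact Dvd.intro (h₁ * h₂) (by simp; ring)
    choose f hf using hex
    have hinj : Function.Injective f := by
      intro i j hij
      by_contra hne
      exact hn i j hne ((hf i).trans (hij ▸ (hf j).symm))
    exact sumOfSquaresIdeal_congr (h := ![h₁, h₂, h₃]) (h' := ![k₁, k₂, k₃])
      (Equiv.ofBijective f (Finite.injective_iff_bijective.1 hinj)) hf
  · obtain ⟨h, g, H, hD, rfl⟩ := H
    obtain ⟨h', g', H', hD', rfl⟩ := H'
    obtain ⟨a, b⟩ := associated_of_mul_sq H.left.prime H.right.prime H'.left.prime H'.right.prime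
      (not_associated_of_coords H) (hD.symm.trans hD')
    rw [Ideal.span_singleton_eq_span_singleton.2 a, Ideal.span_singleton_eq_span_singleton.2 b]
  · obtain ⟨h, g, H, hD, rfl⟩ := H
    obtain ⟨h', g', H', hD', -⟩ := H'
    exact (not_coords_of_tangent H H' (hD.symm.trans hD')).elim
  · obtain ⟨_, _, _, _, rfl⟩ := H; obtain ⟨_, _, _, _, rfl⟩ := H'; rfl
  · obtain ⟨h, g, H, hD, -⟩ := H
    obtain ⟨h', g', H', hD', -⟩ := H'
    exact (not_coords_of_tangent H' H (hD'.symm.trans hD)).elim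
  · obtain ⟨h, g, c, hT, hD, hc, hs, rfl⟩ := isSilhouetteIdeal_tangential_iff.1 H
    obtain ⟨h', g', c', hT', hD', hc', hs', rfl⟩ := isSilhouetteIdeal_tangential_iff.1 H'
    obtain ⟨a, b⟩ := associated_of_mul_sq hT.left.prime hT.right.prime hT'.left.prime
      hT'.right.prime hT.not_associated (hD.symm.trans hD')
    exact tangIdeal_eq_of_associated hT.left hT.right hs hs' a b

end FatSilhouette
end

noncomputable section

namespace FatSilhouette

open Polynomial

/-! ### Discriminants as resultants, and their multiplicativity. -/

section Disc

variable {A : Type*} [CommRing A]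

/-- The resultant of a polynomial and its derivative. -/
def disc (f : A[X]) : A := resultant f (derivative f) f.natDegree (f.natDegree - 1)

theorem disc_one : disc (1 : A[X]) = 1 := by
  rw [disc, natDegree_one]
  exact (resultant_zero_left_deg _ _ _).trans (pow_zero _)

theorem disc_X_sub_C [Nontrivial A] (a : A) : disc (X - C a) = 1 := by
  rw [disc, natDegree_X_sub_C]
  exact (resultant_X_sub_C_left (n := 0) (r := a) (hg := by simp)).trans (by simp)

variable [IsDomain A] [CharZero A]

/-- In the resultant of `W` with `W' V + W V'` the multiple of `W` can be dropped, and likewise for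
`V`; what remains is multiplicativity of the resultant. Characteristic zero fixes the degrees of the
derivatives. -/
theorem disc_mul {W V : A[X]} (hW : W.Monic) (hV : V.Monic) :
    disc (W * V) = disc W * disc V * (resultant W V * resultant V W) := by
  rcases Nat.eq_zero_or_pos W.natDegree with hw | hw
  · obtain rfl := eq_one_of_monic_natDegree_zero hW hw
    simp [disc_one]
  rcases Nat.eq_zero_or_pos V.natDegree with hv | hv
  · obtain rfl := eq_one_of_monic_natDegree_zero hV hv
    simp [disc_one]
  have hdW := natDegree_derivative W
  have hdV := natDegree_derivative V
  have key : ∀ {W V : A[X]}, W.Monic → V.Monic → 0 < W.natDegree → 0 < V.natDegree →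
      resultant W (derivative W * V + W * derivative V) W.natDegree (W.natDegree + V.natDegree - 1) =
        disc W * resultant W V := by
    intro W V hW hV hw hv
    have hdW := natDegree_derivative W
    have hdV := natDegree_derivative V
    rw [resultant_add_mul_right _ _ _ _ _ (by omega) le_rfl,
      show W.natDegree + V.natDegree - 1 = (derivative W).natDegree + V.natDegree by omega,
      resultant_mul_right _ _ _ _ le_rfl, hdW]
    rfl
  rw [disc, hW.natDegree_mul hV, derivative_mul,
    resultant_mul_left _ _ _ _ ((natDegree_add_le _ _).trans (max_le ?_ ?_)), key hW hV hw hv]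
  · rw [add_comm (derivative W * V), mul_comm W, mul_comm (derivative W), add_comm W.natDegree,
      key hV hW hv hw]
    ring
  · exact natDegree_mul_le.trans (by omega)
  · exact natDegree_mul_le.trans (by omega)

end Disc

/-! ### Lower bounds for the order of the discriminant of a distinguished polynomial. -/

section DiscBound

variable {A : Type*} [CommRing A] {I : Ideal A}

theorem prod_mem_pow {n : ℕ} {a : Fin n → A} (h : ∀ i, a i ∈ I) : ∏ i, a i ∈ I ^ n := by
  have := Ideal.prod_mem_prod (s := Finset.univ) (x := a) (I := fun _ => I) fun i _ => h i
  simpa using this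

/-- The coefficients of `f` fill `n` columns of the Sylvester matrix, and every term of the
determinant has one factor from each of them. -/
theorem resultant_mem_pow {f g : A[X]} {m n : ℕ} (hf : ∀ i, f.coeff i ∈ I) :
    resultant f g m n ∈ I ^ n := by
  rw [resultant, Matrix.det_apply]
  refine Ideal.sum_mem _ fun σ _ => Submodule.smul_of_tower_mem _ _ ?_
  rw [Fin.prod_univ_add]
  refine Ideal.mul_mem_left _ _ (prod_mem_pow fun j => ?_)
  simp only [sylvester, Matrix.of_apply, Fin.addCases_right]
  split_ifs
  · exact hf _
  · exact zero_mem _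

/-- The columns of `f` give `Iⁿ`, and the change of `g` modulo `I` in the other columns gives one
more factor from `I`. -/
theorem resultant_sub_mem_pow {f g g' : A[X]} {m n : ℕ} (hf : ∀ i, f.coeff i ∈ I)
    (hg : ∀ i, g.coeff i - g'.coeff i ∈ I) :
    resultant f g m n - resultant f g' m n ∈ I ^ (n + 1) := by
  rw [resultant, resultant, Matrix.det_apply, Matrix.det_apply, ← Finset.sum_sub_distrib]
  refine Ideal.sum_mem _ fun σ _ => ?_
  rw [← smul_sub]
  refine Submodule.smul_of_tower_mem _ _ ?_
  have h1 : ∏ j : Fin n, sylvester f g m n (σ (Fin.natAdd m j)) (Fin.natAdd m j) ∈ I ^ n := by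
    refine prod_mem_pow fun j => ?_
    simp only [sylvester, Matrix.of_apply, Fin.addCases_right]
    split_ifs
    · exact hf _
    · exact zero_mem _
  have h2 : (∏ j : Fin m, sylvester f g m n (σ (Fin.castAdd n j)) (Fin.castAdd n j)) -
      ∏ j : Fin m, sylvester f g' m n (σ (Fin.castAdd n j)) (Fin.castAdd n j) ∈ I := by
    rw [← Ideal.Quotient.eq, map_prod, map_prod]
    refine Finset.prod_congr rfl fun j _ => ?_
    rw [Ideal.Quotient.eq]
    simp only [sylvester, Matrix.of_apply, Fin.addCases_left]
    split_ifs
    · exact hg _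
    · simp
  have e : ∏ j : Fin n, sylvester f g' m n (σ (Fin.natAdd m j)) (Fin.natAdd m j) =
      ∏ j : Fin n, sylvester f g m n (σ (Fin.natAdd m j)) (Fin.natAdd m j) :=
    Finset.prod_congr rfl fun j _ => by simp [sylvester]
  have h3 := Ideal.mul_mem_mul h1 h2
  rw [Fin.prod_univ_add, Fin.prod_univ_add, e, ← sub_mul, mul_comm, pow_succ]
  exact h3

variable [Algebra ℂ A]

/-- The leading term of `W` is removed by subtraction of `X W' / (m + 1)`, which does not affect the
resultant with `W'`. Each coefficient of the result `R` is a multiple of the corresponding one of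
`W`, so for distinguished `W` all of them are in `I`. -/
theorem disc_eq_resultant {W : A[X]} {m : ℕ} (hW : W.Monic) (hm : W.natDegree = m + 1) :
    ∃ R : A[X], R.coeff 0 = W.coeff 0 ∧ (∀ i, i ≤ m → ∃ c : A, R.coeff i = c * W.coeff i) ∧
      (∀ i, m < i → R.coeff i = 0) ∧
      disc W = (-1) ^ m * (m + 1) * resultant R (derivative W) m m := by
  -- With this constant the coefficient of `Xⁱ` is multiplied by `1 - i / (m + 1)`, which is `1` for
  -- `i = 0` and `0` for `i = m + 1`.
  set κ : A := algebraMap ℂ A (1 / (m + 1))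
  have hκ : κ * (m + 1) = 1 := by
    have : (m + 1 : A) = algebraMap ℂ A (m + 1) := by simp
    rw [this, ← map_mul, one_div_mul_cancel (by exact_mod_cast Nat.succ_ne_zero m), map_one]
  have hR : ∀ i, (W + derivative W * (C (-κ) * X)).coeff i = (1 - κ * i) * W.coeff i := by
    intro i
    rw [coeff_add, show derivative W * (C (-κ) * X) = C (-κ) * (derivative W * X) by ring,
      coeff_C_mul]
    cases i with
    | zero => simp
    | succ i => rw [coeff_mul_X, coeff_derivative]; push_cast; ring
  have htop : ∀ i, m < i → (W + derivative W * (C (-κ) * X)).coeff i = 0 := by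
    intro i hi
    rw [hR]
    rcases (Nat.succ_le_of_lt hi).eq_or_lt with h | h
    · subst h
      have : (1 - κ * ((m.succ : ℕ) : A)) = 0 := by push_cast; linear_combination -hκ
      rw [this, zero_mul]
    · rw [coeff_eq_zero_of_natDegree_lt (by omega), mul_zero]
  refine ⟨W + derivative W * (C (-κ) * X), by rw [hR]; simp, fun i _ => ⟨_, hR i⟩, htop, ?_⟩
  have hd : (derivative W).natDegree ≤ m := (natDegree_derivative_le _).trans (by omega)
  rw [disc, hm, Nat.add_sub_cancel, ← resultant_add_mul_left W (derivative W) (C (-κ) * X) (m + 1) m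
    (by
      have : (C (-κ) * X : A[X]).natDegree ≤ 1 := (natDegree_C_mul_le _ _).trans natDegree_X_le
      omega) hd,
    resultant_succ_left_deg _ _ _ _ (natDegree_le_iff_coeff_eq_zero.2 fun i hi => htop i hi),
    coeff_derivative]
  have : W.coeff (m + 1) = 1 := by rw [← hm]; exact hW
  rw [this]
  ring

theorem disc_mem_pow {W : A[X]} (hW : W.IsDistinguishedAt I) :
    disc W ∈ I ^ (W.natDegree - 1) := by
  rcases Nat.eq_zero_or_pos W.natDegree with h | h
  · rw [h]; simp
  obtain ⟨m, hm⟩ : ∃ m, W.natDegree = m + 1 := ⟨W.natDegree - 1, by omega⟩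
  obtain ⟨R, -, h1, h2, h3⟩ := disc_eq_resultant hW.monic hm
  rw [hm, h3]
  refine Ideal.mul_mem_left _ _ (resultant_mem_pow fun i => ?_)
  rcases lt_or_ge m i with hi | hi
  · rw [h2 i hi]; exact zero_mem _
  · obtain ⟨c, hc⟩ := h1 i hi
    rw [hc]
    exact Ideal.mul_mem_left _ _ (hW.mem (by omega))

/-- This is one power more than for a general distinguished polynomial. Applied to the maximal
ideal, the condition on the constant term says that the surface is singular at the point. -/
theorem disc_mem_pow_of_mem_sq {W : A[X]} (hW : W.IsDistinguishedAt I) (hm : 2 ≤ W.natDegree)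
    (h0 : W.coeff 0 ∈ I ^ 2) : disc W ∈ I ^ W.natDegree := by
  obtain ⟨m, hm⟩ : ∃ m, W.natDegree = m + 1 := ⟨W.natDegree - 1, by omega⟩
  obtain ⟨R, h0', h1, h2, h3⟩ := disc_eq_resultant hW.monic hm
  have hR : ∀ i, R.coeff i ∈ I := by
    intro i
    rcases lt_or_ge m i with hi | hi
    · rw [h2 i hi]; exact zero_mem _
    · obtain ⟨c, hc⟩ := h1 i hi
      rw [hc]
      exact Ideal.mul_mem_left _ _ (hW.mem (by omega))
  rw [hm, h3]
  refine Ideal.mul_mem_left _ _ ?_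
  -- Modulo `I` the derivative is `(m + 1) X ^ m`. The resultant of `R` with it is, up to a
  -- constant, the `m`-th power of the constant term; it lies in `I ^ (2 * m)`, and `2 * m ≥ m + 1`.
  have h4 := resultant_sub_mem_pow (m := m) (n := m) (g := derivative W)
    (g' := C ((m : A) + 1) * X ^ m) hR (fun i => by
      rw [coeff_derivative, coeff_C_mul_X_pow]
      split_ifs with h
      · subst h
        have : W.coeff (i + 1) = 1 := by rw [← hm]; exact hW.monic
        rw [this]; simp
      · rw [sub_zero]
        rcases lt_or_ge i m with hi | hi
        · exact Ideal.mul_mem_right _ _ (hW.mem (by omega))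
        · rw [coeff_eq_zero_of_natDegree_lt (by omega), zero_mul]; exact zero_mem _)
  rw [resultant_C_mul_right, resultant_X_pow_right _ _ _
    (natDegree_le_iff_coeff_eq_zero.2 fun i hi => h2 i hi), h0'] at h4
  have h5 : (m + 1 : A) ^ m * ((-1) ^ (m * m) * W.coeff 0 ^ m) ∈ I ^ (m + 1) := by
    refine Ideal.mul_mem_left _ _ (Ideal.mul_mem_left _ _ ?_)
    have := Ideal.pow_mem_pow h0 m
    rw [← pow_mul] at this
    exact Ideal.pow_le_pow_right (by omega) this
  have := add_mem h4 h5
  rwa [sub_add_cancel] at this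

end DiscBound

/-! ### Weierstrass polynomials over a complete local ring. -/

section Distinguished

variable {A : Type*} [CommRing A] [IsLocalRing A]

/-- Distinguished polynomials over a local ring. -/
abbrev IsDist (W : A[X]) : Prop := W.IsDistinguishedAt (IsLocalRing.maximalIdeal A)

theorem IsDist.order_toNat {W : A[X]} (hW : IsDist W) :
    ((W : PowerSeries A).map (Ideal.Quotient.mk (IsLocalRing.maximalIdeal A))).order.toNat =
      W.natDegree := by
  rw [← hW.coe_natDegree_eq_order_map (W : PowerSeries A) 1
    (by rw [map_one, ← Ideal.ne_top_iff_one]; exact Ideal.IsPrime.ne_top') (by simp)]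
  simp

variable [IsAdicComplete (IsLocalRing.maximalIdeal A) A]

/-- The remainder of polynomial division is a multiple of `W` as a power series and has smaller
degree, so it is zero by uniqueness of Weierstrass division. -/
theorem IsDist.dvd_of_dvd {W g : A[X]} (hW : IsDist W)
    (h : (W : PowerSeries A) ∣ (g : PowerSeries A)) : W ∣ g := by
  obtain ⟨s, hs⟩ := h
  have hdiv := modByMonic_add_div g W
  have hr : (W : PowerSeries A) * (s - (g /ₘ W : A[X])) = ((g %ₘ W : A[X]) : PowerSeries A) := by
    have : ((g %ₘ W + W * (g /ₘ W) : A[X]) : PowerSeries A) = g := by rw [hdiv]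
    rw [Polynomial.coe_add, Polynomial.coe_mul, hs] at this
    linear_combination -this
  have := hW.isWeierstrassDivisorAt'.eq_zero_of_mul_eq (by
    rw [hW.order_toNat]
    exact (degree_modByMonic_lt g hW.monic).trans_eq (degree_eq_natDegree hW.monic.ne_zero)) hr
  exact (modByMonic_eq_zero_iff_dvd hW.monic).1 this.2

theorem IsDist.eq_of_associated [IsDomain A] {W W' : A[X]} (hW : IsDist W) (hW' : IsDist W')
    (h : Associated (W : PowerSeries A) (W' : PowerSeries A)) : W = W' :=
  (eq_of_monic_of_associated hW.monic hW'.monic (associated_of_dvd_dvd (hW.dvd_of_dvd h.dvd)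
    (hW'.dvd_of_dvd h.symm.dvd)))

theorem exists_isDist {g : PowerSeries A} (hg : g.map (IsLocalRing.residue A) ≠ 0) :
    ∃ W : A[X], IsDist W ∧ Associated (W : PowerSeries A) g := by
  obtain ⟨W, h, H⟩ := PowerSeries.exists_isWeierstrassFactorization hg
  exact ⟨W, H.isDistinguishedAt, H.isUnit.unit, H.eq_mul.symm⟩

end Distinguished

end FatSilhouette
end

noncomputable section

namespace FatSilhouette

open Polynomial hiding constantCoeff

/-! ### Zeros of the discriminant are multiple roots. -/

section DiscZero

theorem disc_map {A B : Type*} [CommRing A] [CommRing B] (φ : A →+* B) {W : A[X]}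
    (hW : (W.map φ).natDegree = W.natDegree) : disc (W.map φ) = φ (disc W) := by
  rw [disc, hW, derivative_map, resultant_map_map, disc]

theorem disc_taylor {A : Type*} [CommRing A] [IsDomain A] [CharZero A] (r : A) (W : A[X]) :
    disc (taylor r W) = disc W := by
  have h := natDegree_derivative W
  have h' : derivative (taylor r W) = taylor r (derivative W) := by
    rw [taylor_apply, taylor_apply, derivative_comp]; simp
  rw [disc, disc, h', natDegree_taylor, ← h, ← resultant_taylor W (derivative W) r,
    natDegree_taylor, natDegree_taylor]

/-- Over an algebraically closed field, the discriminant vanishes if and only if there is a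
multiple root. -/
theorem disc_eq_zero_iff {K : Type*} [Field K] [IsAlgClosed K] [CharZero K] {f : K[X]}
    (hf : f ≠ 0) : disc f = 0 ↔ ∃ z, f.eval z = 0 ∧ (derivative f).eval z = 0 := by
  rw [disc, ← natDegree_derivative f, resultant_eq_zero_iff]
  constructor
  · rintro ⟨-, h⟩
    rw [isCoprime_iff_aeval_ne_zero_of_isAlgClosed K K] at h
    push Not at h
    obtain ⟨z, h1, h2⟩ := h
    exact ⟨z, by simpa using h1, by simpa using h2⟩
  · rintro ⟨z, h1, h2⟩
    refine ⟨Or.inl hf, ?_⟩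
    rintro ⟨a, b, h⟩
    have := congrArg (eval z) h
    simp [h1, h2] at this

theorem map_disc_eq_zero_iff {A K : Type*} [CommRing A] [Field K] [IsAlgClosed K] [CharZero K]
    (φ : A →+* K) {W : A[X]} (hW : W.Monic) : φ (disc W) = 0 ↔
      ∃ z, W.eval₂ φ z = 0 ∧ (derivative W).eval₂ φ z = 0 := by
  rw [← disc_map φ (hW.natDegree_map φ), disc_eq_zero_iff (hW.map φ).ne_zero]
  simp only [derivative_map, eval_map]

end DiscZero

/-! ### Splitting of monic polynomials over a local ring. -/

section Split

variable {O : Type*} [CommRing O]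

/-- For a monic polynomial coprimality means that the resultant is a unit, and a local homomorphism
reflects units. -/
theorem isCoprime_of_residue {K : Type*} [Field K] (φ : O →+* K) [IsLocalHom φ] {W V : O[X]}
    (hW : W.Monic) (hV : V.Monic) (h : IsCoprime (W.map φ) (V.map φ)) : IsCoprime W V := by
  rw [← isUnit_resultant_iff_isCoprime hW]
  rw [← isUnit_resultant_iff_isCoprime (hW.map φ), hW.natDegree_map, hV.natDegree_map,
    resultant_map_map] at h
  exact isUnit_of_map_unit φ _ h

theorem disc_mul_associated [IsDomain O] [CharZero O] {W V : O[X]} (hW : W.Monic) (hV : V.Monic)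
    (h : IsCoprime W V) : Associated (disc (W * V)) (disc W * disc V) := by
  rw [disc_mul hW hV]
  have h1 := (isUnit_resultant_iff_isCoprime hW).2 h
  have h2 := (isUnit_resultant_iff_isCoprime hV).2 h.symm
  exact associated_mul_unit_left _ _ (h1.mul h2)

variable [IsDomain O] [IsLocalRing O] [IsAdicComplete (IsLocalRing.maximalIdeal O) O]

/-- The factorization of a monic polynomial into a distinguished polynomial and a polynomial
that does not vanish at the origin. -/
theorem exists_isDist_mul {g : O[X]} (hg : g.Monic) : ∃ W V : O[X], g = W * V ∧ IsDist W ∧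
    V.Monic ∧ IsUnit (V.coeff 0) ∧ IsUnit (V : PowerSeries O) := by
  have h0 : (g : PowerSeries O).map (IsLocalRing.residue O) ≠ 0 := by
    intro h
    have := congrArg (PowerSeries.coeff g.natDegree) h
    rw [PowerSeries.coeff_map, Polynomial.coeff_coe, coeff_natDegree, hg.leadingCoeff] at this
    simp at this
  obtain ⟨W, hW, u, hu⟩ := exists_isDist h0
  obtain ⟨V, hV⟩ := hW.dvd_of_dvd ⟨_, hu.symm⟩
  have hVu : (V : PowerSeries O) = u := by
    have hW0 : (W : PowerSeries O) ≠ 0 := by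
      rw [Ne, Polynomial.coe_eq_zero_iff]; exact hW.monic.ne_zero
    apply mul_left_cancel₀ hW0
    rw [hu, hV, Polynomial.coe_mul]
  have hVm : IsUnit (V : PowerSeries O) := hVu ▸ u.isUnit
  refine ⟨W, V, hV, hW, ?_, ?_, hVm⟩
  · rw [hV] at hg
    exact hW.monic.of_mul_monic_left hg
  · rw [PowerSeries.isUnit_iff_constantCoeff] at hVm
    simpa using hVm

end Split

/-! ### Local factors at a point of the fibre over the origin. -/

section Plane

open MvPowerSeries (constantCoeff)

theorem le_order_of_mem_pow {n : ℕ} {a : PlaneSeries}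
    (h : a ∈ IsLocalRing.maximalIdeal PlaneSeries ^ n) : (n : ℕ∞) ≤ a.order := by
  induction n generalizing a with
  | zero => simp
  | succ n ih =>
    rw [pow_succ] at h
    refine Submodule.mul_induction_on h (fun x hx y hy => ?_) fun x y hx hy => ?_
    · rw [MvPowerSeries.order_mul]
      push_cast
      exact add_le_add (ih hx) (one_le_order.2 (mem_maximalIdeal.1 hy))
    · exact (le_min hx hy).trans (MvPowerSeries.min_order_le_add)

instance : IsLocalHom (constantCoeff : PlaneSeries →+* ℂ) :=
  ⟨fun _ h => isUnit_iff.2 h.ne_zero⟩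

instance : CharZero PlaneSeries := algebraRat.charZero _

/-- The polynomial `W` over `ℂ⟦x, y⟧` is monic, and its only root over the origin is `z₀`. -/
def IsDistAt (z₀ : ℂ) (W : PlaneSeries[X]) : Prop := IsDist (taylor (MvPowerSeries.C z₀) W)

/-- The restriction of a polynomial over `ℂ⟦x, y⟧` to the fibre over the origin. -/
def fibre (f : PlaneSeries[X]) : ℂ[X] := f.map constantCoeff

theorem fibre_mul (f g : PlaneSeries[X]) : fibre (f * g) = fibre f * fibre g :=
  Polynomial.map_mul _

theorem taylor_neg_taylor {A : Type*} [CommRing A] (r : A) (f : A[X]) :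
    taylor (-r) (taylor r f) = f := by
  rw [taylor_taylor]; simp

theorem IsDistAt.monic {z₀ : ℂ} {W : PlaneSeries[X]} (hW : IsDistAt z₀ W) : W.Monic := by
  have := IsDistinguishedAt.monic hW
  rwa [Monic, leadingCoeff, natDegree_taylor, coeff_taylor_natDegree] at this

theorem fibre_taylor (z₀ : ℂ) (f : PlaneSeries[X]) :
    fibre (taylor (MvPowerSeries.C z₀) f) = taylor z₀ (fibre f) := by
  rw [fibre, map_taylor]
  simp [fibre]

theorem IsDistAt.fibre_eq {z₀ : ℂ} {W : PlaneSeries[X]} (hW : IsDistAt z₀ W) :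
    fibre W = (X - C z₀) ^ W.natDegree := by
  have h : fibre (taylor (MvPowerSeries.C z₀) W) = X ^ W.natDegree := by
    ext i
    rw [fibre, coeff_map, coeff_X_pow]
    split_ifs with hi
    · subst hi
      rw [coeff_taylor_natDegree, hW.monic.leadingCoeff, map_one]
    · rcases lt_or_gt_of_ne hi with hi | hi
      · exact mem_maximalIdeal.1 (IsWeaklyEisensteinAt.mem
          (IsDistinguishedAt.toIsWeaklyEisensteinAt hW) (by rwa [natDegree_taylor]))
      · rw [coeff_eq_zero_of_natDegree_lt (by rwa [natDegree_taylor]), map_zero]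
  rw [fibre_taylor] at h
  rw [← taylor_neg_taylor z₀ (fibre W), h]
  simp [taylor_pow, sub_eq_add_neg]

/-- Weierstrass preparation after translation of `z₀` to the origin. -/
theorem exists_split {f : PlaneSeries[X]} (hf : f.Monic) (z₀ : ℂ) :
    ∃ W V : PlaneSeries[X], f = W * V ∧ IsDistAt z₀ W ∧ V.Monic ∧ (fibre V).eval z₀ ≠ 0 ∧
      IsUnit (taylor (MvPowerSeries.C z₀) V : PowerSeries PlaneSeries) := by
  have hg : (taylor (MvPowerSeries.C z₀) f).Monic := by
    rwa [Monic, leadingCoeff, natDegree_taylor, coeff_taylor_natDegree]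
  obtain ⟨W, V, h, hW, hV, h0, hu⟩ := exists_isDist_mul hg
  have e : ∀ g : PlaneSeries[X],
      taylor (MvPowerSeries.C z₀) (taylor (-MvPowerSeries.C z₀) g) = g := fun g => by
    rw [taylor_taylor]; simp
  refine ⟨taylor (-MvPowerSeries.C z₀) W, taylor (-MvPowerSeries.C z₀) V, ?_, ?_, ?_, ?_, ?_⟩
  · rw [← taylor_mul, ← h, taylor_neg_taylor]
  · rw [IsDistAt, e]; exact hW
  · rwa [Monic, leadingCoeff, natDegree_taylor, coeff_taylor_natDegree]
  · have h2 : (fibre V).eval 0 ≠ 0 := by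
      rw [← coeff_zero_eq_eval_zero, fibre, coeff_map]
      exact isUnit_iff.1 h0
    have h3 := fibre_taylor z₀ (taylor (-MvPowerSeries.C z₀) V)
    rw [e] at h3
    rw [h3, taylor_eval] at h2
    simpa using h2
  · rw [e]; exact hu

theorem isCoprime_of_fibre {W V : PlaneSeries[X]} (hW : W.Monic) (hV : V.Monic)
    (h : ∀ z, (fibre W).eval z = 0 → (fibre V).eval z ≠ 0) : IsCoprime W V := by
  apply isCoprime_of_residue (constantCoeff : PlaneSeries →+* ℂ) hW hV
  rw [isCoprime_iff_aeval_ne_zero_of_isAlgClosed ℂ ℂ]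
  intro z
  by_cases hz : (fibre W).eval z = 0
  · right; simpa [fibre] using h z hz
  · left; simpa [fibre] using hz

theorem IsDistAt.isCoprime {z₀ : ℂ} {W V : PlaneSeries[X]} (hW : IsDistAt z₀ W) (hV : V.Monic)
    (h : (fibre V).eval z₀ ≠ 0) : IsCoprime W V := by
  refine isCoprime_of_fibre hW.monic hV fun z hz => ?_
  rw [hW.fibre_eq] at hz
  have : z = z₀ := by
    have := eq_zero_of_pow_eq_zero (by simpa using hz : (z - z₀) ^ W.natDegree = 0)
    linear_combination this
  rwa [this]

/-- A multiple root over the origin. -/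
def IsContourRoot (f : PlaneSeries[X]) (z : ℂ) : Prop :=
  (fibre f).eval z = 0 ∧ (derivative (fibre f)).eval z = 0

theorem isUnit_disc_iff {V : PlaneSeries[X]} (hV : V.Monic) :
    IsUnit (disc V) ↔ ∀ z, ¬ IsContourRoot V z := by
  rw [isUnit_iff, Ne, map_disc_eq_zero_iff _ hV]
  push Not
  refine forall_congr' fun z => ?_
  rw [IsContourRoot, not_and, fibre, derivative_map, eval_map, eval_map]

theorem IsDistAt.disc_mem_pow {z₀ : ℂ} {W : PlaneSeries[X]} (hW : IsDistAt z₀ W) :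
    ((W.natDegree - 1 : ℕ) : ℕ∞) ≤ (disc W).order := by
  have := le_order_of_mem_pow (FatSilhouette.disc_mem_pow hW)
  rwa [disc_taylor, natDegree_taylor] at this

theorem isContourRoot_mul_left {W V : PlaneSeries[X]} {z : ℂ} (h : (fibre W).eval z ≠ 0) :
    IsContourRoot (W * V) z ↔ IsContourRoot V z := by
  rw [IsContourRoot, IsContourRoot, fibre_mul, derivative_mul]
  simp only [eval_mul, eval_add, mul_eq_zero, h, false_or]
  constructor
  · rintro ⟨h1, h2⟩; rw [h1] at h2; exact ⟨h1, by simpa [h] using h2⟩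
  · rintro ⟨h1, h2⟩; simp [h1, h2]

theorem IsDistAt.isContourRoot_iff {z₀ : ℂ} {W V : PlaneSeries[X]} (hW : IsDistAt z₀ W)
    (h : (fibre V).eval z₀ ≠ 0) : IsContourRoot (W * V) z₀ ↔ 2 ≤ W.natDegree := by
  rw [mul_comm, isContourRoot_mul_left h, IsContourRoot, hW.fibre_eq]
  rcases hn : W.natDegree with _ | _ | n
  · simp
  · simp
  · simp [derivative_pow]

theorem IsDistAt.isContourRoot_ne {z₀ z : ℂ} {W V : PlaneSeries[X]} (hW : IsDistAt z₀ W)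
    (hz : z ≠ z₀) : IsContourRoot (W * V) z ↔ IsContourRoot V z := by
  apply isContourRoot_mul_left
  rw [hW.fibre_eq]
  simp [sub_eq_zero, hz]

end Plane

end FatSilhouette
end

noncomputable section

namespace FatSilhouette

open Polynomial hiding constantCoeff
open MvPowerSeries (constantCoeff)

/-! ### Germs in three variables as series in the fibre coordinate. -/

section Series

/-- Power series in `x, y, z` as power series in `z` over `ℂ⟦x, y⟧`. -/
def toSeries : MvPowerSeries (Fin 3) ℂ →+* PowerSeries PlaneSeries :=
  ((MvPowerSeries.renameEquiv ℂ (finSuccEquivLast (n := 2))).trans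
    (MvPowerSeries.optionEquivLeft (Fin 2) ℂ)).toRingEquiv.toRingHom

theorem toSeries_apply (h : MvPowerSeries (Fin 3) ℂ) : toSeries h =
    MvPowerSeries.optionEquivLeft (Fin 2) ℂ (MvPowerSeries.rename (finSuccEquivLast (n := 2)) h) :=
  rfl

theorem coeff_toSeries (h : MvPowerSeries (Fin 3) ℂ) (n : ℕ) (x : Fin 2 →₀ ℕ) (y : Fin 3 →₀ ℕ)
    (hn : y (Fin.last 2) = n) (hx : ∀ i : Fin 2, y i.castSucc = x i) :
    MvPowerSeries.coeff x (PowerSeries.coeff n (toSeries h)) = MvPowerSeries.coeff y h := by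
  rw [toSeries_apply, MvPowerSeries.coeff_coeff_optionEquivLeft]
  have : x.optionElim n = Finsupp.embDomain (finSuccEquivLast (n := 2)).toEmbedding y := by
    ext a
    obtain ⟨i, rfl⟩ := (finSuccEquivLast (n := 2)).surjective a
    have e := Finsupp.embDomain_apply_self (finSuccEquivLast (n := 2)).toEmbedding y i
    rw [Equiv.coe_toEmbedding] at e
    rw [e]
    refine Fin.lastCases ?_ (fun j => ?_) i
    · rw [finSuccEquivLast_last, hn]; simp
    · rw [finSuccEquivLast_castSucc, hx]; simp
  rw [this]
  exact MvPowerSeries.coeff_embDomain_rename (finSuccEquivLast (n := 2)).toEmbedding h y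

/-- The coefficients of `x`, `y` and `z`. -/
def lin3 (w : PowerSeries PlaneSeries) : Fin 3 → ℂ :=
  ![linPart (PowerSeries.coeff 0 w) 0, linPart (PowerSeries.coeff 0 w) 1,
    constantCoeff (PowerSeries.coeff 1 w)]

theorem constantCoeff_toSeries (h : MvPowerSeries (Fin 3) ℂ) :
    constantCoeff (PowerSeries.constantCoeff (toSeries h)) = constantCoeff h := by
  have := coeff_toSeries h 0 0 0 rfl fun _ => rfl
  simpa using this

theorem lin3_toSeries (h : MvPowerSeries (Fin 3) ℂ) : lin3 (toSeries h) = linPart h := by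
  ext i
  fin_cases i
  · exact coeff_toSeries h 0 (Finsupp.single 0 1) (Finsupp.single 0 1) (by simp) (by
      intro i; fin_cases i <;> simp)
  · exact coeff_toSeries h 0 (Finsupp.single 1 1) (Finsupp.single 1 1) (by simp) (by
      intro i; fin_cases i <;> simp)
  · exact coeff_toSeries h 1 0 (Finsupp.single 2 1) (by simp) (by
      intro i; fin_cases i <;> simp)

theorem lin3_mul (v w : PowerSeries PlaneSeries) : lin3 (v * w) =
    constantCoeff (PowerSeries.constantCoeff v) • lin3 w +
      constantCoeff (PowerSeries.constantCoeff w) • lin3 v := by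
  have e0 : PowerSeries.coeff 0 (v * w) = PowerSeries.coeff 0 v * PowerSeries.coeff 0 w := by
    simp
  have e1 : PowerSeries.coeff 1 (v * w) =
      PowerSeries.coeff 0 v * PowerSeries.coeff 1 w + PowerSeries.coeff 1 v *
        PowerSeries.coeff 0 w := by
    rw [PowerSeries.coeff_mul, Finset.Nat.antidiagonal_succ]; simp
  ext i
  fin_cases i
  · simp [lin3, e0, linPart_mul]
  · simp [lin3, e0, linPart_mul]
  · simp [lin3, e1]
    ring

theorem lin3_coe (W : PlaneSeries[X]) : lin3 (W : PowerSeries PlaneSeries) =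
    ![linPart (W.coeff 0) 0, linPart (W.coeff 0) 1, constantCoeff (W.coeff 1)] := by
  simp [lin3]

end Series

/-! ### Factorization of a local factor into sheets. -/

section LocalForm

/-- A factorization of the germ of a distinguished polynomial into smooth germs comes from a
factorization into distinguished polynomials. -/
theorem exists_dist_factors {k : ℕ} {W : PlaneSeries[X]} (hW : IsDist W)
    {h : Fin k → MvPowerSeries (Fin 3) ℂ} (hc : IsPartOfCoords h)
    (ha : Associated (W : PowerSeries PlaneSeries) (toSeries (∏ i, h i))) :
    ∃ w : Fin k → PlaneSeries[X], W = ∏ i, w i ∧ (∀ i, IsDist (w i)) ∧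
      (∀ i, 1 ≤ (w i).natDegree) ∧ LinearIndependent ℂ fun i => lin3 (w i) := by
  -- No factor vanishes identically on the line over the origin, because the monic polynomial `W`
  -- does not; so each one has a Weierstrass polynomial.
  have hres : ∀ i, (toSeries (h i)).map (IsLocalRing.residue PlaneSeries) ≠ 0 := by
    intro i hi
    have h1 : (toSeries (∏ i, h i)).map (IsLocalRing.residue PlaneSeries) = 0 := by
      rw [map_prod, map_prod]
      exact Finset.prod_eq_zero (Finset.mem_univ i) hi
    obtain ⟨u, hu⟩ := ha
    have h2 : (W : PowerSeries PlaneSeries).map (IsLocalRing.residue PlaneSeries) = 0 := by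
      have : (W : PowerSeries PlaneSeries) = toSeries (∏ i, h i) * (↑u⁻¹ : PowerSeries PlaneSeries) := by
        rw [← hu, mul_assoc, Units.mul_inv, mul_one]
      rw [this, map_mul, h1, zero_mul]
    have := congrArg (PowerSeries.coeff W.natDegree) h2
    rw [PowerSeries.coeff_map, Polynomial.coeff_coe, coeff_natDegree, hW.monic.leadingCoeff] at this
    simp at this
  choose w hw1 hw2 using fun i => exists_isDist (hres i)
  choose u hu using fun i => (hw2 i)
  have hprod : IsDist (∏ i, w i) := by
    refine Finset.prod_induction _ IsDist (fun _ _ => IsDistinguishedAt.mul)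
      ⟨⟨fun {n} hn => ?_⟩, monic_one⟩ fun i _ => hw1 i
    simp at hn
  refine ⟨w, hW.eq_of_associated hprod (ha.trans ?_), hw1, fun i => ?_, ?_⟩
  · rw [map_prod]
    have : ((∏ i, w i : PlaneSeries[X]) : PowerSeries PlaneSeries) =
        ∏ i, (w i : PowerSeries PlaneSeries) :=
      map_prod (Polynomial.coeToPowerSeries.ringHom (R := PlaneSeries)) w Finset.univ
    rw [this]
    exact (Associated.prod _ _ _ fun i _ => hw2 i).symm
  · by_contra H
    have h1 : w i = 1 := eq_one_of_monic_natDegree_zero (hw1 i).monic (by omega)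
    have h2 : IsUnit (toSeries (h i)) := by
      rw [← hu i, h1, Polynomial.coe_one, one_mul]; exact (u i).isUnit
    rw [PowerSeries.isUnit_iff_constantCoeff, isUnit_iff, constantCoeff_toSeries] at h2
    exact h2 (hc.1 i)
  -- Since `w i` vanishes at the origin, the unit acts on its linear part only through its value
  -- there; so linear independence carries over.
  · have e : ∀ i, linPart (h i) =
        constantCoeff (PowerSeries.constantCoeff (u i : PowerSeries PlaneSeries)) • lin3 (w i) := by
      intro i
      have h0 : constantCoeff (PowerSeries.constantCoeff (w i : PowerSeries PlaneSeries)) = 0 := by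
        have := hc.1 i
        rw [← constantCoeff_toSeries, ← hu i, map_mul, map_mul, mul_eq_zero] at this
        refine this.resolve_right ?_
        exact isUnit_iff.1 (PowerSeries.isUnit_iff_constantCoeff.1 (u i).isUnit)
      rw [← lin3_toSeries, ← hu i, lin3_mul, h0, zero_smul, zero_add]
    have hl := hc.2
    simp only [e] at hl
    have hne : ∀ i, constantCoeff (PowerSeries.constantCoeff (u i : PowerSeries PlaneSeries)) ≠ 0 :=
      fun i => isUnit_iff.1 (PowerSeries.isUnit_iff_constantCoeff.1 (u i).isUnit)
    have := hl.units_smul fun i => (Units.mk0 _ (hne i))⁻¹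
    convert! this using 1
    ext1 i
    simp [Units.smul_def, smul_smul, inv_mul_cancel₀ (hne i)]

end LocalForm

/-! ### Affine charts and the equation of the surface as a polynomial in the fibre coordinate. -/

section Frames

variable (F : MvPolynomial (Fin 4) ℂ)

/-- The frame with the origin moved to the point with coordinates `x, y, z`. -/
def shift (b : Frame) (x y z : ℂ) : Frame :=
  b.map (LinearEquiv.ofLinearMap
    (LinearMap.id + (b.coord 0).smulRight (x • b 1 + y • b 2 + z • b 3))
    (LinearMap.id - (b.coord 0).smulRight (x • b 1 + y • b 2 + z • b 3))
    (by ext v; simp) (by ext v; simp))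

variable (b : Frame) (x y z : ℂ)

theorem shift_zero : shift b x y z 0 = b 0 + x • b 1 + y • b 2 + z • b 3 := by
  simp [shift, add_assoc]

theorem shift_of_ne {i : Fin 4} (hi : i ≠ 0) : shift b x y z i = b i := by
  simp [shift, hi]

@[simp] theorem shift_one : shift b x y z 1 = b 1 := shift_of_ne b x y z (by decide)
@[simp] theorem shift_two : shift b x y z 2 = b 2 := shift_of_ne b x y z (by decide)
@[simp] theorem shift_three : shift b x y z 3 = b 3 := shift_of_ne b x y z (by decide)

/-- The canonical map from polynomials to power series. -/
abbrev toPlane : MvPolynomial (Fin 2) ℂ →+* PlaneSeries := MvPolynomial.coeToMvPowerSeries.ringHom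

/-- The equation of the surface as a monic polynomial over `ℂ⟦x, y⟧`. -/
def sheet : PlaneSeries[X] :=
  C (MvPowerSeries.C (MvPolynomial.eval (b 3) F)⁻¹) * (fibrePoly F b).map toPlane

/-- The substitution that defines the equation of the surface over `ℂ[x, y]`. -/
def fibreHom : MvPolynomial (Fin 4) ℂ →+* (MvPolynomial (Fin 2) ℂ)[X] :=
  ((MvPolynomial.aeval (fun j => C (MvPolynomial.C (b 0 j) +
        MvPolynomial.C (b 1 j) * MvPolynomial.X 0 + MvPolynomial.C (b 2 j) * MvPolynomial.X 1) +
      C (MvPolynomial.C (b 3 j)) * X) :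
        MvPolynomial (Fin 4) ℂ →ₐ[ℂ] (MvPolynomial (Fin 2) ℂ)[X])).toRingHom

/-- The restriction of polynomials to an affine chart. -/
def chart : MvPolynomial (Fin 4) ℂ →+* MvPolynomial (Fin 3) ℂ :=
  (MvPolynomial.aeval (fun j => MvPolynomial.C (b 0 j) +
        ∑ i : Fin 3, MvPolynomial.C (b i.succ j) * MvPolynomial.X i) :
        MvPolynomial (Fin 4) ℂ →ₐ[ℂ] MvPolynomial (Fin 3) ℂ).toRingHom

theorem fibrePoly_eq : fibrePoly F b = fibreHom b F := rfl

theorem spaceGerm_eq : spaceGerm F b = MvPolynomial.coeToMvPowerSeries.ringHom (chart b F) := rfl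

theorem fibreHom_C (c : ℂ) : fibreHom b (MvPolynomial.C c) = C (MvPolynomial.C c) := by
  simp [fibreHom, MvPolynomial.algebraMap_eq, Polynomial.algebraMap_apply]

theorem fibreHom_X (j : Fin 4) : fibreHom b (MvPolynomial.X j) = C (MvPolynomial.C (b 0 j) +
    MvPolynomial.C (b 1 j) * MvPolynomial.X 0 + MvPolynomial.C (b 2 j) * MvPolynomial.X 1) +
      C (MvPolynomial.C (b 3 j)) * X := by
  simp [fibreHom]

theorem chart_C (c : ℂ) : chart b (MvPolynomial.C c) = MvPolynomial.C c := by
  simp [chart, MvPolynomial.algebraMap_eq]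

theorem chart_X (j : Fin 4) : chart b (MvPolynomial.X j) = MvPolynomial.C (b 0 j) +
    ∑ i : Fin 3, MvPolynomial.C (b i.succ j) * MvPolynomial.X i := by
  simp [chart]

/-- Choosing another base point on the same line through the centre is a translation of the fibre
coordinate. -/
theorem fibrePoly_shift : fibrePoly F (shift b 0 0 z) =
    taylor (MvPolynomial.C z) (fibrePoly F b) := by
  have : (taylorAlgHom (MvPolynomial.C z : MvPolynomial (Fin 2) ℂ)).toRingHom.comp
      (fibreHom b) = fibreHom (shift b 0 0 z) := by
    apply MvPolynomial.ringHom_ext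
    · intro a
      simp [fibreHom_C]
    · intro j
      simp [fibreHom_X, shift_zero]
      ring
  exact (RingHom.congr_fun this F).symm

theorem sheet_shift : sheet F (shift b 0 0 z) = taylor (MvPowerSeries.C z) (sheet F b) := by
  rw [sheet, sheet, fibrePoly_shift, taylor_mul, taylor_C, shift_three, map_taylor]
  simp

/-- This links the formal types of singularities, stated in three variables, with the polynomial
over `ℂ⟦x, y⟧`. -/
theorem toSeries_spaceGerm : toSeries (spaceGerm F b) =
    ((fibrePoly F b).map toPlane : PlaneSeries[X]) := by
  have hX : ∀ i : Fin 2, toSeries (MvPowerSeries.X i.castSucc) =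
      PowerSeries.C (MvPowerSeries.X i) := by
    intro i
    rw [toSeries_apply, MvPowerSeries.rename_X, finSuccEquivLast_castSucc,
      MvPowerSeries.optionEquivLeft_X_some]
  have hZ : toSeries (MvPowerSeries.X (Fin.last 2)) = PowerSeries.X := by
    rw [toSeries_apply, MvPowerSeries.rename_X, finSuccEquivLast_last,
      MvPowerSeries.optionEquivLeft_X_none]
  have hC : ∀ c : ℂ, toSeries (MvPowerSeries.C c) = PowerSeries.C (MvPowerSeries.C c) := by
    intro c
    rw [toSeries_apply, MvPowerSeries.rename_C, MvPowerSeries.optionEquivLeft_C]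
  have : (toSeries.comp MvPolynomial.coeToMvPowerSeries.ringHom).comp (chart b) =
      ((Polynomial.coeToPowerSeries.ringHom (R := PlaneSeries)).comp (mapRingHom toPlane)).comp
      (fibreHom b) := by
    have h0 := hX 0
    have h1 := hX 1
    simp only [Fin.castSucc_zero, Fin.castSucc_one] at h0 h1
    have h2 : toSeries (MvPowerSeries.X 2) = PowerSeries.X := hZ
    apply MvPolynomial.ringHom_ext
    · intro a
      simp [chart_C, fibreHom_C, hC]
    · intro j
      simp [chart_X, fibreHom_X, Fin.sum_univ_three, hC, h0, h1, h2]
      ring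
  exact RingHom.congr_fun this F

end Frames

end FatSilhouette
end

noncomputable section

namespace FatSilhouette

open Polynomial hiding constantCoeff
open MvPowerSeries (constantCoeff)

/-! ### The degree of a form along lines. -/

section Degree

theorem aeval_line_monomial {B : Type*} [CommRing B] (u v : Fin 4 → B) (m : Fin 4 →₀ ℕ) :
    (∏ j, (C (u j) + C (v j) * X) ^ m j).natDegree ≤ ∑ j, m j ∧
      (∏ j, (C (u j) + C (v j) * X) ^ m j).coeff (∑ j, m j) = ∏ j, v j ^ m j := by
  have h1 : ∀ j, (C (u j) + C (v j) * X).natDegree ≤ 1 := fun j => by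
    rw [add_comm]; exact natDegree_linear_le
  have h2 : ∀ j, (C (u j) + C (v j) * X).coeff 1 = v j := fun j => by simp
  have h3 : ∀ j, ((C (u j) + C (v j) * X) ^ m j).natDegree ≤ m j := fun j => by
    have := natDegree_pow_le_of_le (m j) (h1 j)
    rwa [mul_one] at this
  have h4 : ∀ j, ((C (u j) + C (v j) * X) ^ m j).coeff (m j) = v j ^ m j := fun j => by
    have := coeff_pow_of_natDegree_le (n := 1) (m := m j) (h1 j)
    rwa [mul_one, h2] at this
  rw [Fin.prod_univ_four, Fin.sum_univ_four, Fin.prod_univ_four]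
  have d1 := natDegree_mul_le_of_le (h3 0) (h3 1)
  have d2 := natDegree_mul_le_of_le d1 (h3 2)
  have d3 := natDegree_mul_le_of_le d2 (h3 3)
  refine ⟨d3, ?_⟩
  rw [coeff_mul_add_eq_of_natDegree_le d2 (h3 3), coeff_mul_add_eq_of_natDegree_le d1 (h3 2),
    coeff_mul_add_eq_of_natDegree_le (h3 0) (h3 1), h4, h4, h4, h4]

/-- For the direction `p` of the projection the top coefficient is the value of `F` at the centre;
so the equation can be made monic when the centre is off the surface. -/
theorem aeval_line_degree {B : Type*} [CommRing B] [Algebra ℂ B] {F : MvPolynomial (Fin 4) ℂ}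
    {d : ℕ} (hF : F.IsHomogeneous d) (u v : Fin 4 → B) :
    (MvPolynomial.aeval (fun j => C (u j) + C (v j) * X) F : B[X]).natDegree ≤ d ∧
      (MvPolynomial.aeval (fun j => C (u j) + C (v j) * X) F : B[X]).coeff d =
        MvPolynomial.aeval v F := by
  have key : ∀ m ∈ F.support, ∑ j, m j = d := fun m hm => by
    have := hF (MvPolynomial.mem_support_iff.1 hm)
    rw [← this]
    simp [Finsupp.weight_apply, Finsupp.sum_fintype]
  rw [MvPolynomial.aeval_def, MvPolynomial.eval₂_eq, MvPolynomial.aeval_def, MvPolynomial.eval₂_eq]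
  constructor
  · refine natDegree_sum_le_of_forall_le _ _ fun m hm => ?_
    rw [Polynomial.algebraMap_apply]
    rw [← key m hm]
    refine (natDegree_C_mul_le _ _).trans ?_
    rw [Finset.prod_subset (Finset.subset_univ _) (by
      intro j _ hj; rw [Finsupp.notMem_support_iff.1 hj, pow_zero])]
    exact (aeval_line_monomial u v m).1
  · rw [finsetSum_coeff]
    refine Finset.sum_congr rfl fun m hm => ?_
    rw [Polynomial.algebraMap_apply, coeff_C_mul, ← key m hm,
      Finset.prod_subset (Finset.subset_univ m.support) (by
      intro j _ hj; rw [Finsupp.notMem_support_iff.1 hj, pow_zero]),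
      Finset.prod_subset (Finset.subset_univ m.support) (by
      intro j _ hj; rw [Finsupp.notMem_support_iff.1 hj, pow_zero]),
      (aeval_line_monomial u v m).2]

end Degree

/-! ### Monic equation, discriminant, contour and multiplicities on a line. -/

section Sheet

variable {F : MvPolynomial (Fin 4) ℂ} {d : ℕ} (hF : F.IsHomogeneous d) {b : Frame}
  (hp : MvPolynomial.eval (b 3) F ≠ 0)

include hF in
theorem fibrePoly_degree : (fibrePoly F b).natDegree ≤ d ∧
    (fibrePoly F b).coeff d = MvPolynomial.C (MvPolynomial.eval (b 3) F) := by
  have := aeval_line_degree hF (fun j => (MvPolynomial.C (b 0 j) +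
    MvPolynomial.C (b 1 j) * MvPolynomial.X 0 + MvPolynomial.C (b 2 j) * MvPolynomial.X 1 :
      MvPolynomial (Fin 2) ℂ)) (fun j => MvPolynomial.C (b 3 j))
  refine ⟨this.1, this.2.trans ?_⟩
  have e : (MvPolynomial.aeval fun j => (MvPolynomial.C (b 3 j) : MvPolynomial (Fin 2) ℂ)) F =
      algebraMap ℂ (MvPolynomial (Fin 2) ℂ) (MvPolynomial.aeval (b 3) F) := by
    rw [← MvPolynomial.aeval_algebraMap_apply]; rfl
  rw [e]; rfl

include hF hp in
theorem natDegree_fibrePoly : (fibrePoly F b).natDegree = d := by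
  refine le_antisymm (fibrePoly_degree hF).1 (le_natDegree_of_ne_zero ?_)
  rw [(fibrePoly_degree hF).2]
  simpa using hp

include hF hp in
theorem leadingCoeff_fibrePoly :
    (fibrePoly F b).leadingCoeff = MvPolynomial.C (MvPolynomial.eval (b 3) F) := by
  rw [leadingCoeff, natDegree_fibrePoly hF hp, (fibrePoly_degree hF).2]

theorem toPlane_C (c : ℂ) : toPlane (MvPolynomial.C c) = MvPowerSeries.C c := by simp

theorem toPlane_injective : Function.Injective toPlane := MvPolynomial.coe_injective _ _

include hF hp in
theorem sheet_monic : (sheet F b).Monic := by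
  rw [Monic, sheet, leadingCoeff_mul, leadingCoeff_C, leadingCoeff_map_of_injective
    toPlane_injective, leadingCoeff_fibrePoly hF hp, toPlane_C, ← map_mul, inv_mul_cancel₀ hp,
    map_one]

include hF hp in
theorem natDegree_sheet : (sheet F b).natDegree = d := by
  rw [sheet, natDegree_C_mul, natDegree_map_eq_of_injective toPlane_injective,
    natDegree_fibrePoly hF hp]
  simpa using hp

theorem disc_C_mul {A : Type*} [CommRing A] [IsDomain A] {a : A} (ha : IsUnit a) (f : A[X]) :
    Associated (disc (C a * f)) (disc f) := by
  have h : (C a * f).natDegree = f.natDegree := natDegree_C_mul ha.ne_zero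
  rw [disc, h, derivative_C_mul, resultant_C_mul_left, resultant_C_mul_right, disc, ← mul_assoc]
  exact associated_unit_mul_left _ _ ((ha.pow _).mul (ha.pow _))

include hF hp in
-- The discriminant and the resultant with the derivative differ by a sign and the leading
-- coefficient, a non-zero constant; the normalization of `sheet` only contributes further
-- constants.
theorem silhouetteEq_associated (hd : 0 < d) :
    Associated (silhouetteEq F b) (disc (sheet F b)) := by
  have hn := natDegree_fibrePoly hF hp
  have h1 : disc (fibrePoly F b) = (-1) ^ (d * (d - 1) / 2) *
      (MvPolynomial.C (MvPolynomial.eval (b 3) F)) * (fibrePoly F b).discr := by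
    rw [disc, resultant_deriv (natDegree_pos_iff_degree_pos.1 (hn ▸ hd)), hn,
      leadingCoeff_fibrePoly hF hp]
  have hu : IsUnit (MvPowerSeries.C (MvPolynomial.eval (b 3) F)⁻¹ : PlaneSeries) :=
    (isUnit_iff_ne_zero.2 (inv_ne_zero hp)).map _
  refine Associated.trans ?_ (disc_C_mul hu _).symm
  rw [disc_map toPlane (natDegree_map_eq_of_injective toPlane_injective _), h1, map_mul, map_mul,
    map_pow, map_neg, map_one, toPlane_C]
  refine associated_unit_mul_right _ _ (IsUnit.mul (isUnit_one.neg.pow _) ?_)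
  exact (isUnit_iff_ne_zero.2 hp).map _

/-- The equation of the surface on the line through `q` in the direction `p`. -/
def linePoly (F : MvPolynomial (Fin 4) ℂ) (p q : Fin 4 → ℂ) : ℂ[X] :=
  MvPolynomial.aeval (fun j => C (q j) + C (p j) * X) F

theorem lineMultiplicity_eq (F : MvPolynomial (Fin 4) ℂ) (p q : Fin 4 → ℂ) :
    lineMultiplicity F p q = (linePoly F p q).rootMultiplicity 0 := rfl

theorem eval_linePoly (F : MvPolynomial (Fin 4) ℂ) (p q : Fin 4 → ℂ) (z : ℂ) :
    (linePoly F p q).eval z = MvPolynomial.eval (q + z • p) F := by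
  have : (evalRingHom z).comp (MvPolynomial.aeval (fun j => C (q j) + C (p j) * X) :
      MvPolynomial (Fin 4) ℂ →ₐ[ℂ] ℂ[X]).toRingHom = MvPolynomial.eval (q + z • p) := by
    apply MvPolynomial.ringHom_ext
    · intro a; simp
    · intro j; simp; ring
  exact RingHom.congr_fun this F

theorem dirDeriv_add (F G : MvPolynomial (Fin 4) ℂ) (p q : Fin 4 → ℂ) :
    dirDeriv (F + G) p q = dirDeriv F p q + dirDeriv G p q := by
  simp [dirDeriv, mul_add, Finset.sum_add_distrib]

theorem dirDeriv_mul (F G : MvPolynomial (Fin 4) ℂ) (p q : Fin 4 → ℂ) :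
    dirDeriv (F * G) p q = MvPolynomial.eval q F * dirDeriv G p q +
      MvPolynomial.eval q G * dirDeriv F p q := by
  simp only [dirDeriv, Derivation.leibniz, smul_eq_mul, map_add, map_mul, Finset.mul_sum,
    ← Finset.sum_add_distrib]
  exact Finset.sum_congr rfl fun j _ => by ring

theorem dirDeriv_C (c : ℂ) (p q : Fin 4 → ℂ) : dirDeriv (MvPolynomial.C c) p q = 0 := by
  simp [dirDeriv]

theorem dirDeriv_X (j : Fin 4) (p q : Fin 4 → ℂ) : dirDeriv (MvPolynomial.X j) p q = p j := by
  simp [dirDeriv, MvPolynomial.pderiv_X, Pi.single_apply]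

theorem linePoly_add (F G : MvPolynomial (Fin 4) ℂ) (p q : Fin 4 → ℂ) :
    linePoly (F + G) p q = linePoly F p q + linePoly G p q := map_add _ _ _

theorem linePoly_mul (F G : MvPolynomial (Fin 4) ℂ) (p q : Fin 4 → ℂ) :
    linePoly (F * G) p q = linePoly F p q * linePoly G p q := map_mul _ _ _

theorem eval_derivative_linePoly (F : MvPolynomial (Fin 4) ℂ) (p q : Fin 4 → ℂ) (z : ℂ) :
    (derivative (linePoly F p q)).eval z = dirDeriv F p (q + z • p) := by
  induction F using MvPolynomial.induction_on with
  | C a => simp [linePoly, dirDeriv_C]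
  | add F G hF hG => rw [linePoly_add, derivative_add, eval_add, hF, hG, dirDeriv_add]
  | mul_X F j hF =>
    rw [linePoly_mul, derivative_mul, eval_add, eval_mul, eval_mul, hF, dirDeriv_mul, dirDeriv_X,
      eval_linePoly, eval_linePoly]
    simp [linePoly]
    ring

theorem map_fibrePoly (F : MvPolynomial (Fin 4) ℂ) (b : Frame) (t : Fin 2 → ℂ) :
    (fibrePoly F b).map (MvPolynomial.eval t) =
      linePoly F (b 3) (b 0 + t 0 • b 1 + t 1 • b 2) := by
  have : (mapRingHom (MvPolynomial.eval t)).comp (fibreHom b) =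
      (MvPolynomial.aeval (fun j => C ((b 0 + t 0 • b 1 + t 1 • b 2) j) + C (b 3 j) * X) :
      MvPolynomial (Fin 4) ℂ →ₐ[ℂ] ℂ[X]).toRingHom := by
    apply MvPolynomial.ringHom_ext
    · intro a; simp [fibreHom_C]
    · intro j; simp [fibreHom_X]; ring
  exact RingHom.congr_fun this F

theorem constantCoeff_comp_toPlane :
    (constantCoeff : PlaneSeries →+* ℂ).comp toPlane = MvPolynomial.eval 0 := by
  apply MvPolynomial.ringHom_ext
  · intro a; simp
  · intro j; simp

theorem fibre_sheet (F : MvPolynomial (Fin 4) ℂ) (b : Frame) : fibre (sheet F b) =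
    C (MvPolynomial.eval (b 3) F)⁻¹ * linePoly F (b 3) (b 0) := by
  rw [fibre, sheet, Polynomial.map_mul, map_C, Polynomial.map_map, constantCoeff_comp_toPlane,
    map_fibrePoly]
  simp

include hp in
theorem isContourRoot_sheet (z : ℂ) :
    IsContourRoot (sheet F b) z ↔ b 0 + z • b 3 ∈ contour F (b 3) := by
  rw [IsContourRoot, fibre_sheet, derivative_C_mul]
  simp [eval_linePoly, eval_derivative_linePoly, contour, hp]

theorem rootMultiplicity_taylor (f : ℂ[X]) (z : ℂ) :
    (taylor z f).rootMultiplicity 0 = f.rootMultiplicity z := by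
  rw [rootMultiplicity_eq_rootMultiplicity (p := f) (t := z)]; rfl

theorem linePoly_add_smul (F : MvPolynomial (Fin 4) ℂ) (p q : Fin 4 → ℂ) (z : ℂ) :
    linePoly F p (q + z • p) = taylor z (linePoly F p q) := by
  have : (taylorAlgHom z).toRingHom.comp
      (MvPolynomial.aeval (fun j => C (q j) + C (p j) * X) :
      MvPolynomial (Fin 4) ℂ →ₐ[ℂ] ℂ[X]).toRingHom =
      (MvPolynomial.aeval (fun j => C ((q + z • p) j) + C (p j) * X) :
      MvPolynomial (Fin 4) ℂ →ₐ[ℂ] ℂ[X]).toRingHom := by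
    apply MvPolynomial.ringHom_ext
    · intro a; simp
    · intro j; simp; ring
  exact (RingHom.congr_fun this F).symm

include hp in
theorem lineMultiplicity_eq_natDegree {z : ℂ} {W V : PlaneSeries[X]} (h : sheet F b = W * V)
    (hW : IsDistAt z W) (hV : (fibre V).eval z ≠ 0) :
    lineMultiplicity F (b 3) (b 0 + z • b 3) = W.natDegree := by
  have h1 := fibre_sheet F b
  rw [h, fibre_mul, hW.fibre_eq] at h1
  have h2 : linePoly F (b 3) (b 0) =
      (X - C z) ^ W.natDegree * (C (MvPolynomial.eval (b 3) F) * fibre V) := by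
    calc _ = C (MvPolynomial.eval (b 3) F) * (C (MvPolynomial.eval (b 3) F)⁻¹ *
          linePoly F (b 3) (b 0)) := by
            rw [← mul_assoc, ← C_mul, mul_inv_cancel₀ hp, C_1, one_mul]
      _ = _ := by rw [← h1]; ring
  have hne : C (MvPolynomial.eval (b 3) F) * fibre V ≠ 0 := by
    intro h0
    have := congrArg (eval z) h0
    simp [hp, hV] at this
  rw [lineMultiplicity_eq, linePoly_add_smul, rootMultiplicity_taylor, h2,
    rootMultiplicity_mul (mul_ne_zero (pow_ne_zero _ (X_sub_C_ne_zero z)) hne),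
    rootMultiplicity_X_sub_C_pow, rootMultiplicity_eq_zero, add_zero]
  simp [hp, hV]

/-- The linear part of the germ of a polynomial. -/
theorem linPart_spaceGerm (F : MvPolynomial (Fin 4) ℂ) (b : Frame) :
    constantCoeff (spaceGerm F b) = MvPolynomial.eval (b 0) F ∧
      ∀ i : Fin 3, linPart (spaceGerm F b) i = dirDeriv F (b i.succ) (b 0) := by
  simp only [spaceGerm_eq]
  induction F using MvPolynomial.induction_on with
  | C a => simp [chart_C, dirDeriv_C]
  | add F G hF hG =>
    simp only [map_add, linPart_add, dirDeriv_add, hF.1, hG.1, Pi.add_apply, hF.2, hG.2]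
    simp
  | mul_X F j hF =>
    have e0 : constantCoeff (MvPolynomial.coeToMvPowerSeries.ringHom (chart b (MvPolynomial.X j)))
        = b 0 j := by simp [chart_X, Fin.sum_univ_three]
    have e1 : ∀ i : Fin 3, linPart (MvPolynomial.coeToMvPowerSeries.ringHom
        (chart b (MvPolynomial.X j))) i = b i.succ j := by
      intro i
      fin_cases i <;> simp [chart_X, Fin.sum_univ_three, linPart_X]
    simp only [map_mul, linPart_mul, dirDeriv_mul, hF.1, e0, Pi.add_apply, Pi.smul_apply, hF.2, e1,
      dirDeriv_X, MvPolynomial.eval_X, smul_eq_mul]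
    simp

include hF in
-- On the surface the derivative in the direction of the point itself vanishes by Euler's relation;
-- so the three derivatives in the chart suffice.
theorem grad_eq_zero_iff {q : Fin 4 → ℂ} (hq : MvPolynomial.eval q F = 0) (b : Frame)
    (hb : b 0 = q) : grad F q = 0 ↔ ∀ i : Fin 3, dirDeriv F (b i.succ) q = 0 := by
  constructor
  · intro h i
    rw [dirDeriv]
    exact Finset.sum_eq_zero fun j _ => by
      have := congrFun h j
      rw [grad] at this
      rw [this]; simp
  · intro h
    have h0 : dirDeriv F q q = 0 := by
      have := congrArg (MvPolynomial.eval q) hF.sum_X_mul_pderiv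
      simpa [dirDeriv, hq] using this
    have key : ∀ i : Fin 4, grad F q ⬝ᵥ b i = 0 := by
      intro i
      have e : ∀ p, grad F q ⬝ᵥ p = dirDeriv F p q := fun p => by
        rw [dotProduct_comm]; rfl
      rw [e]
      refine Fin.cases ?_ (fun j => ?_) i
      · rw [hb, h0]
      · exact h j
    have : ∀ v, grad F q ⬝ᵥ v = 0 := fun v => by
      rw [← b.sum_repr v, dotProduct_sum]
      exact Finset.sum_eq_zero fun i _ => by rw [dotProduct_smul, key, smul_zero]
    exact dotProduct_eq_zero_iff.1 this

include hF in
/-- A point of the surface is singular if and only if the linear part of the equation vanishes. -/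
theorem mem_singularLocus_iff (z : ℂ) (hq : MvPolynomial.eval (b 0 + z • b 3) F = 0) :
    b 0 + z • b 3 ∈ singularLocus F ↔
      lin3 (((fibrePoly F b).map toPlane).taylor (MvPowerSeries.C z) : PlaneSeries[X]) = 0 := by
  have hb : shift b 0 0 z 0 = b 0 + z • b 3 := by simp [shift_zero]
  have h1 : (((fibrePoly F b).map toPlane).taylor (MvPowerSeries.C z) : PlaneSeries[X]) =
      (fibrePoly F (shift b 0 0 z)).map toPlane := by
    rw [fibrePoly_shift, map_taylor]; simp
  rw [h1, ← toSeries_spaceGerm, lin3_toSeries, singularLocus, Set.mem_ofPred_eq,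
    grad_eq_zero_iff hF hq (shift b 0 0 z) hb]
  simp only [hq, true_and]
  constructor
  · intro h; ext i; rw [(linPart_spaceGerm F _).2, hb]; exact h i
  · intro h i
    have := congrFun h i
    rwa [(linPart_spaceGerm F _).2, hb] at this

end Sheet

end FatSilhouette
end

noncomputable section

namespace FatSilhouette

open Polynomial hiding constantCoeff
open MvPowerSeries (constantCoeff)

/-! ### Normal forms of quadratic and cubic polynomials. -/

section Discriminants

variable {A : Type*} [CommRing A]

theorem disc_associated_discr {f : A[X]} (hf : f.Monic) (h : 0 < f.natDegree) :
    Associated (disc f) f.discr := by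
  rw [disc, resultant_deriv (natDegree_pos_iff_degree_pos.1 h), hf.leadingCoeff, mul_one]
  exact associated_unit_mul_left _ _ (isUnit_one.neg.pow _)

theorem Monic.eq_linear {f : A[X]} (hf : f.Monic) (h : f.natDegree = 1) :
    f = X - C (-f.coeff 0) := by
  conv_lhs => rw [hf.as_sum, h]
  simp

theorem Monic.eq_quadratic {f : A[X]} (hf : f.Monic) (h : f.natDegree = 2) :
    f = X ^ 2 + C (f.coeff 1) * X + C (f.coeff 0) := by
  conv_lhs => rw [hf.as_sum, h]
  simp [Finset.sum_range_succ]; ring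

theorem Monic.eq_cubic {f : A[X]} (hf : f.Monic) (h : f.natDegree = 3) :
    f = X ^ 3 + C (f.coeff 2) * X ^ 2 + C (f.coeff 1) * X + C (f.coeff 0) := by
  conv_lhs => rw [hf.as_sum, h]
  simp [Finset.sum_range_succ]; ring

theorem natDegree_depressed [Nontrivial A] (p q : A) :
    (X ^ 3 + C (3 * p) * X + C (2 * q) : A[X]).natDegree = 3 := by
  compute_degree!

theorem monic_depressed (p q : A) : (X ^ 3 + C (3 * p) * X + C (2 * q) : A[X]).Monic := by
  monicity!

variable [Algebra ℂ A]

theorem isUnit_natCast (A : Type*) [CommRing A] [Algebra ℂ A] (n : ℕ) (hn : n ≠ 0) :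
    IsUnit (n : A) := by
  have : (n : A) = algebraMap ℂ A n := by simp
  rw [this]
  exact (isUnit_iff_ne_zero.2 (Nat.cast_ne_zero.2 hn)).map _

theorem disc_quadratic [IsDomain A] (δ : A) : Associated (disc (X ^ 2 - C δ : A[X])) δ := by
  have hm : (X ^ 2 - C δ : A[X]).Monic := monic_X_pow_sub_C δ two_ne_zero
  have hn : (X ^ 2 - C δ : A[X]).natDegree = 2 := natDegree_X_pow_sub_C
  refine (disc_associated_discr hm (by omega)).trans ?_
  rw [discr_of_degree_eq_two (by rw [degree_X_pow_sub_C two_pos]; rfl)]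
  have : (X ^ 2 - C δ : A[X]).coeff 1 ^ 2 - 4 * (X ^ 2 - C δ : A[X]).coeff 0 *
      (X ^ 2 - C δ : A[X]).coeff 2 = (4 : ℕ) * δ := by
    simp [coeff_X_pow, coeff_C]
  rw [this]
  exact associated_unit_mul_left _ _ (isUnit_natCast A 4 (by norm_num))

theorem disc_cubic [IsDomain A] (p q : A) :
    Associated (disc (X ^ 3 + C (3 * p) * X + C (2 * q) : A[X])) (p ^ 3 + q ^ 2) := by
  have hn := natDegree_depressed p q
  refine (disc_associated_discr (monic_depressed p q) (by omega)).trans ?_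
  rw [discr_of_degree_eq_three (degree_eq_iff_natDegree_eq_of_pos (by norm_num) |>.2 hn)]
  have : ∀ e : A, e = -(108 : ℕ) * (p ^ 3 + q ^ 2) → Associated e (p ^ 3 + q ^ 2) := by
    rintro e rfl
    exact associated_unit_mul_left _ _ (isUnit_natCast A 108 (by norm_num)).neg
  apply this
  simp only [coeff_add, coeff_X_pow, coeff_C_mul, coeff_X, coeff_C]
  norm_num
  ring

/-- Completing the square. -/
theorem exists_taylor_quadratic {W : A[X]} (hW : W.Monic) (h : W.natDegree = 2) :
    ∃ β δ : A, taylor β W = X ^ 2 - C δ := by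
  obtain ⟨κ, hκ⟩ := (isUnit_natCast A 2 two_ne_zero).exists_left_inv
  obtain ⟨c, e, hce⟩ : ∃ c e, W = X ^ 2 + C c * X + C e := ⟨_, _, Monic.eq_quadratic hW h⟩
  refine ⟨-(κ * c), (κ * c) ^ 2 - e, ?_⟩
  have e : C κ * 2 = (1 : A[X]) := by
    rw [← C_1, ← hκ, C_mul]; rfl
  rw [hce]
  simp only [map_add, taylor_mul, taylor_X_pow, taylor_X, taylor_C, map_neg, map_sub, map_pow, map_mul]
  linear_combination (-X * C c + C κ * C c ^ 2) * e

/-- Removing the quadratic term. -/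
theorem exists_taylor_cubic {W : A[X]} (hW : W.Monic) (h : W.natDegree = 3) :
    ∃ β p q : A, taylor β W = X ^ 3 + C (3 * p) * X + C (2 * q) ∧ 3 * β = - W.coeff 2 := by
  obtain ⟨κ, hκ⟩ := (isUnit_natCast A 3 three_ne_zero).exists_left_inv
  obtain ⟨ι, hι⟩ := (isUnit_natCast A 2 two_ne_zero).exists_left_inv
  obtain ⟨c, d, e, hce⟩ : ∃ c d e, W = X ^ 3 + C c * X ^ 2 + C d * X + C e :=
    ⟨_, _, _, Monic.eq_cubic hW h⟩
  have hc : W.coeff 2 = c := by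
    rw [hce]; simp [coeff_X_pow, coeff_C_succ]
  have e3 : C κ * 3 = (1 : A[X]) := by rw [← C_1, ← hκ, C_mul]; rfl
  have e2 : C ι * 2 = (1 : A[X]) := by rw [← C_1, ← hι, C_mul]; rfl
  have h3 : (C 3 : A[X]) = 3 := rfl
  have h2 : (C 2 : A[X]) = 2 := rfl
  refine ⟨-(κ * c), κ * (3 * (κ * c) ^ 2 - 2 * (κ * c) * c + d),
    ι * (-(κ * c) ^ 3 + (κ * c) ^ 2 * c - κ * c * d + e), ?_, ?_⟩
  · rw [hce]
    simp only [map_add, taylor_mul, taylor_X_pow, taylor_X, taylor_C, map_neg, map_sub, map_pow,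
      map_mul, h3, h2]
    linear_combination (-(C c) * X ^ 2 - X * (3 * (C κ * C c) ^ 2 - 2 * (C κ * C c) * C c + C d)) * e3
      - (-(C κ * C c) ^ 3 + (C κ * C c) ^ 2 * C c - C κ * C c * C d + C e) * e2
  · rw [hc]; push_cast at hκ; linear_combination (-c) * hκ

end Discriminants

/-! ### Conductor ideals of split, quadratic and cubic polynomials. -/

section Conductor

variable {R : Type*} [CommRing R]

/-- The ideal generated by a polynomial and its derivative. -/
def jacIdeal (f : R[X]) : Ideal R[X] := Ideal.span {f, derivative f}

/-- The values at `1` of the linear maps `R[X]⧸I → R⧸K`, as an ideal of `R`. -/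
def condIdeal (K : Ideal R) (I : Ideal R[X]) : Ideal R where
  carrier := {a | ∃ φ : R[X] →ₗ[R] R ⧸ K, (∀ g ∈ I, φ g = 0) ∧
    φ 1 = Ideal.Quotient.mk _ a}
  zero_mem' := ⟨0, fun _ _ => rfl, by simp⟩
  add_mem' := by
    rintro a b ⟨φ, h1, h2⟩ ⟨ψ, h3, h4⟩
    exact ⟨φ + ψ, fun g hg => by simp [h1 g hg, h3 g hg], by simp [h2, h4]⟩
  smul_mem' := by
    rintro c a ⟨φ, h1, h2⟩
    refine ⟨c • φ, fun g hg => by simp [h1 g hg], ?_⟩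
    rw [LinearMap.smul_apply, h2, smul_eq_mul, map_mul, Algebra.smul_def]; rfl

theorem condIdeal_mono (K : Ideal R) {I J : Ideal R[X]} (h : I ≤ J) : condIdeal K J ≤ condIdeal K I := by
  rintro a ⟨φ, h1, h2⟩
  exact ⟨φ, fun g hg => h1 g (h hg), h2⟩

/-- By the Chinese remainder theorem a functional on the quotient by `I ⊓ J` is a pair of
functionals on the two quotients; the elements `v` and `u` represent the idempotents `1` and `u + v
= 1` splits the value at `1`. -/
theorem condIdeal_inf (K : Ideal R) {I J : Ideal R[X]} (h : IsCoprime I J) :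
    condIdeal K (I ⊓ J) = condIdeal K I ⊔ condIdeal K J := by
  apply le_antisymm
  · rintro a ⟨φ, h1, h2⟩
    obtain ⟨u, hu, v, hv, huv⟩ := Ideal.isCoprime_iff_exists.1 h
    have key : ∀ {w : R[X]} {I' : Ideal R[X]}, (∀ g ∈ I', w * g ∈ I ⊓ J) →
        ∀ c, φ w = Ideal.Quotient.mk _ c → c ∈ condIdeal K I' := by
      intro w I' hw c hc
      refine ⟨φ.comp (LinearMap.mulLeft R w), fun g hg => h1 _ (hw g hg), ?_⟩
      rw [LinearMap.comp_apply, LinearMap.mulLeft_apply, mul_one, hc]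
    obtain ⟨c, hc⟩ := Ideal.Quotient.mk_surjective (φ v)
    have e1 : c ∈ condIdeal K I := key (fun g hg => ⟨I.mul_mem_left _ hg, J.mul_mem_right _ hv⟩) c hc.symm
    have e2 : a - c ∈ condIdeal K J := by
      refine key (w := u) (fun g hg => ⟨I.mul_mem_right _ hu, J.mul_mem_left _ hg⟩) _ ?_
      rw [map_sub, hc, ← h2, ← map_sub, ← huv, add_sub_cancel_right]
    have := Submodule.add_mem_sup e1 e2
    rwa [add_sub_cancel] at this
  · exact sup_le (condIdeal_mono K inf_le_left) (condIdeal_mono K inf_le_right)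

theorem condIdeal_taylor (K : Ideal R) (β : R) (f : R[X]) :
    condIdeal K (jacIdeal (taylor β f)) = condIdeal K (jacIdeal f) := by
  have hd : ∀ (β : R) (f : R[X]), derivative (taylor β f) = taylor β (derivative f) := by
    intro β f
    rw [taylor_apply, taylor_apply, derivative_comp]; simp
  have key : ∀ (β : R) (f : R[X]),
      condIdeal K (jacIdeal (taylor β f)) ≤ condIdeal K (jacIdeal f) := by
    rintro β f a ⟨φ, h1, h2⟩
    refine ⟨φ.comp (taylor β), fun g hg => h1 _ ?_, by simp [h2]⟩
    obtain ⟨u, v, rfl⟩ := Ideal.mem_span_pair.1 hg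
    rw [map_add, taylor_mul, taylor_mul, ← hd]
    exact Ideal.mem_span_pair.2 ⟨_, _, rfl⟩
  refine le_antisymm (key β f) ?_
  have := key (-β) (taylor β f)
  rwa [taylor_neg_taylor] at this

/-- Where `W` vanishes, `V` is invertible and `(W V)'` is `W' V`, so the two ideals agree there, and
symmetrically. The explicit combinations express the four products of generators. -/
theorem jacIdeal_mul {W V : R[X]} (h : IsCoprime W V) :
    jacIdeal (W * V) = jacIdeal W ⊓ jacIdeal V ∧ IsCoprime (jacIdeal W) (jacIdeal V) := by
  have hc : IsCoprime (jacIdeal W) (jacIdeal V) := by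
    obtain ⟨a, b, hab⟩ := h
    exact Ideal.isCoprime_iff_exists.2 ⟨a * W, Ideal.mul_mem_left _ _ (Ideal.subset_span (by simp)),
      b * V, Ideal.mul_mem_left _ _ (Ideal.subset_span (by simp)), hab⟩
  refine ⟨le_antisymm (le_inf ?_ ?_) ?_, hc⟩
  · rw [jacIdeal, Ideal.span_le]
    rintro _ (rfl | rfl)
    · exact Ideal.mem_span_pair.2 ⟨V, 0, by ring⟩
    · rw [derivative_mul]; exact Ideal.mem_span_pair.2 ⟨derivative V, V, by ring⟩
  · rw [jacIdeal, Ideal.span_le]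
    rintro _ (rfl | rfl)
    · exact Ideal.mem_span_pair.2 ⟨W, 0, by ring⟩
    · rw [derivative_mul]; exact Ideal.mem_span_pair.2 ⟨derivative W, W, by ring⟩
  · rw [← Ideal.mul_eq_inf_of_isCoprime hc, jacIdeal, jacIdeal, Ideal.span_pair_mul_span_pair,
      jacIdeal, derivative_mul]
    obtain ⟨a, b, hab⟩ := h
    rw [Ideal.span_le]
    rintro _ (rfl | rfl | rfl | rfl)
    · exact Ideal.subset_span (by simp)
    · exact Ideal.mem_span_pair.2 ⟨b * derivative V - a * derivative W, a * W, by
        linear_combination (W * derivative V) * hab⟩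
    · exact Ideal.mem_span_pair.2 ⟨a * derivative W - b * derivative V, b * V, by
        linear_combination (derivative W * V) * hab⟩
    · exact Ideal.mem_span_pair.2 ⟨a * derivative W * (b * derivative V - a * derivative W) +
        b * derivative V * (a * derivative W - b * derivative V),
        a ^ 2 * W * derivative W + b ^ 2 * V * derivative V, by
        linear_combination (derivative W * derivative V * (a * W + b * V + 1)) * hab⟩

/-- As `2` is a unit, the quotient of `R[X]` by `(X² - δ, 2X)` is `R/δ`; a functional is an element
that is killed by `δ`. -/
theorem condIdeal_quadratic (K : Ideal R) (δ : R) (h2 : IsUnit (2 : R)) (a : R) :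
    a ∈ condIdeal K (jacIdeal (X ^ 2 - C δ)) ↔ δ * a ∈ K := by
  have hd : derivative (X ^ 2 - C δ : R[X]) = C 2 * X := by
    simp only [derivative_sub, derivative_X_pow, derivative_C]; simp
  rw [jacIdeal, hd]
  constructor
  · rintro ⟨φ, h1, h3⟩
    obtain ⟨ι, hι⟩ := h2.exists_left_inv
    have e : (C ι * C 2 : R[X]) = 1 := by rw [← C_mul, hι, C_1]
    have hδ : C δ ∈ Ideal.span {X ^ 2 - C δ, C 2 * X} :=
      Ideal.mem_span_pair.2 ⟨-1, C ι * X, by linear_combination X ^ 2 * e⟩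
    have h4 := h1 _ hδ
    rw [← mul_one (C δ), ← smul_eq_C_mul, map_smul, h3] at h4
    rw [← Ideal.Quotient.eq_zero_iff_mem, map_mul]
    exact h4
  · intro ha
    refine ⟨(LinearMap.toSpanSingleton R (R ⧸ K) (Ideal.Quotient.mk K a)).comp (leval 0),
      fun g hg => ?_, by simp⟩
    obtain ⟨u, v, rfl⟩ := Ideal.mem_span_pair.1 hg
    have : Ideal.Quotient.mk K δ * Ideal.Quotient.mk K a = 0 := by
      rw [← map_mul, Ideal.Quotient.eq_zero_iff_mem]; exact ha
    simp only [LinearMap.comp_apply, leval_apply, LinearMap.toSpanSingleton_apply, Algebra.smul_def]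
    simp only [eval_add, eval_mul, eval_sub, eval_pow, eval_X, eval_C, mul_zero, add_zero]
    change Ideal.Quotient.mk K _ * _ = 0
    rw [map_mul, mul_assoc]
    simp [this]

/-- Modulo `X² + p` the ideal becomes a set of combinations of the two relations `pX + q` and `qX -
p²` in the free module with basis `1`, `X`. So `a` and `b`, the values at `1` and `X`, only have to
satisfy these two relations. -/
theorem mem_condIdeal_cubic {K : Ideal R} {p q : R} [Nontrivial R] {a b : R}
    (h1 : p * b + q * a ∈ K) (h2 : q * b - p ^ 2 * a ∈ K) :
    a ∈ condIdeal K (jacIdeal (X ^ 3 + C (3 * p) * X + C (2 * q))) := by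
  have hm : (X ^ 2 + C p : R[X]).Monic := monic_X_pow_add_C p two_ne_zero
  have hdeg : (X ^ 2 + C p : R[X]).degree = 2 := degree_X_pow_add_C two_pos p
  let ψ : R[X] →ₗ[R] R ⧸ K :=
    (LinearMap.toSpanSingleton R (R ⧸ K) (Ideal.Quotient.mk K a)).comp (lcoeff R 0) +
      (LinearMap.toSpanSingleton R (R ⧸ K) (Ideal.Quotient.mk K b)).comp (lcoeff R 1)
  have hψ : ∀ g, ψ g = Ideal.Quotient.mk K (g.coeff 0 * a + g.coeff 1 * b) := fun g => by
    simp only [ψ, LinearMap.add_apply, LinearMap.comp_apply, lcoeff_apply,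
      LinearMap.toSpanSingleton_apply, Algebra.smul_def, map_add, map_mul]
    rfl
  have hlin : ∀ c d : R, (C c * X + C d) %ₘ (X ^ 2 + C p) = C c * X + C d := fun c d =>
    (modByMonic_eq_self_iff hm).2 (by rw [hdeg]; exact degree_linear_lt)
  refine ⟨ψ.comp (modByMonicHom (X ^ 2 + C p)), fun g hg => ?_, ?_⟩
  · obtain ⟨u, v, rfl⟩ := Ideal.mem_span_pair.1 hg
    have hd : derivative (X ^ 3 + C (3 * p) * X + C (2 * q) : R[X]) = C 3 * (X ^ 2 + C p) := by
      simp only [derivative_add, derivative_C_mul, derivative_X_pow, derivative_C,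
        C_mul]
      simp; ring
    have hu := modByMonic_add_div u (X ^ 2 + C p)
    set r := u %ₘ (X ^ 2 + C p) with hr
    set k := u /ₘ (X ^ 2 + C p)
    have hrdeg : r.natDegree ≤ 1 := by
      have := degree_modByMonic_lt u hm
      rw [hdeg] at this
      exact natDegree_le_of_degree_le (Order.le_of_lt_succ (this.trans_eq (by rfl)))
    obtain ⟨c, d, hcd⟩ := exists_eq_X_add_C_of_natDegree_le_one hrdeg
    have key : u * (X ^ 3 + C (3 * p) * X + C (2 * q)) +
        v * derivative (X ^ 3 + C (3 * p) * X + C (2 * q)) =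
        (C (2 * (p * d + q * c)) * X + C (2 * (q * d - p ^ 2 * c))) + (X ^ 2 + C p) *
        (k * (X ^ 3 + C (3 * p) * X + C (2 * q)) + v * C 3 + X * r + C (2 * p * c)) := by
      rw [hd, ← hu, hcd]
      have h3 : (C 3 : R[X]) = 3 := rfl
      have h2 : (C 2 : R[X]) = 2 := rfl
      simp only [map_add, map_sub, map_mul, map_pow, h2, h3]
      ring
    rw [LinearMap.comp_apply, modByMonicHom_apply, key, add_modByMonic, hlin,
      (modByMonic_eq_zero_iff_dvd hm).2 (dvd_mul_right _ _), add_zero, hψ,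
      Ideal.Quotient.eq_zero_iff_mem]
    have := K.add_mem (K.mul_mem_left (2 * d) h2) (K.mul_mem_left (2 * c) h1)
    have h1' := K.add_mem (K.mul_mem_left (2 * c) h2) (K.mul_mem_left (2 * d) h1)
    simp only [coeff_add, coeff_C_mul, coeff_X_zero, coeff_X_one, coeff_C_zero, coeff_C_succ]
    convert h1' using 1
    ring
  · rw [LinearMap.comp_apply, modByMonicHom_apply, (modByMonic_eq_self_iff hm).2, hψ]
    · simp [coeff_one]
    · rw [hdeg, degree_one]; norm_num

/-- The two relations `p b + q a` and `q b - p² a` have determinant `p³ + q²` up to sign, which is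
zero in the target; Cramer's rule turns them into a parametrization of all solutions. -/
theorem condIdeal_cubic [IsDomain R] (p q : R) (h2 : IsUnit (2 : R)) (h3 : IsUnit (3 : R))
    (hne : p ^ 3 + q ^ 2 ≠ 0) :
    condIdeal (Ideal.span {p ^ 3 + q ^ 2}) (jacIdeal (X ^ 3 + C (3 * p) * X + C (2 * q))) =
      Ideal.span {p, q} := by
  apply le_antisymm
  · rintro a ⟨φ, h1, ha⟩
    obtain ⟨b, hb⟩ := Ideal.Quotient.mk_surjective (φ X)
    obtain ⟨ι, hι⟩ := h2.exists_left_inv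
    obtain ⟨κ, hκ⟩ := h3.exists_left_inv
    have hd : derivative (X ^ 3 + C (3 * p) * X + C (2 * q) : R[X]) = C 3 * (X ^ 2 + C p) := by
      simp only [derivative_add, derivative_C_mul, derivative_X_pow, derivative_C,
        C_mul]
      simp; ring
    have e2 : (C ι * C 2 : R[X]) = 1 := by rw [← C_mul, hι, C_1]
    have e3 : (C κ * C 3 : R[X]) = 1 := by rw [← C_mul, hκ, C_1]
    rw [jacIdeal, hd] at h1
    have k1 : p • X + q • 1 ∈ Ideal.span {X ^ 3 + C (3 * p) * X + C (2 * q),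
        (C 3 * (X ^ 2 + C p) : R[X])} :=
      Ideal.mem_span_pair.2 ⟨C ι, -C ι * X * C κ, by
        have h3 : (C 3 : R[X]) = 1 + C 2 := by rw [← C_1, ← C_add]; norm_num
        simp only [smul_eq_C_mul, C_mul]
        linear_combination (C p * X + C q) * e2 -
          (C ι * X * (X ^ 2 + C p)) * e3 + C ι * C p * X * h3⟩
    have k2 : q • X + (-p ^ 2) • 1 ∈ Ideal.span {X ^ 3 + C (3 * p) * X + C (2 * q),
        (C 3 * (X ^ 2 + C p) : R[X])} := by
      have : q • X + (-p ^ 2) • 1 = X * (p • X + q • 1) - C p * C κ * (C 3 * (X ^ 2 + C p)) := by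
        simp only [smul_eq_C_mul, map_neg, map_pow]
        linear_combination (C p * (X ^ 2 + C p)) * e3
      rw [this]
      exact Ideal.sub_mem _ (Ideal.mul_mem_left _ _ k1)
        (Ideal.mul_mem_left _ _ (Ideal.subset_span (by simp)))
    have h4 := h1 _ k1
    have h5 := h1 _ k2
    rw [map_add, map_smul, map_smul, ha, ← hb, Algebra.smul_def, Algebra.smul_def] at h4 h5
    replace h4 : p * b + q * a ∈ Ideal.span {p ^ 3 + q ^ 2} := by
      rw [← Ideal.Quotient.eq_zero_iff_mem, map_add, map_mul, map_mul]; exact h4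
    replace h5 : q * b + -p ^ 2 * a ∈ Ideal.span {p ^ 3 + q ^ 2} := by
      rw [← Ideal.Quotient.eq_zero_iff_mem, map_add, map_mul, map_mul]; exact h5
    obtain ⟨u, hu⟩ := Ideal.mem_span_singleton.1 h4
    obtain ⟨v, hv⟩ := Ideal.mem_span_singleton.1 h5
    -- Elimination of `b` gives `(p³ + q²) a` on the left and the same factor on the right; it is
    -- cancelled.
    have : a = q * u - p * v := by
      apply mul_left_cancel₀ hne
      linear_combination q * hu - p * hv
    rw [this]
    exact Ideal.mem_span_pair.2 ⟨-v, u, by ring⟩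
  · rw [Ideal.span_le]
    rintro _ (rfl | rfl)
    -- The pairs `(p, -q)` and `(q, p²)` each satisfy one relation exactly and the other one modulo
    -- `p³ + q²`.
    · exact mem_condIdeal_cubic (b := -q) (Ideal.mem_span_singleton.2 ⟨0, by ring⟩)
        (Ideal.mem_span_singleton.2 ⟨-1, by ring⟩)
    · exact mem_condIdeal_cubic (b := p ^ 2) (Ideal.mem_span_singleton.2 ⟨1, by ring⟩)
        (Ideal.mem_span_singleton.2 ⟨0, by ring⟩)

theorem jacIdeal_C_mul {c : R} (hc : IsUnit c) (f : R[X]) : jacIdeal (C c * f) = jacIdeal f := by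
  obtain ⟨e, he⟩ := hc.exists_left_inv
  have he' : C e * C c = (1 : R[X]) := by rw [← C_mul, he, C_1]
  rw [jacIdeal, jacIdeal, derivative_C_mul]
  apply le_antisymm <;> rw [Ideal.span_le]
  · rintro _ (rfl | rfl)
    · exact Ideal.mul_mem_left _ _ (Ideal.subset_span (by simp))
    · exact Ideal.mul_mem_left _ _ (Ideal.subset_span (by simp))
  · rintro x (hx | hx)
    · exact Ideal.mem_span_pair.2 ⟨C e, 0, by rw [hx]; linear_combination f * he'⟩
    · exact Ideal.mem_span_pair.2 ⟨0, C e, by rw [hx]; linear_combination derivative f * he'⟩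

theorem mem_range_applyₗ_one {S : Type*} [CommRing S] (I : Ideal S[X]) (a : S) :
    a ∈ LinearMap.range (LinearMap.applyₗ (R := S) (M := S[X] ⧸ I) (M₂ := S) 1) ↔
      ∃ ψ : S[X] →ₗ[S] S, (∀ g ∈ I, ψ g = 0) ∧ ψ 1 = a := by
  constructor
  · rintro ⟨φ, hφ⟩
    refine ⟨φ.comp (Ideal.Quotient.mkₐ S I).toLinearMap, fun g hg => ?_, hφ⟩
    have : (Ideal.Quotient.mkₐ S I) g = 0 := Ideal.Quotient.eq_zero_iff_mem.2 hg
    rw [LinearMap.comp_apply, AlgHom.toLinearMap_apply, this, map_zero]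
  · rintro ⟨ψ, h, ha⟩
    exact ⟨Submodule.liftQ (I.restrictScalars S) ψ fun g hg => h g hg, ha⟩

/-- Functionals over the ring of the fat silhouette lift to maps from `ℂ⟦x, y⟧[X]` with values
modulo the discriminant; this allows the computation to use the domain `ℂ⟦x, y⟧`. -/
theorem conductorPreimage_eq {F : MvPolynomial (Fin 4) ℂ} {b : Frame}
    (hp : MvPolynomial.eval (b 3) F ≠ 0) : conductorPreimage F b =
      condIdeal (Ideal.span {silhouetteEq F b}) (jacIdeal (sheet F b)) := by
  have hu : IsUnit (MvPowerSeries.C (MvPolynomial.eval (b 3) F)⁻¹ : PlaneSeries) :=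
    (isUnit_iff_ne_zero.2 (inv_ne_zero hp)).map _
  rw [sheet, jacIdeal_C_mul hu]
  set f := (fibrePoly F b).map toPlane with hf
  set π := toSilhouetteRing F b with hπ
  have hE : fibrePolyE F b = f.map π := by
    rw [fibrePolyE, hf, Polynomial.map_map]
  set I : Ideal (SilhouetteRing F b)[X] := Ideal.span {fibrePolyE F b, derivative (fibrePolyE F b)}
    with hI
  have hJ : I = (jacIdeal f).map (mapRingHom π) := by
    rw [hI, jacIdeal, Ideal.map_span, Set.image_pair, hE, coe_mapRingHom, derivative_map]
  ext a
  constructor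
  · intro ha
    obtain ⟨φ', h0, hφ⟩ := (mem_range_applyₗ_one I (π a)).1 ha
    refine ⟨{ toFun := fun g => φ' (g.map π)
              map_add' := fun g h => by rw [Polynomial.map_add, map_add]
              map_smul' := fun c g => ?_ }, fun g hg => ?_, ?_⟩
    · rw [smul_eq_C_mul, Polynomial.map_mul, map_C, ← smul_eq_C_mul, map_smul]
      rfl
    · exact h0 _ (hJ ▸ Ideal.mem_map_of_mem (mapRingHom π) hg)
    · change φ' ((1 : PlaneSeries[X]).map π) = _
      rw [Polynomial.map_one]
      exact hφ
  · rintro ⟨φ, h1, h2⟩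
    -- Polynomials with coefficients in `(D)` are killed because the target is a module over the
    -- quotient; so `φ` descends.
    have hker : ∀ g : PlaneSeries[X], g.map π = 0 → φ g = 0 := by
      intro g hg
      rw [g.as_sum_range, map_sum]
      refine Finset.sum_eq_zero fun i _ => ?_
      have hi : π (g.coeff i) = 0 := by rw [← coeff_map, hg, coeff_zero]
      rw [← mul_one (g.coeff i), ← smul_eq_mul, ← smul_monomial, map_smul, Algebra.smul_def]
      change π _ * _ = 0
      rw [hi, zero_mul]
    have hsurj : Function.Surjective (mapRingHom π) :=
      map_surjective _ Ideal.Quotient.mk_surjective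
    have hs : ∀ g : (SilhouetteRing F b)[X], ∃ g' : PlaneSeries[X], g'.map π = g := hsurj
    choose s hs using hs
    have hφs : ∀ g g' : PlaneSeries[X], g.map π = g'.map π → φ g = φ g' := fun g g' h => by
      rw [← sub_eq_zero, ← map_sub]
      exact hker _ (by rw [Polynomial.map_sub, h, sub_self])
    let ψ : (SilhouetteRing F b)[X] →ₗ[SilhouetteRing F b] SilhouetteRing F b :=
      { toFun := fun g => φ (s g)
        map_add' := fun g h => by
          rw [← map_add]; exact hφs _ _ (by rw [hs, Polynomial.map_add, hs, hs])
        map_smul' := fun c g => by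
          obtain ⟨c, rfl⟩ := Ideal.Quotient.mk_surjective c
          have : φ (s (π c • g)) = φ (c • s g) := hφs _ _ (by
            rw [hs, smul_eq_C_mul, smul_eq_C_mul, Polynomial.map_mul, map_C, hs])
          exact this.trans (map_smul φ c _) }
    have hψ : ∀ g ∈ I, ψ g = 0 := by
      intro g hg
      rw [hJ] at hg
      obtain ⟨g', hg', rfl⟩ := (Ideal.mem_map_iff_of_surjective _ hsurj).1 hg
      exact (hφs _ g' (hs _)).trans (h1 _ hg')
    refine (mem_range_applyₗ_one I (π a)).2 ⟨ψ, hψ, ?_⟩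
    change φ (s 1) = _
    rw [← h2]
    exact hφs _ _ (by rw [hs, Polynomial.map_one])

end Conductor

end FatSilhouette
end

noncomputable section

namespace FatSilhouette

open Polynomial hiding constantCoeff
open MvPowerSeries (constantCoeff)

/-! ### Discriminants at double points, triple points, pinch points and smooth points. -/

section Dist

theorem IsDist.coeff_mem {A : Type*} [CommRing A] [IsLocalRing A] {W : A[X]} (hW : IsDist W) {i : ℕ}
    (hi : i < W.natDegree) : W.coeff i ∈ IsLocalRing.maximalIdeal A := hW.mem hi

theorem IsDist.constantCoeff_coeff {W : PlaneSeries[X]} (hW : IsDist W) {i : ℕ}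
    (hi : i < W.natDegree) : constantCoeff (W.coeff i) = 0 := mem_maximalIdeal.1 (hW.coeff_mem hi)

theorem associated_resultant_comm {A : Type*} [CommRing A] (f g : A[X]) :
    Associated (resultant f g) (resultant g f) := by
  rw [resultant_comm]
  exact associated_unit_mul_left _ _ (isUnit_one.neg.pow _)

theorem disc_mul_associated_sq {A : Type*} [CommRing A] [IsDomain A] [CharZero A] {W V : A[X]}
    (hW : W.Monic) (hV : V.Monic) :
    Associated (disc (W * V)) (disc W * disc V * resultant W V ^ 2) := by
  rw [disc_mul hW hV, sq]
  exact (Associated.refl _).mul_mul ((Associated.refl _).mul_mul (associated_resultant_comm V W))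

theorem IsDist.eq_X_sub_C {W : PlaneSeries[X]} (hW : IsDist W) (h : W.natDegree = 1) :
    ∃ a, constantCoeff a = 0 ∧ W = X - C a :=
  ⟨-W.coeff 0, by simpa using hW.constantCoeff_coeff (i := 0) (by omega), Monic.eq_linear hW.monic h⟩

/-- Over the origin the two polynomials have the common root zero. -/
theorem constantCoeff_resultant {W V : PlaneSeries[X]} (hW : IsDist W) (hV : IsDist V)
    (h : 1 ≤ W.natDegree) (h' : 1 ≤ V.natDegree) : constantCoeff (resultant W V) = 0 := by
  by_contra H
  have hc := (isUnit_resultant_iff_isCoprime hW.monic).1 (isUnit_iff.2 H)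
  obtain ⟨a, b, hab⟩ := hc
  have := congrArg (fun f => constantCoeff (f.coeff 0)) hab
  simp [mul_coeff_zero, hW.constantCoeff_coeff (i := 0) (by omega),
    hV.constantCoeff_coeff (i := 0) (by omega)] at this

theorem resultant_linear (a b : PlaneSeries) :
    Associated (resultant (X - C a) (X - C b)) (a - b) := by
  have := resultant_X_sub_C_left (n := 1) (r := a) (g := X - C b) (hg := by simp)
  rw [natDegree_X_sub_C, natDegree_X_sub_C, this]
  simp

theorem order_sq (a : PlaneSeries) : (a ^ 2).order = 2 * a.order := by
  rw [sq, MvPowerSeries.order_mul, two_mul]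

theorem isSmooth_sub_of_lin3 {a b : PlaneSeries} (ha : constantCoeff a = 0)
    (hb : constantCoeff b = 0)
    (h : lin3 (X - C a : PlaneSeries[X]) ≠ lin3 (X - C b : PlaneSeries[X])) : IsSmooth (a - b) := by
  refine ⟨by simp [ha, hb], fun h0 => h ?_⟩
  rw [linPart_sub, sub_eq_zero] at h0
  rw [lin3_coe, lin3_coe]
  simp [h0]

/-- Two transversal sheets. -/
theorem disc_double {W : PlaneSeries[X]} (hW : IsDist W) {g : MvPowerSeries (Fin 3) ℂ}
    {h : Fin 2 → MvPowerSeries (Fin 3) ℂ} (hc : IsPartOfCoords h)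
    (hg : Associated g (h 0 * h 1)) (ha : Associated (W : PowerSeries PlaneSeries) (toSeries g)) :
    ∃ w₀ w₁ : PlaneSeries[X], W = w₀ * w₁ ∧ IsDist w₀ ∧ IsDist w₁ ∧ 1 ≤ w₀.natDegree ∧
      1 ≤ w₁.natDegree ∧ LinearIndependent ℂ ![lin3 w₀, lin3 w₁] := by
  obtain ⟨w, h1, h2, h3, h4⟩ := exists_dist_factors hW hc (by
    rw [Fin.prod_univ_two]; exact ha.trans (hg.map toSeries))
  refine ⟨w 0, w 1, by rw [h1, Fin.prod_univ_two], h2 0, h2 1, h3 0, h3 1, ?_⟩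
  convert! h4 using 1
  ext i; fin_cases i <;> rfl

/-- Two transversal sheets that are not tangent to the projection. -/
theorem disc_double_linear {w₀ w₁ : PlaneSeries[X]} (h0 : IsDist w₀) (h1 : IsDist w₁)
    (d0 : w₀.natDegree = 1) (d1 : w₁.natDegree = 1)
    (hl : LinearIndependent ℂ ![lin3 w₀, lin3 w₁]) :
    ∃ s, IsSmooth s ∧ Associated (resultant w₀ w₁) s ∧ Associated (disc (w₀ * w₁)) (s ^ 2) := by
  obtain ⟨a, ha, rfl⟩ := h0.eq_X_sub_C d0
  obtain ⟨b, hb, rfl⟩ := h1.eq_X_sub_C d1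
  refine ⟨a - b, isSmooth_sub_of_lin3 ha hb fun h => ?_, resultant_linear a b, ?_⟩
  · have := hl.injective.ne (show (0 : Fin 2) ≠ 1 by decide)
    exact this h
  · refine (disc_mul_associated_sq (monic_X_sub_C a) (monic_X_sub_C b)).trans ?_
    rw [disc_X_sub_C, disc_X_sub_C, one_mul, one_mul]
    exact (resultant_linear a b).pow_pow

theorem isDist_mul {W V : PlaneSeries[X]} (hW : IsDist W) (hV : IsDist V) : IsDist (W * V) :=
  IsDistinguishedAt.mul hW hV

/-- The discriminant of three sheets is the product of their discriminants, of orders `dᵢ`, and of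
the squares of the pairwise resultants, of orders `rᵢ`. The total order is six only if all three
sheets have unit discriminants. -/
theorem enat_order_triple {d₀ d₁ d₂ r₀ r₁ r₂ : ℕ∞} (h0 : 1 ≤ r₀) (h1 : 1 ≤ r₁) (h2 : 1 ≤ r₂) :
    6 ≤ d₀ + d₁ + 2 * r₀ + d₂ + 2 * (r₁ + r₂) ∧
      (d₀ + d₁ + 2 * r₀ + d₂ + 2 * (r₁ + r₂) = 6 → d₀ = 0 ∧ d₁ = 0 ∧ d₂ = 0) := by
  have h6 : (6 : ℕ∞) = 2 * 1 + 2 * (1 + 1) := by norm_num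
  have key : 6 + (d₀ + d₁ + d₂) ≤ d₀ + d₁ + 2 * r₀ + d₂ + 2 * (r₁ + r₂) :=
    calc 6 + (d₀ + d₁ + d₂) = d₀ + d₁ + 2 * 1 + d₂ + 2 * (1 + 1) := by rw [h6]; ring
      _ ≤ _ := by gcongr
  refine ⟨le_self_add.trans key, fun h => ?_⟩
  rw [h] at key
  have h0 : d₀ + d₁ + d₂ = 0 := by
    by_contra hne
    have h7 : (6 : ℕ∞) + 1 ≤ 6 := le_trans (add_le_add le_rfl (Order.one_le_iff_ne_zero.2 hne)) key
    exact absurd h7 (by norm_num)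
  simpa [add_eq_zero, and_assoc] using h0

theorem IsDist.natDegree_eq_one {W : PlaneSeries[X]} (hW : IsDist W) (h : 1 ≤ W.natDegree)
    (h0 : (disc W).order = 0) : W.natDegree = 1 := by
  have := le_order_of_mem_pow (disc_mem_pow hW)
  rw [h0] at this
  have : W.natDegree - 1 ≤ 0 := by exact_mod_cast this
  omega

/-- For three graphs `z = a`, `z = b`, `z = c`, the determinant of the tangent planes is, up to
sign, the Jacobian of the differences. -/
theorem linearIndependent_triple {a b c : PlaneSeries}
    (h : LinearIndependent ℂ ![lin3 (X - C a : PlaneSeries[X]), lin3 (X - C b : PlaneSeries[X]),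
      lin3 (X - C c : PlaneSeries[X])]) : jac (b - c) (c - a) ≠ 0 := by
  have := (Matrix.linearIndependent_rows_iff_isUnit (K := ℂ) (A := Matrix.of
    ![lin3 (X - C a : PlaneSeries[X]), lin3 (X - C b : PlaneSeries[X]),
      lin3 (X - C c : PlaneSeries[X])])).1 h
  rw [Matrix.isUnit_iff_isUnit_det, isUnit_iff_ne_zero, Matrix.det_fin_three] at this
  intro h0
  apply this
  simp only [Matrix.of_apply, lin3_coe]
  simp [jac] at h0 ⊢
  linear_combination h0

/-- Three independent sheets. -/
theorem disc_triple {W : PlaneSeries[X]} (hW : IsDist W) {g : MvPowerSeries (Fin 3) ℂ}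
    {h : Fin 3 → MvPowerSeries (Fin 3) ℂ} (hc : IsPartOfCoords h)
    (hg : Associated g (h 0 * h 1 * h 2))
    (ha : Associated (W : PowerSeries PlaneSeries) (toSeries g)) :
    3 ≤ W.natDegree ∧ 6 ≤ (disc W).order ∧ ((disc W).order = 6 → ∃ a b c : PlaneSeries,
      W = (X - C a) * (X - C b) * (X - C c) ∧ Associated (disc W) (((b - c) * (c - a) * (a - b)) ^ 2) ∧
      IsPartOfCoords ![b - c, c - a] ∧ IsPartOfCoords ![b - c, a - b] ∧
      IsPartOfCoords ![c - a, a - b]) := by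
  obtain ⟨w, h1, h2, h3, h4⟩ := exists_dist_factors hW hc (by
    rw [Fin.prod_univ_three]; exact ha.trans (hg.map toSeries))
  rw [Fin.prod_univ_three] at h1
  have hm := fun i => (h2 i).monic
  have h01 := isDist_mul (h2 0) (h2 1)
  have hR : resultant (w 0 * w 1) (w 2) = resultant (w 0) (w 2) * resultant (w 1) (w 2) := by
    rw [(hm 0).natDegree_mul (hm 1)]
    exact resultant_mul_left _ _ _ _ le_rfl
  have hD : Associated (disc W) (disc (w 0) * disc (w 1) * resultant (w 0) (w 1) ^ 2 * disc (w 2) *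
      (resultant (w 0) (w 2) * resultant (w 1) (w 2)) ^ 2) := by
    rw [h1, ← hR]
    exact (disc_mul_associated_sq h01.monic (hm 2)).trans
      (((disc_mul_associated_sq (hm 0) (hm 1)).mul_mul (Associated.refl _)).mul_mul
        (Associated.refl _))
  have ho := order_of_associated hD
  simp only [MvPowerSeries.order_mul, order_sq] at ho
  have hr : ∀ i j, 1 ≤ (resultant (w i) (w j)).order := fun i j =>
    one_le_order.2 (constantCoeff_resultant (h2 i) (h2 j) (h3 i) (h3 j))
  obtain ⟨k1, k2⟩ := enat_order_triple (d₀ := (disc (w 0)).order) (d₁ := (disc (w 1)).order)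
    (d₂ := (disc (w 2)).order) (hr 0 1) (hr 0 2) (hr 1 2)
  refine ⟨?_, ho ▸ k1, fun h6 => ?_⟩
  · rw [h1, h01.monic.natDegree_mul (hm 2), (hm 0).natDegree_mul (hm 1)]
    have := h3 0; have := h3 1; have := h3 2
    omega
  · obtain ⟨e0, e1, e2⟩ := k2 (ho ▸ h6)
    obtain ⟨a, ha, wa⟩ := (h2 0).eq_X_sub_C ((h2 0).natDegree_eq_one (h3 0) e0)
    obtain ⟨b, hb, wb⟩ := (h2 1).eq_X_sub_C ((h2 1).natDegree_eq_one (h3 1) e1)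
    obtain ⟨c, hcc, wc⟩ := (h2 2).eq_X_sub_C ((h2 2).natDegree_eq_one (h3 2) e2)
    have hl : LinearIndependent ℂ ![lin3 (X - C a : PlaneSeries[X]), lin3 (X - C b : PlaneSeries[X]),
        lin3 (X - C c : PlaneSeries[X])] := by
      rw [← wa, ← wb, ← wc]
      convert! h4 using 1
      ext i; fin_cases i <;> rfl
    have hj := linearIndependent_triple hl
    refine ⟨a, b, c, by rw [h1, wa, wb, wc], hD.trans ?_, ?_, ?_, ?_⟩
    · rw [wa, wb, wc, disc_X_sub_C, disc_X_sub_C, disc_X_sub_C, one_mul, one_mul, mul_one,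
        ← mul_pow]
      refine Associated.pow_pow ?_
      have e : (b - c) * (c - a) * (a - b) = -1 * ((a - b) * ((a - c) * (b - c))) := by ring
      rw [e]
      refine Associated.trans ?_ (associated_unit_mul_left _ _ isUnit_one.neg).symm
      exact (resultant_linear a b).mul_mul ((resultant_linear a c).mul_mul (resultant_linear b c))
    all_goals
      rw [isPartOfCoords_iff_jac]
      refine ⟨by simp [ha, hb, hcc], by simp [ha, hb, hcc], ?_⟩
      intro h0
      apply hj
      simp only [jac, linPart_sub, Pi.sub_apply] at h0 ⊢
      first | linear_combination h0 | linear_combination -h0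

theorem disc_quadratic_associated {W : PlaneSeries[X]} (hW : W.Monic) (h : W.natDegree = 2) :
    Associated (disc W) (W.coeff 1 ^ 2 - 4 * W.coeff 0) := by
  refine (disc_associated_discr hW (by omega)).trans ?_
  rw [discr_of_degree_eq_two (degree_eq_iff_natDegree_eq_of_pos (by norm_num) |>.2 h)]
  have : W.coeff 2 = 1 := by
    have := hW.leadingCoeff; rwa [leadingCoeff, h] at this
  rw [this, mul_one]

/-- In `c₁² - 4c₀` the square has no linear part. -/
theorem IsDist.order_disc_of_smooth {W : PlaneSeries[X]} (hW : IsDist W) (h : W.natDegree = 2)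
    (h0 : linPart (W.coeff 0) ≠ 0) : (disc W).order = 1 := by
  rw [order_of_associated (disc_quadratic_associated hW.monic h)]
  have c0 := hW.constantCoeff_coeff (i := 0) (by omega)
  have c1 := hW.constantCoeff_coeff (i := 1) (by omega)
  apply order_eq_one
  · simp [c0, c1]
  · have e4 : (4 : PlaneSeries) = MvPowerSeries.C 4 := rfl
    rw [e4, sq, linPart_sub, linPart_mul, linPart_C_mul, c1]
    simpa using h0

theorem IsDist.le_order_disc {W : PlaneSeries[X]} (hW : IsDist W) (h : 2 ≤ W.natDegree)
    (h0 : linPart (W.coeff 0) = 0) : (W.natDegree : ℕ∞) ≤ (disc W).order := by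
  apply le_order_of_mem_pow
  apply disc_mem_pow_of_mem_sq hW h
  rw [mem_maximalIdeal_sq]
  exact ⟨hW.constantCoeff_coeff (by omega), h0⟩

theorem coeff_one_mul' {A : Type*} [CommRing A] (a b : PowerSeries A) :
    PowerSeries.coeff 1 (a * b) = PowerSeries.coeff 0 a * PowerSeries.coeff 1 b +
      PowerSeries.coeff 1 a * PowerSeries.coeff 0 b := by
  rw [PowerSeries.coeff_mul, Finset.Nat.antidiagonal_succ]; simp

theorem coeff_two_mul' {A : Type*} [CommRing A] (a b : PowerSeries A) :
    PowerSeries.coeff 2 (a * b) = PowerSeries.coeff 0 a * PowerSeries.coeff 2 b +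
      PowerSeries.coeff 1 a * PowerSeries.coeff 1 b +
      PowerSeries.coeff 2 a * PowerSeries.coeff 0 b := by
  rw [PowerSeries.coeff_mul, Finset.Nat.sum_antidiagonal_succ, Finset.Nat.sum_antidiagonal_succ]
  simp [add_assoc]

theorem coeff_zero_mul' {A : Type*} [CommRing A] (a b : PowerSeries A) :
    PowerSeries.coeff 0 (a * b) = PowerSeries.coeff 0 a * PowerSeries.coeff 0 b := by simp

/-- The hypotheses are the coefficients of `1`, `z`, `z²` in `(z² + c₁ z + c₀) u = a² b - p²`. They
give `c₀ u₀ ≡ -p₀²` modulo `M³`, `c₁ u₀ ≡ -2 p₀ p₁` modulo `M²` and `u₀ ≡ -p₁²` modulo `M`. Hence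
`u₀² (c₁² - 4 c₀) ≡ 4 p₀² (p₁² + u₀) ≡ 0` modulo `M³`. -/
theorem pinch_aux {A : Type*} [CommRing A] {M : Ideal A} {c₀ c₁ u₀ u₁ u₂ a₀ a₁ a₂ b₀ b₁ b₂ p₀ p₁ p₂ : A}
    (hc0 : c₀ ∈ M) (hc1 : c₁ ∈ M) (ha0 : a₀ ∈ M) (hb0 : b₀ ∈ M) (hp0 : p₀ ∈ M) (hu : IsUnit u₀)
    (H0 : c₀ * u₀ = a₀ * a₀ * b₀ - p₀ * p₀)
    (H1 : c₀ * u₁ + c₁ * u₀ = a₀ * a₀ * b₁ + (a₀ * a₁ + a₁ * a₀) * b₀ - (p₀ * p₁ + p₁ * p₀))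
    (H2 : c₀ * u₂ + c₁ * u₁ + u₀ = a₀ * a₀ * b₂ + (a₀ * a₁ + a₁ * a₀) * b₁ +
      (a₀ * a₂ + a₁ * a₁ + a₂ * a₀) * b₀ - (p₀ * p₂ + p₁ * p₁ + p₂ * p₀)) :
    c₁ ^ 2 - 4 * c₀ ∈ M ^ 3 := by
  have m2 : ∀ {x y}, x ∈ M → y ∈ M → x * y ∈ M ^ 2 := fun hx hy => by
    rw [sq]; exact Ideal.mul_mem_mul hx hy
  have m3 : ∀ {x y}, x ∈ M ^ 2 → y ∈ M → x * y ∈ M ^ 3 := fun hx hy => by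
    rw [pow_succ]; exact Ideal.mul_mem_mul hx hy
  obtain ⟨e, he⟩ := hu.exists_left_inv
  have hc0' : c₀ ∈ M ^ 2 := by
    have : c₀ = e * (a₀ * a₀ * b₀ - p₀ * p₀) := by rw [← H0]; linear_combination (-c₀) * he
    rw [this]
    exact Ideal.mul_mem_left _ _ (Ideal.sub_mem _ (Ideal.mul_mem_right _ _ (m2 ha0 ha0)) (m2 hp0 hp0))
  have ht1 : a₀ * a₀ * b₁ + (a₀ * a₁ + a₁ * a₀) * b₀ - c₀ * u₁ ∈ M ^ 2 := by
    refine Ideal.sub_mem _ (Ideal.add_mem _ (Ideal.mul_mem_right _ _ (m2 ha0 ha0)) ?_)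
      (Ideal.mul_mem_right _ _ hc0')
    exact m2 (Ideal.add_mem _ (Ideal.mul_mem_right _ _ ha0) (Ideal.mul_mem_left _ _ ha0)) hb0
  have ht2 : a₀ * (a₀ * b₂ + a₁ * b₁ + a₁ * b₁) + (a₀ * a₂ + a₁ * a₁ + a₂ * a₀) * b₀ -
      p₀ * (p₂ + p₂) - c₀ * u₂ - c₁ * u₁ ∈ M :=
    Ideal.sub_mem _ (Ideal.sub_mem _ (Ideal.sub_mem _ (Ideal.add_mem _ (Ideal.mul_mem_right _ _ ha0)
      (Ideal.mul_mem_left _ _ hb0)) (Ideal.mul_mem_right _ _ hp0)) (Ideal.mul_mem_right _ _ hc0))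
      (Ideal.mul_mem_right _ _ hc1)
  set t₁ := a₀ * a₀ * b₁ + (a₀ * a₁ + a₁ * a₀) * b₀ - c₀ * u₁ with h1
  set t₂ := a₀ * (a₀ * b₂ + a₁ * b₁ + a₁ * b₁) + (a₀ * a₂ + a₁ * a₁ + a₂ * a₀) * b₀ -
      p₀ * (p₂ + p₂) - c₀ * u₂ - c₁ * u₁ with h2
  have e1 : c₁ * u₀ = t₁ - 2 * p₀ * p₁ := by rw [h1]; linear_combination H1
  have e2 : u₀ = t₂ - p₁ * p₁ := by rw [h2]; linear_combination H2
  have key : c₁ ^ 2 - 4 * c₀ = e ^ 2 * (t₁ * t₁ - 4 * p₁ * (t₁ * p₀) + 4 * ((p₀ * p₀) * t₂) +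
      4 * (u₀ + t₂ - t₂) * -(a₀ * a₀ * b₀)) := by
    have : t₁ * t₁ - 4 * p₁ * (t₁ * p₀) + 4 * ((p₀ * p₀) * t₂) +
      4 * (u₀ + t₂ - t₂) * -(a₀ * a₀ * b₀) = u₀ ^ 2 * (c₁ ^ 2 - 4 * c₀) := by
      linear_combination (-(c₁ * u₀ + (t₁ - 2 * p₀ * p₁))) * e1 - 4 * p₀ * p₀ * e2 + 4 * u₀ * H0
    rw [this]
    linear_combination (-(c₁ ^ 2 - 4 * c₀) * (e * u₀ + 1)) * he
  rw [key]
  refine Ideal.mul_mem_left _ _ (Ideal.add_mem _ (Ideal.add_mem _ (Ideal.sub_mem _ ?_ ?_) ?_) ?_)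
  · exact m3 ht1 (Ideal.pow_le_self two_ne_zero ht1)
  · exact Ideal.mul_mem_left _ _ (m3 ht1 hp0)
  · exact Ideal.mul_mem_left _ _ (m3 (m2 hp0 hp0) ht2)
  · exact Ideal.mul_mem_left _ _ (Ideal.neg_mem_iff _ |>.2 (m3 (m2 ha0 ha0) hb0))

/-- A pinch point with transversal line. -/
theorem order_disc_pinch {W : PlaneSeries[X]} (hW : IsDist W) (hd : W.natDegree = 2)
    {g : MvPowerSeries (Fin 3) ℂ} {h : Fin 3 → MvPowerSeries (Fin 3) ℂ} (hc : IsPartOfCoords h)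
    (hg : Associated g (h 0 ^ 2 * h 1 - h 2 ^ 2))
    (ha : Associated (W : PowerSeries PlaneSeries) (toSeries g)) : 3 ≤ (disc W).order := by
  obtain ⟨u, hu⟩ := ha.trans (hg.map toSeries)
  set M := IsLocalRing.maximalIdeal PlaneSeries
  have hW0 : W.coeff 0 ∈ M := hW.coeff_mem (by omega)
  have hW1 : W.coeff 1 ∈ M := hW.coeff_mem (by omega)
  have hW2 : W.coeff 2 = 1 := by
    have := hW.monic.leadingCoeff; rwa [leadingCoeff, hd] at this
  have hM : ∀ i, PowerSeries.coeff 0 (toSeries (h i)) ∈ M := fun i => by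
    rw [mem_maximalIdeal, PowerSeries.coeff_zero_eq_constantCoeff_apply, constantCoeff_toSeries]
    exact hc.1 i
  rw [map_sub, map_mul, map_pow, map_pow] at hu
  have ha0 := hM 0; have hb0 := hM 1; have hp0 := hM 2
  have H0 := congrArg (PowerSeries.coeff 0) hu
  have H1 := congrArg (PowerSeries.coeff 1) hu
  have H2 := congrArg (PowerSeries.coeff 2) hu
  simp only [sq, map_sub, coeff_one_mul', coeff_two_mul', coeff_zero_mul', Polynomial.coeff_coe, hW2,
    one_mul] at H0 H1 H2
  rw [order_of_associated (disc_quadratic_associated hW.monic hd)]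
  refine le_order_of_mem_pow (n := 3) (pinch_aux hW0 hW1 ha0 hb0 hp0 ?_ H0 H1 H2)
  simpa using PowerSeries.isUnit_iff_constantCoeff.1 u.isUnit

end Dist

end FatSilhouette
end

noncomputable section

namespace FatSilhouette

open Polynomial hiding constantCoeff
open MvPowerSeries (constantCoeff)

/-! ### The local factor of the surface at a point, and the order of its discriminant. -/

section LocalFactor

variable {F : MvPolynomial (Fin 4) ℂ} {d : ℕ} {b : Frame} {z : ℂ} {W V : PlaneSeries[X]}

/-- `W` is the factor of the equation of the surface at the point with coordinate `z` over the
origin. -/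
structure IsLocalFactor (F : MvPolynomial (Fin 4) ℂ) (b : Frame) (z : ℂ)
    (W V : PlaneSeries[X]) : Prop where
  eq : sheet F b = W * V
  dist : IsDistAt z W
  monic : V.Monic
  ne : (fibre V).eval z ≠ 0
  germ : Associated (taylor (MvPowerSeries.C z) W : PowerSeries PlaneSeries)
    (toSeries (spaceGerm F (shift b 0 0 z)))

theorem exists_isLocalFactor (hF : F.IsHomogeneous d) (hp : MvPolynomial.eval (b 3) F ≠ 0) (z : ℂ) :
    ∃ W V, IsLocalFactor F b z W V := by
  obtain ⟨W, V, h, hW, hV, hz, hu⟩ := exists_split (sheet_monic hF hp) z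
  refine ⟨W, V, h, hW, hV, hz, ?_⟩
  have e : (taylor (MvPowerSeries.C z) (sheet F b) : PowerSeries PlaneSeries) =
      PowerSeries.C (MvPowerSeries.C (MvPolynomial.eval (b 3) F)⁻¹) *
        toSeries (spaceGerm F (shift b 0 0 z)) := by
    rw [toSeries_spaceGerm, ← sheet_shift, sheet, shift_three, Polynomial.coe_mul, Polynomial.coe_C]
  rw [h, taylor_mul, Polynomial.coe_mul] at e
  refine (associated_mul_unit_right _ _ hu).trans ?_
  rw [e]
  exact associated_unit_mul_left _ _
    (((isUnit_iff_ne_zero.2 (inv_ne_zero hp)).map MvPowerSeries.C).map PowerSeries.C)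

theorem IsLocalFactor.isDist (H : IsLocalFactor F b z W V) :
    IsDist (taylor (MvPowerSeries.C z) W) := H.dist

theorem IsLocalFactor.natDegree_taylor (_ : IsLocalFactor F b z W V) :
    (taylor (MvPowerSeries.C z) W).natDegree = W.natDegree := Polynomial.natDegree_taylor _ _

theorem IsLocalFactor.disc_taylor (_ : IsLocalFactor F b z W V) :
    disc (taylor (MvPowerSeries.C z) W) = disc W := FatSilhouette.disc_taylor _ _

theorem IsLocalFactor.isCoprime (H : IsLocalFactor F b z W V) : IsCoprime W V :=
  H.dist.isCoprime H.monic H.ne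

theorem IsLocalFactor.two_le_iff (H : IsLocalFactor F b z W V)
    (hp : MvPolynomial.eval (b 3) F ≠ 0) :
    2 ≤ W.natDegree ↔ b 0 + z • b 3 ∈ contour F (b 3) := by
  rw [← isContourRoot_sheet hp, H.eq, H.dist.isContourRoot_iff H.ne]

theorem IsLocalFactor.lineMultiplicity_eq (H : IsLocalFactor F b z W V)
    (hp : MvPolynomial.eval (b 3) F ≠ 0) :
    lineMultiplicity F (b 3) (b 0 + z • b 3) = W.natDegree :=
  lineMultiplicity_eq_natDegree hp H.eq H.dist H.ne

/-- The cofactor `V` carries the contributions of all the other points on the line. The bound on the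
degree of `W` makes the degree of the surface positive. -/
theorem IsLocalFactor.disc_associated (H : IsLocalFactor F b z W V) (hF : F.IsHomogeneous d)
    (hp : MvPolynomial.eval (b 3) F ≠ 0) (h2 : 2 ≤ W.natDegree) :
    Associated (silhouetteEq F b) (disc W * disc V) := by
  have hd : 0 < d := by
    rw [← natDegree_sheet hF hp, H.eq, H.dist.monic.natDegree_mul H.monic]; omega
  refine (silhouetteEq_associated hF hp hd).trans ?_
  rw [H.eq]
  exact disc_mul_associated H.dist.monic H.monic H.isCoprime

/-- No other point of the contour on the line. -/
theorem IsLocalFactor.isUnit_disc_iff (H : IsLocalFactor F b z W V)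
    (hp : MvPolynomial.eval (b 3) F ≠ 0) : IsUnit (disc V) ↔
      ∀ z', z' ≠ z → b 0 + z' • b 3 ∉ contour F (b 3) := by
  rw [FatSilhouette.isUnit_disc_iff H.monic]
  constructor
  · intro h z' hz' hc
    rw [← isContourRoot_sheet hp, H.eq, H.dist.isContourRoot_ne hz'] at hc
    exact h z' hc
  · intro h z' hz'
    have hne : z' ≠ z := by
      rintro rfl; exact H.ne hz'.1
    refine h z' hne ?_
    rwa [← isContourRoot_sheet hp, H.eq, H.dist.isContourRoot_ne hne]

/-- The derivative along the line vanishes already, as its multiplicity is at least two; the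
derivatives in `x` and `y` are carried by the constant term of `W`. -/
theorem IsLocalFactor.mem_singularLocus_iff (H : IsLocalFactor F b z W V) (hF : F.IsHomogeneous d)
    (hp : MvPolynomial.eval (b 3) F ≠ 0) (h2 : 2 ≤ W.natDegree) :
    b 0 + z • b 3 ∈ singularLocus F ↔ linPart ((taylor (MvPowerSeries.C z) W).coeff 0) = 0 := by
  have hc := (H.two_le_iff hp).1 h2
  have hb : shift b 0 0 z 0 = b 0 + z • b 3 := by simp [shift_zero]
  have hn := H.natDegree_taylor
  have h0 : constantCoeff (PowerSeries.constantCoeff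
      (taylor (MvPowerSeries.C z) W : PowerSeries PlaneSeries)) = 0 := by
    have := H.isDist.constantCoeff_coeff (i := 0) (by omega)
    simpa using this
  obtain ⟨u, hu⟩ := H.germ
  have hu0 : constantCoeff (PowerSeries.constantCoeff (u : PowerSeries PlaneSeries)) ≠ 0 :=
    isUnit_iff.1 (PowerSeries.isUnit_iff_constantCoeff.1 u.isUnit)
  rw [FatSilhouette.mem_singularLocus_iff hF z hc.1]
  have e : (((fibrePoly F b).map toPlane).taylor (MvPowerSeries.C z) : PlaneSeries[X]) =
      (fibrePoly F (shift b 0 0 z)).map toPlane := by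
    rw [fibrePoly_shift, map_taylor]; simp
  rw [e, ← toSeries_spaceGerm, ← hu, lin3_mul, h0, zero_smul, zero_add, smul_eq_zero, or_iff_right hu0,
    lin3_coe]
  have h1 := H.isDist.constantCoeff_coeff (i := 1) (by omega)
  rw [h1]
  constructor
  · intro h
    ext i
    have e0 := congrFun h 0
    have e1 := congrFun h 1
    fin_cases i
    · exact e0
    · exact e1
  · intro h
    rw [h]
    ext i; fin_cases i <;> rfl

theorem IsLocalFactor.order_disc_of_smooth (H : IsLocalFactor F b z W V) (hF : F.IsHomogeneous d)
    (hp : MvPolynomial.eval (b 3) F ≠ 0) (h2 : W.natDegree = 2)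
    (hs : b 0 + z • b 3 ∉ singularLocus F) : (disc W).order = 1 := by
  rw [← H.disc_taylor]
  refine H.isDist.order_disc_of_smooth (H.natDegree_taylor.trans h2) ?_
  rwa [Ne, ← H.mem_singularLocus_iff hF hp h2.ge]

theorem IsLocalFactor.one_le_order (H : IsLocalFactor F b z W V) (h2 : 2 ≤ W.natDegree) :
    1 ≤ (disc W).order := by
  refine le_trans ?_ H.dist.disc_mem_pow
  exact_mod_cast (by omega : 1 ≤ W.natDegree - 1)

theorem IsLocalFactor.le_order_of_singular (H : IsLocalFactor F b z W V) (hF : F.IsHomogeneous d)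
    (hp : MvPolynomial.eval (b 3) F ≠ 0) (h2 : 2 ≤ W.natDegree)
    (hs : b 0 + z • b 3 ∈ singularLocus F) : (W.natDegree : ℕ∞) ≤ (disc W).order := by
  have := H.isDist.le_order_disc (H.natDegree_taylor ▸ h2) ((H.mem_singularLocus_iff hF hp h2).1 hs)
  rwa [H.disc_taylor, H.natDegree_taylor] at this

theorem IsLocalFactor.two_le_order (H : IsLocalFactor F b z W V) (hF : F.IsHomogeneous d)
    (hp : MvPolynomial.eval (b 3) F ≠ 0) (h2 : 2 ≤ W.natDegree)
    (hs : b 0 + z • b 3 ∈ singularLocus F) : 2 ≤ (disc W).order :=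
  le_trans (by exact_mod_cast h2) (H.le_order_of_singular hF hp h2 hs)

theorem shift_zero' (b : Frame) (z : ℂ) : shift b 0 0 z 0 = b 0 + z • b 3 := by
  simp [shift_zero]

theorem IsLocalFactor.exists_double (H : IsLocalFactor F b z W V)
    (h : IsDoublePoint F (b 0 + z • b 3)) : ∃ w₀ w₁ : PlaneSeries[X],
      taylor (MvPowerSeries.C z) W = w₀ * w₁ ∧ IsDist w₀ ∧ IsDist w₁ ∧ 1 ≤ w₀.natDegree ∧
      1 ≤ w₁.natDegree ∧ LinearIndependent ℂ ![lin3 w₀, lin3 w₁] := by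
  obtain ⟨h, hc, hg⟩ := h.2 (shift b 0 0 z) (shift_zero' b z)
  exact disc_double H.isDist hc hg H.germ

theorem IsLocalFactor.triple (H : IsLocalFactor F b z W V)
    (h : IsTriplePoint F (b 0 + z • b 3)) : 3 ≤ W.natDegree ∧ 6 ≤ (disc W).order ∧
      ((disc W).order = 6 → ∃ a b c : PlaneSeries, taylor (MvPowerSeries.C z) W =
        (X - C a) * (X - C b) * (X - C c) ∧
        Associated (disc W) (((b - c) * (c - a) * (a - b)) ^ 2) ∧
        IsPartOfCoords ![b - c, c - a] ∧ IsPartOfCoords ![b - c, a - b] ∧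
        IsPartOfCoords ![c - a, a - b]) := by
  obtain ⟨h, hc, hg⟩ := h.2 (shift b 0 0 z) (shift_zero' b z)
  have := disc_triple H.isDist hc hg H.germ
  rwa [H.natDegree_taylor, H.disc_taylor] at this

theorem IsLocalFactor.pinch (H : IsLocalFactor F b z W V)
    (h : IsPinchPoint F (b 0 + z • b 3)) (h2 : W.natDegree = 2) : 3 ≤ (disc W).order := by
  obtain ⟨h, hc, hg⟩ := h.2 (shift b 0 0 z) (shift_zero' b z)
  have := order_disc_pinch H.isDist (H.natDegree_taylor.trans h2) hc hg H.germ
  rwa [H.disc_taylor] at this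

theorem mem_singularLocus_of_germ (hF : F.IsHomogeneous d) (b : Frame)
    (h : constantCoeff (spaceGerm F b) = 0) (h' : linPart (spaceGerm F b) = 0) :
    b 0 ∈ singularLocus F := by
  have h0 : MvPolynomial.eval (b 0) F = 0 := by rw [← (linPart_spaceGerm F b).1, h]
  refine ⟨h0, (grad_eq_zero_iff hF h0 b rfl).2 fun i => ?_⟩
  rw [← (linPart_spaceGerm F b).2, h']; rfl

theorem germ_of_associated {n : ℕ} {g k : MvPowerSeries (Fin n) ℂ} (h : Associated g k)
    (h0 : constantCoeff k = 0) (h1 : linPart k = 0) : constantCoeff g = 0 ∧ linPart g = 0 := by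
  rw [← FatSilhouette.two_le_order] at *
  rw [order_of_associated h]
  exact FatSilhouette.two_le_order.2 ⟨h0, h1⟩

theorem _root_.IsPinchPoint.mem_singularLocus (hF : F.IsHomogeneous d)
    (h : IsPinchPoint F (b 0 + z • b 3)) : b 0 + z • b 3 ∈ singularLocus F := by
  obtain ⟨h, hc, hg⟩ := h.2 (shift b 0 0 z) (shift_zero' b z)
  have := germ_of_associated hg (by simp [hc.1]) (by simp [sq, linPart_mul, hc.1])
  rw [← shift_zero']
  exact mem_singularLocus_of_germ hF _ this.1 this.2

theorem singularLocus_subset_contour (p : Fin 4 → ℂ) : singularLocus F ⊆ contour F p := by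
  rintro q ⟨h0, h1⟩
  refine ⟨h0, ?_⟩
  rw [dirDeriv]
  exact Finset.sum_eq_zero fun j _ => by
    have : MvPolynomial.eval q (MvPolynomial.pderiv j F) = 0 := congrFun h1 j
    rw [this, mul_zero]

theorem contour_subset {p q : Fin 4 → ℂ} (h : q ∈ contour F p) :
    q ∈ singularLocus F ∨ q ∈ properContour F p := by
  by_cases hg : grad F q = 0
  · exact Or.inl ⟨h.1, hg⟩
  · refine Or.inr fun g hg' => ?_
    have := hg' q ⟨h, hg⟩
    exact this

/-- The derivative in the direction `p`, as a polynomial. -/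
def dirPoly (F : MvPolynomial (Fin 4) ℂ) (p : Fin 4 → ℂ) : MvPolynomial (Fin 4) ℂ :=
  ∑ j, MvPolynomial.C (p j) * MvPolynomial.pderiv j F

theorem eval_dirPoly (p q : Fin 4 → ℂ) : MvPolynomial.eval q (dirPoly F p) = dirDeriv F p q := by
  simp [dirPoly, dirDeriv]

/-- The contour is closed: the closure still satisfies the equations `F` and the polar `dirPoly F
p`. -/
theorem properContour_subset_contour (p : Fin 4 → ℂ) : properContour F p ⊆ contour F p := by
  intro q hq
  have h1 := hq F fun q' hq' => by simpa using hq'.1.1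
  have h2 := hq (dirPoly F p) fun q' hq' => by
    have := hq'.1.2
    rw [← eval_dirPoly] at this
    simpa using this
  refine ⟨by simpa using h1, ?_⟩
  rw [← eval_dirPoly]; simpa using h2

theorem point_ne_zero (b : Frame) (z : ℂ) : b 0 + z • b 3 ≠ 0 := by
  rw [← shift_zero']; exact (shift b 0 0 z).ne_zero 0

end LocalFactor

end FatSilhouette
end

noncomputable section

namespace FatSilhouette

open Polynomial hiding constantCoeff
open MvPowerSeries (constantCoeff)

/-! ### Images of closed sets under the projection are closed. -/

section Vanishing

theorem mem_vanishingIdeal {n : ℕ} {A : Set (Fin n → ℂ)} {g : MvPolynomial (Fin n) ℂ} :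
    g ∈ MvPolynomial.vanishingIdeal ℂ A ↔ ∀ q ∈ A, MvPolynomial.eval q g = 0 := by
  rw [MvPolynomial.mem_vanishingIdeal_iff]; simp

/-- The set is closed. -/
def IsZariskiClosed (A : Set (Fin 4 → ℂ)) : Prop :=
  ∀ q, (∀ g ∈ MvPolynomial.vanishingIdeal ℂ A, MvPolynomial.eval q g = 0) → q ∈ A

theorem isZariskiClosed_properContour (F : MvPolynomial (Fin 4) ℂ) (p : Fin 4 → ℂ) :
    IsZariskiClosed (properContour F p) := by
  intro q hq g hg
  rw [MvPolynomial.aeval_eq_eval]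
  refine hq g (mem_vanishingIdeal.2 fun q' hq' => ?_)
  simpa using hq' g hg

theorem isZariskiClosed_singularLocus (F : MvPolynomial (Fin 4) ℂ) :
    IsZariskiClosed (singularLocus F) := by
  intro q hq
  refine ⟨hq F (mem_vanishingIdeal.2 fun q' hq' => hq'.1), ?_⟩
  ext j
  exact hq (MvPolynomial.pderiv j F) (mem_vanishingIdeal.2 fun q' hq' => congrFun hq'.2 j)

theorem eval_fibreHom (G : MvPolynomial (Fin 4) ℂ) (b : Frame) (t : Fin 2 → ℂ) (z : ℂ) :
    eval₂ (MvPolynomial.eval t) z (fibreHom b G) =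
      MvPolynomial.eval (b 0 + t 0 • b 1 + t 1 • b 2 + z • b 3) G := by
  rw [← eval_map, ← fibrePoly_eq, map_fibrePoly, eval_linePoly]

/-- Nakayama's lemma: a monic element makes `R[X]/J` finite over `R`, and `j` shows that `n` times
this module is everything; so an element congruent to `1` kills it. -/
theorem exists_sub_one_mem_of_monic {R : Type*} [CommRing R] {n : Ideal R} {J : Ideal R[X]} {f j : R[X]}
    (hf : f.Monic) (hfJ : f ∈ J) (hj : j ∈ J) (hk : 1 - j ∈ n.map C) :
    ∃ r, r - 1 ∈ n ∧ C r ∈ J := by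
  have hfin : Module.Finite R (R[X] ⧸ J) := by
    have := hf.finite_quotient
    have hle : Ideal.span {f} ≤ J := by rwa [Ideal.span_singleton_le_iff_mem]
    exact Module.Finite.of_surjective (Ideal.Quotient.factorₐ R hle).toLinearMap
      (Ideal.Quotient.factor_surjective hle)
  obtain ⟨r, hr, hr0⟩ := Submodule.exists_sub_one_mem_and_smul_eq_zero_of_fg_of_le_smul
    n (⊤ : Submodule R (R[X] ⧸ J)) hfin.fg_top (by
      rw [Ideal.smul_top_eq_map]
      have : n.map (algebraMap R (R[X] ⧸ J)) = ⊤ := by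
        rw [Ideal.eq_top_iff_one]
        have e := Ideal.mem_map_of_mem (Ideal.Quotient.mk J) hk
        rw [Ideal.map_map, map_sub, map_one, Ideal.Quotient.eq_zero_iff_mem.2 hj, sub_zero] at e
        exact e
      rw [this]; exact le_rfl)
  refine ⟨r, hr, ?_⟩
  have h1 : r • (Ideal.Quotient.mk J 1) = 0 := hr0 _ trivial
  have h2 : Ideal.Quotient.mk J (r • 1) = 0 := h1
  rw [Ideal.Quotient.eq_zero_iff_mem, smul_eq_C_mul, mul_one] at h2
  exact h2

/-- The projection of a closed subset of the surface is closed. -/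
theorem localIdeal_eq_top {F : MvPolynomial (Fin 4) ℂ} {d : ℕ} (hF : F.IsHomogeneous d)
    {b : Frame} (hp : MvPolynomial.eval (b 3) F ≠ 0) {A : Set (Fin 4 → ℂ)} (hA : IsZariskiClosed A)
    (hAF : ∀ q ∈ A, MvPolynomial.eval q F = 0) (h : ¬ HasPointOver A b) : localIdeal A b = ⊤ := by
  set 𝔍 := MvPolynomial.vanishingIdeal ℂ A
  set J := 𝔍.map (fibreHom b) with hJ
  set ε := mapRingHom (MvPolynomial.eval (0 : Fin 2 → ℂ)) with hε
  have hsurj : Function.Surjective ε := Polynomial.map_surjective _ fun c => ⟨MvPolynomial.C c, by simp⟩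
  -- On the line over the origin the equations of `A` generate a principal ideal; a root of its
  -- generator would be a point of `A` over the origin.
  have htop : J.map ε = ⊤ := by
    by_contra hne
    obtain ⟨g, hg⟩ := IsPrincipalIdealRing.principal (J.map ε)
    have hz : ∃ z, g.eval z = 0 := by
      by_cases hd : g.degree = 0
      · exfalso
        apply hne
        rw [hg]
        exact Ideal.span_singleton_eq_top.2 (isUnit_iff_degree_eq_zero.2 hd)
      · exact IsAlgClosed.exists_root g hd
    obtain ⟨z, hz⟩ := hz
    refine h ⟨z, hA _ fun G hG => ?_⟩
    have h1 : ε (fibreHom b G) ∈ J.map ε := Ideal.mem_map_of_mem _ (Ideal.mem_map_of_mem _ hG)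
    rw [hg] at h1
    obtain ⟨c, hc⟩ := Ideal.mem_span_singleton'.1 h1
    have h2 := congrArg (eval z) hc
    rw [eval_mul, hz, mul_zero] at h2
    have := eval_fibreHom G b 0 z
    rw [← eval_map] at this
    simp only [hε, coe_mapRingHom] at h2
    rw [← h2] at this
    simpa using this.symm
  have h1 : ∃ j ∈ J, 1 - j ∈ (RingHom.ker (MvPolynomial.eval (0 : Fin 2 → ℂ))).map C := by
    obtain ⟨j, hj, h1⟩ := (Ideal.mem_map_iff_of_surjective _ hsurj).1
      (htop ▸ Submodule.mem_top : (1 : ℂ[X]) ∈ J.map ε)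
    refine ⟨j, hj, ?_⟩
    rw [← Polynomial.ker_mapRingHom, RingHom.mem_ker, map_sub, map_one, h1, sub_self]
  obtain ⟨j, hj, hk⟩ := h1
  set f := C (MvPolynomial.C (MvPolynomial.eval (b 3) F)⁻¹) * fibrePoly F b with hf
  have hfm : f.Monic := by
    rw [Monic, hf, leadingCoeff_mul, leadingCoeff_C, leadingCoeff_fibrePoly hF hp, ← map_mul,
      inv_mul_cancel₀ hp, map_one]
  obtain ⟨r, hr, hrJ⟩ := exists_sub_one_mem_of_monic hfm
    (Ideal.mul_mem_left _ _ (Ideal.mem_map_of_mem _ (mem_vanishingIdeal.2 hAF))) hj hk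
  -- The element `r` is free of `z` and lies in the ideal generated by the equations of `A`, so it
  -- vanishes on the projection; it does not vanish at the origin.
  have hrv : r ∈ MvPolynomial.vanishingIdeal ℂ (planeImage A b) := by
    rw [mem_vanishingIdeal]
    rintro t ⟨z, hz⟩
    have hle : J ≤ RingHom.ker (eval₂RingHom (MvPolynomial.eval t) z) := by
      rw [hJ, Ideal.map_le_iff_le_comap]
      intro G hG
      rw [Ideal.mem_comap, RingHom.mem_ker, coe_eval₂RingHom, eval_fibreHom]
      exact mem_vanishingIdeal.1 hG _ hz
    have := hle hrJ
    rwa [RingHom.mem_ker, coe_eval₂RingHom, eval₂_C] at this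
  refine Ideal.eq_top_of_isUnit_mem _ (Ideal.mem_map_of_mem toPlane hrv) ?_
  rw [isUnit_iff]
  have e : constantCoeff (toPlane r) = MvPolynomial.eval 0 r :=
    RingHom.congr_fun constantCoeff_comp_toPlane r
  rw [RingHom.mem_ker, map_sub, map_one, sub_eq_zero] at hr
  rw [e, hr]; exact one_ne_zero

end Vanishing

/-! ### Moving the base point in the plane. -/

section Translate

/-- Translation of the plane. -/
def translate (t : Fin 2 → ℂ) : MvPolynomial (Fin 2) ℂ →ₐ[ℂ] MvPolynomial (Fin 2) ℂ :=
  MvPolynomial.aeval fun i => MvPolynomial.X i + MvPolynomial.C (t i)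

theorem eval_translate (s t : Fin 2 → ℂ) (g : MvPolynomial (Fin 2) ℂ) :
    MvPolynomial.eval s (translate t g) = MvPolynomial.eval (s + t) g := by
  have : (MvPolynomial.eval s).comp (translate t).toRingHom = MvPolynomial.eval (s + t) := by
    apply MvPolynomial.ringHom_ext
    · intro a; simp
    · intro i; simp [translate]
  exact RingHom.congr_fun this g

theorem translate_neg (t : Fin 2 → ℂ) (g : MvPolynomial (Fin 2) ℂ) :
    translate t (translate (-t) g) = g := by
  have : (translate t).comp (translate (-t)) = AlgHom.id ℂ _ := by
    apply MvPolynomial.algHom_ext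
    intro i; simp [translate]
  exact AlgHom.congr_fun this g

theorem translate_injective (t : Fin 2 → ℂ) : Function.Injective (translate t) := by
  apply Function.LeftInverse.injective (g := translate (-t))
  intro g
  have := translate_neg (-t) g
  rwa [neg_neg] at this

variable (F : MvPolynomial (Fin 4) ℂ) (b : Frame) (t : Fin 2 → ℂ)

/-- The frame with the origin moved to a point of the plane. -/
abbrev move : Frame := shift b (t 0) (t 1) 0

theorem move_zero : move b t 0 = b 0 + t 0 • b 1 + t 1 • b 2 := by simp [shift_zero]

theorem fibrePoly_move : fibrePoly F (move b t) = (fibrePoly F b).map (translate t).toRingHom := by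
  have : fibreHom (move b t) = (mapRingHom (translate t).toRingHom).comp (fibreHom b) := by
    apply MvPolynomial.ringHom_ext
    · intro a
      simp [fibreHom_C]
    · intro j
      simp [fibreHom_X, shift_zero, translate]
      ring
  exact RingHom.congr_fun this F

theorem disc_fibrePoly_move : disc (fibrePoly F (move b t)) = translate t (disc (fibrePoly F b)) := by
  rw [fibrePoly_move, disc_map _ (natDegree_map_eq_of_injective (translate_injective t) _)]
  rfl

theorem mem_planeImage_move (A : Set (Fin 4 → ℂ)) (s : Fin 2 → ℂ) :
    s ∈ planeImage A (move b t) ↔ s + t ∈ planeImage A b := by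
  simp only [planeImage, Set.mem_ofPred_eq, move_zero, shift_one, shift_two, shift_three, Pi.add_apply]
  refine exists_congr fun z => ?_
  have : b 0 + t 0 • b 1 + t 1 • b 2 + s 0 • b 1 + s 1 • b 2 + z • b 3 =
      b 0 + (s 0 + t 0) • b 1 + (s 1 + t 1) • b 2 + z • b 3 := by module
  rw [this]

theorem mem_vanishingIdeal_move (A : Set (Fin 4 → ℂ)) (g : MvPolynomial (Fin 2) ℂ) :
    translate t g ∈ MvPolynomial.vanishingIdeal ℂ (planeImage A (move b t)) ↔
      g ∈ MvPolynomial.vanishingIdeal ℂ (planeImage A b) := by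
  rw [mem_vanishingIdeal, mem_vanishingIdeal]
  simp only [eval_translate, mem_planeImage_move]
  constructor
  · intro h q hq
    have := h (q - t) (by rwa [sub_add_cancel])
    rwa [sub_add_cancel] at this
  · intro h s hs
    exact h _ hs

variable {b t}

theorem localIdeal_move_le {A : Set (Fin 4 → ℂ)} {π : MvPolynomial (Fin 2) ℂ}
    (h : MvPolynomial.vanishingIdeal ℂ (planeImage A b) ≤ Ideal.span {π}) :
    localIdeal A (move b t) ≤ Ideal.span {toPlane (translate t π)} := by
  rw [localIdeal, Ideal.map_le_iff_le_comap]
  intro g hg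
  rw [← translate_neg t g, mem_vanishingIdeal_move] at hg
  obtain ⟨k, hk⟩ := Ideal.mem_span_singleton.1 (h hg)
  rw [Ideal.mem_comap, Ideal.mem_span_singleton]
  refine ⟨toPlane (translate t k), ?_⟩
  rw [← translate_neg t g, hk, map_mul]
  exact map_mul toPlane _ _

theorem mem_localIdeal_move {A : Set (Fin 4 → ℂ)} {g : MvPolynomial (Fin 2) ℂ}
    (h : g ∈ MvPolynomial.vanishingIdeal ℂ (planeImage A b)) :
    toPlane (translate t g) ∈ localIdeal A (move b t) :=
  Ideal.mem_map_of_mem _ ((mem_vanishingIdeal_move b t A g).2 h)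

theorem constantCoeff_translate (g : MvPolynomial (Fin 2) ℂ) :
    constantCoeff (toPlane (translate t g)) = MvPolynomial.eval t g := by
  have e : constantCoeff (toPlane (translate t g)) = MvPolynomial.eval 0 (translate t g) :=
    RingHom.congr_fun constantCoeff_comp_toPlane _
  rw [e, eval_translate, zero_add]

theorem localIdeal_move_eq_top {A : Set (Fin 4 → ℂ)} {g : MvPolynomial (Fin 2) ℂ}
    (h : g ∈ MvPolynomial.vanishingIdeal ℂ (planeImage A b)) (hg : MvPolynomial.eval t g ≠ 0) :
    localIdeal A (move b t) = ⊤ := by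
  refine Ideal.eq_top_of_isUnit_mem _ (mem_localIdeal_move h) ?_
  rw [isUnit_iff, constantCoeff_translate]
  exact hg

theorem linPart_toPlane_translate (g : MvPolynomial (Fin 2) ℂ) (i : Fin 2) :
    linPart (toPlane (translate t g)) i = MvPolynomial.eval t (MvPolynomial.pderiv i g) := by
  induction g using MvPolynomial.induction_on with
  | C a => simp [translate]
  | add F G hF hG => simp only [map_add, linPart_add, Pi.add_apply, hF, hG]
  | mul_X F j hF =>
    rw [map_mul, map_mul, linPart_mul, Pi.add_apply, Pi.smul_apply, Pi.smul_apply, hF,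
      constantCoeff_translate, constantCoeff_translate, Derivation.leibniz]
    have : linPart (toPlane (translate t (MvPolynomial.X j))) i = if i = j then 1 else 0 := by
      simp [translate, linPart_X]
    rw [this]
    rcases eq_or_ne i j with rfl | hij
    · simp
    · simp [MvPolynomial.pderiv_X, hij, hij.symm]

end Translate

/-! ### General points of an irreducible plane curve. -/

section Generic

/-- A polynomial that vanishes at almost all points of an irreducible plane curve. -/
theorem dvd_of_forall_notMem {π g : MvPolynomial (Fin 2) ℂ} (hπ : Prime π)
    {S : Set (Fin 2 → ℂ)} (hS : S.Finite)
    (h : ∀ t, MvPolynomial.eval t π = 0 → t ∉ S → MvPolynomial.eval t g = 0) : π ∣ g := by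
  have hP : (Ideal.span {π}).IsPrime := (Ideal.span_singleton_prime hπ.ne_zero).2 hπ
  have key : ∀ k : MvPolynomial (Fin 2) ℂ, (∀ t, MvPolynomial.eval t π = 0 →
      MvPolynomial.eval t k = 0) → π ∣ k := by
    intro k hk
    rw [← Ideal.mem_span_singleton, ← hP.radical,
      ← MvPolynomial.vanishingIdeal_zeroLocus_eq_radical (K := ℂ), mem_vanishingIdeal]
    intro t ht
    exact hk t (by simpa using ht π (Ideal.mem_span_singleton_self π))
  by_contra hg
  -- Multiplying `g` by linear factors that vanish on the exceptional points gives a polynomial that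
  -- vanishes on the whole curve. If `π` does not divide `g`, it divides such a factor, for each of
  -- the two coordinates.
  have key2 : ∀ i : Fin 2, ∃ a : ℂ, π ∣ MvPolynomial.X i - MvPolynomial.C a := by
    intro i
    have h1 : π ∣ g * ∏ s ∈ hS.toFinset, (MvPolynomial.X i - MvPolynomial.C (s i)) := by
      apply key
      intro t ht
      by_cases hts : t ∈ S
      · rw [map_mul, map_prod, Finset.prod_eq_zero (hS.mem_toFinset.2 hts) (by simp), mul_zero]
      · rw [map_mul, h t ht hts, zero_mul]
    rcases hπ.dvd_or_dvd h1 with h1 | h1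
    · exact absurd h1 hg
    · obtain ⟨s, -, hs⟩ := hπ.exists_mem_finset_dvd h1
      exact ⟨s i, hs⟩
  -- By degree the cofactor is constant. Then `π = 0` would be both a vertical and a horizontal
  -- line.
  have key3 : ∀ i : Fin 2, ∃ a e : ℂ, e ≠ 0 ∧ MvPolynomial.X i - MvPolynomial.C a = π * MvPolynomial.C e := by
    intro i
    obtain ⟨a, k, hk⟩ := key2 i
    have hne : (MvPolynomial.X i - MvPolynomial.C a : MvPolynomial (Fin 2) ℂ) ≠ 0 := by
      intro h0
      have := congrArg (MvPolynomial.eval fun _ => a + 1) h0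
      simp at this
    have hk0 : k ≠ 0 := by rintro rfl; exact hne (by rw [hk, mul_zero])
    have hdeg : (MvPolynomial.X i - MvPolynomial.C a : MvPolynomial (Fin 2) ℂ).totalDegree ≤ 1 :=
      (MvPolynomial.totalDegree_sub _ _).trans (by simp)
    rw [hk, MvPolynomial.totalDegree_mul_of_isDomain hπ.ne_zero hk0] at hdeg
    have hπ1 : π.totalDegree ≠ 0 := by
      intro h0
      rw [MvPolynomial.totalDegree_eq_zero_iff_eq_C] at h0
      apply hπ.not_isUnit
      rw [h0]
      refine IsUnit.map _ (isUnit_iff_ne_zero.2 fun hc => hπ.ne_zero ?_)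
      rw [h0, hc, map_zero]
    have hk1 : k = MvPolynomial.C (k.coeff 0) :=
      MvPolynomial.totalDegree_eq_zero_iff_eq_C.1 (by omega)
    exact ⟨a, k.coeff 0, fun hc => hk0 (by rw [hk1, hc, map_zero]), hk1 ▸ hk⟩
  obtain ⟨a, e, he, h0⟩ := key3 0
  obtain ⟨c, l, hl, h1⟩ := key3 1
  have e0 := congrArg (MvPolynomial.eval ![a, c + 1]) h0
  have e1 := congrArg (MvPolynomial.eval ![a, c + 1]) h1
  simp at e0 e1
  rcases e0 with e0 | e0
  · rw [e0] at e1; simp at e1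
  · exact he e0

theorem exists_generic {π g : MvPolynomial (Fin 2) ℂ} (hπ : Prime π) (hg : ¬ π ∣ g)
    {S : Set (Fin 2 → ℂ)} (hS : S.Finite) :
    ∃ t, MvPolynomial.eval t π = 0 ∧ t ∉ S ∧ MvPolynomial.eval t g ≠ 0 := by
  by_contra H
  push Not at H
  exact hg (dvd_of_forall_notMem hπ hS H)

/-- The points of the plane over which a point of a finite set lies. -/
theorem finite_image_projectivization (b : Frame)
    {T : Set (Projectivization ℂ (Fin 4 → ℂ))} (hT : T.Finite) :
    {t : Fin 2 → ℂ | ∃ z : ℂ, ∃ P ∈ T, ∃ a : ℂ, P.rep = a • (move b t 0 + z • b 3)}.Finite := by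
  let φ : Projectivization ℂ (Fin 4 → ℂ) → Fin 2 → ℂ := fun P =>
    ![b.repr P.rep 1 / b.repr P.rep 0, b.repr P.rep 2 / b.repr P.rep 0]
  refine (hT.image φ).subset ?_
  rintro t ⟨z, P, hP, a, ha⟩
  refine ⟨P, hP, ?_⟩
  have ha0 : a ≠ 0 := by
    rintro rfl
    rw [zero_smul] at ha
    exact P.rep_nonzero ha
  ext i
  simp only [φ, ha, move_zero]
  fin_cases i <;> simp [ha0]

end Generic

end FatSilhouette
end

noncomputable section

namespace FatSilhouette

open Polynomial hiding constantCoeff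
open MvPowerSeries (constantCoeff)

/-! ### Prime polynomials are separable in characteristic zero. -/

section Pderiv

theorem totalDegree_pderiv_lt {σ : Type*} {f : MvPolynomial σ ℂ} {i : σ}
    (h : MvPolynomial.pderiv i f ≠ 0) : (MvPolynomial.pderiv i f).totalDegree < f.totalDegree := by
  have key : ∀ m ∈ (MvPolynomial.pderiv i f).support, (m.sum fun _ e => e) < f.totalDegree := by
    intro m hm
    rw [MvPolynomial.mem_support_iff, MvPolynomial.coeff_pderiv] at hm
    have := MvPolynomial.le_totalDegree (MvPolynomial.mem_support_iff.2 (left_ne_zero_of_mul hm))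
    rw [Finsupp.sum_add_index' (fun _ => rfl) (fun _ _ _ => rfl),
      Finsupp.sum_single_index rfl] at this
    omega
  obtain ⟨m, hm⟩ := MvPolynomial.support_nonempty.2 h
  exact (Finset.sup_lt_iff (lt_of_le_of_lt bot_le (key m hm))).2 key

/-- By degree, divisibility would force every partial derivative to vanish, so that `π` would be
constant. -/
theorem exists_not_dvd_pderiv {σ : Type*} {π : MvPolynomial σ ℂ} (hπ : Prime π) :
    ∃ i, ¬ π ∣ MvPolynomial.pderiv i π := by
  by_contra! hd
  have h0 : ∀ i, MvPolynomial.pderiv i π = 0 := fun i => by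
    by_contra hn
    exact absurd (MvPolynomial.totalDegree_le_of_dvd_of_isDomain (hd i) hn)
      (not_le.2 (totalDegree_pderiv_lt hn))
  classical
  have hC : π = MvPolynomial.C (MvPolynomial.coeff 0 π) := by
    ext m
    rw [MvPolynomial.coeff_C]
    split_ifs with hm
    · rw [hm]
    obtain ⟨i, hi⟩ := Finsupp.ne_iff.1 (Ne.symm hm)
    have := congrArg (MvPolynomial.coeff (m - Finsupp.single i 1)) (h0 i)
    rw [MvPolynomial.coeff_pderiv, tsub_add_cancel_of_le
      (Finsupp.single_le_iff.2 (Nat.one_le_iff_ne_zero.2 hi)), MvPolynomial.coeff_zero] at this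
    exact (mul_eq_zero.1 this).resolve_right (by norm_cast)
  apply hπ.not_isUnit
  rw [hC]
  refine (isUnit_iff_ne_zero.2 fun h => hπ.ne_zero ?_).map _
  rw [hC, h, map_zero]

end Pderiv

/-! ### Homogeneity: contour, singular locus and multiplicities on projective points. -/

section Cone

variable {F : MvPolynomial (Fin 4) ℂ} {d : ℕ}

theorem eval_smul_of_isHomogeneous {n : ℕ} {G : MvPolynomial (Fin n) ℂ} (hG : G.IsHomogeneous d)
    (a : ℂ) (q : Fin n → ℂ) : MvPolynomial.eval (a • q) G = a ^ d * MvPolynomial.eval q G := by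
  rw [MvPolynomial.eval_eq, MvPolynomial.eval_eq, Finset.mul_sum]
  refine Finset.sum_congr rfl fun m hm => ?_
  have := hG.degree_eq_sum_deg_support hm
  simp only [Pi.smul_apply, smul_eq_mul, mul_pow, Finset.prod_mul_distrib]
  rw [Finset.prod_subset (Finset.subset_univ m.support) (f := fun i => a ^ m i)
    (fun i _ hi => by simp [Finsupp.notMem_support_iff.1 hi]), Finset.prod_pow_eq_pow_sum,
    show ∑ i, m i = d from (this.trans (Finset.sum_subset (Finset.subset_univ _)
      fun i _ hi => Finsupp.notMem_support_iff.1 hi)).symm]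
  ring

theorem smul_mem_singularLocus (hF : F.IsHomogeneous d) (a : ℂ) {q : Fin 4 → ℂ}
    (h : q ∈ singularLocus F) : a • q ∈ singularLocus F := by
  refine ⟨?_, funext fun j => ?_⟩
  · rw [eval_smul_of_isHomogeneous hF, h.1, mul_zero]
  · have := congrFun h.2 j
    simp only [grad, Pi.zero_apply] at this ⊢
    rw [eval_smul_of_isHomogeneous hF.pderiv, this, mul_zero]

theorem smul_mem_contour (hF : F.IsHomogeneous d) (p : Fin 4 → ℂ) (a : ℂ) {q : Fin 4 → ℂ}
    (h : q ∈ contour F p) : a • q ∈ contour F p := by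
  refine ⟨?_, ?_⟩
  · rw [eval_smul_of_isHomogeneous hF, h.1, mul_zero]
  · have : dirDeriv F p (a • q) = a ^ (d - 1) * dirDeriv F p q := by
      rw [dirDeriv, dirDeriv, Finset.mul_sum]
      exact Finset.sum_congr rfl fun j _ => by
        rw [eval_smul_of_isHomogeneous hF.pderiv]; ring
    rw [this, h.2, mul_zero]

/-- Rescaling the point multiplies the restriction to the line by a constant and rescales its
parameter. This transfers hypotheses on chosen representatives of projective points. -/
theorem lineMultiplicity_smul (hF : F.IsHomogeneous d) (p q : Fin 4 → ℂ) {a : ℂ} (ha : a ≠ 0) :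
    lineMultiplicity F p (a • q) = lineMultiplicity F p q := by
  have e : linePoly F p (a • q) =
      C (a ^ d) * (linePoly F p q).comp (C a⁻¹ * X + C 0) := by
    refine Polynomial.funext fun z => ?_
    rw [eval_mul, eval_comp, eval_linePoly, eval_linePoly, eval_C,
      ← eval_smul_of_isHomogeneous hF]
    simp [smul_smul, ha]
  have hu : IsUnit a⁻¹ := isUnit_iff_ne_zero.2 (inv_ne_zero ha)
  rw [lineMultiplicity_eq, lineMultiplicity_eq, e]
  by_cases h0 : linePoly F p q = 0
  · simp [h0]
  rw [rootMultiplicity_mul, rootMultiplicity_C, zero_add, rootMultiplicity_comp_C_mul_X_add_C _ _ _ _ hu]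
  · simp
  · refine mul_ne_zero (by simpa using pow_ne_zero d ha) fun h => h0 ?_
    have : ((linePoly F p q).comp (C a⁻¹ * X + C 0)).comp (C a * X) = 0 := by rw [h, zero_comp]
    rw [comp_assoc] at this
    simpa [← mul_assoc, ← map_mul, ha] using this

end Cone

/-! ### Change of frame over a fixed point of the plane. -/

section Frames

variable {F : MvPolynomial (Fin 4) ℂ} {d : ℕ} {b : Frame}

theorem move_three (b : Frame) (t : Fin 2 → ℂ) : move b t 3 = b 3 :=
  shift_of_ne _ _ _ _ (by decide)

theorem localIdeal_shift (A : Set (Fin 4 → ℂ)) (b : Frame) (z : ℂ) :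
    localIdeal A (shift b 0 0 z) = localIdeal A b := by
  have : planeImage A (shift b 0 0 z) = planeImage A b := by
    ext t
    have e : ∀ z', shift b 0 0 z 0 + t 0 • shift b 0 0 z 1 + t 1 • shift b 0 0 z 2 +
        z' • shift b 0 0 z 3 = b 0 + t 0 • b 1 + t 1 • b 2 + (z + z') • b 3 := fun z' => by
      rw [shift_zero', shift_of_ne _ _ _ _ (by decide), shift_of_ne _ _ _ _ (by decide),
        shift_of_ne _ _ _ _ (by decide), add_smul]
      abel
    constructor
    · rintro ⟨z', h⟩
      exact ⟨z + z', by rwa [← e]⟩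
    · rintro ⟨z', h⟩
      exact ⟨z' - z, by rw [e]; simpa using h⟩
  rw [localIdeal, this, localIdeal]

theorem point_eq_of_smul {b : Frame} {z z' a : ℂ} (h : b 0 + z • b 3 = a • (b 0 + z' • b 3)) :
    z = z' := by
  have h0 := congrArg (fun v => b.repr v 0) h
  have h3 := congrArg (fun v => b.repr v 3) h
  simp at h0 h3
  rw [h3, ← h0, one_mul]

end Frames

/-! ### The discriminant at varying points of the plane. -/

section Glob

variable {F : MvPolynomial (Fin 4) ℂ} {d : ℕ} {b : Frame}

theorem mem_planeImage_iff {A : Set (Fin 4 → ℂ)} {t : Fin 2 → ℂ} :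
    t ∈ planeImage A b ↔ HasPointOver A (move b t) := by
  simp [planeImage, HasPointOver, move_zero]

theorem silhouetteEq_associated_toPlane (hF : F.IsHomogeneous d)
    (hp : MvPolynomial.eval (b 3) F ≠ 0) (hd : 0 < d) :
    Associated (silhouetteEq F b) (toPlane (disc (fibrePoly F b))) := by
  refine (silhouetteEq_associated hF hp hd).trans ?_
  rw [← disc_map toPlane (natDegree_map_eq_of_injective toPlane_injective _)]
  exact disc_C_mul ((isUnit_iff_ne_zero.2 (inv_ne_zero hp)).map _) _

theorem silhouetteEq_move (hF : F.IsHomogeneous d)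
    (hp : MvPolynomial.eval (b 3) F ≠ 0) (hd : 0 < d) (t : Fin 2 → ℂ) :
    Associated (silhouetteEq F (move b t)) (toPlane (translate t (disc (fibrePoly F b)))) := by
  rw [← disc_fibrePoly_move]
  exact silhouetteEq_associated_toPlane hF (by rwa [move_three]) hd

theorem isUnit_silhouetteEq_iff (hF : F.IsHomogeneous d)
    (hp : MvPolynomial.eval (b 3) F ≠ 0) (hd : 0 < d) :
    IsUnit (silhouetteEq F b) ↔ ¬ HasPointOver (contour F (b 3)) b := by
  rw [(silhouetteEq_associated hF hp hd).isUnit_iff, FatSilhouette.isUnit_disc_iff (sheet_monic hF hp),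
    HasPointOver, not_exists]
  exact forall_congr' fun z => by rw [isContourRoot_sheet hp]

theorem eval_disc_eq_zero_iff (hF : F.IsHomogeneous d)
    (hp : MvPolynomial.eval (b 3) F ≠ 0) (hd : 0 < d) (t : Fin 2 → ℂ) :
    MvPolynomial.eval t (disc (fibrePoly F b)) = 0 ↔
      HasPointOver (contour F (move b t 3)) (move b t) := by
  have h := isUnit_silhouetteEq_iff (b := move b t) hF (by rwa [move_three]) hd
  rw [(silhouetteEq_move hF hp hd t).isUnit_iff, FatSilhouette.isUnit_iff,
    constantCoeff_translate] at h
  exact not_iff_not.1 h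

/-- Off a finite set, there is at most one point of the contour over a point of the plane. -/
theorem exists_finite_injective (hF : F.IsHomogeneous d) (hg : IsGoodProjection F (b 3)) :
    ∃ S : Set (Fin 2 → ℂ), S.Finite ∧ ∀ t ∉ S, ∀ z z' : ℂ,
      move b t 0 + z • move b t 3 ∈ contour F (move b t 3) →
      move b t 0 + z' • move b t 3 ∈ contour F (move b t 3) → z = z' := by
  obtain ⟨T, hT, H⟩ := hg.injective
  refine ⟨_, finite_image_projectivization b hT, fun t ht z z' hz hz' => ?_⟩
  have h3 := move_three b t
  rw [h3] at hz hz'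
  simp only [Set.mem_ofPred_eq, not_exists, not_and] at ht
  obtain ⟨a, ha⟩ := Projectivization.exists_smul_eq_mk_rep ℂ _ (point_ne_zero (move b t) z)
  obtain ⟨a', ha'⟩ := Projectivization.exists_smul_eq_mk_rep ℂ _ (point_ne_zero (move b t) z')
  have h1 := H (Projectivization.mk ℂ _ (point_ne_zero (move b t) z))
    (fun h => ht z _ h a (by rw [← ha, move_three]; rfl))
    (Projectivization.mk ℂ _ (point_ne_zero (move b t) z'))
    (fun h => ht z' _ h a' (by rw [← ha', move_three]; rfl))
    (by rw [← ha, h3]; exact smul_mem_contour hF _ _ hz)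
    (by rw [← ha', h3]; exact smul_mem_contour hF _ _ hz')
    (by
      rw [← ha, ← ha', Submodule.mem_span_pair, move_three]
      refine ⟨a' * (a⁻¹ : ℂˣ), a' * (z' - z), ?_⟩
      rw [Units.smul_def, Units.smul_def, smul_smul, mul_assoc, Units.inv_mul, mul_one]
      module)
  obtain ⟨c, hc⟩ := (Projectivization.mk_eq_mk_iff' ℂ _ _ _ _).1 h1
  exact (point_eq_of_smul hc.symm)

/-- Off a finite set, the multiplicity at singular points over points of the plane is two. -/
theorem exists_finite_multiplicity (hF : F.IsHomogeneous d) (hg : IsGoodProjection F (b 3)) :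
    ∃ S : Set (Fin 2 → ℂ), S.Finite ∧ ∀ t ∉ S, ∀ z : ℂ,
      move b t 0 + z • move b t 3 ∈ singularLocus F →
      lineMultiplicity F (move b t 3) (move b t 0 + z • move b t 3) = 2 := by
  obtain ⟨T, hT, H⟩ := hg.singularMultiplicity
  refine ⟨_, finite_image_projectivization b hT, fun t ht z hz => ?_⟩
  simp only [Set.mem_ofPred_eq, not_exists, not_and] at ht
  obtain ⟨a, ha⟩ := Projectivization.exists_smul_eq_mk_rep ℂ _ (point_ne_zero (move b t) z)
  have := H (Projectivization.mk ℂ _ (point_ne_zero (move b t) z))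
    (fun h => ht z _ h a (by rw [← ha, move_three]; rfl))
    (by rw [← ha]; exact smul_mem_singularLocus hF _ hz)
  rw [move_three]
  rwa [← ha, move_three, Units.smul_def, lineMultiplicity_smul hF _ _ a.ne_zero] at this

theorem order_of_unique {z : ℂ} {W V : PlaneSeries[X]} (H : IsLocalFactor F b z W V)
    (hF : F.IsHomogeneous d) (hp : MvPolynomial.eval (b 3) F ≠ 0) (h2 : 2 ≤ W.natDegree)
    (hu : ∀ z', b 0 + z' • b 3 ∈ contour F (b 3) → z' = z) :
    Associated (silhouetteEq F b) (disc W) := by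
  refine (H.disc_associated hF hp h2).trans (associated_mul_unit_left _ _ ?_)
  exact (H.isUnit_disc_iff hp).2 fun z' hz' h => hz' (hu z' h)

/-- The multiplicity condition of a good projection, applied in the frame that starts at the point
itself; passing to that frame does not change the germ of `B`. -/
theorem IsLocalFactor.natDegree_eq_two (hg : IsGoodProjection F (b 3)) {z : ℂ}
    {W V : PlaneSeries[X]} (H : IsLocalFactor F b z W V)
    (hR : b 0 + z • b 3 ∈ properContour F (b 3)) (hZ : b 0 + z • b 3 ∉ singularLocus F)
    (hc : ¬ IsCuspGerm (properIdeal F b)) : W.natDegree = 2 := by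
  have h3 : shift b 0 0 z 3 = b 3 := shift_of_ne _ _ _ _ (by decide)
  rw [← H.lineMultiplicity_eq hg.center]
  have := hg.multiplicity (shift b 0 0 z) h3
  rw [shift_zero'] at this
  refine this hR (fun h => hZ ⟨?_, h⟩) ?_
  · exact (properContour_subset_contour _ hR).1
  · rwa [properIdeal, h3, localIdeal_shift]

/-- Used to recognize that a point of `B` is not a cusp: it suffices to find an equation with
non-zero linear part. -/
theorem IsCuspGerm.linPart_eq_zero {I : Ideal PlaneSeries} (h : IsCuspGerm I) {a : PlaneSeries}
    (ha : a ∈ I) : linPart a = 0 := by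
  obtain ⟨h₁, h₂, hc, rfl⟩ := h
  obtain ⟨k, rfl⟩ := Ideal.mem_span_singleton'.1 ha
  obtain ⟨h0, h0', -⟩ := isPartOfCoords_two.1 hc
  have : linPart (h₁ ^ 3 - h₂ ^ 2) = 0 := by
    have e : linPart (h₁ ^ 3 - h₂ ^ 2) = linPart (h₁ * (h₁ * h₁)) - linPart (h₂ * h₂) := by
      ext i
      rw [pow_succ, pow_two, pow_two, mul_comm (h₁ * h₁)]
      simp [linPart]
    rw [e, linPart_mul, linPart_mul, linPart_mul, h0, h0']
    simp [h0]
  rw [linPart_mul, this]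
  simp [h0, h0']

end Glob

end FatSilhouette
end

noncomputable section

namespace FatSilhouette

open Polynomial hiding constantCoeff
open MvPowerSeries (constantCoeff)

/-! ### The fat silhouette is the proper silhouette plus twice the singular image. -/

section Glob

variable {F : MvPolynomial (Fin 4) ℂ} {d : ℕ} {b : Frame}

theorem localIdeal_ne_top_of_le {I : Ideal PlaneSeries} {a : PlaneSeries}
    (h : I ≤ Ideal.span {a}) (ha : constantCoeff a = 0) : I ≠ ⊤ := by
  rintro rfl
  obtain ⟨k, hk⟩ := Ideal.mem_span_singleton'.1 (h (Submodule.mem_top (x := 1)))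
  have := congrArg constantCoeff hk
  rw [map_mul, ha, mul_zero, map_one] at this
  exact zero_ne_one this

theorem hasPointOver_properContour (hF : F.IsHomogeneous d) (hp : MvPolynomial.eval (b 3) F ≠ 0)
    (h : properIdeal F b ≠ ⊤) : HasPointOver (properContour F (b 3)) b := by
  by_contra hn
  exact h (localIdeal_eq_top hF hp (isZariskiClosed_properContour F _)
    (fun q hq => (properContour_subset_contour _ hq).1) hn)

theorem hasPointOver_singularLocus (hF : F.IsHomogeneous d) (hp : MvPolynomial.eval (b 3) F ≠ 0)
    (h : singularIdeal F b ≠ ⊤) : HasPointOver (singularLocus F) b := by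
  by_contra hn
  exact h (localIdeal_eq_top hF hp (isZariskiClosed_singularLocus F)
    (fun q hq => hq.1) hn)

theorem notMem_of_eval_ne_zero {A : Set (Fin 4 → ℂ)} {t : Fin 2 → ℂ}
    {g : MvPolynomial (Fin 2) ℂ} (hg : g ∈ MvPolynomial.vanishingIdeal ℂ (planeImage A b))
    (ht : MvPolynomial.eval t g ≠ 0) {z : ℂ} : move b t 0 + z • move b t 3 ∉ A := fun h =>
  ht (mem_vanishingIdeal.1 hg t (mem_planeImage_iff.2 ⟨z, h⟩))

theorem le_order_move (hF : F.IsHomogeneous d) (hp : MvPolynomial.eval (b 3) F ≠ 0) (hd : 0 < d)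
    {π : MvPolynomial (Fin 2) ℂ} {k : ℕ} (h : π ^ k ∣ disc (fibrePoly F b)) {t : Fin 2 → ℂ}
    (ht : MvPolynomial.eval t π = 0) : (k : ℕ∞) ≤ (silhouetteEq F (move b t)).order := by
  rw [order_of_associated (silhouetteEq_move hF hp hd t)]
  obtain ⟨E, hE⟩ := h
  apply le_order_of_mem_pow
  rw [hE, map_mul, map_mul, map_pow, map_pow]
  refine Ideal.mul_mem_right _ _ (Ideal.pow_mem_pow (mem_maximalIdeal.2 ?_) k)
  rw [constantCoeff_translate, ht]

/-- Over a general point of the proper silhouette, the discriminant has order one. -/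
theorem exists_finite_order_eq_one (hF : F.IsHomogeneous d) (hg : IsGoodProjection F (b 3))
    (hd : 0 < d) {g : MvPolynomial (Fin 2) ℂ}
    (hgW : g ∈ MvPolynomial.vanishingIdeal ℂ (planeImage (singularLocus F) b)) :
    ∃ S : Set (Fin 2 → ℂ), S.Finite ∧ ∀ t ∉ S, MvPolynomial.eval t g ≠ 0 →
      ¬ IsCuspGerm (properIdeal F (move b t)) →
      MvPolynomial.eval t (disc (fibrePoly F b)) = 0 → (silhouetteEq F (move b t)).order = 1 := by
  obtain ⟨S, hS, H⟩ := exists_finite_injective hF hg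
  refine ⟨S, hS, fun t ht hgt hc h0 => ?_⟩
  have hp := hg.center
  have hg' : IsGoodProjection F (move b t 3) := by rwa [move_three]
  obtain ⟨z, hz⟩ := (eval_disc_eq_zero_iff hF hp hd t).1 h0
  obtain ⟨W, V, L⟩ := exists_isLocalFactor (b := move b t) hF hg'.center z
  have h2 : 2 ≤ W.natDegree := (L.two_le_iff hg'.center).2 hz
  rw [order_of_associated (order_of_unique L hF hg'.center h2 fun z' hz' => H t ht z' z hz' hz)]
  have hZ : move b t 0 + z • move b t 3 ∉ singularLocus F := notMem_of_eval_ne_zero hgW hgt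
  exact L.order_disc_of_smooth hF hg'.center
    (L.natDegree_eq_two hg' ((contour_subset hz).resolve_left hZ) hZ hc) hZ

/-- Over a general point of the singular image, the discriminant has order two. -/
theorem exists_finite_order_eq_two (hF : F.IsHomogeneous d) (hg : IsGoodProjection F (b 3))
    (hd : 0 < d) {g : MvPolynomial (Fin 2) ℂ}
    (hgB : g ∈ MvPolynomial.vanishingIdeal ℂ (planeImage (properContour F (b 3)) b)) :
    ∃ S : Set (Fin 2 → ℂ), S.Finite ∧ ∀ t ∉ S, MvPolynomial.eval t g ≠ 0 →
      MvPolynomial.eval t (disc (fibrePoly F b)) = 0 → (silhouetteEq F (move b t)).order = 2 := by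
  obtain ⟨S, hS, H⟩ := exists_finite_injective hF hg
  obtain ⟨S', hS', H'⟩ := exists_finite_multiplicity hF hg
  refine ⟨S ∪ S', hS.union hS', fun t ht hgt h0 => ?_⟩
  rw [Set.mem_union, not_or] at ht
  have hp := hg.center
  have hg' : IsGoodProjection F (move b t 3) := by rwa [move_three]
  obtain ⟨z, hz⟩ := (eval_disc_eq_zero_iff hF hp hd t).1 h0
  obtain ⟨W, V, L⟩ := exists_isLocalFactor (b := move b t) hF hg'.center z
  have h2 : 2 ≤ W.natDegree := (L.two_le_iff hg'.center).2 hz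
  rw [order_of_associated (order_of_unique L hF hg'.center h2 fun z' hz' => H t ht.1 z' z hz' hz)]
  have hR : move b t 0 + z • move b t 3 ∉ properContour F (move b t 3) := by
    have := notMem_of_eval_ne_zero hgB hgt (z := z)
    rwa [← move_three b t] at this
  have hZ : move b t 0 + z • move b t 3 ∈ singularLocus F :=
    (contour_subset hz).resolve_right hR
  have hW : W.natDegree = 2 := by
    rw [← L.lineMultiplicity_eq hg'.center]
    exact H' t ht.2 z hZ
  rcases hg.ordinary _ hZ (point_ne_zero _ z) with h | h | h
  · obtain ⟨w₀, w₁, e, d0, d1, n0, n1, hl⟩ := L.exists_double h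
    have hn : w₀.natDegree + w₁.natDegree = 2 := by
      rw [← d0.monic.natDegree_mul d1.monic, ← e, L.natDegree_taylor, hW]
    obtain ⟨s, hs, -, hs'⟩ := disc_double_linear d0 d1 (by omega) (by omega) hl
    rw [← L.disc_taylor, e, order_of_associated hs', order_sq, hs.order_eq, mul_one]
  · have := (L.triple h).1
    omega
  · obtain ⟨k, g', hc, hI, -⟩ := hg'.pinch (move b t) rfl ⟨z, h⟩
    have htop : properIdeal F (move b t) = ⊤ := by
      rw [properIdeal, move_three]
      exact localIdeal_move_eq_top hgB hgt
    exact absurd htop (localIdeal_ne_top_of_le hI.le hc.left.1)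

theorem exists_eval_eq_zero {π : MvPolynomial (Fin 2) ℂ} (hπ : Prime π) :
    ∃ t, MvPolynomial.eval t π = 0 := by
  obtain ⟨t, ht, -⟩ := exists_generic hπ (g := 1) (fun h => hπ.not_isUnit (isUnit_of_dvd_one h))
    Set.finite_empty
  exact ⟨t, ht⟩

/-- The permitted germs all have a non-zero equation, and away from `B` the ideal is the whole ring.
-/
theorem properIdeal_ne_bot (hF : F.IsHomogeneous d) (hg : IsGoodProjection F (b 3)) :
    properIdeal F b ≠ ⊥ := by
  intro h
  have hR := hasPointOver_properContour hF hg.center (by rw [h]; exact bot_ne_top)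
  rcases hg.proper b rfl hR with ⟨k, hk, e⟩ | ⟨h₁, h₂, hk, e⟩ | ⟨h₁, h₂, hk, e⟩ <;>
    rw [h, eq_comm, Ideal.span_singleton_eq_bot] at e
  · exact (isPartOfCoords_one.1 hk).ne_zero e
  · exact mul_ne_zero hk.left.ne_zero hk.right.ne_zero e
  · have := order_cusp hk.left hk.right
    rw [e] at this
    simp at this

theorem singularIdeal_ne_bot (hF : F.IsHomogeneous d) (hg : IsGoodProjection F (b 3)) :
    singularIdeal F b ≠ ⊥ := by
  intro h
  have hR := hasPointOver_singularLocus hF hg.center (by rw [h]; exact bot_ne_top)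
  rcases hg.singular b rfl hR with ⟨k, hk, e⟩ | ⟨h₁, h₂, hk, e⟩ | ⟨h₁, h₂, h₃, hk, hk', -, e⟩ <;>
    rw [h, eq_comm, Ideal.span_singleton_eq_bot] at e
  · exact (isPartOfCoords_one.1 hk).ne_zero e
  · exact mul_ne_zero hk.left.ne_zero hk.right.ne_zero e
  · exact mul_ne_zero (mul_ne_zero hk.left.ne_zero hk.right.ne_zero) hk'.right.ne_zero e

theorem vanishingIdeal_ne_bot {A : Set (Fin 4 → ℂ)} (h : localIdeal A b ≠ ⊥) :
    ∃ g ∈ MvPolynomial.vanishingIdeal ℂ (planeImage A b), g ≠ 0 := by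
  by_contra! hn
  apply h
  rw [localIdeal, (Submodule.eq_bot_iff _).2 hn, Ideal.map_bot]

theorem eval_mul_eq_zero (hF : F.IsHomogeneous d) (hg : IsGoodProjection F (b 3)) (hd : 0 < d)
    {g h : MvPolynomial (Fin 2) ℂ}
    (hgB : g ∈ MvPolynomial.vanishingIdeal ℂ (planeImage (properContour F (b 3)) b))
    (hgW : h ∈ MvPolynomial.vanishingIdeal ℂ (planeImage (singularLocus F) b)) {t : Fin 2 → ℂ}
    (ht : MvPolynomial.eval t (disc (fibrePoly F b)) = 0) : MvPolynomial.eval t (g * h) = 0 := by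
  obtain ⟨z, hz⟩ := (eval_disc_eq_zero_iff hF hg.center hd t).1 ht
  rw [map_mul]
  rcases contour_subset hz with hz | hz
  · rw [mem_vanishingIdeal.1 hgW t (mem_planeImage_iff.2 ⟨z, hz⟩), mul_zero]
  · rw [move_three] at hz
    rw [mem_vanishingIdeal.1 hgB t (mem_planeImage_iff.2 ⟨z, by rwa [move_three]⟩), zero_mul]

theorem disc_fibrePoly_ne_zero (hF : F.IsHomogeneous d) (hg : IsGoodProjection F (b 3))
    (hd : 0 < d) : disc (fibrePoly F b) ≠ 0 := by
  intro h0
  obtain ⟨g, hgB, hg0⟩ := vanishingIdeal_ne_bot (properIdeal_ne_bot hF hg)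
  obtain ⟨h, hgW, hh0⟩ := vanishingIdeal_ne_bot (singularIdeal_ne_bot hF hg)
  refine mul_ne_zero hg0 hh0 (MvPolynomial.funext fun t => ?_)
  rw [eval_mul_eq_zero hF hg hd hgB hgW (by rw [h0, map_zero]), map_zero]

/-- The zeros of the discriminant lie in the union of `B` and `W`. So the product of an equation of
`B` and an equation of `W` is divisible by `π`, hence one of the two factors is. -/
theorem le_span_or (hF : F.IsHomogeneous d) (hg : IsGoodProjection F (b 3)) (hd : 0 < d)
    {π : MvPolynomial (Fin 2) ℂ} (hπ : Prime π) (h : π ∣ disc (fibrePoly F b)) :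
    MvPolynomial.vanishingIdeal ℂ (planeImage (properContour F (b 3)) b) ≤ Ideal.span {π} ∨
      MvPolynomial.vanishingIdeal ℂ (planeImage (singularLocus F) b) ≤ Ideal.span {π} := by
  by_contra! hn
  obtain ⟨⟨g, hgB, hg0⟩, ⟨k, hgW, hk0⟩⟩ :=
    And.intro (SetLike.not_le_iff_exists.1 hn.1) (SetLike.not_le_iff_exists.1 hn.2)
  rw [Ideal.mem_span_singleton] at hg0 hk0
  refine (hπ.dvd_or_dvd (dvd_of_forall_notMem hπ Set.finite_empty fun t ht _ => ?_)).elim hg0 hk0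
  refine eval_mul_eq_zero hF hg hd hgB hgW ?_
  obtain ⟨E, hE⟩ := h
  rw [hE, map_mul, ht, zero_mul]

/-- At a point of a common component, `B` and `W` would have smooth germs with non-associated
equations, both divisible by the same non-unit `π`. -/
theorem not_le_span_both (hF : F.IsHomogeneous d) (hg : IsGoodProjection F (b 3))
    {π : MvPolynomial (Fin 2) ℂ} (hπ : Prime π)
    (hB : MvPolynomial.vanishingIdeal ℂ (planeImage (properContour F (b 3)) b) ≤ Ideal.span {π})
    (hW : MvPolynomial.vanishingIdeal ℂ (planeImage (singularLocus F) b) ≤ Ideal.span {π}) :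
    False := by
  obtain ⟨t, ht⟩ := exists_eval_eq_zero hπ
  have hg' : IsGoodProjection F (move b t 3) := by rwa [move_three]
  have h0 : constantCoeff (toPlane (translate t π)) = 0 := by rw [constantCoeff_translate, ht]
  have h1 : properIdeal F (move b t) ≤ Ideal.span {toPlane (translate t π)} := by
    rw [properIdeal, move_three]
    exact localIdeal_move_le hB
  have h2 : singularIdeal F (move b t) ≤ Ideal.span {toPlane (translate t π)} :=
    localIdeal_move_le hW
  have hu : ¬ IsUnit (toPlane (translate t π)) := by rw [FatSilhouette.isUnit_iff, h0]; simp
  have key : ∀ h g : PlaneSeries, IsSmooth h → IsSmooth g → ¬ Associated h g →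
      properIdeal F (move b t) = Ideal.span {h} → singularIdeal F (move b t) = Ideal.span {g} →
      False := by
    intro h g hh hg hn e e'
    rw [e, Ideal.span_singleton_le_span_singleton] at h1
    rw [e', Ideal.span_singleton_le_span_singleton] at h2
    exact hn ((((hh.prime.irreducible.dvd_iff.1 h1).resolve_left hu)).trans
      ((hg.prime.irreducible.dvd_iff.1 h2).resolve_left hu).symm)
  rcases hg'.intersection _ rfl
    (hasPointOver_properContour hF hg'.center (localIdeal_ne_top_of_le h1 h0))
    (hasPointOver_singularLocus hF hg'.center (localIdeal_ne_top_of_le h2 h0)) with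
    ⟨h, g, hc, e, e'⟩ | ⟨⟨h, g, hc, e, e'⟩, -⟩
  · exact key h g hc.left hc.right (not_associated_of_coords hc) e e'
  · exact key h g hc.left hc.right hc.not_associated e e'

/-- A non-zero equation of the curve can be made to contain `π` exactly once; at a general point of
`π = 0` it then has a non-zero linear part. -/
theorem exists_mul_mem {A : Set (Fin 4 → ℂ)} {π : MvPolynomial (Fin 2) ℂ} (hπ : Prime π)
    (h : localIdeal A b ≠ ⊥) :
    ∃ g, ¬ π ∣ g ∧ π * g ∈ MvPolynomial.vanishingIdeal ℂ (planeImage A b) := by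
  obtain ⟨G, hG, hG0⟩ := vanishingIdeal_ne_bot h
  obtain ⟨g, e, hn⟩ :=
    (FiniteMultiplicity.of_prime_left hπ hG0).exists_eq_pow_mul_and_not_dvd
  refine ⟨g, hn, mem_vanishingIdeal.2 fun t ht => ?_⟩
  have := mem_vanishingIdeal.1 hG t ht
  rw [e, map_mul, map_pow] at this
  rw [map_mul]
  rcases mul_eq_zero.1 this with h | h
  · rw [eq_zero_of_pow_eq_zero h, zero_mul]
  · rw [h, mul_zero]

/-- At a general point of this component the discriminant has order one, whereas `π²` has order at
least two. The factors `k`, `g` and the derivative of `π` keep the point off `W` and off the cusps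
of `B`. -/
theorem not_sq_dvd_disc (hF : F.IsHomogeneous d) (hg : IsGoodProjection F (b 3)) (hd : 0 < d)
    {π : MvPolynomial (Fin 2) ℂ} (hπ : Prime π)
    (hB : MvPolynomial.vanishingIdeal ℂ (planeImage (properContour F (b 3)) b) ≤ Ideal.span {π}) :
    ¬ π ^ 2 ∣ disc (fibrePoly F b) := by
  intro hdvd
  obtain ⟨k, hgW, hk⟩ := SetLike.not_le_iff_exists.1 fun h => not_le_span_both hF hg hπ hB h
  rw [Ideal.mem_span_singleton] at hk
  obtain ⟨g, hgn, hgm⟩ := exists_mul_mem hπ (properIdeal_ne_bot hF hg)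
  obtain ⟨i, hi⟩ := exists_not_dvd_pderiv hπ
  obtain ⟨S, hS, H⟩ := exists_finite_order_eq_one hF hg hd hgW
  obtain ⟨t, ht, htS, hne⟩ := exists_generic hπ (g := k * (g * MvPolynomial.pderiv i π))
    (fun h => (hπ.dvd_or_dvd h).elim hk fun h => (hπ.dvd_or_dvd h).elim hgn hi) hS
  rw [map_mul, map_mul] at hne
  have hD : MvPolynomial.eval t (disc (fibrePoly F b)) = 0 := by
    obtain ⟨E, hE⟩ := hdvd
    rw [hE, map_mul, map_pow, ht]
    simp
  have h1 := H t htS (left_ne_zero_of_mul hne) (fun hc => ?_) hD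
  · have h2 := le_order_move hF hg.center hd hdvd ht
    rw [h1] at h2
    exact absurd h2 (by decide)
  · have h0 : linPart (toPlane (translate t (π * g))) = 0 := by
      refine IsCuspGerm.linPart_eq_zero hc ?_
      rw [properIdeal, move_three]
      exact mem_localIdeal_move hgm
    have := congrFun h0 i
    rw [linPart_toPlane_translate, Derivation.leibniz, map_add, smul_eq_mul, smul_eq_mul, map_mul,
      map_mul, ht, zero_mul, zero_add] at this
    exact right_ne_zero_of_mul hne this

/-- The order of the discriminant is exactly two at general points of this component. -/
theorem dvd_disc_of_singular (hF : F.IsHomogeneous d) (hg : IsGoodProjection F (b 3)) (hd : 0 < d)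
    {π : MvPolynomial (Fin 2) ℂ} (hπ : Prime π) (h : π ∣ disc (fibrePoly F b))
    (hW : MvPolynomial.vanishingIdeal ℂ (planeImage (singularLocus F) b) ≤ Ideal.span {π}) :
    π ^ 2 ∣ disc (fibrePoly F b) ∧ ¬ π ^ 3 ∣ disc (fibrePoly F b) := by
  obtain ⟨k, hgB, hk⟩ := SetLike.not_le_iff_exists.1 fun h => not_le_span_both hF hg hπ h hW
  rw [Ideal.mem_span_singleton] at hk
  obtain ⟨S, hS, H⟩ := exists_finite_order_eq_two hF hg hd hgB
  have hD : ∀ t, MvPolynomial.eval t π = 0 → MvPolynomial.eval t (disc (fibrePoly F b)) = 0 := by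
    intro t ht
    obtain ⟨E, hE⟩ := h
    rw [hE, map_mul, ht, zero_mul]
  constructor
  -- Order two makes the partial derivatives vanish at general points of the curve. With `disc = π
  -- E` and a derivative of `π` not divisible by `π`, this forces `π` to divide `E`.
  · have h' : ∀ i, π ∣ MvPolynomial.pderiv i (disc (fibrePoly F b)) := by
      intro i
      refine (hπ.dvd_or_dvd (dvd_of_forall_notMem hπ hS fun t ht htS => ?_)).resolve_left hk
      by_contra hn
      rw [map_mul] at hn
      have := H t htS (left_ne_zero_of_mul hn) (hD t ht)
      rw [order_of_associated (silhouetteEq_move hF hg.center hd t)] at this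
      apply right_ne_zero_of_mul hn
      rw [← linPart_toPlane_translate, (FatSilhouette.two_le_order.1 this.ge).2]
      rfl
    obtain ⟨i, hi⟩ := exists_not_dvd_pderiv hπ
    have h2 := h' i
    obtain ⟨E, hE⟩ := h
    rw [hE, Derivation.leibniz, smul_eq_mul, smul_eq_mul,
      dvd_add_right (dvd_mul_right _ _)] at h2
    rw [hE, pow_two]
    exact mul_dvd_mul_left π ((hπ.dvd_or_dvd h2).resolve_right hi)
  · intro hdvd
    obtain ⟨t, ht, htS, hne⟩ := exists_generic hπ hk hS
    have h2 := le_order_move hF hg.center hd hdvd ht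
    rw [H t htS hne (hD t ht)] at h2
    exact absurd h2 (by decide)

/-- Induction on coprime factors of the discriminant; the cofactor `E` is carried along because the
exponent of a prime in the factor `D` has to be its exact exponent in the whole discriminant.
Components of `B` go to `G`, those of `W` to `H`. -/
theorem exists_factorization_aux (hF : F.IsHomogeneous d) (hg : IsGoodProjection F (b 3))
    (hd : 0 < d) (D : MvPolynomial (Fin 2) ℂ) : ∀ E, disc (fibrePoly F b) = D * E →
      IsRelPrime D E → ∃ G H : MvPolynomial (Fin 2) ℂ, Associated D (G * H ^ 2) ∧
      MvPolynomial.vanishingIdeal ℂ (planeImage (properContour F (b 3)) b) ≤ Ideal.span {G} ∧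
      MvPolynomial.vanishingIdeal ℂ (planeImage (singularLocus F) b) ≤ Ideal.span {H} := by
  have hu : ∀ x : MvPolynomial (Fin 2) ℂ, IsUnit x → ∃ G H : MvPolynomial (Fin 2) ℂ,
      Associated x (G * H ^ 2) ∧
      MvPolynomial.vanishingIdeal ℂ (planeImage (properContour F (b 3)) b) ≤ Ideal.span {G} ∧
      MvPolynomial.vanishingIdeal ℂ (planeImage (singularLocus F) b) ≤ Ideal.span {H} :=
    fun x hx => ⟨1, 1, by simpa using associated_one_iff_isUnit.2 hx, by simp, by simp⟩
  refine UniqueFactorizationMonoid.induction_on_coprime D ?_ ?_ ?_ ?_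
  · intro E hE
    exact absurd (hE.trans (zero_mul E)) (disc_fibrePoly_ne_zero hF hg hd)
  · exact fun hx E _ _ => hu _ hx
  · intro π i hπ E hE hr
    rcases Nat.eq_zero_or_pos i with rfl | hi
    · exact hu _ (by simp)
    have hπE : ¬ π ∣ E := fun h => hπ.not_isUnit (hr (dvd_pow_self π hi.ne') h)
    have hdvd : π ∣ disc (fibrePoly F b) := by
      rw [hE]; exact (dvd_pow_self π hi.ne').mul_right E
    have hmax : ∀ n, π ^ n ∣ disc (fibrePoly F b) ↔ n ≤ i := by
      intro n
      rw [hE]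
      constructor
      · intro h
        by_contra! hn
        have h' := (pow_dvd_pow π hn).trans h
        rw [pow_succ] at h'
        exact hπE ((mul_dvd_mul_iff_left (pow_ne_zero i hπ.ne_zero)).1 h')
      · exact fun h => (pow_dvd_pow π h).mul_right E
    rcases le_span_or hF hg hd hπ hdvd with hB | hW
    · have h2 := not_sq_dvd_disc hF hg hd hπ hB
      rw [hmax] at h2
      obtain rfl : i = 1 := by omega
      exact ⟨π, 1, by simp, hB, by simp⟩
    · have h2 := dvd_disc_of_singular hF hg hd hπ hdvd hW
      rw [hmax, hmax] at h2
      obtain rfl : i = 2 := by omega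
      exact ⟨1, π, by simp, by simp, hW⟩
  · intro x y hxy hx hy E hE hr
    obtain ⟨G, H, h1, h2, h3⟩ := hx (y * E) (by rw [hE, mul_assoc])
      (hxy.mul_right hr.of_mul_left_left)
    obtain ⟨G', H', h1', h2', h3'⟩ := hy (x * E) (by rw [hE]; ring)
      (hxy.symm.mul_right hr.of_mul_left_right)
    have aux : ∀ {u v : MvPolynomial (Fin 2) ℂ} {J : Ideal (MvPolynomial (Fin 2) ℂ)}, u ∣ x → v ∣ y →
        J ≤ Ideal.span {u} → J ≤ Ideal.span {v} → J ≤ Ideal.span {u * v} := by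
      intro u v J hu hv h h' a ha
      rw [Ideal.mem_span_singleton]
      refine IsRelPrime.mul_dvd_of_left_isPrimal (hxy.of_dvd_left hu |>.of_dvd_right hv)
        (Ideal.mem_span_singleton.1 (h ha)) (Ideal.mem_span_singleton.1 (h' ha))
        (DecompositionMonoid.primal _)
    refine ⟨G * G', H * H', ?_, aux ?_ ?_ h2 h2', aux ?_ ?_ h3 h3'⟩
    · rw [show G * G' * (H * H') ^ 2 = (G * H ^ 2) * (G' * H' ^ 2) by ring]
      exact h1.mul_mul h1'
    · exact (dvd_mul_right _ _).trans h1.symm.dvd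
    · exact (dvd_mul_right _ _).trans h1'.symm.dvd
    · exact ((dvd_pow_self _ two_ne_zero).mul_left _).trans h1.symm.dvd
    · exact ((dvd_pow_self _ two_ne_zero).mul_left _).trans h1'.symm.dvd

/-- The fat silhouette is the sum of the proper silhouette and of twice the singular image. -/
theorem exists_factorization (hF : F.IsHomogeneous d) (hg : IsGoodProjection F (b 3))
    (hd : 0 < d) : ∃ G H : PlaneSeries, Associated (silhouetteEq F b) (G * H ^ 2) ∧
      properIdeal F b ≤ Ideal.span {G} ∧ singularIdeal F b ≤ Ideal.span {H} ∧
      G * H ∈ properIdeal F b ∧ G * H ∈ singularIdeal F b := by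
  obtain ⟨G, H, h1, h2, h3⟩ := exists_factorization_aux hF hg hd _ 1 (mul_one _).symm isRelPrime_one_right
  have h0 : ∀ t, HasPointOver (contour F (move b t 3)) (move b t) →
      MvPolynomial.eval t (G * H) = 0 := by
    intro t ht
    rw [← eval_disc_eq_zero_iff hF hg.center hd] at ht
    obtain ⟨u, hu⟩ := h1
    have := congrArg (MvPolynomial.eval t) hu
    rw [map_mul, ht, zero_mul, map_mul, map_pow, eq_comm] at this
    rw [map_mul]
    rcases mul_eq_zero.1 this with h | h
    · rw [h, zero_mul]
    · rw [eq_zero_of_pow_eq_zero h, mul_zero]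
  refine ⟨toPlane G, toPlane H, ?_, ?_, ?_, ?_, ?_⟩
  · refine (silhouetteEq_associated_toPlane hF hg.center hd).trans ?_
    rw [← map_pow, ← map_mul]
    exact h1.map toPlane
  · rw [properIdeal, localIdeal, ← Set.image_singleton, ← Ideal.map_span]
    exact Ideal.map_mono h2
  · rw [singularIdeal, localIdeal, ← Set.image_singleton, ← Ideal.map_span]
    exact Ideal.map_mono h3
  · rw [← map_mul]
    refine Ideal.mem_map_of_mem _ (mem_vanishingIdeal.2 fun t ht => h0 t ?_)
    obtain ⟨z, hz⟩ := mem_planeImage_iff.1 ht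
    exact ⟨z, by rw [move_three b] at hz ⊢; exact properContour_subset_contour _ hz⟩
  · rw [← map_mul]
    refine Ideal.mem_map_of_mem _ (mem_vanishingIdeal.2 fun t ht => h0 t ?_)
    obtain ⟨z, hz⟩ := mem_planeImage_iff.1 ht
    exact ⟨z, singularLocus_subset_contour _ hz⟩

end Glob

end FatSilhouette
end

noncomputable section

namespace FatSilhouette

open Polynomial hiding constantCoeff
open MvPowerSeries (constantCoeff)

/-! ### The equations of the proper contour in an affine chart. -/

section Chart

variable {F : MvPolynomial (Fin 4) ℂ} {d : ℕ} {b : Frame}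

theorem eval_chart (b : Frame) (x : Fin 3 → ℂ) (G : MvPolynomial (Fin 4) ℂ) :
    MvPolynomial.eval x (chart b G) = MvPolynomial.eval (b 0 + ∑ i : Fin 3, x i • b i.succ) G := by
  have : (MvPolynomial.eval x).comp (chart b) =
      MvPolynomial.eval (b 0 + ∑ i : Fin 3, x i • b i.succ) := by
    apply MvPolynomial.ringHom_ext
    · intro c; simp [chart_C]
    · intro j
      simp [chart_X, Fin.sum_univ_three]
      ring
  exact RingHom.congr_fun this G

theorem dirPoly_add (G H : MvPolynomial (Fin 4) ℂ) (p : Fin 4 → ℂ) :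
    dirPoly (G + H) p = dirPoly G p + dirPoly H p :=
  MvPolynomial.funext fun q => by rw [map_add, eval_dirPoly, eval_dirPoly, eval_dirPoly, dirDeriv_add]

theorem dirPoly_mul_X (G : MvPolynomial (Fin 4) ℂ) (j : Fin 4) (p : Fin 4 → ℂ) :
    dirPoly (G * MvPolynomial.X j) p =
      G * MvPolynomial.C (p j) + MvPolynomial.X j * dirPoly G p :=
  MvPolynomial.funext fun q => by
    rw [map_add, map_mul, map_mul, eval_dirPoly, eval_dirPoly, dirDeriv_mul, dirDeriv_X,
      MvPolynomial.eval_C, MvPolynomial.eval_X]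

theorem pderiv_chart_X (b : Frame) (i : Fin 3) (j : Fin 4) :
    MvPolynomial.pderiv i (chart b (MvPolynomial.X j)) = MvPolynomial.C (b i.succ j) := by
  rw [chart_X, Fin.sum_univ_three, map_add, map_add, map_add, MvPolynomial.pderiv_C,
    MvPolynomial.pderiv_C_mul, MvPolynomial.pderiv_C_mul, MvPolynomial.pderiv_C_mul,
    MvPolynomial.pderiv_X, MvPolynomial.pderiv_X, MvPolynomial.pderiv_X]
  fin_cases i <;> simp

theorem pderiv_chart (b : Frame) (i : Fin 3) (G : MvPolynomial (Fin 4) ℂ) :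
    MvPolynomial.pderiv i (chart b G) = chart b (dirPoly G (b i.succ)) := by
  induction G using MvPolynomial.induction_on with
  | C a => rw [chart_C, MvPolynomial.pderiv_C]; simp [dirPoly]
  | add G H hG hH => rw [map_add, map_add, hG, hH, ← map_add, dirPoly_add]
  | mul_X G j hG =>
    rw [map_mul, Derivation.leibniz, pderiv_chart_X, hG, dirPoly_mul_X, map_add, map_mul, map_mul,
      chart_C, smul_eq_mul, smul_eq_mul]

theorem eval_pderiv_chart (b : Frame) (i : Fin 3) (x : Fin 3 → ℂ) (G : MvPolynomial (Fin 4) ℂ) :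
    MvPolynomial.eval x (MvPolynomial.pderiv i (chart b G)) =
      dirDeriv G (b i.succ) (b 0 + ∑ i : Fin 3, x i • b i.succ) := by
  rw [pderiv_chart, eval_chart, eval_dirPoly]

/-- Equations of the projection of the proper contour, times a partial derivative of `F`, vanish on
the contour. -/
theorem map_mul_map_eq_zero {A : Type*} [CommRing A] [IsDomain A]
    (ψ : MvPolynomial (Fin 3) ℂ →+* A) (h0 : ψ (chart b F) = 0)
    (h1 : ψ (chart b (dirPoly F (b 3))) = 0) {G : MvPolynomial (Fin 2) ℂ}
    (hG : G ∈ MvPolynomial.vanishingIdeal ℂ (planeImage (properContour F (b 3)) b)) (j : Fin 4) :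
    ψ (MvPolynomial.rename Fin.castSucc G) * ψ (chart b (MvPolynomial.pderiv j F)) = 0 := by
  set g := MvPolynomial.rename Fin.castSucc G * chart b (MvPolynomial.pderiv j F)
  -- At a point of the contour either the gradient vanishes or the point lies on the proper contour,
  -- so one factor of `g` is zero. By the Nullstellensatz a power of `g` lies in the ideal, and this
  -- can be evaluated in every domain.
  have hg : g ∈ MvPolynomial.vanishingIdeal ℂ (MvPolynomial.zeroLocus ℂ
      (Ideal.span {chart b F, chart b (dirPoly F (b 3))})) := by
    rw [mem_vanishingIdeal]
    intro x hx
    rw [MvPolynomial.mem_zeroLocus_iff] at hx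
    have e0 := hx _ (Ideal.subset_span (Set.mem_insert _ _))
    have e1 := hx _ (Ideal.subset_span (Set.mem_insert_of_mem _ rfl))
    rw [MvPolynomial.aeval_eq_eval] at e0 e1
    change MvPolynomial.eval x _ = 0 at e0 e1
    rw [eval_chart] at e0 e1
    rw [eval_dirPoly] at e1
    rw [map_mul, eval_chart, MvPolynomial.eval_rename]
    by_cases hgr : grad F (b 0 + ∑ i : Fin 3, x i • b i.succ) = 0
    · rw [show MvPolynomial.eval _ (MvPolynomial.pderiv j F) = 0 from congrFun hgr j, mul_zero]
    · refine mul_eq_zero_of_left (mem_vanishingIdeal.1 hG _ ⟨x 2, ?_⟩) _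
      have : b 0 + (x ∘ Fin.castSucc) 0 • b 1 + (x ∘ Fin.castSucc) 1 • b 2 + x 2 • b 3 =
          b 0 + ∑ i : Fin 3, x i • b i.succ := by
        simp [Fin.sum_univ_three, add_assoc]
      rw [this]
      exact MvPolynomial.zeroLocus_vanishingIdeal_le _ ⟨⟨e0, e1⟩, hgr⟩
  rw [MvPolynomial.vanishingIdeal_zeroLocus_eq_radical] at hg
  obtain ⟨n, hn⟩ := hg
  have hle : Ideal.span {chart b F, chart b (dirPoly F (b 3))} ≤ RingHom.ker ψ := by
    rw [Ideal.span_le]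
    rintro _ (rfl | rfl)
    · exact h0
    · exact h1
  have := hle hn
  rw [RingHom.mem_ker, map_pow] at this
  rw [← map_mul]
  exact eq_zero_of_pow_eq_zero this

end Chart

/-! ### Formal germs and the Zariski closure: points off the proper contour. -/

section Krull

/-- Truncation shows that `a` lies in `I + 𝔫ᵏ` for all `k`; Krull's intersection theorem then yields
a multiplier that is `1` at the origin. -/
theorem exists_mul_mem_of_mem_map {n : ℕ} {I : Ideal (MvPolynomial (Fin n) ℂ)}
    {a : MvPolynomial (Fin n) ℂ}
    (h : MvPolynomial.coeToMvPowerSeries.ringHom a ∈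
      I.map (MvPolynomial.coeToMvPowerSeries.ringHom (R := ℂ))) :
    ∃ s, MvPolynomial.eval 0 s = 1 ∧ s * a ∈ I := by
  set 𝔫 := MvPolynomial.idealOfVars (Fin n) ℂ with h𝔫
  have hk : ∀ k, a ∈ I ⊔ 𝔫 ^ k := by
    intro k
    have e : (MvPowerSeries.truncTotalAlgHom (Fin n) ℂ k).toRingHom.comp
        MvPolynomial.coeToMvPowerSeries.ringHom = Ideal.Quotient.mk (𝔫 ^ k) := by
      refine RingHom.ext fun x => ?_
      exact (MvPowerSeries.truncTotalAlgHom (Fin n) ℂ k).commutes x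
    have := Ideal.mem_map_of_mem (MvPowerSeries.truncTotalAlgHom (Fin n) ℂ k).toRingHom h
    rw [Ideal.map_map, e] at this
    have h2 := RingHom.congr_fun e a
    rw [RingHom.comp_apply] at h2
    rw [h2] at this
    exact Ideal.mem_quotient_iff_mem_sup.1 this
  have hx : Ideal.Quotient.mk I a ∈
      (⨅ i : ℕ, 𝔫 ^ i • ⊤ : Submodule (MvPolynomial (Fin n) ℂ) (MvPolynomial (Fin n) ℂ ⧸ I)) := by
    rw [Submodule.mem_iInf]
    intro k
    obtain ⟨y, hy, z, hz, rfl⟩ := Submodule.mem_sup.1 (hk k)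
    rw [map_add, Ideal.Quotient.eq_zero_iff_mem.2 hy, zero_add]
    have := Submodule.smul_mem_smul hz (Submodule.mem_top (x := (1 : MvPolynomial (Fin n) ℂ ⧸ I)))
    change Ideal.Quotient.mk I (z * 1) ∈ _ at this
    rwa [mul_one] at this
  obtain ⟨r, hr⟩ := (Ideal.mem_iInf_smul_pow_eq_bot_iff 𝔫 _).1 hx
  refine ⟨1 - r, ?_, ?_⟩
  · have h0 : 𝔫 ≤ RingHom.ker (MvPolynomial.eval (0 : Fin n → ℂ)) := by
      rw [h𝔫, MvPolynomial.idealOfVars, Ideal.span_le]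
      rintro _ ⟨i, rfl⟩
      simp [RingHom.mem_ker]
    have := h0 r.2
    rw [RingHom.mem_ker] at this
    rw [map_sub, this, map_one, sub_zero]
  · change Ideal.Quotient.mk I (r * a) = _ at hr
    rw [map_mul] at hr
    rw [← Ideal.Quotient.eq_zero_iff_mem, map_mul, map_sub, map_one, sub_mul, one_mul, sub_eq_zero]
    exact hr.symm

/-- If both sheets are transversal to the direction of `D`, the ideal of the contour contains `h k`,
`h²` and `k²`. So near the point the contour is contained, as a set, in the intersection of the two
sheets, where all derivatives vanish. -/
theorem sq_derivation_mem {A : Type*} [CommRing A] [Algebra ℂ A] (D D' : Derivation ℂ A A) {h k u : A}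
    (hu : IsUnit u) (h1 : IsUnit (D h)) (k1 : IsUnit (D k)) :
    D' (h * k * u) ^ 2 ∈ Ideal.span {h * k * u, D (h * k * u)} := by
  set J := Ideal.span {h * k * u, D (h * k * u)}
  have e0 : h * k ∈ J := by
    rw [← Ideal.mul_unit_mem_iff_mem J hu]
    exact Ideal.subset_span (Set.mem_insert _ _)
  have e1 : D h * k + D k * h ∈ J := by
    rw [← Ideal.mul_unit_mem_iff_mem J hu]
    have : D (h * k * u) ∈ J := Ideal.subset_span (Set.mem_insert_of_mem _ rfl)
    simp only [Derivation.leibniz, smul_eq_mul] at this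
    have h2 := J.sub_mem this (J.mul_mem_right (D u) e0)
    convert h2 using 1; ring
  have e2 : k ^ 2 ∈ J := by
    rw [← Ideal.unit_mul_mem_iff_mem J h1]
    have h2 := J.sub_mem (J.mul_mem_right k e1) (J.mul_mem_right (D k) e0)
    convert h2 using 1; ring
  have e3 : h ^ 2 ∈ J := by
    rw [← Ideal.unit_mul_mem_iff_mem J k1]
    have h2 := J.sub_mem (J.mul_mem_right h e1) (J.mul_mem_right (D h) e0)
    convert h2 using 1; ring
  simp only [Derivation.leibniz, smul_eq_mul]
  have := J.add_mem (J.add_mem (J.mul_mem_left (u ^ 2 * D' k ^ 2) e3)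
    (J.mul_mem_left (u ^ 2 * D' h ^ 2) e2))
    (J.mul_mem_left (2 * u ^ 2 * D' h * D' k + 2 * D' u * u * (h * D' k + k * D' h) +
      D' u ^ 2 * (h * k)) e0)
  convert this using 1; ring

theorem exists_mul_pderiv_sq_mem {F : MvPolynomial (Fin 4) ℂ} {b : Frame}
    {h k : MvPowerSeries (Fin 3) ℂ} (ha : Associated (spaceGerm F b) (h * k))
    (hh : linPart h 2 ≠ 0) (hk : linPart k 2 ≠ 0) (i : Fin 3) :
    ∃ s, MvPolynomial.eval 0 s = 1 ∧ s * MvPolynomial.pderiv i (chart b F) ^ 2 ∈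
      Ideal.span {chart b F, MvPolynomial.pderiv 2 (chart b F)} := by
  apply exists_mul_mem_of_mem_map
  obtain ⟨u, hu⟩ := ha.symm
  rw [spaceGerm_eq] at hu
  have := sq_derivation_mem (MvPowerSeries.pderiv ℂ 2) (MvPowerSeries.pderiv ℂ i) (h := h) (k := k)
    u.isUnit (by rwa [FatSilhouette.isUnit_iff, ← linPart_eq_pderiv])
    (by rwa [FatSilhouette.isUnit_iff, ← linPart_eq_pderiv])
  rw [hu] at this
  rw [Ideal.map_span, Set.image_pair, map_pow]
  have e : ∀ j : Fin 3, MvPowerSeries.pderiv ℂ j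
      (MvPolynomial.coeToMvPowerSeries.ringHom (chart b F)) =
      MvPolynomial.coeToMvPowerSeries.ringHom (MvPolynomial.pderiv j (chart b F)) :=
    fun j => MvPowerSeries.pderiv_coe _
  rwa [e, e] at this

theorem exists_coordPoly (b : Frame) (i : Fin 4) :
    ∃ L : MvPolynomial (Fin 4) ℂ, ∀ q, MvPolynomial.eval q L = b.repr q i := by
  refine ⟨∑ j, MvPolynomial.C (b.repr (Pi.single j 1) i) * MvPolynomial.X j, fun q => ?_⟩
  conv_rhs => rw [pi_eq_sum_univ' q]
  simp [mul_comm]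

/-- Denominators are cleared so that a function on the affine chart becomes a polynomial on the
cone, where the proper contour is defined. -/
theorem exists_homogenization (b : Frame) (s : MvPolynomial (Fin 3) ℂ) :
    ∃ (N : ℕ) (S : MvPolynomial (Fin 4) ℂ), ∀ q, b.repr q 0 ≠ 0 → MvPolynomial.eval q S =
      b.repr q 0 ^ N * MvPolynomial.eval (fun i : Fin 3 => b.repr q i.succ / b.repr q 0) s := by
  obtain ⟨L, hL⟩ := exists_coordPoly b 0
  induction s using MvPolynomial.induction_on with
  | C a => exact ⟨0, MvPolynomial.C a, by simp⟩
  | add f g hf hg =>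
    obtain ⟨N, S, h⟩ := hf
    obtain ⟨M, T, h'⟩ := hg
    refine ⟨N + M, L ^ M * S + L ^ N * T, fun q hq => ?_⟩
    simp only [map_add, map_mul, map_pow, hL, h q hq, h' q hq]
    ring
  | mul_X f i hf =>
    obtain ⟨N, S, h⟩ := hf
    obtain ⟨M, hM⟩ := exists_coordPoly b i.succ
    refine ⟨N + 1, S * M, fun q hq => ?_⟩
    simp only [map_mul, MvPolynomial.eval_X, hM, h q hq]
    field_simp
    ring

/-- A polynomial is exhibited that vanishes on all smooth points of the contour but not at the given
point: where the local multipliers do not vanish, all derivatives of `F` vanish on the contour. -/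
theorem notMem_properContour_of_germ {F : MvPolynomial (Fin 4) ℂ} {d : ℕ} (hF : F.IsHomogeneous d)
    {b : Frame} {h k : MvPowerSeries (Fin 3) ℂ} (ha : Associated (spaceGerm F b) (h * k))
    (hh : linPart h 2 ≠ 0) (hk : linPart k 2 ≠ 0) : b 0 ∉ properContour F (b 3) := by
  intro hR
  choose s hs0 hs using exists_mul_pderiv_sq_mem ha hh hk
  obtain ⟨N, S, hS⟩ := exists_homogenization b (∏ i, s i)
  obtain ⟨L, hL⟩ := exists_coordPoly b 0
  have hv : L * S ∈ MvPolynomial.vanishingIdeal ℂ {q | q ∈ contour F (b 3) ∧ grad F q ≠ 0} := by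
    rw [mem_vanishingIdeal]
    rintro q ⟨hq, hgr⟩
    rw [map_mul, hL]
    by_cases h0 : b.repr q 0 = 0
    · rw [h0, zero_mul]
    set x : Fin 3 → ℂ := fun i => b.repr q i.succ / b.repr q 0 with hx
    have hqx : b 0 + ∑ i : Fin 3, x i • b i.succ = (b.repr q 0)⁻¹ • q := by
      have e : q = b.repr q 0 • b 0 + ∑ i : Fin 3, b.repr q i.succ • b i.succ := by
        rw [← Fin.sum_univ_succ (fun i => b.repr q i • b i), b.sum_repr]
      refine Eq.trans ?_ (congrArg ((b.repr q 0)⁻¹ • ·) e.symm)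
      rw [smul_add, smul_smul, inv_mul_cancel₀ h0, one_smul, Finset.smul_sum]
      refine congrArg₂ _ rfl (Finset.sum_congr rfl fun i _ => ?_)
      rw [smul_smul, ← div_eq_inv_mul]
    have hc : b 0 + ∑ i : Fin 3, x i • b i.succ ∈ contour F (b 3) := by
      rw [hqx]; exact smul_mem_contour hF _ _ hq
    rw [hS q h0, map_prod]
    by_contra hne
    have hsi : ∀ i, MvPolynomial.eval x (s i) ≠ 0 := fun i hi =>
      hne (by rw [Finset.prod_eq_zero (Finset.mem_univ i) hi]; simp)
    have hle : Ideal.span {chart b F, MvPolynomial.pderiv 2 (chart b F)} ≤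
        RingHom.ker (MvPolynomial.eval x) := by
      rw [Ideal.span_le]
      rintro _ (rfl | rfl)
      · rw [SetLike.mem_coe, RingHom.mem_ker, eval_chart]; exact hc.1
      · rw [SetLike.mem_coe, RingHom.mem_ker, eval_pderiv_chart]; exact hc.2
    have hd : ∀ i : Fin 3, dirDeriv F (b i.succ) (b 0 + ∑ i : Fin 3, x i • b i.succ) = 0 := by
      intro i
      have := hle (hs i)
      rw [RingHom.mem_ker, map_mul, map_pow, eval_pderiv_chart] at this
      exact eq_zero_of_pow_eq_zero ((mul_eq_zero.1 this).resolve_left (hsi i))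
    have hgr' := (grad_eq_zero_iff hF hc.1 (shift b (x 0) (x 1) (x 2))
      (by rw [shift_zero]; simp [Fin.sum_univ_three, add_assoc])).2 fun i => by
        rw [shift_of_ne _ _ _ _ (Fin.succ_ne_zero i)]; exact hd i
    apply hgr
    have h1 : q = b.repr q 0 • (b 0 + ∑ i : Fin 3, x i • b i.succ) := by
      rw [hqx, smul_smul, mul_inv_cancel₀ h0, one_smul]
    have h2 := smul_mem_singularLocus hF (b.repr q 0) (F := F) ⟨hc.1, hgr'⟩
    rw [← h1] at h2
    exact h2.2
  have h0 := MvPolynomial.mem_zeroLocus_iff.1 hR _ hv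
  change MvPolynomial.eval (b 0) (L * S) = 0 at h0
  have h1 : b.repr (b 0) 0 = 1 := by simp
  rw [map_mul, hL, hS _ (by rw [h1]; exact one_ne_zero), h1, one_pow, one_mul, one_mul] at h0
  have h2 : (fun i : Fin 3 => b.repr (b 0) i.succ / 1) = 0 := by
    ext i
    fin_cases i <;> simp
  rw [h2, map_prod, Finset.prod_congr rfl fun i _ => hs0 i] at h0
  simp at h0

/-- A double point at which the line through the centre has multiplicity two is not on the proper
contour. -/
theorem IsLocalFactor.notMem_properContour {F : MvPolynomial (Fin 4) ℂ} {d : ℕ} {b : Frame} {z : ℂ}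
    {W V : PlaneSeries[X]} (H : IsLocalFactor F b z W V) (hF : F.IsHomogeneous d)
    (h2 : W.natDegree = 2) (hd : IsDoublePoint F (b 0 + z • b 3)) :
    b 0 + z • b 3 ∉ properContour F (b 3) := by
  obtain ⟨h, hc, ha⟩ := hd.2 (shift b 0 0 z) (shift_zero' b z)
  have h3 : shift b 0 0 z 3 = b 3 := shift_of_ne _ _ _ _ (by decide)
  obtain ⟨u, hu⟩ := (ha.map toSeries).trans (by rw [map_mul]) |>.symm.trans H.germ.symm
  have hu2 := congrArg (fun w => constantCoeff (PowerSeries.coeff 2 w)) hu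
  have hm : constantCoeff (PowerSeries.coeff 2
      (taylor (MvPowerSeries.C z) W : PowerSeries PlaneSeries)) = 1 := by
    have := H.isDist.monic.coeff_natDegree
    rw [H.natDegree_taylor, h2] at this
    rw [Polynomial.coeff_coe, this, map_one]
  have hz : ∀ i, constantCoeff (PowerSeries.coeff 0 (toSeries (h i))) = 0 := fun i => by
    have := constantCoeff_toSeries (h i)
    rw [hc.1 i] at this
    rwa [PowerSeries.coeff_zero_eq_constantCoeff_apply]
  have hl : ∀ i, constantCoeff (PowerSeries.coeff 1 (toSeries (h i))) = linPart (h i) 2 := fun i => by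
    rw [← lin3_toSeries]; rfl
  simp only [hm, coeff_two_mul', coeff_one_mul', coeff_zero_mul', map_add, map_mul, hz, hl] at hu2
  -- Comparison of the coefficients of `z²` over the origin: multiplicity two means that neither
  -- sheet is tangent to the line.
  have h1 : linPart (h 0) 2 * linPart (h 1) 2 ≠ 0 := by
    intro h0
    simp [h0] at hu2
  rw [← shift_zero', ← h3]
  exact notMem_properContour_of_germ hF ha (left_ne_zero_of_mul h1) (right_ne_zero_of_mul h1)

end Krull

end FatSilhouette
end

noncomputable section

namespace FatSilhouette

open Polynomial hiding constantCoeff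
open MvPowerSeries (constantCoeff)

/-! ### Derivations that act on coefficients. -/

section CoeffDeriv

variable {R A : Type*} [CommRing R] [CommRing A] [Algebra R A]

/-- The derivation of the polynomial ring that acts on the coefficients. -/
def coeffDeriv (d : Derivation R A A) : Derivation R A[X] A[X] :=
  PolynomialModule.equivPolynomialSelf.compDer d.mapCoeffs

theorem coeff_coeffDeriv (d : Derivation R A A) (p : A[X]) (i : ℕ) :
    (coeffDeriv d p).coeff i = d (p.coeff i) := rfl

theorem coeffDeriv_C (d : Derivation R A A) (a : A) : coeffDeriv d (C a) = C (d a) := by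
  ext i
  rw [coeff_coeffDeriv, coeff_C, coeff_C]
  split_ifs <;> simp

theorem coeffDeriv_X (d : Derivation R A A) : coeffDeriv d (X : A[X]) = 0 := by
  ext i
  rw [coeff_coeffDeriv, coeff_X]
  split_ifs <;> simp

end CoeffDeriv

/-! ### Formal points of the contour and their images. -/

section FormalPoint

variable {F : MvPolynomial (Fin 4) ℂ} {d : ℕ} {b : Frame}

theorem derivative_fibreHom (b : Frame) (G : MvPolynomial (Fin 4) ℂ) :
    derivative (fibreHom b G) = fibreHom b (dirPoly G (b 3)) := by
  induction G using MvPolynomial.induction_on with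
  | C a => rw [fibreHom_C, derivative_C]; simp [dirPoly]
  | add G H hG hH => rw [map_add, map_add, hG, hH, ← map_add, dirPoly_add]
  | mul_X G j hG =>
    rw [map_mul, derivative_mul, hG, dirPoly_mul_X, map_add, map_mul, map_mul, fibreHom_X, fibreHom_C]
    simp only [derivative_add, derivative_C, derivative_mul, derivative_X, zero_mul, zero_add, mul_one]
    ring

/-- The chain rule: differentiating coefficients in `x` or `y` is the directional derivative along
the corresponding vector of the frame. -/
theorem coeffDeriv_fibreHom (b : Frame) (i : Fin 2) (G : MvPolynomial (Fin 4) ℂ) :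
    coeffDeriv (MvPowerSeries.pderiv ℂ i) ((fibreHom b G).map toPlane) =
      (fibreHom b (dirPoly G (b i.castSucc.succ))).map toPlane := by
  have hX : coeffDeriv (MvPowerSeries.pderiv ℂ i : Derivation ℂ PlaneSeries PlaneSeries) X = 0 :=
    coeffDeriv_X _
  induction G using MvPolynomial.induction_on with
  | C a =>
    rw [fibreHom_C, Polynomial.map_C, coeffDeriv_C, toPlane_C, MvPowerSeries.pderiv_C]
    simp [dirPoly]
  | add G H hG hH =>
    rw [map_add, Polynomial.map_add, map_add, hG, hH, ← Polynomial.map_add, ← map_add, dirPoly_add]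
  | mul_X G j hG =>
    have e : coeffDeriv (MvPowerSeries.pderiv ℂ i) ((fibreHom b (MvPolynomial.X j)).map toPlane) =
        C (MvPowerSeries.C (b i.castSucc.succ j)) := by
      have e1 : MvPowerSeries.pderiv ℂ i (toPlane (MvPolynomial.C (b 0 j) +
          MvPolynomial.C (b 1 j) * MvPolynomial.X 0 + MvPolynomial.C (b 2 j) * MvPolynomial.X 1)) =
          MvPowerSeries.C (b i.castSucc.succ j) := by
        refine (MvPowerSeries.pderiv_coe _).trans ?_
        rw [← toPlane_C, map_add, map_add, MvPolynomial.pderiv_C, MvPolynomial.pderiv_C_mul,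
          MvPolynomial.pderiv_C_mul, MvPolynomial.pderiv_X, MvPolynomial.pderiv_X]
        fin_cases i <;> simp
      rw [fibreHom_X, Polynomial.map_add, Polynomial.map_mul, Polynomial.map_C, Polynomial.map_C,
        Polynomial.map_X, map_add, coeffDeriv_C, e1, Derivation.leibniz, coeffDeriv_C, hX, toPlane_C,
        MvPowerSeries.pderiv_C]
      simp
    rw [map_mul, Polynomial.map_mul, Derivation.leibniz, e, hG, dirPoly_mul_X, map_add, map_mul,
      map_mul, Polynomial.map_add, Polynomial.map_mul, Polynomial.map_mul, fibreHom_C,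
      Polynomial.map_C, toPlane_C, smul_eq_mul, smul_eq_mul]

variable {A : Type*} [CommRing A]

/-- Evaluation of polynomials at `(x, y, β)`. -/
def pointHom (φ : PlaneSeries →+* A) (β : A) : MvPolynomial (Fin 3) ℂ →+* A :=
  MvPolynomial.eval₂Hom (φ.comp MvPowerSeries.C) ![φ (MvPowerSeries.X 0), φ (MvPowerSeries.X 1), β]

theorem pointHom_chart (φ : PlaneSeries →+* A) (β : A) (G : MvPolynomial (Fin 4) ℂ) :
    pointHom φ β (chart b G) = (fibreHom b G).eval₂ (φ.comp toPlane) β := by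
  have : (pointHom φ β).comp (chart b) = (eval₂RingHom (φ.comp toPlane) β).comp (fibreHom b) := by
    apply MvPolynomial.ringHom_ext
    · intro c
      simp [chart_C, fibreHom_C, pointHom]
    · intro j
      simp [chart_X, fibreHom_X, Fin.sum_univ_three, pointHom]
      ring
  exact RingHom.congr_fun this G

theorem pointHom_rename (φ : PlaneSeries →+* A) (β : A) (G : MvPolynomial (Fin 2) ℂ) :
    pointHom φ β (MvPolynomial.rename Fin.castSucc G) = φ (toPlane G) := by
  have : (pointHom φ β).comp (MvPolynomial.rename (Fin.castSucc : Fin 2 → Fin 3)).toRingHom =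
      φ.comp toPlane := by
    apply MvPolynomial.ringHom_ext
    · intro c
      simp [pointHom]
    · intro j
      fin_cases j <;> simp [pointHom]
  exact RingHom.congr_fun this G

theorem eval₂_sheet (hp : MvPolynomial.eval (b 3) F ≠ 0) (φ : PlaneSeries →+* A) {β : A}
    (h : (sheet F b).eval₂ φ β = 0) : (fibreHom b F).eval₂ (φ.comp toPlane) β = 0 := by
  rw [sheet, eval₂_mul, eval₂_C, eval₂_map, fibrePoly_eq] at h
  exact (IsUnit.mul_right_eq_zero (((isUnit_iff_ne_zero.2 (inv_ne_zero hp)).map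
    MvPowerSeries.C).map φ)).1 h

theorem eval₂_derivative_sheet (hp : MvPolynomial.eval (b 3) F ≠ 0) (φ : PlaneSeries →+* A) {β : A}
    (h : (derivative (sheet F b)).eval₂ φ β = 0) :
    (fibreHom b (dirPoly F (b 3))).eval₂ (φ.comp toPlane) β = 0 := by
  rw [sheet, derivative_C_mul, derivative_map, eval₂_mul, eval₂_C, eval₂_map, fibrePoly_eq,
    derivative_fibreHom] at h
  exact (IsUnit.mul_right_eq_zero (((isUnit_iff_ne_zero.2 (inv_ne_zero hp)).map
    MvPowerSeries.C).map φ)).1 h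

/-- Series in the ideal of the proper silhouette, times partial derivatives of `F`, vanish on the
contour. -/
theorem map_mul_eval₂_eq_zero [IsDomain A] (hp : MvPolynomial.eval (b 3) F ≠ 0)
    (φ : PlaneSeries →+* A) {β : A} (h0 : (sheet F b).eval₂ φ β = 0)
    (h1 : (derivative (sheet F b)).eval₂ φ β = 0) {a : PlaneSeries} (ha : a ∈ properIdeal F b)
    (j : Fin 4) : φ a * (fibreHom b (MvPolynomial.pderiv j F)).eval₂ (φ.comp toPlane) β = 0 := by
  by_cases hj : (fibreHom b (MvPolynomial.pderiv j F)).eval₂ (φ.comp toPlane) β = 0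
  · rw [hj, mul_zero]
  have hle : properIdeal F b ≤ RingHom.ker φ := by
    rw [properIdeal, localIdeal, Ideal.map_le_iff_le_comap]
    intro G hG
    have := map_mul_map_eq_zero (pointHom φ β) (by rw [pointHom_chart]; exact eval₂_sheet hp φ h0)
      (by rw [pointHom_chart]; exact eval₂_derivative_sheet hp φ h1) hG j
    rw [pointHom_rename, pointHom_chart] at this
    exact (mul_eq_zero.1 this).resolve_right hj
  rw [show φ a = 0 from hle ha, zero_mul]

theorem constantCoeff_eval₂ (b : Frame) (β : PlaneSeries) (G : MvPolynomial (Fin 4) ℂ) :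
    constantCoeff ((fibreHom b G).eval₂ toPlane β) =
      MvPolynomial.eval (b 0 + constantCoeff β • b 3) G := by
  rw [hom_eval₂, constantCoeff_comp_toPlane, eval_fibreHom]
  simp

/-- The branch of the silhouette at a smooth point of the contour at which the line through the
centre has multiplicity two contains the proper silhouette. -/
theorem IsLocalFactor.properIdeal_le {z : ℂ} {W V : PlaneSeries[X]} (H : IsLocalFactor F b z W V)
    (hF : F.IsHomogeneous d) (hp : MvPolynomial.eval (b 3) F ≠ 0) (h2 : W.natDegree = 2)
    (hs : b 0 + z • b 3 ∉ singularLocus F) : properIdeal F b ≤ Ideal.span {disc W} := by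
  obtain ⟨β, δ, hβ⟩ := exists_taylor_quadratic H.dist.monic h2
  have hδ : Associated (disc W) δ := by
    rw [← FatSilhouette.disc_taylor β W, hβ]; exact disc_quadratic δ
  have hsm : IsSmooth δ := isSmooth_of_order (by
    rw [← order_of_associated hδ, H.order_disc_of_smooth hF hp h2 hs])
  rw [Ideal.span_singleton_eq_span_singleton.2 hδ]
  have hW0 : W.eval β = -δ := by
    have := congrArg (eval 0) hβ
    rw [taylor_eval] at this
    simpa using this
  have hW1 : (derivative W).eval β = 0 := by
    have := congrArg (fun f => (derivative f).eval 0) hβ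
    rw [taylor_apply, derivative_comp, eval_mul, eval_comp] at this
    simpa using this
  have hβ0 : constantCoeff β = z := by
    have hf := H.dist.fibre_eq
    have e : (fibre W).eval (constantCoeff β) = constantCoeff (W.eval β) := by
      rw [fibre, eval_map_apply]
    rw [hf, h2, hW0, map_neg, hsm.1, neg_zero] at e
    simpa [sub_eq_zero] using e
  -- Modulo the prime `δ`, the series `β` is a double root of the equation: a formal point of the
  -- contour over the branch `δ = 0`. Some partial derivative of `F` does not vanish at its origin,
  -- so every equation of `B` vanishes on the branch.
  set φ := Ideal.Quotient.mk (Ideal.span {δ})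
  have hδp : (Ideal.span {δ}).IsPrime := (Ideal.span_singleton_prime hsm.ne_zero).2 hsm.prime
  have hφ : φ δ = 0 := Ideal.Quotient.eq_zero_iff_mem.2 (Ideal.mem_span_singleton_self δ)
  have h0 : (sheet F b).eval₂ φ (φ β) = 0 := by
    rw [eval₂_hom, H.eq, eval_mul, hW0, map_mul, map_neg, hφ]; simp
  have h1 : (derivative (sheet F b)).eval₂ φ (φ β) = 0 := by
    rw [eval₂_hom, H.eq, derivative_mul, eval_add, eval_mul, eval_mul, hW0, hW1, zero_mul, zero_add,
      map_mul, map_neg, hφ]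
    simp
  obtain ⟨j, hj⟩ : ∃ j, MvPolynomial.eval (b 0 + z • b 3) (MvPolynomial.pderiv j F) ≠ 0 := by
    by_contra! hn
    refine hs ⟨?_, funext hn⟩
    exact ((H.two_le_iff hp).1 h2.ge).1
  intro a ha
  have h3 := map_mul_eval₂_eq_zero hp φ h0 h1 ha j
  rw [← hom_eval₂, mul_eq_zero] at h3
  rcases h3 with h3 | h3
  · exact Ideal.Quotient.eq_zero_iff_mem.1 h3
  · exfalso
    obtain ⟨k, hk⟩ := Ideal.mem_span_singleton'.1 (Ideal.Quotient.eq_zero_iff_mem.1 h3)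
    apply hj
    rw [← hβ0, ← constantCoeff_eval₂, ← hk, map_mul, hsm.1, mul_zero]

/-- Over the origin the only root of `w` is zero, where `g` does not vanish; Nakayama's lemma lifts
this to `ℂ⟦x, y⟧`. The polynomial `g` is not supposed to be monic, so the resultant criterion does
not apply. -/
theorem isCoprime_of_isDist {w g : PlaneSeries[X]} (hw : IsDist w) (hg : IsUnit (g.coeff 0)) :
    IsCoprime w g := by
  set M := IsLocalRing.maximalIdeal PlaneSeries
  set K := Ideal.span {w, g} ⊔ M.map C with hK
  have hwK : w ∈ K := le_sup_left (a := Ideal.span {w, g}) (Ideal.subset_span (Set.mem_insert _ _))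
  have hgK : g ∈ K := le_sup_left (a := Ideal.span {w, g})
    (Ideal.subset_span (Set.mem_insert_of_mem _ rfl))
  have hX : X ∈ K.radical := by
    refine ⟨w.natDegree, ?_⟩
    have : X ^ w.natDegree - w ∈ K := by
      refine le_sup_right (a := Ideal.span {w, g}) (Ideal.mem_map_C_iff.2 fun n => ?_)
      rw [coeff_sub, coeff_X_pow]
      rcases lt_trichotomy n w.natDegree with h | h | h
      · rw [if_neg h.ne, zero_sub]; exact M.neg_mem (hw.coeff_mem h)
      · rw [if_pos h, h, hw.monic.coeff_natDegree, sub_self]; exact M.zero_mem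
      · rw [if_neg h.ne', coeff_eq_zero_of_natDegree_lt h, sub_self]; exact M.zero_mem
    have h2 := K.add_mem this hwK
    rwa [sub_add_cancel] at h2
  have htop : K = ⊤ := by
    rw [← Ideal.radical_eq_top]
    refine Ideal.eq_top_of_isUnit_mem _ ?_ (hg.map C)
    have h1 : g - X * divX g ∈ K.radical :=
      K.radical.sub_mem (Ideal.le_radical hgK) (K.radical.mul_mem_right _ hX)
    have h2 : g - X * divX g = C (g.coeff 0) := by
      rw [sub_eq_iff_eq_add, add_comm, X_mul_divX_add]
    rwa [h2] at h1
  obtain ⟨j, hj, k, hk, e⟩ := Submodule.mem_sup.1 (htop ▸ Submodule.mem_top : (1 : PlaneSeries[X]) ∈ K)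
  obtain ⟨r, hr, hrJ⟩ := exists_sub_one_mem_of_monic hw.monic
    (Ideal.subset_span (Set.mem_insert _ _)) hj (n := M) (by rwa [← e, add_sub_cancel_left])
  have hru : IsUnit r := by
    rw [FatSilhouette.isUnit_iff]
    have := mem_maximalIdeal.1 hr
    rw [map_sub, map_one, sub_eq_zero] at this
    rw [this]; exact one_ne_zero
  have h1 := Ideal.eq_top_of_isUnit_mem _ hrJ (hru.map C)
  obtain ⟨x, y, hxy⟩ := Ideal.mem_span_pair.1 (h1 ▸ Submodule.mem_top :
    (1 : PlaneSeries[X]) ∈ Ideal.span {w, g})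
  exact ⟨x, y, hxy⟩

theorem map_resultant_eq_zero {A K : Type*} [CommRing A] [Field K] (φ : A →+* K)
    {f g : A[X]} (hf : f.natDegree ≠ 0) {β : K} (h0 : f.eval₂ φ β = 0) (h1 : g.eval₂ φ β = 0) :
    φ (resultant f g) = 0 := by
  obtain ⟨p, q, -, -, e⟩ := exists_mul_add_mul_eq_C_resultant f g le_rfl le_rfl (Or.inl hf)
  have := congrArg (fun f => f.eval₂ φ β) e
  simp only [eval₂_add, eval₂_mul, h0, h1, zero_mul, add_zero, eval₂_C] at this
  exact this.symm

theorem eval₂_ne_zero_of_isCoprime {A K : Type*} [CommRing A] [Field K] (φ : A →+* K)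
    {f g : A[X]} (h : IsCoprime f g) {β : K} (h0 : f.eval₂ φ β = 0) : g.eval₂ φ β ≠ 0 := by
  intro h1
  obtain ⟨p, q, e⟩ := h
  have := congrArg (fun f => f.eval₂ φ β) e
  simp [eval₂_add, eval₂_mul, h0, h1] at this

/-- Away from the proper contour, the partial derivatives of `F` vanish on the contour, so that
a smooth sheet has no formal contour points off the other sheets. -/
theorem eval₂_eq_zero_of_double {K : Type*} [Field K] (hp : MvPolynomial.eval (b 3) F ≠ 0)
    (htop : properIdeal F b = ⊤) {w v : PlaneSeries[X]} (e : sheet F b = w * v) (hw : IsDist w)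
    (h1 : 1 ≤ w.natDegree) (hl : lin3 (w : PowerSeries PlaneSeries) ≠ 0)
    (φ : PlaneSeries →+* K) {β : K} (h0 : w.eval₂ φ β = 0)
    (h0' : (derivative w).eval₂ φ β = 0) : v.eval₂ φ β = 0 := by
  by_contra hv
  have hs0 : (sheet F b).eval₂ φ β = 0 := by rw [e, eval₂_mul, h0, zero_mul]
  have hs1 : (derivative (sheet F b)).eval₂ φ β = 0 := by
    rw [e, derivative_mul, eval₂_add, eval₂_mul, eval₂_mul, h0, h0', zero_mul, zero_mul, add_zero]
  have hj : ∀ j, (fibreHom b (MvPolynomial.pderiv j F)).eval₂ (φ.comp toPlane) β = 0 := fun j => by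
    have := map_mul_eval₂_eq_zero hp φ hs0 hs1 (a := 1) (by rw [htop]; trivial) j
    rwa [map_one, one_mul] at this
  have hdir : ∀ p, (fibreHom b (dirPoly F p)).eval₂ (φ.comp toPlane) β = 0 := by
    intro p
    rw [dirPoly, map_sum, eval₂_finsetSum]
    refine Finset.sum_eq_zero fun j _ => ?_
    rw [map_mul, eval₂_mul, hj j, mul_zero]
  -- As `B` is absent, all partial derivatives of `F` vanish at the formal point, and hence those of
  -- `w`. But the constant term of `w` has a non-zero linear part if `deg w ≥ 2`, so one of these
  -- derivatives is coprime to `w`.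
  have hD : ∀ i : Fin 2, (coeffDeriv (MvPowerSeries.pderiv ℂ i) w).eval₂ φ β = 0 := by
    intro i
    have h2 : (coeffDeriv (MvPowerSeries.pderiv ℂ i) (sheet F b)).eval₂ φ β = 0 := by
      rw [sheet, Derivation.leibniz, coeffDeriv_C, MvPowerSeries.pderiv_C, fibrePoly_eq,
        coeffDeriv_fibreHom]
      simp only [map_zero, add_zero, smul_eq_mul, eval₂_mul, eval₂_map, hdir, mul_zero]
    rw [e, Derivation.leibniz, smul_eq_mul, smul_eq_mul, eval₂_add, eval₂_mul, eval₂_mul, h0, zero_mul,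
      zero_add] at h2
    exact (mul_eq_zero.1 h2).resolve_left hv
  rcases h1.eq_or_lt with h1 | h1
  · obtain ⟨a, -, rfl⟩ := hw.eq_X_sub_C h1.symm
    simp at h0'
  · obtain ⟨i, hi⟩ : ∃ i, linPart (w.coeff 0) i ≠ 0 := by
      by_contra! hn
      apply hl
      rw [lin3_coe, hn, hn, hw.constantCoeff_coeff h1]
      ext i; fin_cases i <;> rfl
    refine eval₂_ne_zero_of_isCoprime φ (isCoprime_of_isDist hw ?_) h0 (hD i)
    rwa [coeff_coeffDeriv, FatSilhouette.isUnit_iff, ← linPart_eq_pderiv]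

/-- Over an algebraic closure of the field of fractions modulo `P` there is a double root of `w₀
w₁`. A root of one sheet alone would be a double root of this sheet, which is impossible away from
`B`; so it is a common root. -/
theorem resultant_mem_of_disc_mem (hp : MvPolynomial.eval (b 3) F ≠ 0)
    (htop : properIdeal F b = ⊤) {w₀ w₁ v : PlaneSeries[X]} (e : sheet F b = w₀ * w₁ * v)
    (hv : IsCoprime (w₀ * w₁) v) (d₀ : IsDist w₀) (d₁ : IsDist w₁)
    (n₀ : 1 ≤ w₀.natDegree) (n₁ : 1 ≤ w₁.natDegree)
    (l₀ : lin3 (w₀ : PowerSeries PlaneSeries) ≠ 0) (l₁ : lin3 (w₁ : PowerSeries PlaneSeries) ≠ 0)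
    {P : Ideal PlaneSeries} (hP : P.IsPrime) (hD : disc (w₀ * w₁) ∈ P) : resultant w₀ w₁ ∈ P := by
  let K := AlgebraicClosure (FractionRing (PlaneSeries ⧸ P))
  let φ : PlaneSeries →+* K := ((algebraMap (FractionRing (PlaneSeries ⧸ P)) K).comp
    (algebraMap (PlaneSeries ⧸ P) _)).comp (Ideal.Quotient.mk P)
  have hφ : ∀ a, φ a = 0 ↔ a ∈ P := by
    intro a
    rw [← Ideal.Quotient.eq_zero_iff_mem]
    exact map_eq_zero_iff ((algebraMap (FractionRing (PlaneSeries ⧸ P)) K).comp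
      (algebraMap (PlaneSeries ⧸ P) _)) ((algebraMap (FractionRing (PlaneSeries ⧸ P)) K).injective.comp
        (IsFractionRing.injective (PlaneSeries ⧸ P) (FractionRing (PlaneSeries ⧸ P))))
  have : CharZero K := charZero_of_injective_ringHom (φ.comp MvPowerSeries.C).injective
  obtain ⟨β, h0, h1⟩ := (map_disc_eq_zero_iff φ (d₀.monic.mul d₁.monic)).1 ((hφ _).2 hD)
  have hvβ : v.eval₂ φ β ≠ 0 := eval₂_ne_zero_of_isCoprime φ hv h0
  rw [derivative_mul, eval₂_add, eval₂_mul, eval₂_mul] at h1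
  rw [eval₂_mul, mul_eq_zero] at h0
  suffices h : w₀.eval₂ φ β = 0 ∧ w₁.eval₂ φ β = 0 from
    (hφ _).1 (map_resultant_eq_zero φ (by omega) h.1 h.2)
  rcases h0 with h0 | h0
  · refine ⟨h0, ?_⟩
    by_contra hn
    rw [h0, zero_mul, add_zero] at h1
    have := eval₂_eq_zero_of_double hp htop (e.trans (mul_assoc _ _ _)) d₀ n₀ l₀ φ h0
      ((mul_eq_zero.1 h1).resolve_right hn)
    rw [eval₂_mul, mul_eq_zero] at this
    exact this.elim hn hvβ
  · refine ⟨?_, h0⟩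
    by_contra hn
    rw [h0, mul_zero, zero_add] at h1
    have := eval₂_eq_zero_of_double hp htop (v := w₀ * v) (by rw [e]; ring) d₁ n₁ l₁ φ h0
      ((mul_eq_zero.1 h1).resolve_left hn)
    rw [eval₂_mul, mul_eq_zero] at this
    exact this.elim hn hvβ

/-- Away from the proper contour, the silhouette of two transversal smooth sheets is the image of
their intersection. -/
theorem IsLocalFactor.resultant_mem {z : ℂ} {W V : PlaneSeries[X]} (H : IsLocalFactor F b z W V)
    (hp : MvPolynomial.eval (b 3) F ≠ 0) (htop : properIdeal F b = ⊤) {w₀ w₁ : PlaneSeries[X]}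
    (e : taylor (MvPowerSeries.C z) W = w₀ * w₁) (d₀ : IsDist w₀) (d₁ : IsDist w₁)
    (n₀ : 1 ≤ w₀.natDegree) (n₁ : 1 ≤ w₁.natDegree)
    (hl : LinearIndependent ℂ ![lin3 w₀, lin3 w₁])
    {P : Ideal PlaneSeries} (hP : P.IsPrime) (hD : disc W ∈ P) : resultant w₀ w₁ ∈ P := by
  have h3 : shift b 0 0 z 3 = b 3 := shift_of_ne _ _ _ _ (by decide)
  refine resultant_mem_of_disc_mem (b := shift b 0 0 z) (v := taylor (MvPowerSeries.C z) V)
    (by rwa [h3]) ?_ ?_ ?_ d₀ d₁ n₀ n₁ (hl.ne_zero 0) (hl.ne_zero 1) hP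
    (by rwa [← e, FatSilhouette.disc_taylor])
  · rw [properIdeal, h3, localIdeal_shift]; exact htop
  · rw [sheet_shift, H.eq, taylor_mul, e]
  · rw [← e]
    exact H.isCoprime.map (taylorAlgHom (MvPowerSeries.C z)).toRingHom

end FormalPoint

end FatSilhouette
end

noncomputable section

namespace FatSilhouette

open Polynomial hiding constantCoeff
open MvPowerSeries (constantCoeff)

/-! ### The equation of the fat silhouette at a special point. -/

section Shape

variable {F : MvPolynomial (Fin 4) ℂ} {d : ℕ} {b : Frame}

theorem localIdeal_ne_top {A : Set (Fin 4 → ℂ)} (h : HasPointOver A b) : localIdeal A b ≠ ⊤ := by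
  intro htop
  have hle : localIdeal A b ≤ IsLocalRing.maximalIdeal PlaneSeries := by
    rw [localIdeal, Ideal.map_le_iff_le_comap]
    intro G hG
    obtain ⟨z, hz⟩ := h
    rw [Ideal.mem_comap, mem_maximalIdeal]
    refine (RingHom.congr_fun constantCoeff_comp_toPlane G).trans ?_
    exact mem_vanishingIdeal.1 hG 0 ⟨z, by simpa using hz⟩
  exact (IsLocalRing.maximalIdeal.isMaximal PlaneSeries).ne_top (top_le_iff.1 (htop ▸ hle))

theorem silhouetteEq_proper (hF : F.IsHomogeneous d) (hg : IsGoodProjection F (b 3)) (hd : 0 < d)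
    {h : PlaneSeries} (hB : properIdeal F b = Ideal.span {h}) (hW : singularIdeal F b = ⊤) :
    Associated (silhouetteEq F b) h := by
  obtain ⟨G, H, hD, h1, h2, h3, -⟩ := exists_factorization hF hg hd
  rw [hB, Ideal.span_singleton_le_span_singleton] at h1
  rw [hW, top_le_iff, Ideal.span_singleton_eq_top] at h2
  rw [hB, Ideal.mem_span_singleton] at h3
  refine hD.trans ((associated_mul_unit_left _ _ (h2.pow 2)).trans ?_)
  exact associated_of_dvd_dvd h1 ((h2.dvd_mul_right).1 h3)

theorem silhouetteEq_singular (hF : F.IsHomogeneous d) (hg : IsGoodProjection F (b 3)) (hd : 0 < d)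
    {g : PlaneSeries} (hB : properIdeal F b = ⊤) (hW : singularIdeal F b = Ideal.span {g}) :
    Associated (silhouetteEq F b) (g ^ 2) := by
  obtain ⟨G, H, hD, h1, h2, -, h3⟩ := exists_factorization hF hg hd
  rw [hW, Ideal.span_singleton_le_span_singleton] at h2
  rw [hB, top_le_iff, Ideal.span_singleton_eq_top] at h1
  rw [hW, Ideal.mem_span_singleton] at h3
  refine hD.trans ((associated_unit_mul_left _ _ h1).trans ?_)
  exact (associated_of_dvd_dvd h2 ((h1.dvd_mul_left).1 h3)).pow_pow

/-- The factor `G` divides `h`, `H` divides `g`, and both primes divide `G H`; since `h` and `g` are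
not associated, `h` has to divide `G` and `g` has to divide `H`. -/
theorem silhouetteEq_both (hF : F.IsHomogeneous d) (hg : IsGoodProjection F (b 3)) (hd : 0 < d)
    {h g : PlaneSeries} (hh : Prime h) (hg' : Prime g) (hn : ¬ Associated h g)
    (hB : properIdeal F b = Ideal.span {h}) (hW : singularIdeal F b = Ideal.span {g}) :
    Associated (silhouetteEq F b) (h * g ^ 2) := by
  obtain ⟨G, H, hD, h1, h2, h3, h4⟩ := exists_factorization hF hg hd
  rw [hB, Ideal.span_singleton_le_span_singleton] at h1
  rw [hW, Ideal.span_singleton_le_span_singleton] at h2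
  rw [hB, Ideal.mem_span_singleton] at h3
  rw [hW, Ideal.mem_span_singleton] at h4
  have a1 : h ∣ G := by
    refine (hh.dvd_or_dvd h3).resolve_right fun h5 => hn ?_
    exact (hh.dvd_prime_iff_associated hg').1 (h5.trans h2)
  have a2 : g ∣ H := by
    refine (hg'.dvd_or_dvd h4).resolve_left fun h5 => hn ?_
    exact ((hg'.dvd_prime_iff_associated hh).1 (h5.trans h1)).symm
  exact hD.trans ((associated_of_dvd_dvd h1 a1).mul_mul (associated_of_dvd_dvd h2 a2).pow_pow)

theorem pos_of_hasPointOver (hF : F.IsHomogeneous d) (hp : MvPolynomial.eval (b 3) F ≠ 0)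
    (h : HasPointOver (contour F (b 3)) b) : 0 < d := by
  obtain ⟨z, hz⟩ := h
  obtain ⟨W, V, H⟩ := exists_isLocalFactor (b := b) hF hp z
  have h2 := (H.two_le_iff hp).2 hz
  have := natDegree_sheet hF hp
  rw [H.eq, H.dist.monic.natDegree_mul H.monic] at this
  omega

/-- By the intersection condition `W` does not pass through singular points of `B`. -/
theorem singularIdeal_eq_top (hF : F.IsHomogeneous d) (hg : IsGoodProjection F (b 3))
    (h : properIdeal F b ≠ ⊤) (hs : ∀ k, IsSmooth k → properIdeal F b ≠ Ideal.span {k}) :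
    singularIdeal F b = ⊤ := by
  by_contra hn
  rcases hg.intersection b rfl (hasPointOver_properContour hF hg.center h)
    (hasPointOver_singularLocus hF hg.center hn) with ⟨k, g, hc, e, -⟩ | ⟨⟨k, g, hc, e, -⟩, -⟩
  · exact hs k hc.left e
  · exact hs k hc.left e

theorem properIdeal_eq_top (hF : F.IsHomogeneous d) (hg : IsGoodProjection F (b 3))
    (h : singularIdeal F b ≠ ⊤) (hs : ∀ k, IsSmooth k → singularIdeal F b ≠ Ideal.span {k}) :
    properIdeal F b = ⊤ := by
  by_contra hn
  rcases hg.intersection b rfl (hasPointOver_properContour hF hg.center hn)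
    (hasPointOver_singularLocus hF hg.center h) with ⟨k, g, hc, -, e⟩ | ⟨⟨k, g, hc, -, e⟩, -⟩
  · exact hs g hc.right e
  · exact hs g hc.right e

theorem span_ne_of_order {a k : PlaneSeries} (hk : IsSmooth k) (ha : a.order ≠ 1) :
    Ideal.span {a} ≠ Ideal.span {k} := fun h => ha (by
  rw [order_of_associated (Ideal.span_singleton_eq_span_singleton.1 h), hk.order_eq])

end Shape

/-! ### The conductor ideal in terms of local factors. -/

section Conductor

variable {F : MvPolynomial (Fin 4) ℂ} {d : ℕ} {b : Frame} {z z' : ℂ}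
  {W V W' V' : PlaneSeries[X]}

/-- The resultant is a combination of `f` and its derivative. So a cofactor with unit discriminant
contributes no points of the contour. -/
theorem jacIdeal_eq_top {A : Type*} [CommRing A] {f : A[X]}
    (hf : f.Monic) (h : IsUnit (disc f)) : jacIdeal f = ⊤ := by
  rcases Nat.eq_zero_or_pos f.natDegree with h0 | h0
  · rw [jacIdeal, eq_one_of_monic_natDegree_zero hf h0]
    exact Ideal.eq_top_of_isUnit_mem _ (Ideal.subset_span (Set.mem_insert _ _)) isUnit_one
  obtain ⟨x, y, -, -, e⟩ := exists_mul_add_mul_eq_C_resultant f (derivative f) le_rfl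
    (natDegree_derivative_le f) (Or.inl h0.ne')
  refine Ideal.eq_top_of_isUnit_mem _ (Ideal.mem_span_pair.2 ⟨x, y, ?_⟩) (h.map C)
  rw [disc, ← e, mul_comm x, mul_comm y]

/-- With `D = δ e` up to a unit, the elements killed by `δ` modulo `D` are the multiples of `e`:
each point of multiplicity two contributes the equation of the rest of the silhouette. -/
theorem condIdeal_eq_quadratic {D e : PlaneSeries} (hD : D ≠ 0) (hW : W.Monic)
    (h2 : W.natDegree = 2) (h : Associated D (disc W * e)) :
    condIdeal (Ideal.span {D}) (jacIdeal W) = Ideal.span {e} := by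
  obtain ⟨β, δ, hβ⟩ := exists_taylor_quadratic hW h2
  have hδ : Associated (disc W) δ := by
    rw [← FatSilhouette.disc_taylor β W, hβ]; exact disc_quadratic δ
  have h' := h.trans (hδ.mul_right e)
  ext a
  rw [← condIdeal_taylor _ β, hβ, condIdeal_quadratic _ _ (isUnit_natCast PlaneSeries 2 two_ne_zero),
    Ideal.mem_span_singleton, Ideal.mem_span_singleton, h'.dvd_iff_dvd_left]
  refine mul_dvd_mul_iff_left fun h0 => hD ?_
  rw [h0, zero_mul] at h'
  exact (associated_zero_iff_eq_zero _).1 h'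

theorem condIdeal_eq_cubic {D p q β : PlaneSeries} (hD : D ≠ 0)
    (hβ : taylor β W = X ^ 3 + C (3 * p) * X + C (2 * q)) (h : Associated D (disc W)) :
    condIdeal (Ideal.span {D}) (jacIdeal W) = Ideal.span {p, q} := by
  have h' : Associated D (p ^ 3 + q ^ 2) := h.trans (by
    rw [← FatSilhouette.disc_taylor β W, hβ]; exact disc_cubic p q)
  rw [← condIdeal_taylor _ β, hβ, Ideal.span_singleton_eq_span_singleton.2 h',
    condIdeal_cubic _ _ (isUnit_natCast PlaneSeries 2 two_ne_zero)
      (isUnit_natCast PlaneSeries 3 three_ne_zero)]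
  intro h0
  rw [h0] at h'
  exact hD ((associated_zero_iff_eq_zero _).1 h')

/-- The conductor ideal, if there is only one point of the contour. -/
theorem IsLocalFactor.conductorPreimage_eq (H : IsLocalFactor F b z W V)
    (hp : MvPolynomial.eval (b 3) F ≠ 0) (hu : IsUnit (disc V)) : conductorPreimage F b =
      condIdeal (Ideal.span {silhouetteEq F b}) (jacIdeal W) := by
  rw [FatSilhouette.conductorPreimage_eq hp, H.eq, (jacIdeal_mul H.isCoprime).1,
    jacIdeal_eq_top H.monic hu, inf_top_eq]

/-- The local factors at different points have no common root over the origin, so that of `z'`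
divides the cofactor of that of `z`. -/
theorem IsLocalFactor.exists_pair (H : IsLocalFactor F b z W V) (H' : IsLocalFactor F b z' W' V')
    (hz : z ≠ z') : ∃ U : PlaneSeries[X], U.Monic ∧ V = W' * U ∧ IsCoprime W' U := by
  have hc : IsCoprime W' W := H'.dist.isCoprime H.dist.monic (by
    rw [H.dist.fibre_eq]
    simpa using fun h => absurd (sub_eq_zero.1 h).symm hz)
  obtain ⟨U, hU⟩ := hc.dvd_of_dvd_mul_left
    (show W' ∣ W * V by rw [← H.eq, H'.eq]; exact dvd_mul_right _ _)
  have hUm : U.Monic := (H'.dist.monic.of_mul_monic_left (by rw [← hU]; exact H.monic))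
  refine ⟨U, hUm, hU, H'.dist.isCoprime hUm fun h0 => H'.ne ?_⟩
  have e : V' = W * U := by
    have : W' * V' = W' * (W * U) := by rw [← H'.eq, H.eq, hU]; ring
    exact mul_left_cancel₀ H'.dist.monic.ne_zero this
  rw [e, fibre_mul, eval_mul, h0, mul_zero]

/-- The conductor ideal, if there are two points of the contour. -/
theorem conductorPreimage_eq_pair (hF : F.IsHomogeneous d) (H : IsLocalFactor F b z W V)
    (H' : IsLocalFactor F b z' W' V') (hz : z ≠ z')
    (hp : MvPolynomial.eval (b 3) F ≠ 0) (h2 : 2 ≤ W.natDegree) :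
    ∃ u, Associated (silhouetteEq F b) (disc W * disc W' * u) ∧ (IsUnit u →
      conductorPreimage F b = condIdeal (Ideal.span {silhouetteEq F b}) (jacIdeal W) ⊔
        condIdeal (Ideal.span {silhouetteEq F b}) (jacIdeal W')) := by
  obtain ⟨U, hU, e, hc⟩ := H.exists_pair H' hz
  refine ⟨disc U, ?_, fun hu => ?_⟩
  · refine (H.disc_associated hF hp h2).trans ?_
    rw [mul_assoc, e]
    exact (disc_mul_associated H'.dist.monic hU hc).mul_left _
  · have h1 := jacIdeal_mul H.isCoprime
    rw [FatSilhouette.conductorPreimage_eq hp, H.eq, h1.1, condIdeal_inf _ h1.2]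
    conv_lhs => rw [e, (jacIdeal_mul hc).1, jacIdeal_eq_top hU hu, inf_top_eq]

theorem silhouetteEq_ne_zero (hF : F.IsHomogeneous d) (hg : IsGoodProjection F (b 3)) (hd : 0 < d) :
    silhouetteEq F b ≠ 0 := by
  intro h0
  have := silhouetteEq_associated_toPlane hF hg.center hd
  rw [h0, Associated.comm, associated_zero_iff_eq_zero] at this
  exact disc_fibrePoly_ne_zero hF hg hd (toPlane_injective (this.trans (map_zero _).symm))

end Conductor

end FatSilhouette
end

noncomputable section

namespace FatSilhouette

open Polynomial hiding constantCoeff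
open MvPowerSeries (constantCoeff)

/-! ### Recognition of coordinates by orders along arcs. -/

section Arcs

theorem jac_eq_zero_of_linEval {p q : PlaneSeries} {u : Fin 2 → ℂ} (hu : u ≠ 0)
    (hp : linEval p u = 0) (hq : linEval q u = 0) : jac p q = 0 := by
  simp only [linEval, Fin.sum_univ_two] at hp hq
  have h0 : u 0 * jac p q = 0 := by rw [jac]; linear_combination linPart q 1 * hp - linPart p 1 * hq
  have h1 : u 1 * jac p q = 0 := by rw [jac]; linear_combination linPart p 0 * hq - linPart q 0 * hp
  by_contra hj
  refine hu (funext fun i => ?_)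
  fin_cases i
  exacts [(mul_eq_zero.1 h0).resolve_right hj, (mul_eq_zero.1 h1).resolve_right hj]

theorem linEval_eq_zero_of_jac {p q : PlaneSeries} {u : Fin 2 → ℂ} (hs : linPart q ≠ 0)
    (hj : jac p q = 0) (hq : linEval q u = 0) : linEval p u = 0 := by
  simp only [linEval, Fin.sum_univ_two, jac] at *
  by_contra hn
  refine hs (funext fun i => (mul_eq_zero.1 ?_).resolve_right hn)
  fin_cases i
  · simp only [Fin.zero_eta]; linear_combination linPart p 0 * hq - u 1 * hj
  · simp only [Fin.mk_one]; linear_combination linPart p 1 * hq + u 0 * hj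

theorem linPart_eq_zero_of_jac {p h g : PlaneSeries} (H : IsPartOfCoords ![h, g])
    (hh : jac p h = 0) (hg : jac p g = 0) : linPart p = 0 := by
  have hj := (isPartOfCoords_iff_jac.1 H).2.2
  simp only [jac] at *
  refine funext fun i => (mul_eq_zero.1 ?_).resolve_right hj
  fin_cases i
  · simp only [Fin.zero_eta]; linear_combination linPart h 0 * hg - linPart g 0 * hh
  · simp only [Fin.mk_one]; linear_combination linPart h 1 * hg - linPart g 1 * hh

variable {ρ : PlaneSeries →ₐ[ℂ] PowerSeries ℂ} {h k : PlaneSeries}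

theorem X_dvd_arc (ρ : PlaneSeries →ₐ[ℂ] PowerSeries ℂ) {a : PlaneSeries}
    (ha : constantCoeff a = 0) : PowerSeries.X ∣ ρ a := by
  rw [PowerSeries.X_dvd_iff, constantCoeff_arc, ha]

theorem coeff_one_X_mul (a : PowerSeries ℂ) :
    PowerSeries.coeff 1 (PowerSeries.X * a) = PowerSeries.constantCoeff a := by
  rw [← PowerSeries.coeff_zero_eq_constantCoeff_apply]
  exact PowerSeries.coeff_succ_X_mul 0 a

/-- A smooth arc has contact of order at most three with a cusp: for contact four, both `h` and `k`
would vanish to order two along the arc. -/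
theorem not_X_pow_four_dvd_cusp (hρ : Function.Surjective ρ) (H : IsPartOfCoords ![h, k]) :
    ¬ PowerSeries.X ^ 4 ∣ ρ (h ^ 3 - k ^ 2) := by
  rintro ⟨e, he⟩
  obtain ⟨a, ha⟩ := X_dvd_arc ρ H.left.1
  obtain ⟨b, hb⟩ := X_dvd_arc ρ H.right.1
  have hX : Prime (PowerSeries.X : PowerSeries ℂ) := PowerSeries.X_prime
  have e1 : PowerSeries.X * a ^ 3 - b ^ 2 = PowerSeries.X ^ 2 * e := by
    refine mul_left_cancel₀ (pow_ne_zero 2 hX.ne_zero) ?_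
    rw [map_sub, map_pow, map_pow, ha, hb] at he
    linear_combination he
  obtain ⟨b', rfl⟩ : PowerSeries.X ∣ b := hX.dvd_of_dvd_pow (n := 2)
    ⟨a ^ 3 - PowerSeries.X * e, by linear_combination -e1⟩
  have e2 : a ^ 3 = PowerSeries.X * (e + b' ^ 2) := by
    refine mul_left_cancel₀ hX.ne_zero ?_
    linear_combination e1
  have ha' : PowerSeries.constantCoeff a = 0 :=
    PowerSeries.X_dvd_iff.1 (hX.dvd_of_dvd_pow ⟨_, e2⟩)
  have c1 := coeff_one_arc ρ h
  rw [ha, coeff_one_X_mul, ha'] at c1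
  have c2 := coeff_one_arc ρ k
  rw [hb, coeff_one_X_mul, map_mul, PowerSeries.constantCoeff_X, zero_mul] at c2
  exact (isPartOfCoords_iff_jac.1 H).2.2 (jac_eq_zero_of_linEval (arcDir_ne_zero hρ) c1.symm c2.symm)

theorem not_dvd_cusp (H : IsPartOfCoords ![h, k]) {s : PlaneSeries} (hs : IsSmooth s) :
    ¬ s ∣ h ^ 3 - k ^ 2 := by
  intro hd
  obtain ⟨ρ, hρ, hker⟩ := hs.exists_arc
  have h0 : ρ (h ^ 3 - k ^ 2) = 0 := by
    rw [← RingHom.mem_ker, hker]; exact Ideal.mem_span_singleton.2 hd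
  exact not_X_pow_four_dvd_cusp hρ H (h0 ▸ dvd_zero _)

theorem X_sq_dvd_arc {a : PlaneSeries} (ha : constantCoeff a = 0)
    (h : linEval a (arcDir ρ) = 0) : PowerSeries.X ^ 2 ∣ ρ a := by
  obtain ⟨b, hb⟩ := X_dvd_arc ρ ha
  have c := coeff_one_arc ρ a
  rw [hb, coeff_one_X_mul, h] at c
  obtain ⟨e, rfl⟩ := PowerSeries.X_dvd_iff.2 c
  exact ⟨e, by rw [hb]; ring⟩

theorem linEval_arc_eq_zero {h : PlaneSeries} (hker : RingHom.ker ρ = Ideal.span {h}) :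
    linEval h (arcDir ρ) = 0 := by
  have : ρ h = 0 := by
    rw [← RingHom.mem_ker, hker]; exact Ideal.mem_span_singleton_self h
  rw [← coeff_one_arc, this, map_zero]

/-- If `p³ + q²` is the equation of a cusp and `q` is smooth, then `p`, `q` are coordinates. -/
theorem coords_of_cusp {p q : PlaneSeries} (H : IsPartOfCoords ![h, k])
    (hp : constantCoeff p = 0) (hq : IsSmooth q) (e : Associated (h ^ 3 - k ^ 2) (p ^ 3 + q ^ 2)) :
    IsPartOfCoords ![p, q] := by
  refine isPartOfCoords_iff_jac.2 ⟨hp, hq.1, fun hj => ?_⟩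
  obtain ⟨ρ, hρ, hker⟩ := hq.exists_arc
  have h0 : ρ q = 0 := by
    rw [← RingHom.mem_ker, hker]; exact Ideal.mem_span_singleton_self q
  -- If the linear parts were dependent, `p` would vanish to order two along `q = 0`, and `p³ + q²`
  -- to order six, too much for a cusp.
  have h2 := X_sq_dvd_arc (ρ := ρ) hp (linEval_eq_zero_of_jac hq.2 hj (linEval_arc_eq_zero hker))
  refine not_X_pow_four_dvd_cusp hρ H (((pow_dvd_pow _ (by norm_num : 4 ≤ 6)).trans ?_).trans
    (map_dvd ρ e.symm.dvd))
  rw [map_add, map_pow, map_pow, h0, zero_pow two_ne_zero, add_zero,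
    show (6 : ℕ) = 2 * 3 by norm_num, pow_mul]
  exact pow_dvd_pow_of_dvd h2 3

/-- A curve of the form `p³ + q² = 0` with singular `q = 0` is not `h g² = 0`. -/
theorem not_cubic_of_coords {p q : PlaneSeries} (H : IsPartOfCoords ![h, k])
    (hp : constantCoeff p = 0) (hq : constantCoeff q = 0) (hq' : linPart q = 0) :
    ¬ Associated (h * k ^ 2) (p ^ 3 + q ^ 2) := by
  intro e
  have hX : Prime (PowerSeries.X : PowerSeries ℂ) := PowerSeries.X_prime
  -- Along a branch of the curve `p³ = -q²` vanishes to order four, so `p` vanishes to order two.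
  -- Two transversal branches force the linear part of `p` to vanish, and then `p³ + q²` has order
  -- at least four instead of three.
  have key : ∀ s, IsSmooth s → s ∣ h * k ^ 2 → jac p s = 0 := by
    intro s hs hd
    obtain ⟨ρ, hρ, hker⟩ := hs.exists_arc
    have h0 : ρ (p ^ 3 + q ^ 2) = 0 := by
      rw [← RingHom.mem_ker, hker]; exact Ideal.mem_span_singleton.2 (hd.trans e.dvd)
    obtain ⟨q', e1⟩ := X_sq_dvd_arc (ρ := ρ) hq (by simp [linEval, hq'])
    obtain ⟨a, e2⟩ := X_dvd_arc ρ hp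
    rw [map_add, map_pow, map_pow, e1, e2] at h0
    have e3 : a ^ 3 = PowerSeries.X * -q' ^ 2 := by
      refine mul_left_cancel₀ (pow_ne_zero 3 hX.ne_zero) ?_
      linear_combination h0
    have ha' : PowerSeries.constantCoeff a = 0 :=
      PowerSeries.X_dvd_iff.1 (hX.dvd_of_dvd_pow ⟨_, e3⟩)
    have c1 := coeff_one_arc ρ p
    rw [e2, coeff_one_X_mul, ha'] at c1
    exact jac_eq_zero_of_linEval (arcDir_ne_zero hρ) c1.symm (linEval_arc_eq_zero hker)
  have hp' := linPart_eq_zero_of_jac H (key h H.left (dvd_mul_right _ _))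
    (key k H.right (dvd_mul_of_dvd_right (dvd_pow_self k two_ne_zero) _))
  have o1 : (4 : ℕ∞) ≤ (p ^ 3 + q ^ 2).order := by
    refine le_trans (le_min ?_ ?_) MvPowerSeries.min_order_le_add
    · refine le_trans ?_ (MvPowerSeries.le_order_pow 3)
      calc (4 : ℕ∞) ≤ 3 • 2 := by norm_num
        _ ≤ 3 • p.order := by gcongr; exact FatSilhouette.two_le_order.2 ⟨hp, hp'⟩
    · rw [order_sq]
      calc (4 : ℕ∞) = 2 * 2 := by norm_num
        _ ≤ 2 * q.order := by gcongr; exact FatSilhouette.two_le_order.2 ⟨hq, hq'⟩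
  rw [← order_of_associated e, MvPowerSeries.order_mul, order_sq, H.left.order_eq,
    H.right.order_eq] at o1
  exact absurd o1 (by decide)

theorem coords_of_sq {s t : PlaneSeries} (H : IsPartOfCoords ![h, k]) (hs : IsSmooth s)
    (ht : IsSmooth t) (e : Associated (h ^ 2 * k ^ 2) (s ^ 2 * t ^ 2)) :
    IsPartOfCoords ![s, t] := by
  have key : ∀ r, IsSmooth r → r ∣ s ^ 2 * t ^ 2 → Associated r h ∨ Associated r k := by
    intro r hr hd
    rcases hr.prime.dvd_or_dvd (hd.trans e.symm.dvd) with h1 | h1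
    · exact .inl ((hr.prime.dvd_prime_iff_associated H.left.prime).1 (hr.prime.dvd_of_dvd_pow h1))
    · exact .inr ((hr.prime.dvd_prime_iff_associated H.right.prime).1 (hr.prime.dvd_of_dvd_pow h1))
  have aux : ∀ {h k : PlaneSeries}, IsPartOfCoords ![h, k] → Associated (h ^ 2 * k ^ 2)
      (s ^ 2 * t ^ 2) → Associated s h → ¬ Associated t h := by
    intro h k H e a1 a2
    have e' := e.trans ((a1.pow_pow (n := 2)).mul_mul (a2.pow_pow (n := 2)))
    have e'' := e'.of_mul_left (Associated.refl _) (pow_ne_zero 2 H.left.ne_zero)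
    exact not_associated_of_coords H ((H.left.prime.dvd_prime_iff_associated H.right.prime).1
      (H.left.prime.dvd_of_dvd_pow ((dvd_pow_self h two_ne_zero).trans e''.symm.dvd)))
  rcases key s hs (dvd_mul_of_dvd_left (dvd_pow_self s two_ne_zero) _) with a | a <;>
    rcases key t ht (dvd_mul_of_dvd_right (dvd_pow_self t two_ne_zero) _) with c | c
  · exact (aux H e a c).elim
  · exact H.of_associated a.symm c.symm
  · exact H.swap.of_associated a.symm c.symm
  · exact (aux H.swap (mul_comm (h ^ 2) _ ▸ e) a c).elim

theorem not_isCuspGerm_of_node (H : IsPartOfCoords ![h, k]) :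
    ¬ IsCuspGerm (Ideal.span {h * k}) := by
  rintro ⟨h₁, h₂, H', e⟩
  exact not_dvd_cusp H' H.left
    ((dvd_mul_right h k).trans (Ideal.span_singleton_eq_span_singleton.1 e).dvd)

theorem not_isCuspGerm_of_smooth (H : IsSmooth h) : ¬ IsCuspGerm (Ideal.span {h}) := fun hc =>
  H.2 (FatSilhouette.IsCuspGerm.linPart_eq_zero hc (Ideal.mem_span_singleton_self h))

end Arcs

/-- A finite sum of orders allows the counting to be done in `ℕ`. -/
theorem exists_coe_of_add_eq {a b c : ℕ∞} {n : ℕ} (h : a + b + c = n) :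
    ∃ a' b' c' : ℕ, a = a' ∧ b = b' ∧ c = c' ∧ a' + b' + c' = n := by
  have hc : c ≠ ⊤ := fun e => by simp [e] at h
  have hb : b ≠ ⊤ := fun e => by simp [e] at h
  have ha : a ≠ ⊤ := fun e => by simp [e] at h
  lift a to ℕ using ha
  lift b to ℕ using hb
  lift c to ℕ using hc
  exact ⟨a, b, c, rfl, rfl, rfl, by exact_mod_cast h⟩

/-! ### Preparations for the analysis of special points. -/

section Points

variable {F : MvPolynomial (Fin 4) ℂ} {d : ℕ} {b : Frame} {z : ℂ} {W V : PlaneSeries[X]}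

theorem pos_of_properIdeal (hF : F.IsHomogeneous d) (hg : IsGoodProjection F (b 3))
    (h : properIdeal F b ≠ ⊤) : 0 < d := by
  obtain ⟨z, hz⟩ := hasPointOver_properContour hF hg.center h
  exact pos_of_hasPointOver hF hg.center ⟨z, properContour_subset_contour _ hz⟩

theorem pos_of_singularIdeal (hF : F.IsHomogeneous d) (hg : IsGoodProjection F (b 3))
    (h : singularIdeal F b ≠ ⊤) : 0 < d := by
  obtain ⟨z, hz⟩ := hasPointOver_singularLocus hF hg.center h
  exact pos_of_hasPointOver hF hg.center ⟨z, singularLocus_subset_contour _ hz⟩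

theorem span_ne_top {a : PlaneSeries} (ha : constantCoeff a = 0) : Ideal.span {a} ≠ ⊤ :=
  localIdeal_ne_top_of_le le_rfl ha

/-- Either there is only one point of the contour, or there is another one. -/
theorem IsLocalFactor.isUnit_or (H : IsLocalFactor F b z W V) (hF : F.IsHomogeneous d)
    (hp : MvPolynomial.eval (b 3) F ≠ 0) (h2 : 2 ≤ W.natDegree) :
    (IsUnit (disc V) ∧ Associated (silhouetteEq F b) (disc W)) ∨
    ∃ z' W' V', IsLocalFactor F b z' W' V' ∧ z ≠ z' ∧ b 0 + z' • b 3 ∈ contour F (b 3) ∧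
      2 ≤ W'.natDegree := by
  by_cases hu : IsUnit (disc V)
  · exact .inl ⟨hu, (H.disc_associated hF hp h2).trans (associated_mul_unit_left _ _ hu)⟩
  · right
    rw [H.isUnit_disc_iff hp] at hu
    push Not at hu
    obtain ⟨z', hz, hc⟩ := hu
    obtain ⟨W', V', H'⟩ := exists_isLocalFactor hF hp z'
    exact ⟨z', W', V', H', hz.symm, hc, (H'.two_le_iff hp).2 hc⟩

theorem IsLocalFactor.natDegree_le (H : IsLocalFactor F b z W V) {n : ℕ}
    (h : (disc W).order = n) : W.natDegree ≤ n + 1 := by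
  have := H.dist.disc_mem_pow
  rw [h] at this
  have : W.natDegree - 1 ≤ n := by exact_mod_cast this
  omega

/-- The translation that removes the quadratic term lies in the maximal ideal, so it changes the
constant term only in order two. Thus `q` has order one exactly at smooth points of the surface. -/
theorem IsLocalFactor.exists_depressed (H : IsLocalFactor F b z W V) (h3 : W.natDegree = 3) :
    ∃ β p q, taylor β W = X ^ 3 + C (3 * p) * X + C (2 * q) ∧ constantCoeff p = 0 ∧
      constantCoeff q = 0 ∧ linPart ((taylor (MvPowerSeries.C z) W).coeff 0) = (2 : ℂ) • linPart q := by
  have hd := H.isDist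
  have hn := H.natDegree_taylor.trans h3
  have hW := Monic.eq_cubic hd.monic hn
  obtain ⟨β, p, q, e, hβ⟩ := exists_taylor_cubic hd.monic hn
  set U := taylor (MvPowerSeries.C z) W with hU
  have c0 := hd.constantCoeff_coeff (show 0 < U.natDegree by omega)
  have c1 := hd.constantCoeff_coeff (show 1 < U.natDegree by omega)
  have c2 := hd.constantCoeff_coeff (show 2 < U.natDegree by omega)
  have hb : constantCoeff β = 0 := by
    have := congrArg constantCoeff hβ
    rw [map_mul, map_neg, c2, map_ofNat] at this
    simpa using this
  have hq : 2 * q = β ^ 3 + U.coeff 2 * β ^ 2 + U.coeff 1 * β + U.coeff 0 := by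
    have := congrArg (fun f => f.coeff 0) e
    simp only [taylor_coeff_zero] at this
    rw [hW] at this
    simp at this
    linear_combination -this
  have hp : 3 * p = 3 * β ^ 2 + 2 * U.coeff 2 * β + U.coeff 1 := by
    have := congrArg (fun f => f.coeff 1) e
    simp only [taylor_coeff_one] at this
    rw [hW] at this
    simp [coeff_X_pow] at this
    linear_combination -this
  refine ⟨β + MvPowerSeries.C z, p, q, by rw [← e, hU, taylor_taylor], ?_, ?_, ?_⟩
  · have := congrArg constantCoeff hp
    simpa [hb, c1, map_ofNat] using this
  · have := congrArg constantCoeff hq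
    simpa [hb, c0, map_ofNat] using this
  · have hq0 : constantCoeff q = 0 := by
      have := congrArg constantCoeff hq
      simpa [hb, c0, map_ofNat] using this
    have e0 : U.coeff 0 = 2 * q - (β * (β ^ 2 + U.coeff 2 * β + U.coeff 1)) := by
      linear_combination -hq
    funext i
    have l1 : linPart (2 * q) i = 2 * linPart q i := by
      rw [linPart_mul]; simp [hq0, map_ofNat]
    have l2 : linPart (β * (β ^ 2 + U.coeff 2 * β + U.coeff 1)) i = 0 := by
      rw [linPart_mul]; simp [hb, c1]
    have l3 : linPart (U.coeff 0) i =
        linPart (2 * q) i - linPart (β * (β ^ 2 + U.coeff 2 * β + U.coeff 1)) i := by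
      rw [e0]; simp only [linPart, map_sub]
    rw [l3, l1, l2, sub_zero]; rfl

end Points

end FatSilhouette
end

noncomputable section

namespace FatSilhouette

open Polynomial hiding constantCoeff
open MvPowerSeries (constantCoeff)

/-! ### Nodes and cusps of the proper silhouette. -/

section ProperPoints

variable {F : MvPolynomial (Fin 4) ℂ} {d : ℕ} {b : Frame}

theorem notMem_singularLocus {z : ℂ} (h : singularIdeal F b = ⊤) :
    b 0 + z • b 3 ∉ singularLocus F := fun hz => localIdeal_ne_top ⟨z, hz⟩ h

theorem notMem_properContour {z : ℂ} (h : properIdeal F b = ⊤) :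
    b 0 + z • b 3 ∉ properContour F (b 3) := fun hz => localIdeal_ne_top ⟨z, hz⟩ h

theorem exists_contour_point (hF : F.IsHomogeneous d) (hp : MvPolynomial.eval (b 3) F ≠ 0)
    {A : Set (Fin 4 → ℂ)} (hA : A ⊆ contour F (b 3)) (h : HasPointOver A b) :
    ∃ z W V, IsLocalFactor F b z W V ∧ b 0 + z • b 3 ∈ A ∧ 2 ≤ W.natDegree := by
  obtain ⟨z, hz⟩ := h
  obtain ⟨W, V, H⟩ := exists_isLocalFactor (b := b) hF hp z
  exact ⟨z, W, V, H, hz, (H.two_le_iff hp).2 (hA hz)⟩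

theorem order_mul_coords {h k : PlaneSeries} (H : IsPartOfCoords ![h, k]) : (h * k).order = 2 := by
  rw [MvPowerSeries.order_mul, H.left.order_eq, H.right.order_eq]; rfl

/-- Every point of the contour over the node is a smooth point of the surface with multiplicity two
and smooth branch. As `D` has order two, there are exactly two such points, and their branches,
which are transversal, generate the ideal. -/
theorem isSilhouetteIdeal_properNode (hF : F.IsHomogeneous d) (hg : IsGoodProjection F (b 3))
    (h : IsNodeGerm (properIdeal F b)) :
    IsSilhouetteIdeal (silhouetteEq F b) (conductorPreimage F b) .properNode := by
  obtain ⟨h, k, H, hB⟩ := h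
  have hp := hg.center
  have ho := order_mul_coords H
  have hne : properIdeal F b ≠ ⊤ := hB ▸ span_ne_top (by rw [map_mul, H.left.1, zero_mul])
  have hd := pos_of_properIdeal hF hg hne
  have hW : singularIdeal F b = ⊤ := singularIdeal_eq_top hF hg hne fun s hs =>
    hB ▸ span_ne_of_order hs (by rw [ho]; decide)
  have hD := silhouetteEq_proper hF hg hd hB hW
  have hD0 := silhouetteEq_ne_zero hF hg hd
  have hsm : ∀ {z W V}, IsLocalFactor F b z W V → 2 ≤ W.natDegree →
      W.natDegree = 2 ∧ IsSmooth (disc W) := by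
    intro z W V H' h2
    have hs := notMem_singularLocus (z := z) hW
    have h2' := H'.natDegree_eq_two hg ((contour_subset ((H'.two_le_iff hp).1 h2)).resolve_left hs)
      hs (hB ▸ not_isCuspGerm_of_node H)
    exact ⟨h2', isSmooth_of_order (H'.order_disc_of_smooth hF hp h2' hs)⟩
  obtain ⟨z, W, V, HW, -, h2⟩ := exists_contour_point hF hp (properContour_subset_contour _)
    (hasPointOver_properContour hF hp hne)
  obtain ⟨e2, s⟩ := hsm HW h2
  rcases HW.isUnit_or hF hp h2 with ⟨-, hu⟩ | ⟨z', W', V', HW', hz, -, h2'⟩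
  · have := order_of_associated (hD.symm.trans hu)
    rw [ho, s.order_eq] at this
    exact absurd this (by decide)
  obtain ⟨e2', s'⟩ := hsm HW' h2'
  obtain ⟨u, ha, hI⟩ := conductorPreimage_eq_pair hF HW HW' hz hp h2
  have hu : IsUnit u := by
    have := order_of_associated (hD.symm.trans ha)
    rw [ho, MvPowerSeries.order_mul, MvPowerSeries.order_mul, s.order_eq, s'.order_eq] at this
    obtain ⟨l, m, n, hl, hm, hn, h3⟩ := exists_coe_of_add_eq (n := 2) this.symm
    have hl' : 1 = l := by exact_mod_cast hl
    have hm' : 1 = m := by exact_mod_cast hm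
    rw [FatSilhouette.isUnit_iff, ← order_eq_zero, hn, show n = 0 by omega]; rfl
  have ha' : Associated (silhouetteEq F b) (disc W * disc W') :=
    ha.trans (associated_mul_unit_left _ _ hu)
  refine ⟨h, k, H, hD, ?_⟩
  rw [hI hu, condIdeal_eq_quadratic hD0 HW.dist.monic e2 ha',
    condIdeal_eq_quadratic hD0 HW'.dist.monic e2' (by rwa [mul_comm]), sup_comm,
    ← Ideal.span_insert]
  refine span_pair_eq_maximalIdeal (coords_of_sq H s s' ?_)
  rw [← mul_pow, ← mul_pow]
  exact (hD.symm.trans ha').pow_pow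

/-- Two points of the contour would give a smooth factor of the cusp. For a single one the order two
excludes degree two, so the degree is three, and `q` is smooth because the surface is; then `p` and
`q` are coordinates. -/
theorem isSilhouetteIdeal_properCusp (hF : F.IsHomogeneous d) (hg : IsGoodProjection F (b 3))
    (h : IsCuspGerm (properIdeal F b)) :
    IsSilhouetteIdeal (silhouetteEq F b) (conductorPreimage F b) .properCusp := by
  obtain ⟨h, k, H, hB⟩ := h
  have hp := hg.center
  have ho := order_cusp H.left H.right
  have hne : properIdeal F b ≠ ⊤ := hB ▸ span_ne_top (by simp [H.left.1, H.right.1])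
  have hd := pos_of_properIdeal hF hg hne
  have hW : singularIdeal F b = ⊤ := singularIdeal_eq_top hF hg hne fun s hs =>
    hB ▸ span_ne_of_order hs (by rw [ho]; decide)
  have hD := silhouetteEq_proper hF hg hd hB hW
  have hD0 := silhouetteEq_ne_zero hF hg hd
  obtain ⟨z, W, V, HW, hz, h2⟩ := exists_contour_point hF hp (properContour_subset_contour _)
    (hasPointOver_properContour hF hp hne)
  rcases HW.isUnit_or hF hp h2 with ⟨hu, ha⟩ | ⟨z', W', V', HW', hz', -, h2'⟩
  · have o := order_of_associated (hD.symm.trans ha)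
    rw [ho] at o
    have hs := notMem_singularLocus (z := z) hW
    have h3 : W.natDegree = 3 := by
      have := HW.natDegree_le (n := 2) o.symm
      by_contra hn
      have := HW.order_disc_of_smooth hF hp (by omega) hs
      rw [this] at o
      exact absurd o (by decide)
    obtain ⟨β, p, q, e, hp0, hq0, hl⟩ := HW.exists_depressed h3
    have hq : IsSmooth q := ⟨hq0, fun h0 => hs ((HW.mem_singularLocus_iff hF hp h2).2 (by
      rw [hl, h0, smul_zero]))⟩
    refine ⟨h, k, H, hD, ?_⟩
    rw [HW.conductorPreimage_eq hp hu, condIdeal_eq_cubic hD0 e ha]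
    refine span_pair_eq_maximalIdeal (coords_of_cusp H hp0 hq ?_)
    refine (hD.symm.trans ha).trans ?_
    rw [← FatSilhouette.disc_taylor β W, e]
    exact disc_cubic p q
  · exfalso
    obtain ⟨u, ha, -⟩ := conductorPreimage_eq_pair hF HW HW' hz' hp h2
    have o := order_of_associated (hD.symm.trans ha)
    rw [ho, MvPowerSeries.order_mul, MvPowerSeries.order_mul] at o
    have o1 := HW.one_le_order h2
    have o2 := HW'.one_le_order h2'
    obtain ⟨l, m, n, hl, hm, hn, e⟩ := exists_coe_of_add_eq (n := 2) o.symm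
    rw [hl] at o1
    rw [hm] at o2
    have o1' : 1 ≤ l := by exact_mod_cast o1
    have o2' : 1 ≤ m := by exact_mod_cast o2
    have hs : IsSmooth (disc W) := isSmooth_of_order (by
      rw [hl, show l = 1 by omega]; rfl)
    exact not_dvd_cusp H hs (((dvd_mul_right _ _).mul_right _).trans (hD.symm.trans ha).symm.dvd)

end ProperPoints

/-! ### Nodes of the singular image. -/

section SingularNode

variable {F : MvPolynomial (Fin 4) ℂ} {d : ℕ} {b : Frame}

theorem isDoublePoint_of_order (hg : IsGoodProjection F (b 3)) {z : ℂ}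
    {W V : PlaneSeries[X]} (H : IsLocalFactor F b z W V) (hz : b 0 + z • b 3 ∈ singularLocus F)
    (h6 : ¬ 6 ≤ (disc W).order)
    (hn : ¬ MeetTransversally (properIdeal F b) (singularIdeal F b)) :
    IsDoublePoint F (b 0 + z • b 3) := by
  rcases hg.ordinary _ hz (point_ne_zero b z) with h | h | h
  · exact h
  · exact (h6 (H.triple h).2.1).elim
  · exact (hn (hg.pinch b rfl ⟨z, h⟩)).elim

/-- The discriminant of a double point whose two sheets are simple over the target plane. -/
theorem IsLocalFactor.exists_disc_eq_sq {z : ℂ} {W V : PlaneSeries[X]} (H : IsLocalFactor F b z W V)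
    (h : IsDoublePoint F (b 0 + z • b 3)) (h2 : W.natDegree = 2) :
    ∃ s, IsSmooth s ∧ Associated (disc W) (s ^ 2) := by
  obtain ⟨w₀, w₁, e, d₀, d₁, n₀, n₁, hl⟩ := H.exists_double h
  have := congrArg natDegree e
  rw [d₀.monic.natDegree_mul d₁.monic, H.natDegree_taylor, h2] at this
  obtain ⟨s, hs, -, ha⟩ := disc_double_linear d₀ d₁ (by omega) (by omega) hl
  exact ⟨s, hs, by rw [← H.disc_taylor, e]; exact ha⟩

/-- A single double point over the node would have a resultant of its two sheets that vanishes on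
both branches, hence of order at least two. By the order of `D` the sheets would then be simple, and
two simple transversal sheets have a smooth resultant. -/
theorem not_unique_of_node (hg : IsGoodProjection F (b 3)) {z : ℂ}
    {W V : PlaneSeries[X]} (HW : IsLocalFactor F b z W V) (h : IsDoublePoint F (b 0 + z • b 3))
    (hB : properIdeal F b = ⊤) {h₁ h₂ : PlaneSeries} (H : IsPartOfCoords ![h₁, h₂])
    (ha : Associated (h₁ ^ 2 * h₂ ^ 2) (disc W)) : False := by
  obtain ⟨w₀, w₁, e, d₀, d₁, n₀, n₁, hl⟩ := HW.exists_double h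
  have hres : ∀ k, IsSmooth k → k ∣ h₁ ^ 2 * h₂ ^ 2 → k ∣ resultant w₀ w₁ := by
    intro k hk hd
    have := HW.resultant_mem hg.center hB e d₀ d₁ n₀ n₁ hl
      ((Ideal.span_singleton_prime hk.ne_zero).2 hk.prime)
      (Ideal.mem_span_singleton.2 (hd.trans ha.dvd))
    exact Ideal.mem_span_singleton.1 this
  obtain ⟨r, hr⟩ := hres h₁ H.left (dvd_mul_of_dvd_left (dvd_pow_self _ two_ne_zero) _)
  have h2r : h₂ ∣ r := by
    have := hres h₂ H.right (dvd_mul_of_dvd_right (dvd_pow_self _ two_ne_zero) _)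
    rw [hr] at this
    refine (H.right.prime.dvd_or_dvd this).resolve_left fun h4 => not_associated_of_coords H ?_
    exact ((H.right.prime.dvd_prime_iff_associated H.left.prime).1 h4).symm
  have o2 : 2 ≤ (resultant w₀ w₁).order := by
    obtain ⟨r', rfl⟩ := h2r
    rw [hr, ← mul_assoc, MvPowerSeries.order_mul, order_mul_coords H]
    exact le_self_add
  have ha' : Associated (disc W) (disc w₀ * disc w₁ * resultant w₀ w₁ ^ 2) := by
    rw [← HW.disc_taylor, e]; exact disc_mul_associated_sq d₀.monic d₁.monic
  have o := order_of_associated (ha.trans ha')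
  rw [MvPowerSeries.order_mul, MvPowerSeries.order_mul, order_sq, order_sq, H.left.order_eq,
    H.right.order_eq, MvPowerSeries.order_mul, order_sq] at o
  obtain ⟨l, m, n, el, em, en, e4⟩ := exists_coe_of_add_eq (n := 4) (o.symm.trans (by norm_num))
  have hn : 4 ≤ n := by
    have : (2 * 2 : ℕ∞) ≤ n := en ▸ mul_le_mul_right o2 2
    exact_mod_cast this
  obtain ⟨s, hs, hrs, -⟩ := disc_double_linear d₀ d₁
    (d₀.natDegree_eq_one n₀ (by rw [el, show l = 0 by omega]; rfl))
    (d₁.natDegree_eq_one n₁ (by rw [em, show m = 0 by omega]; rfl)) hl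
  rw [order_of_associated hrs, hs.order_eq] at o2
  exact absurd o2 (by decide)

/-- Two singular points share the order four, and each takes at least its degree; so both are double
points of degree two. Each discriminant is a square, and each point contributes the square that
belongs to the other one. -/
theorem isSilhouetteIdeal_singularNode (hF : F.IsHomogeneous d) (hg : IsGoodProjection F (b 3))
    (h : IsNodeGerm (singularIdeal F b)) :
    IsSilhouetteIdeal (silhouetteEq F b) (conductorPreimage F b) .singularNode := by
  obtain ⟨h, k, H, hW⟩ := h
  have hp := hg.center
  have ho := order_mul_coords H
  have hne : singularIdeal F b ≠ ⊤ := hW ▸ span_ne_top (by rw [map_mul, H.left.1, zero_mul])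
  have hd := pos_of_singularIdeal hF hg hne
  have hB : properIdeal F b = ⊤ := properIdeal_eq_top hF hg hne fun s hs =>
    hW ▸ span_ne_of_order hs (by rw [ho]; decide)
  have hD := silhouetteEq_singular hF hg hd hB hW
  rw [mul_pow] at hD
  have hD0 := silhouetteEq_ne_zero hF hg hd
  have hoD : (silhouetteEq F b).order = 4 := by
    rw [order_of_associated hD, ← mul_pow, order_sq, ho]; norm_num
  have hnt : ¬ MeetTransversally (properIdeal F b) (singularIdeal F b) := by
    rintro ⟨s, t, hs, e, -⟩
    exact span_ne_top hs.left.1 (e.symm.trans hB)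
  have hdb : ∀ {z W V}, IsLocalFactor F b z W V → 2 ≤ W.natDegree → disc W ∣ silhouetteEq F b →
      b 0 + z • b 3 ∈ singularLocus F ∧ IsDoublePoint F (b 0 + z • b 3) := by
    intro z W V HW h2 hdvd
    have hz := (contour_subset ((HW.two_le_iff hp).1 h2)).resolve_right (notMem_properContour hB)
    refine ⟨hz, isDoublePoint_of_order hg HW hz (fun h6 => ?_) hnt⟩
    obtain ⟨c, hc⟩ := hdvd
    rw [hc, MvPowerSeries.order_mul] at hoD
    have : (6 : ℕ∞) ≤ 4 := (h6.trans le_self_add).trans hoD.le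
    exact absurd this (by decide)
  obtain ⟨z, W, V, HW, -, h2⟩ := exists_contour_point hF hp (singularLocus_subset_contour _)
    (hasPointOver_singularLocus hF hp hne)
  rcases HW.isUnit_or hF hp h2 with ⟨-, hu⟩ | ⟨z', W', V', HW', hz, -, h2'⟩
  · exact (not_unique_of_node hg HW (hdb HW h2 hu.symm.dvd).2 hB H (hD.symm.trans hu)).elim
  obtain ⟨u, ha, hI⟩ := conductorPreimage_eq_pair hF HW HW' hz hp h2
  obtain ⟨hz1, hd1⟩ := hdb HW h2 (((dvd_mul_right _ _).mul_right _).trans ha.symm.dvd)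
  obtain ⟨hz2, hd2⟩ := hdb HW' h2' (((dvd_mul_left _ _).mul_right _).trans ha.symm.dvd)
  have o := order_of_associated ha
  rw [hoD, MvPowerSeries.order_mul, MvPowerSeries.order_mul] at o
  obtain ⟨l, m, n, el, em, en, e4⟩ := exists_coe_of_add_eq (n := 4) o.symm
  have o1 := HW.le_order_of_singular hF hp h2 hz1
  have o2 := HW'.le_order_of_singular hF hp h2' hz2
  rw [el] at o1
  rw [em] at o2
  have o1' : W.natDegree ≤ l := by exact_mod_cast o1
  have o2' : W'.natDegree ≤ m := by exact_mod_cast o2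
  have e2 : W.natDegree = 2 := by omega
  have e2' : W'.natDegree = 2 := by omega
  have hu : IsUnit u := by
    rw [FatSilhouette.isUnit_iff, ← order_eq_zero, en, show n = 0 by omega]; rfl
  obtain ⟨s, hs, as⟩ := HW.exists_disc_eq_sq hd1 e2
  obtain ⟨s', hs', as'⟩ := HW'.exists_disc_eq_sq hd2 e2'
  have ha1 : Associated (silhouetteEq F b) (disc W * s' ^ 2) :=
    (ha.trans (associated_mul_unit_left _ _ hu)).trans (as'.mul_left _)
  have ha2 : Associated (silhouetteEq F b) (disc W' * s ^ 2) := by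
    rw [mul_comm]
    exact (ha.trans (associated_mul_unit_left _ _ hu)).trans (as.mul_right _)
  have ha3 := ha1.trans (as.mul_right _)
  refine ⟨s, s', coords_of_sq H hs hs' (hD.symm.trans ha3), ha3, ?_⟩
  rw [hI hu, condIdeal_eq_quadratic hD0 HW.dist.monic e2 ha1,
    condIdeal_eq_quadratic hD0 HW'.dist.monic e2' ha2, sup_comm,
    Ideal.span_singleton_pow, Ideal.span_singleton_pow]

end SingularNode

end FatSilhouette
end

noncomputable section

namespace FatSilhouette

open Polynomial hiding constantCoeff
open MvPowerSeries (constantCoeff)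

/-! ### Triple points of the singular image. -/

section SingularTriple

/-- The syzygies of `k₁, k₂, -k₁ - k₂` are `(c + k₂ t, c - k₁ t, c)`. Hence the sums of squares are
combinations of the two generators and of `k₁² k₂²`, and three times the latter is `k₁ k₂` times the
first generator minus `k₁ - k₂` times the second. -/
theorem sumOfSquaresIdeal_eq_span {k₁ k₂ : PlaneSeries} (H : IsPartOfCoords ![k₁, k₂]) :
    sumOfSquaresIdeal k₁ k₂ (-k₁ - k₂) =
      Ideal.span {k₁ ^ 2 + k₁ * k₂ + k₂ ^ 2, k₁ * k₂ * (k₁ - k₂)} := by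
  obtain ⟨i2, h2⟩ := (isUnit_natCast PlaneSeries 2 two_ne_zero).exists_right_inv
  obtain ⟨i3, h3⟩ := (isUnit_natCast PlaneSeries 3 three_ne_zero).exists_right_inv
  push_cast at h2 h3
  apply le_antisymm
  · rw [sumOfSquaresIdeal, Ideal.span_le]
    rintro s ⟨a₁, a₂, a₃, ha₁, ha₂, ha₃, h0, rfl⟩
    obtain ⟨c₁, rfl⟩ := Ideal.mem_span_singleton.1 ha₁
    obtain ⟨c₂, rfl⟩ := Ideal.mem_span_singleton.1 ha₂
    obtain ⟨c₃, rfl⟩ := Ideal.mem_span_singleton.1 ha₃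
    obtain ⟨t, ht⟩ : k₂ ∣ c₁ - c₃ := by
      refine (H.right.prime.dvd_or_dvd (show k₂ ∣ k₁ * (c₁ - c₃) from
        ⟨c₃ - c₂, by linear_combination h0⟩)).resolve_left fun h => not_associated_of_coords H ?_
      exact ((H.right.prime.dvd_prime_iff_associated H.left.prime).1 h).symm
    have ht' : c₂ - c₃ = -k₁ * t := by
      refine mul_left_cancel₀ H.right.ne_zero ?_
      linear_combination h0 - k₁ * ht
    obtain rfl : c₁ = c₃ + k₂ * t := by linear_combination ht
    obtain rfl : c₂ = c₃ - k₁ * t := by linear_combination ht'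
    refine Ideal.mem_span_pair.2 ⟨2 * c₃ ^ 2 + 2 * t ^ 2 * i3 * (k₁ * k₂),
      2 * c₃ * t - 2 * t ^ 2 * i3 * (k₁ - k₂), ?_⟩
    linear_combination 2 * t ^ 2 * k₁ ^ 2 * k₂ ^ 2 * h3
  · have key : ∀ c : PlaneSeries, 2 * c ^ 2 * (k₁ ^ 2 + k₁ * k₂ + k₂ ^ 2) +
        2 * c * (k₁ * k₂ * (k₁ - k₂)) + 2 * k₁ ^ 2 * k₂ ^ 2 ∈
        sumOfSquaresIdeal k₁ k₂ (-k₁ - k₂) := by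
      intro c
      refine Ideal.subset_span ⟨k₁ * (c + k₂), k₂ * (c - k₁), (-k₁ - k₂) * c,
        Ideal.mem_span_singleton.2 (dvd_mul_right _ _),
        Ideal.mem_span_singleton.2 (dvd_mul_right _ _),
        Ideal.mem_span_singleton.2 (dvd_mul_right _ _), by ring, by ring⟩
    have hA : k₁ ^ 2 + k₁ * k₂ + k₂ ^ 2 ∈ sumOfSquaresIdeal k₁ k₂ (-k₁ - k₂) := by
      have e : 2 * (k₁ ^ 2 + k₁ * k₂ + k₂ ^ 2) ∈ sumOfSquaresIdeal k₁ k₂ (-k₁ - k₂) :=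
        Ideal.subset_span ⟨k₁, k₂, -k₁ - k₂, Ideal.mem_span_singleton_self _,
          Ideal.mem_span_singleton_self _, Ideal.mem_span_singleton_self _, by ring, by ring⟩
      have := Ideal.mul_mem_left _ i2 e
      rwa [← mul_assoc, mul_comm i2, h2, one_mul] at this
    have hB : k₁ * k₂ * (k₁ - k₂) ∈ sumOfSquaresIdeal k₁ k₂ (-k₁ - k₂) := by
      have e := sub_mem (sub_mem (key 1) (key 0)) (Ideal.mul_mem_left _ 2 hA)
      have := Ideal.mul_mem_left _ i2 e
      convert this using 1
      linear_combination -(k₁ * k₂ * (k₁ - k₂)) * h2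
    rw [Ideal.span_le, Set.insert_subset_iff, Set.singleton_subset_iff]
    exact ⟨hA, hB⟩

/-- Three distinct roots: the ideal generated by the coefficients of the depressed cubic. -/
theorem exists_depressed_triple (a b c : PlaneSeries) : ∃ β p q,
    taylor β ((X - C a) * (X - C b) * (X - C c)) = X ^ 3 + C (3 * p) * X + C (2 * q) ∧
    Ideal.span {p, q} = Ideal.span {(b - c) ^ 2 + (b - c) * (c - a) + (c - a) ^ 2,
      (b - c) * (c - a) * ((b - c) - (c - a))} := by
  obtain ⟨i6, h6⟩ := (isUnit_natCast PlaneSeries 6 (by norm_num)).exists_right_inv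
  obtain ⟨i9, h9⟩ := (isUnit_natCast PlaneSeries 9 (by norm_num)).exists_right_inv
  obtain ⟨i18, h18⟩ := (isUnit_natCast PlaneSeries 18 (by norm_num)).exists_right_inv
  push_cast at h6 h9 h18
  -- Dividing the differences by six clears the denominators of the mean of the roots and of `p` and
  -- `q`.
  obtain ⟨k, hk⟩ : ∃ k, 6 * k = b - c := ⟨i6 * (b - c), by linear_combination (b - c) * h6⟩
  obtain ⟨l, hl⟩ : ∃ l, 6 * l = c - a := ⟨i6 * (c - a), by linear_combination (c - a) * h6⟩
  obtain rfl : b = c + 6 * k := by linear_combination -hk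
  obtain rfl : a = c - 6 * l := by linear_combination hl
  rw [← hk, ← hl]
  refine ⟨c + 2 * k - 2 * l, -4 * (k ^ 2 + k * l + l ^ 2),
    4 * (k + 2 * l) * (2 * k + l) * (l - k), ?_, ?_⟩
  · simp only [taylor_mul, map_sub, map_add, taylor_X, taylor_C]
    simp only [map_mul, map_sub, map_add, map_pow, map_neg, map_ofNat]
    ring
  · apply le_antisymm <;> rw [Ideal.span_le, Set.insert_subset_iff, Set.singleton_subset_iff]
    · refine ⟨Ideal.mem_span_pair.2 ⟨-i9, 0, ?_⟩,
        Ideal.mem_span_pair.2 ⟨-36 * i18 * i9 * (k - l), -i18, ?_⟩⟩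
      · linear_combination -4 * (k ^ 2 + k * l + l ^ 2) * h9
      · linear_combination -144 * (k ^ 2 + k * l + l ^ 2) * (k - l) * i18 * h9 +
          4 * (k + 2 * l) * (2 * k + l) * (l - k) * h18
    · refine ⟨Ideal.mem_span_pair.2 ⟨-9, 0, by ring⟩,
        Ideal.mem_span_pair.2 ⟨36 * (k - l), -18, by ring⟩⟩

/-- The triple point uses up the whole order six, so its sheets are three graphs and it is the only
point of the contour. The differences of the three roots are the `hᵢ`; they have sum zero. -/
theorem isSilhouetteIdeal_singularTriple {F : MvPolynomial (Fin 4) ℂ} {d : ℕ} {b : Frame}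
    (hF : F.IsHomogeneous d) (hg : IsGoodProjection F (b 3))
    (h : IsTripleGerm (singularIdeal F b)) :
    IsSilhouetteIdeal (silhouetteEq F b) (conductorPreimage F b) .singularTriple := by
  obtain ⟨z, hz⟩ := hg.triple b rfl h
  obtain ⟨h₁, h₂, h₃, H₁, H₂, H₃, hW⟩ := h
  have hp := hg.center
  have ho : (h₁ * h₂ * h₃).order = 3 := by
    rw [MvPowerSeries.order_mul, order_mul_coords H₁, H₂.right.order_eq]; rfl
  have hne : singularIdeal F b ≠ ⊤ := hW ▸ span_ne_top (by
    rw [map_mul, map_mul, H₁.left.1, zero_mul, zero_mul])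
  have hd := pos_of_singularIdeal hF hg hne
  have hB : properIdeal F b = ⊤ := properIdeal_eq_top hF hg hne fun s hs =>
    hW ▸ span_ne_of_order hs (by rw [ho]; decide)
  have hD := silhouetteEq_singular hF hg hd hB hW
  have hD0 := silhouetteEq_ne_zero hF hg hd
  obtain ⟨W, V, HW⟩ := exists_isLocalFactor (b := b) hF hp z
  obtain ⟨n3, o6, h6⟩ := HW.triple hz
  have ha := HW.disc_associated hF hp (by omega)
  have o := order_of_associated (hD.symm.trans ha)
  rw [order_sq, ho, MvPowerSeries.order_mul] at o
  obtain ⟨l, m, n, el, em, en, e4⟩ := exists_coe_of_add_eq (n := 6)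
    (show (disc W).order + (disc V).order + 0 = _ by rw [add_zero, ← o]; norm_num)
  have hl : 6 ≤ l := by
    rw [el] at o6; exact_mod_cast o6
  have hu : IsUnit (disc V) := by
    rw [FatSilhouette.isUnit_iff, ← order_eq_zero, em, show m = 0 by omega]; rfl
  obtain ⟨a, b', c, e, hs, K₁, K₂, K₃⟩ := h6 (by rw [el, show l = 6 by omega]; rfl)
  have ha' := ha.trans (associated_mul_unit_left _ _ hu)
  obtain ⟨β, p, q, e3, hpq⟩ := exists_depressed_triple a b' c
  rw [← e, taylor_taylor] at e3
  refine ⟨b' - c, c - a, a - b', K₁, K₂, K₃, by ring, ha'.trans hs, ?_⟩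
  rw [HW.conductorPreimage_eq hp hu, condIdeal_eq_cubic hD0 e3 ha', hpq,
    ← sumOfSquaresIdeal_eq_span K₁, show -(b' - c) - (c - a) = a - b' by ring]

end SingularTriple

/-! ### Transversal intersections, with distinct preimages and from pinch points. -/

section Transversal

variable {F : MvPolynomial (Fin 4) ℂ} {d : ℕ} {b : Frame}

theorem order_mul_sq {h k : PlaneSeries} (hh : IsSmooth h) (hk : IsSmooth k) :
    (h * k ^ 2).order = 3 := by
  rw [MvPowerSeries.order_mul, order_sq, hh.order_eq, hk.order_eq]; rfl

/-- The order three is one from the point of `R` plus two from the point of `Z`. The first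
discriminant is the equation of `B`, so the second one is the square of that of `W`; each point
contributes the other's discriminant. -/
theorem isSilhouetteIdeal_transversalDistinct (hF : F.IsHomogeneous d)
    (hg : IsGoodProjection F (b 3)) (h : IsSpecialPoint F b .transversalDistinct) :
    IsSilhouetteIdeal (silhouetteEq F b) (conductorPreimage F b) .transversalDistinct := by
  obtain ⟨⟨h, k, H, hB, hW⟩, z, z', hzz, hz, hz'⟩ := h
  have hp := hg.center
  have hd := pos_of_properIdeal hF hg (hB ▸ span_ne_top H.left.1)
  have hD := silhouetteEq_both hF hg hd H.left.prime H.right.prime (not_associated_of_coords H) hB hW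
  have hD0 := silhouetteEq_ne_zero hF hg hd
  obtain ⟨W, V, HW⟩ := exists_isLocalFactor (b := b) hF hp z
  obtain ⟨W', V', HW'⟩ := exists_isLocalFactor (b := b) hF hp z'
  have h2 := (HW.two_le_iff hp).2 (properContour_subset_contour _ hz)
  have h2' := (HW'.two_le_iff hp).2 (singularLocus_subset_contour _ hz')
  obtain ⟨u, ha, hI⟩ := conductorPreimage_eq_pair hF HW HW' hzz hp h2
  have o := order_of_associated (hD.symm.trans ha)
  rw [order_mul_sq H.left H.right, MvPowerSeries.order_mul, MvPowerSeries.order_mul] at o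
  obtain ⟨l, m, n, el, em, en, e4⟩ := exists_coe_of_add_eq (n := 3) o.symm
  have o1 := HW.one_le_order h2
  have o2 := HW'.le_order_of_singular hF hp h2' hz'
  rw [el] at o1
  rw [em] at o2
  have o1' : 1 ≤ l := by exact_mod_cast o1
  have o2' : W'.natDegree ≤ m := by exact_mod_cast o2
  have hu : IsUnit u := by
    rw [FatSilhouette.isUnit_iff, ← order_eq_zero, en, show n = 0 by omega]; rfl
  have hs : b 0 + z • b 3 ∉ singularLocus F := by
    intro hs
    have := HW.two_le_order hF hp h2 hs
    rw [el, show l = 1 by omega] at this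
    exact absurd this (by decide)
  have e2 := HW.natDegree_eq_two hg hz hs (hB ▸ not_isCuspGerm_of_smooth H.left)
  have e2' : W'.natDegree = 2 := by omega
  have hsm : IsSmooth (disc W) := isSmooth_of_order (by rw [el, show l = 1 by omega]; rfl)
  have aW : Associated (disc W) h := by
    have := HW.properIdeal_le hF hp e2 hs
    rw [hB, Ideal.span_singleton_le_span_singleton] at this
    exact (hsm.prime.dvd_prime_iff_associated H.left.prime).1 this
  have ha' := ha.trans (associated_mul_unit_left _ _ hu)
  have aW' : Associated (disc W') (k ^ 2) :=
    (ha'.symm.trans hD).of_mul_left aW hsm.ne_zero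
  have ha1 : Associated (silhouetteEq F b) (disc W * k ^ 2) := ha'.trans (aW'.mul_left _)
  have ha2 : Associated (silhouetteEq F b) (disc W' * h) := by
    rw [mul_comm]
    exact ha'.trans (aW.mul_right _)
  refine ⟨h, k, H, hD, ?_⟩
  rw [hI hu, condIdeal_eq_quadratic hD0 HW.dist.monic e2 ha1,
    condIdeal_eq_quadratic hD0 HW'.dist.monic e2' ha2, sup_comm, Ideal.span_singleton_pow]

/-- The pinch point uses up the whole order three. In degree three `q` would have order two, which
is incompatible with `D = h g²`; in degree two the point carries all of `D`, so it contributes the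
unit ideal. -/
theorem isSilhouetteIdeal_transversalPinch (hF : F.IsHomogeneous d)
    (hg : IsGoodProjection F (b 3)) (h : IsSpecialPoint F b .transversalPinch) :
    IsSilhouetteIdeal (silhouetteEq F b) (conductorPreimage F b) .transversalPinch := by
  obtain ⟨⟨h, k, H, hB, hW⟩, z, hz⟩ := h
  have hp := hg.center
  have hd := pos_of_properIdeal hF hg (hB ▸ span_ne_top H.left.1)
  have hD := silhouetteEq_both hF hg hd H.left.prime H.right.prime (not_associated_of_coords H) hB hW
  have hD0 := silhouetteEq_ne_zero hF hg hd
  obtain ⟨W, V, HW⟩ := exists_isLocalFactor (b := b) hF hp z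
  have hs := IsPinchPoint.mem_singularLocus hF hz
  have h2 := (HW.two_le_iff hp).2 (singularLocus_subset_contour _ hs)
  have ha := HW.disc_associated hF hp h2
  have o := order_of_associated (hD.symm.trans ha)
  rw [order_mul_sq H.left H.right, MvPowerSeries.order_mul] at o
  obtain ⟨l, m, n, el, em, en, e4⟩ := exists_coe_of_add_eq (n := 3)
    (show (disc W).order + (disc V).order + 0 = _ by rw [add_zero, ← o]; norm_num)
  have o1 := HW.le_order_of_singular hF hp h2 hs
  rw [el] at o1
  have o1' : W.natDegree ≤ l := by exact_mod_cast o1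
  have hl : l = 3 := by
    by_contra hl
    have o3 := HW.pinch hz (by omega)
    rw [el] at o3
    have : 3 ≤ l := by exact_mod_cast o3
    omega
  have hu : IsUnit (disc V) := by
    rw [FatSilhouette.isUnit_iff, ← order_eq_zero, em, show m = 0 by omega]; rfl
  have ha' := ha.trans (associated_mul_unit_left _ _ hu)
  refine ⟨h, k, H, hD, ?_⟩
  rw [HW.conductorPreimage_eq hp hu]
  rcases (show W.natDegree = 2 ∨ W.natDegree = 3 by omega) with e2 | e3
  · rw [condIdeal_eq_quadratic (e := 1) hD0 HW.dist.monic e2 (by rwa [mul_one]),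
      Ideal.span_singleton_one]
  · obtain ⟨β, p, q, e, hp0, hq0, hl⟩ := HW.exists_depressed e3
    rw [(HW.mem_singularLocus_iff hF hp h2).1 hs] at hl
    refine (not_cubic_of_coords H hp0 hq0 ((smul_eq_zero.1 hl.symm).resolve_left two_ne_zero)
      ((hD.symm.trans ha').trans ?_)).elim
    rw [← FatSilhouette.disc_taylor β W, e]
    exact disc_cubic p q

end Transversal

/-! ### Tangential intersections, and the conductor ideal for all types. -/

section Tangential

variable {F : MvPolynomial (Fin 4) ℂ} {d : ℕ} {b : Frame}

theorem not_meetTransversally {h k : PlaneSeries} (H : AreSimplyTangent h k) :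
    ¬ MeetTransversally (Ideal.span {h}) (Ideal.span {k}) := by
  rintro ⟨s, t, K, e, e'⟩
  have := K.of_associated (Ideal.span_singleton_eq_span_singleton.1 e).symm
    (Ideal.span_singleton_eq_span_singleton.1 e').symm
  exact (isPartOfCoords_iff_jac.1 this).2.2 H.jac_eq

theorem exists_depressed_tangential (a δ : PlaneSeries) : ∃ β p q,
    taylor β ((X - C a) * (X ^ 2 - C δ)) = X ^ 3 + C (3 * p) * X + C (2 * q) ∧
    Ideal.span {p, q} = Ideal.span {a ^ 2 + 3 * δ, a * δ} := by
  obtain ⟨i3, h3⟩ := (isUnit_natCast PlaneSeries 3 (by norm_num)).exists_right_inv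
  obtain ⟨i4, h4⟩ := (isUnit_natCast PlaneSeries 4 (by norm_num)).exists_right_inv
  push_cast at h3 h4
  obtain ⟨k, rfl⟩ : ∃ k, a = 3 * k := ⟨i3 * a, by linear_combination -a * h3⟩
  obtain ⟨l, rfl⟩ : ∃ l, δ = 3 * l := ⟨i3 * δ, by linear_combination -δ * h3⟩
  have h9 : 9 * i3 ^ 2 = 1 := by linear_combination (3 * i3 + 1) * h3
  refine ⟨k, -(k ^ 2 + l), -k * (k ^ 2 - 3 * l), ?_, ?_⟩
  · simp only [taylor_mul, map_sub, taylor_X, taylor_C, pow_two]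
    simp only [map_mul, map_sub, map_add, map_neg, map_ofNat]
    ring
  · apply le_antisymm <;> rw [Ideal.span_le, Set.insert_subset_iff, Set.singleton_subset_iff]
    · refine ⟨Ideal.mem_span_pair.2 ⟨-i3 ^ 2, 0, ?_⟩,
        Ideal.mem_span_pair.2 ⟨-k * i3 ^ 2, 4 * i3 ^ 2, ?_⟩⟩
      · linear_combination -(k ^ 2 + l) * h9
      · linear_combination -k * (k ^ 2 - 3 * l) * h9
    · refine ⟨Ideal.mem_span_pair.2 ⟨-9, 0, by ring⟩,
        Ideal.mem_span_pair.2 ⟨-9 * i4 * k, 9 * i4, ?_⟩⟩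
      linear_combination 9 * k * l * h4

/-- For `g = a² - δ` the ratio of the linear parts is `-1`, and `g + 4δ = a² + 3δ` is the first
generator. The ideal contains `aδ`, `δ²` and `a³`, hence `𝔪 δ + 𝔪³`. -/
theorem span_eq_tangIdeal {a δ : PlaneSeries} (H : IsPartOfCoords ![a, δ]) :
    Ideal.span {a ^ 2 + 3 * δ, a * δ} = tangIdeal δ (a ^ 2 - δ) (-1) := by
  obtain ⟨i3, h3⟩ := (isUnit_natCast PlaneSeries 3 (by norm_num)).exists_right_inv
  push_cast at h3
  have e : a ^ 2 - δ - MvPowerSeries.C (4 * -1) * δ = a ^ 2 + 3 * δ := by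
    rw [map_mul, map_neg, map_one, map_ofNat]; ring
  have hm : ∀ x ∈ IsLocalRing.maximalIdeal PlaneSeries, ∃ x₀ x₁, x = a * x₀ + δ * x₁ :=
    fun x hx => exists_eq_mul_add H (mem_maximalIdeal.1 hx)
  rw [tangIdeal, e]
  set J := Ideal.span {a ^ 2 + 3 * δ, a * δ} with hJ
  have j1 : a ^ 2 + 3 * δ ∈ J := Ideal.subset_span (Set.mem_insert _ _)
  have j2 : a * δ ∈ J := Ideal.subset_span (Set.mem_insert_of_mem _ rfl)
  have j3 : δ ^ 2 ∈ J := Ideal.mem_span_pair.2 ⟨i3 * δ, -i3 * a, by linear_combination δ ^ 2 * h3⟩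
  have j4 : a ^ 3 ∈ J := Ideal.mem_span_pair.2 ⟨a, -3, by ring⟩
  apply le_antisymm
  · rw [hJ, Ideal.span_le, Set.insert_subset_iff, Set.singleton_subset_iff]
    exact ⟨Ideal.mem_sup_left (Ideal.mem_span_singleton_self _), Ideal.mem_sup_right
      (Ideal.mem_sup_left (Ideal.mul_mem_mul (mem_maximalIdeal.2 (isPartOfCoords_two.1 H).1)
        (Ideal.mem_span_singleton_self _)))⟩
  · refine sup_le (by rwa [Ideal.span_singleton_le_iff_mem]) (sup_le ?_ ?_)
    · refine Ideal.mul_le.2 fun r hr s hs => ?_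
      obtain ⟨r₀, r₁, rfl⟩ := hm r hr
      obtain ⟨t, rfl⟩ := Ideal.mem_span_singleton.1 hs
      rw [show (a * r₀ + δ * r₁) * (δ * t) = (r₀ * t) * (a * δ) + (r₁ * t) * δ ^ 2 by ring]
      exact add_mem (J.mul_mem_left _ j2) (J.mul_mem_left _ j3)
    · rw [pow_succ', pow_two]
      refine Ideal.mul_le.2 fun r hr s hs => Submodule.mul_induction_on hs (fun m hm' n hn => ?_)
        fun x y hx hy => by rw [mul_add]; exact add_mem hx hy
      obtain ⟨r₀, r₁, rfl⟩ := hm r hr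
      obtain ⟨m₀, m₁, rfl⟩ := hm m hm'
      obtain ⟨n₀, n₁, rfl⟩ := hm n hn
      rw [show (a * r₀ + δ * r₁) * ((a * m₀ + δ * m₁) * (a * n₀ + δ * n₁)) =
        (r₀ * m₀ * n₀) * a ^ 3 + (a * r₀ * m₀ * n₁ + (r₀ * m₁ + r₁ * m₀) * (a * n₀ + δ * n₁)) *
          (a * δ) + (r₁ * m₁ * (a * n₀ + δ * n₁)) * δ ^ 2 by ring]
      exact add_mem (add_mem (J.mul_mem_left _ j4) (J.mul_mem_left _ j2)) (J.mul_mem_left _ j3)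

/-- The common point of `R` and `Z` is a double point: a triple point has too large an order, and
pinch points are transversal. Degree two is impossible on `R`, so the degree is three and one sheet
is a graph `z = a`, the other one a fold `z² = δ`. Then `δ` is the equation of `B` and the resultant
`a² - δ` that of `W`. -/
theorem isSilhouetteIdeal_tangential (hF : F.IsHomogeneous d)
    (hg : IsGoodProjection F (b 3)) (h : IsSpecialPoint F b .tangential) :
    IsSilhouetteIdeal (silhouetteEq F b) (conductorPreimage F b) .tangential := by
  obtain ⟨h, k, H, hB, hW⟩ := h
  have hp := hg.center
  have hneB : properIdeal F b ≠ ⊤ := hB ▸ span_ne_top H.left.1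
  have hneW : singularIdeal F b ≠ ⊤ := hW ▸ span_ne_top H.right.1
  have hd := pos_of_properIdeal hF hg hneB
  have hD := silhouetteEq_both hF hg hd H.left.prime H.right.prime H.not_associated hB hW
  have hD0 := silhouetteEq_ne_zero hF hg hd
  have hnt : ¬ MeetTransversally (properIdeal F b) (singularIdeal F b) := by
    rw [hB, hW]; exact not_meetTransversally H
  obtain ⟨-, z, hzR, hz⟩ := (hg.intersection b rfl (hasPointOver_properContour hF hp hneB)
    (hasPointOver_singularLocus hF hp hneW)).resolve_left hnt
  obtain ⟨W, V, HW⟩ := exists_isLocalFactor (b := b) hF hp z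
  have h2 := (HW.two_le_iff hp).2 (singularLocus_subset_contour _ hz)
  have ha := HW.disc_associated hF hp h2
  have o := order_of_associated (hD.symm.trans ha)
  rw [order_mul_sq H.left H.right, MvPowerSeries.order_mul] at o
  obtain ⟨l, m, n, el, em, en, e4⟩ := exists_coe_of_add_eq (n := 3)
    (show (disc W).order + (disc V).order + 0 = _ by rw [add_zero, ← o]; norm_num)
  have o1 := HW.le_order_of_singular hF hp h2 hz
  rw [el] at o1
  have o1' : W.natDegree ≤ l := by exact_mod_cast o1
  have hdb : IsDoublePoint F (b 0 + z • b 3) := isDoublePoint_of_order hg HW hz (fun h6 => by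
    rw [el] at h6
    have : 6 ≤ l := by exact_mod_cast h6
    omega) hnt
  have e3 : W.natDegree = 3 := by
    by_contra hn
    exact HW.notMem_properContour hF (by omega) hdb hzR
  have hu : IsUnit (disc V) := by
    rw [FatSilhouette.isUnit_iff, ← order_eq_zero, em, show m = 0 by omega]; rfl
  have ha' := ha.trans (associated_mul_unit_left _ _ hu)
  obtain ⟨w₀, w₁, e, d₀, d₁, n₀, n₁⟩ : ∃ w₀ w₁, taylor (MvPowerSeries.C z) W = w₀ * w₁ ∧
      IsDist w₀ ∧ IsDist w₁ ∧ w₀.natDegree = 1 ∧ w₁.natDegree = 2 := by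
    obtain ⟨w₀, w₁, e, d₀, d₁, n₀, n₁, -⟩ := HW.exists_double hdb
    have := congrArg natDegree e
    rw [d₀.monic.natDegree_mul d₁.monic, HW.natDegree_taylor, e3] at this
    rcases (show w₀.natDegree = 1 ∨ w₁.natDegree = 1 by omega) with h1 | h1
    · exact ⟨w₀, w₁, e, d₀, d₁, h1, by omega⟩
    · exact ⟨w₁, w₀, by rw [e, mul_comm], d₁, d₀, h1, by omega⟩
  have hdisc : Associated (disc W) (disc w₁ * resultant w₀ w₁ ^ 2) := by
    obtain ⟨a₀, -, rfl⟩ := d₀.eq_X_sub_C n₀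
    have := disc_mul_associated_sq d₀.monic d₁.monic
    rw [disc_X_sub_C, one_mul] at this
    rw [← HW.disc_taylor, e]; exact this
  have hr0 := constantCoeff_resultant d₀ d₁ n₀.ge (by omega)
  obtain ⟨a₀, ha₀, rfl⟩ := d₀.eq_X_sub_C n₀
  obtain ⟨β, δ, hβ⟩ := exists_taylor_quadratic d₁.monic n₁
  have hδ : Associated (disc w₁) δ := by
    rw [← FatSilhouette.disc_taylor β w₁, hβ]; exact disc_quadratic δ
  obtain ⟨a, haa⟩ : ∃ a, a = a₀ - β := ⟨_, rfl⟩
  have hres : resultant (X - C a₀) w₁ = a ^ 2 - δ := by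
    have : w₁.eval a₀ = (taylor β w₁).eval a := by rw [taylor_eval, haa]; congr 1; ring
    have hn : resultant (X - C a₀) w₁ = resultant (X - C a₀) w₁ 1 w₁.natDegree := by
      rw [natDegree_X_sub_C]
    rw [hn, resultant_X_sub_C_left _ _ _ le_rfl, this, hβ]
    simp
  rw [hres] at hr0 hdisc
  have hD' : Associated (silhouetteEq F b) (δ * (a ^ 2 - δ) ^ 2) :=
    ha'.trans (hdisc.trans (hδ.mul_right _))
  have oδ : 1 ≤ δ.order := by
    have := le_order_of_mem_pow (FatSilhouette.disc_mem_pow d₁)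
    rw [n₁, order_of_associated hδ] at this
    exact_mod_cast this
  have oγ : 1 ≤ (a ^ 2 - δ).order := one_le_order.2 hr0
  have o' := order_of_associated (hD.symm.trans hD')
  rw [order_mul_sq H.left H.right, MvPowerSeries.order_mul, order_sq, two_mul, ← add_assoc] at o'
  obtain ⟨i, j, j', ei, ej, ej', e5⟩ := exists_coe_of_add_eq (n := 3) o'.symm
  rw [ei] at oδ
  rw [ej] at oγ
  have oδ' : 1 ≤ i := by exact_mod_cast oδ
  have oγ' : 1 ≤ j := by exact_mod_cast oγ
  have hjj : j = j' := by exact_mod_cast ej.symm.trans ej'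
  have sδ : IsSmooth δ := isSmooth_of_order (by rw [ei, show i = 1 by omega]; rfl)
  have sγ : IsSmooth (a ^ 2 - δ) := isSmooth_of_order (by rw [ej, show j = 1 by omega]; rfl)
  have ha0 : constantCoeff a = 0 := by
    have := sγ.1
    rw [map_sub, sδ.1, sub_zero, map_pow] at this
    exact pow_eq_zero_iff two_ne_zero |>.1 this
  obtain ⟨a1, a2⟩ := associated_of_mul_sq H.left.prime H.right.prime sδ.prime sγ.prime
    H.not_associated (hD.symm.trans hD')
  have HT := H.of_associated a1 a2
  have hlin : linPart (a ^ 2 - δ) = (-1 : ℂ) • linPart δ := by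
    have : linPart (a ^ 2) = 0 := by rw [pow_two, linPart_mul, ha0]; simp
    funext i
    have h1 := congrFun this i
    simp only [linPart, map_sub, Pi.smul_apply, smul_eq_mul, Pi.zero_apply] at h1 ⊢
    rw [h1]; ring
  obtain ⟨γ, p, q, ed, hpq⟩ := exists_depressed_tangential a δ
  have eW : taylor (γ + β + MvPowerSeries.C z) W = X ^ 3 + C (3 * p) * X + C (2 * q) := by
    rw [← ed, ← taylor_taylor, e, taylor_mul, ← taylor_taylor, ← taylor_taylor, hβ, taylor_mul]
    congr 1
    simp only [map_sub, map_add, taylor_X, taylor_C, haa]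
    ring
  refine isSilhouetteIdeal_tangential_iff.2 ⟨δ, a ^ 2 - δ, -1, HT, hD', by norm_num, hlin, ?_⟩
  rw [HW.conductorPreimage_eq hp hu, condIdeal_eq_cubic hD0 eW ha', hpq,
    span_eq_tangIdeal (HT.coords ha0)]

/-- The conductor ideal at a special point. -/
theorem isSilhouetteIdeal_conductorPreimage {t : SpecialType} (hF : F.IsHomogeneous d)
    (hg : IsGoodProjection F (b 3)) (h : IsSpecialPoint F b t) :
    IsSilhouetteIdeal (silhouetteEq F b) (conductorPreimage F b) t := by
  cases t with
  | properNode => exact isSilhouetteIdeal_properNode hF hg h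
  | properCusp => exact isSilhouetteIdeal_properCusp hF hg h
  | singularNode => exact isSilhouetteIdeal_singularNode hF hg h
  | singularTriple => exact isSilhouetteIdeal_singularTriple hF hg h
  | transversalDistinct => exact isSilhouetteIdeal_transversalDistinct hF hg h
  | transversalPinch => exact isSilhouetteIdeal_transversalPinch hF hg h
  | tangential => exact isSilhouetteIdeal_tangential hF hg h

end Tangential

end FatSilhouette
end

theorem mainTheorem5 :
    -- The conductor ideal at a special point is the ideal attached to the fat silhouette.
    (∀ (d : ℕ) (F : MvPolynomial (Fin 4) ℂ) (b : Frame) (t : SpecialType),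
      F.IsHomogeneous d → IsGoodProjection F (b 3) → IsSpecialPoint F b t →
      IsSilhouetteIdeal (silhouetteEq F b) (conductorPreimage F b) t) ∧
    -- The attached ideal is invariant under changes of coordinates, and it is determined by the
    -- fat silhouette (take for `σ` the identity).
    (∀ (t : SpecialType) (D D' : PlaneSeries) (I : Ideal PlaneSeries)
      (σ : PlaneSeries ≃ₐ[ℂ] PlaneSeries),
      Associated (σ D) D' → IsSilhouetteIdeal D I t →
      IsSilhouetteIdeal D' (I.map σ) t ∧
        ∀ I' : Ideal PlaneSeries, IsSilhouetteIdeal D' I' t → I' = I.map σ) ∧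
    -- The conductor ideal depends only on the fat silhouette (and, at transversal intersections,
    -- on whether they come from pinch points).
    (∀ (d d' : ℕ) (F F' : MvPolynomial (Fin 4) ℂ) (b b' : Frame) (t t' : SpecialType)
      (σ : PlaneSeries ≃ₐ[ℂ] PlaneSeries),
      F.IsHomogeneous d → IsGoodProjection F (b 3) → IsSpecialPoint F b t →
      F'.IsHomogeneous d' → IsGoodProjection F' (b' 3) → IsSpecialPoint F' b' t' →
      (t = SpecialType.transversalPinch ↔ t' = SpecialType.transversalPinch) →
      Associated (σ (silhouetteEq F b)) (silhouetteEq F' b') →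
      conductorPreimage F' b' = (conductorPreimage F b).map σ) := by
  refine ⟨fun d F b t hF hg h => FatSilhouette.isSilhouetteIdeal_conductorPreimage hF hg h,
    fun t D D' I σ hD H => ⟨H.map σ hD, fun I' H' => H'.unique (H.map σ hD) Iff.rfl⟩, ?_⟩
  intro d d' F F' b b' t t' σ hF hg h hF' hg' h' ht hD
  -- Both conductor ideals are attached to the same equation once the first one is transported by
  -- `σ`; uniqueness applies.
  have H := FatSilhouette.isSilhouetteIdeal_conductorPreimage hF hg h
  exact (FatSilhouette.isSilhouetteIdeal_conductorPreimage hF' hg' h').unique (H.map σ hD) ht.symm
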